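/- **Notation.** For entire $F$ put $F^\sharp(z)=\overline{F(\bar z)}$, and $\widehat\phi(z)=\int_{\mathbb R}\phi(t)e^{izt}\,dt$. $H^2$ is the Hardy space of the upper half-plane $\mathbb C_+$, identified with a subspace of $L^2(\mathbb R)$ by nontangential boundary values. $\mathcal{HB}$ is the class of entire $E$ without real zeros with $|E^\sharp|<|E|$ on $\mathbb C_+$. For $E\in\mathcal{HB}$, $\mathcal H(E)=\{f \text{ entire}: f/E,\ f^\sharp/E\in H^2\}$ with $\|f\|=\|f/E\|_{L^2(\mathbb R)}$, $A=\frac12(E+E^\sharp)$, $B=\frac i2(E-E^\sharp)$, $S_\theta=e^{i\theta}E-e^{-i\theta}E^\sharp$; a linear subspace of $\mathcal H(E)$ is a de Branges subspace if it equals some $\mathcal H(\tilde E)$, $\tilde E\in\mathcal{HB}$, with the same norm. For an inner function $\Theta$, $\mathcal K(\Theta)=H^2\ominus\Theta H^2$, and for a meromorphic one $\sigma(\Theta)=\{x\in\mathbb R:\Theta(x)=-1\}$ and $\mu_\Theta=\sum_{\gamma\in\sigma(\Theta)}\frac{2\pi}{|\Theta'(\gamma)|}\delta_\gamma$. A screw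 function on $\mathbb R$ is a continuous $g$ with $g(-t)=\overline{g(t)}$ for which the kernel $G_g(t,s)=g(t-s)-g(t)-g(-s)+g(0)$ is nonnegative definite; if $g(0)=0$, $\mathcal L(G_g)$ is the space of $\phi\in C_c(\mathbb R)$ with $\int\phi=0$ and $\langle\phi_1,\phi_2\rangle_g=\iint G_g(t,s)\phi_1(s)\overline{\phi_2(t)}\,ds\,dt$, and $\mathcal H(G_g)$ is the Hilbert space obtained from it by dividing out null vectors and completing. Put $\Phi_1(\phi,z)=\int\phi(t)\frac{e^{izt}-1}{z}dt$ and $J=\begin{bmatrix}0&-1\\1&0\end{bmatrix}$. A structure Hamiltonian of $E\in\mathcal{HB}$ is a Hamiltonian $H$ on some $(t_0,t_1]$ (symmetric real $2\times2$, locally integrable, nonnegative and nonzero almost everywhere), with integrable trace near $t_1$, such that the solution of $\frac{d}{dt}Y=zJHY$, $Y(t_1,z)={}^t[A(z)\ B(z)]$, $Y={}^t[A(t,z)\ B(t,z)]$, satisfies: $E_t:=A(t,\cdot)-iB(t,\cdot)\in\mathcal{HB}$ for all $t\in(t_0,t_1]$; the set of de Branges subspaces of $\mathcal H(E)$ is $\{\mathcal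 H(E_t): t\in (t_0,t_1]\text{ regular}\}$ (not an inner point of an indivisible interval); and $\frac{\overline{A(t,z)}B(t,z)-A(t,z)\overline{B(t,z)}}{\pi(z-\bar z)}\to0$ as $t\to t_0$ for every $z\in\mathbb C$ (for real $z$ the quotient is understood as a limit). **Theorem.** Let $r>0$, $E=E_r(z)=e^{-irz}\in\mathcal{HB}$, $\Theta_r(z)=e^{2irz}$, $\gamma_n=\frac{\pi}{2r}(2n-1)$ $(n\in\mathbb Z)$. 1. $A=\cos(rz)$, $B=\sin(rz)$, $\Theta_r=E^\sharp/E$ is a meromorphic inner function, $\sigma(\Theta_r)=\{\gamma_n\}$ and $\mu_{\Theta_r}=\frac\pi r\sum_n\delta_{\gamma_n}$. $\mathcal H(E_r)=\mathrm{PW}_r:=\{\widehat\varphi:\varphi\in L^2(-r,r)\}$, with reproducing kernel $K_r(z,w)=\frac{\overline{A(z)}B(w)-A(w)\overline{B(z)}}{\pi(w-\bar z)}=\frac{\sin(r(w-\bar z))}{\pi(w-\bar z)}$. 2. $S_\theta(z)=-2i\sin(rz-\theta)\notin\mathrm{PW}_r$ for all $\theta$. The operator $\mathsf M$ of multiplication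 by $z$ in $\mathrm{PW}_r$ is densely defined, and for every $w_0$ with $S_{\pi/2}(w_0)\ne0$ the operator $\mathsf M_{\pi/2}:\frac{S_{\pi/2}(w_0)F(z)-S_{\pi/2}(z)F(w_0)}{z-w_0}=:G(z)\mapsto zG(z)+F(w_0)S_{\pi/2}(z)$, $F\in\mathrm{PW}_r$, is a self-adjoint extension of $\mathsf M$. The functions $F_n(z)=\frac{i\cos(rz)}{\sqrt{\pi r}\,(z-\gamma_n)}$, $n\in\mathbb Z$, form an orthonormal basis of $\mathrm{PW}_r$, $\mathsf M_{\pi/2}F_n=\gamma_nF_n$, and $F_n/E_r$ tends to $\sqrt{r/\pi}$ at $\gamma_n$ and to $0$ at $\gamma_m$, $m\ne n$. 3. $H_r(t)=I$ on $[0,r]$ is a structure Hamiltonian of $E_r$, with solution ${}^t[\cos(tz)\ \sin(tz)]$, and $W_r(t,z)=\begin{bmatrix}\cos(tz)&\sin(tz)\\-\sin(tz)&\cos(tz)\end{bmatrix}$ solves $\frac{d}{dt}WJ=zWH_r$, $W(0,z)=I$. 4. $Q_r:=i\frac{1-\Theta_r}{1+\Theta_r}=\tan(rz)$ is a Nevanlinna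 function with $Q_r(iy)/y\to0$ $(y\to+\infty)$, $\tan(rz)=\lim_{N\to\infty}\frac1r\sum_{|n|\le N}\frac1{\gamma_n-z}$ off the poles, and $Q_r(z)=\int\bigl(\frac1{\gamma-z}-\frac{\gamma}{1+\gamma^2}\bigr)d\tau_r(\gamma)$ on $\mathbb C_+$ with $\tau_r=\mu_{\Theta_r}/\pi$. The function $$g_r(t)=\frac2r\sum_{n\ge1}\gamma_n^{-2}\bigl(\cos(\gamma_nt)-1\bigr)$$ is a screw function on $\mathbb R$ with $g_r(0)=0$, $\int_{\mathbb R}\frac{d\tau_r(\gamma)}{1+\gamma^2}<\infty$, $g_r(t)=\int\bigl(e^{it\gamma}-1-\frac{it\gamma}{1+\gamma^2}\bigr)\frac{d\tau_r(\gamma)}{\gamma^2}$, and $\int_0^\infty g_r(t)e^{izt}dt=-\frac{i}{z^2}\tan(rz)$ for $\Im z>0$. 5. $f\mapsto f/E_r|_{\mathbb R}$ is an isometric isomorphism $\mathrm{PW}_r\to\mathcal K(\Theta_r)$, and $r_{\Theta_r}:f\mapsto (f/E_r)|_{\sigma(\Theta_r)}$ is an isometric isomorphism $\mathrm{PW}_r\to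 L^2(\mu_{\Theta_r})$. 6. Let $L^2(H_r)$ be the space of $\mathfrak F={}^t[f\ g]\in L^2((0,r);\mathbb C^2)$ with $\|\mathfrak F\|^2=\frac1\pi\int_0^r(|f|^2+|g|^2)dt$. (The continuous vector functions on $[0,r)$ with compact support in $[0,r)$ are dense in it.) The Weyl transform $(\mathsf W\mathfrak F)(z)=\frac1\pi\int_0^r(f(t)\cos(tz)+g(t)\sin(tz))dt$ is an isometric isomorphism $L^2(H_r)\to\mathrm{PW}_r$. Extending $f$ evenly and $g$ oddly to $[-r,r]$ and putting $\Psi_{\mathfrak F}=f-ig$, one has $\mathsf W\mathfrak F=\frac1{2\pi}\widehat{\Psi_{\mathfrak F}}$, and $\mathfrak F\mapsto\Psi_{\mathfrak F}$ is a linear isomorphism of $L^2(H_r)$ onto $L^2(-r,r)$ with $\|\mathfrak F\|^2=\frac1{2\pi}\|\Psi_{\mathfrak F}\|^2$. 7. For $\phi\in\mathcal L(G_{g_r})$, $\|\phi\|^2=\frac1r\sum_n\gamma_n^{-2}|\widehat\phi(\gamma_n)|^2$; $\phi\mapsto\Phi_1(\phi,\cdot)$ extends to an isometric isomorphism $\Phi_1:\mathcal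 H(G_{g_r})\to L^2(\tau_r)$, and multiplication by $1/\sqrt\pi$ is an isometric isomorphism $L^2(\tau_r)\to L^2(\mu_{\Theta_r})$. 8. $\mathfrak S_t(z)=\sqrt{\frac\pi r}\sum_n\frac{e^{it\gamma_n}-1}{\gamma_n}\cdot\frac{i(1+\Theta_r(z))}{2\sqrt{\pi r}(z-\gamma_n)}=\sqrt{\frac\pi r}\sum_n\frac{e^{it\gamma_n}-1}{\gamma_n}\frac{F_n(z)}{E_r(z)}$ converges in $\mathcal K(\Theta_r)$ and almost everywhere on $\mathbb R$, and $\pi^{-1/2}\mathfrak S$ is a screw line of $g_r$: it is continuous and $\frac1\pi\langle\mathfrak S_{t+u}-\mathfrak S_u,\mathfrak S_{s+u}-\mathfrak S_u\rangle=G_{g_r}(t,s)$ for all $t,s,u\in\mathbb R$. With $\widehat{\mathcal P}_\phi=\int\phi(t)\mathfrak S_t\,dt$, the map $\phi\mapsto\frac1{\sqrt\pi}E_r\widehat{\mathcal P}_\phi$ extends to an isometric isomorphism $\mathcal H(G_{g_r})\to\mathrm{PW}_r$, given by $\frac1{\sqrt r}\sum_n\frac{\widehat\phi(\gamma_n)}{\gamma_n}F_n$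 (pointwise on $\mathbb C$ for $\phi\in\mathcal L(G_{g_r})$); for every $\xi\in\mathcal H(G_{g_r})$ the image is $\frac1{\sqrt r}\sum_n(\Phi_1\xi)(\gamma_n)F_n$, with convergence in $\mathrm{PW}_r$. 9. The limit $$L_r(t,s)=\lim_{N\to\infty}\frac{i\sqrt\pi}{r}\sum_{|n|\le N}(-1)^n\frac{e^{is\gamma_n}-1}{\gamma_n}\begin{bmatrix}\cos(\gamma_nt)\\\sin(\gamma_nt)\end{bmatrix}$$ exists for all real $t,s$, and $(\mathsf L_r\phi)(t)=\int L_r(t,s)\phi(s)\,ds$ extends to an isometric isomorphism $\mathsf L_r:\mathcal H(G_{g_r})\to L^2(H_r)$. 10. The diagram commutes: $\mathsf W\mathsf L_r=\frac1{\sqrt\pi}E_r\widehat{\mathcal P}$ and $r_{\Theta_r}\circ\frac1{\sqrt\pi}E_r\widehat{\mathcal P}=\frac1{\sqrt\pi}\Phi_1$ on $\mathcal H(G_{g_r})$. -/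

import Mathlib

open MeasureTheory Filter Topology ComplexConjugate

namespace ScrewPW

/-! ### Hardy space of the upper half-plane, Hermite--Biehler class, de Branges spaces -/

/-- The open upper half-plane. -/
def upperHalf : Set ℂ := {z | 0 < z.im}

/-- `F♯(z)` is the complex conjugate of `F` at the complex conjugate of `z`. -/
def sharp (F : ℂ → ℂ) : ℂ → ℂ := fun z => conj (F (conj z))

/-- `F` (restricted to the upper half-plane) belongs to the Hardy space `H²`. -/
structure MemH2 (F : ℂ → ℂ) : Prop where
  holo : DifferentiableOn ℂ F upperHalf
  bdd : ∃ C : NNReal, ∀ y : ℝ, 0 < y → ∫⁻ x : ℝ, ‖F (x + y * Complex.I)‖ₑ ^ 2 ≤ C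

theorem MemH2.congr {F G : ℂ → ℂ} (hF : MemH2 F) (h : ∀ z, F z = G z) : MemH2 G := by
  have : F = G := funext h
  exact this ▸ hF

theorem MemH2.zero : MemH2 (fun _ => 0) :=
  ⟨differentiableOn_const _, 0, fun y _ => by simp⟩

theorem MemH2.smul {F : ℂ → ℂ} (c : ℂ) (hF : MemH2 F) : MemH2 (fun z => c * F z) := by
  obtain ⟨h1, C, hC⟩ := hF
  refine ⟨h1.const_mul c, ‖c‖₊ ^ 2 * C, fun y hy => ?_⟩
  have : ∀ x : ℝ, ‖c * F (x + y * Complex.I)‖ₑ ^ 2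
      = ‖c‖ₑ ^ 2 * ‖F (x + y * Complex.I)‖ₑ ^ 2 := fun x => by rw [enorm_mul, mul_pow]
  simp only [this]
  rw [lintegral_const_mul' _ _ (by simp)]
  push_cast
  exact mul_le_mul' le_rfl (hC y hy)

theorem continuous_line {F : ℂ → ℂ} (hF : DifferentiableOn ℂ F upperHalf) {y : ℝ} (hy : 0 < y) :
    Continuous (fun x : ℝ => F (x + y * Complex.I)) := by
  refine hF.continuousOn.comp_continuous (by fun_prop) fun x => ?_
  simpa [upperHalf] using hy

theorem MemH2.add {F G : ℂ → ℂ} (hF : MemH2 F) (hG : MemH2 G) :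
    MemH2 (fun z => F z + G z) := by
  obtain ⟨h1, C, hC⟩ := hF
  obtain ⟨h2, D, hD⟩ := hG
  refine ⟨h1.add h2, 2 * C + 2 * D, fun y hy => ?_⟩
  have key : ∀ x : ℝ, ‖F (x + y * Complex.I) + G (x + y * Complex.I)‖ₑ ^ 2
      ≤ 2 * ‖F (x + y * Complex.I)‖ₑ ^ 2 + 2 * ‖G (x + y * Complex.I)‖ₑ ^ 2 := fun x => by
    set a := F (x + y * Complex.I)
    set b := G (x + y * Complex.I)
    have hab : ‖a + b‖₊ ^ 2 ≤ 2 * ‖a‖₊ ^ 2 + 2 * ‖b‖₊ ^ 2 := by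
      rw [← NNReal.coe_le_coe]
      push_cast
      have := norm_add_le a b
      nlinarith [sq_nonneg (‖a‖ - ‖b‖), norm_nonneg (a + b), norm_nonneg a, norm_nonneg b]
    simp only [enorm_eq_nnnorm]
    exact_mod_cast hab
  have hm : Measurable fun x : ℝ => 2 * ‖F (x + y * Complex.I)‖ₑ ^ 2 :=
    ((continuous_line h1 hy).measurable.enorm.pow_const 2).const_mul 2
  calc ∫⁻ x : ℝ, ‖F (x + y * Complex.I) + G (x + y * Complex.I)‖ₑ ^ 2
      ≤ ∫⁻ x : ℝ, (2 * ‖F (x + y * Complex.I)‖ₑ ^ 2 + 2 * ‖G (x + y * Complex.I)‖ₑ ^ 2) :=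
        lintegral_mono key
    _ = 2 * (∫⁻ x : ℝ, ‖F (x + y * Complex.I)‖ₑ ^ 2)
          + 2 * ∫⁻ x : ℝ, ‖G (x + y * Complex.I)‖ₑ ^ 2 := by
        rw [lintegral_add_left hm, lintegral_const_mul' _ _ (by simp),
          lintegral_const_mul' _ _ (by simp)]
    _ ≤ _ := by
        push_cast
        exact add_le_add (mul_le_mul' le_rfl (hC y hy)) (mul_le_mul' le_rfl (hD y hy))

/-- The Hermite--Biehler class (without real zeros). -/
structure HB where
  toFun : ℂ → ℂ
  entire : Differentiable ℂ toFun
  sharp_lt : ∀ z, 0 < z.im → ‖sharp toFun z‖ < ‖toFun z‖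
  no_real_zero : ∀ x : ℝ, toFun x ≠ 0

instance : CoeFun HB (fun _ => ℂ → ℂ) := ⟨HB.toFun⟩

/-- `A = (E + E♯) / 2`. -/
noncomputable def HB.A (E : HB) (z : ℂ) : ℂ := (E z + sharp E z) / 2

/-- `B = i (E - E♯) / 2`. -/
noncomputable def HB.B (E : HB) (z : ℂ) : ℂ := Complex.I * (E z - sharp E z) / 2

/-- The function `S_θ = e^{iθ} E - e^{-iθ} E♯`. -/
noncomputable def HB.S (E : HB) (θ : ℝ) (z : ℂ) : ℂ :=
  Complex.exp (θ * Complex.I) * E z - Complex.exp (-(θ * Complex.I)) * sharp E z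

/-- The kernel `(conj A(z) B(w) - A(w) conj B(z)) / (π (w - conj z))` formed from two entire
functions that are real on the real line; at the removable singularity `w = conj z`
the value is the limit. -/
noncomputable def abKernel (A B : ℂ → ℂ) (z w : ℂ) : ℂ :=
  (Real.pi : ℂ)⁻¹ * dslope (fun u => conj (A z) * B u - A u * conj (B z)) (conj z) w

/-- The de Branges space `H(E)` as a linear space of entire functions. -/
def deBrangesSubmodule (E : HB) : Submodule ℂ (ℂ → ℂ) where
  carrier := {f | Differentiable ℂ f ∧ MemH2 (fun z => f z / E z) ∧
    MemH2 (fun z => sharp f z / E z)}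
  add_mem' := by
    rintro f g ⟨h1, h2, h3⟩ ⟨k1, k2, k3⟩
    refine ⟨h1.add k1, (h2.add k2).congr fun z => ?_, (h3.add k3).congr fun z => ?_⟩
    · simp [add_div]
    · simp [sharp, add_div]
  zero_mem' := by
    refine ⟨differentiable_const _, MemH2.zero.congr fun z => ?_, MemH2.zero.congr fun z => ?_⟩
    · simp
    · simp [sharp]
  smul_mem' := by
    rintro c f ⟨h1, h2, h3⟩
    refine ⟨h1.const_smul c, (h2.smul c).congr fun z => ?_,
      (h3.smul (conj c)).congr fun z => ?_⟩
    · simp [mul_div_assoc]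
    · simp [sharp, mul_div_assoc]

/-- The norm of `H(E)`: the `L²(ℝ)`-norm of `f / E`. -/
noncomputable def deBrangesNorm (E : HB) (f : ℂ → ℂ) : ENNReal :=
  eLpNorm (fun x : ℝ => f x / E x) 2 volume

theorem continuous_div {E : HB} {f : ℂ → ℂ} (hf : Differentiable ℂ f) :
    Continuous (fun x : ℝ => f x / E x) :=
  (hf.continuous.comp Complex.continuous_ofReal).div
    (E.entire.continuous.comp Complex.continuous_ofReal) E.no_real_zero

/-- On `H(E)` the norm is finite (Fatou's lemma along horizontal lines). -/
theorem memLp_of_mem {E : HB} {f : ℂ → ℂ} (hf : f ∈ deBrangesSubmodule E) :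
    MemLp (fun x : ℝ => f x / E x) 2 volume := by
  obtain ⟨h1, ⟨h2, C, hC⟩, -⟩ := hf
  refine ⟨(continuous_div h1).aestronglyMeasurable, ?_⟩
  rw [eLpNorm_lt_top_iff_lintegral_rpow_enorm_lt_top (by norm_num) (by norm_num)]
  let u : ℕ → ℝ := fun n => 1 / ((n : ℝ) + 1)
  have hu : ∀ n, 0 < u n := fun n => by positivity
  have hu0 : Tendsto u atTop (𝓝 0) := tendsto_one_div_add_atTop_nhds_zero_nat
  have hlim : ∀ x : ℝ, Tendsto (fun n => ‖f (x + u n * Complex.I) / E (x + u n * Complex.I)‖ₑ ^ 2)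
      atTop (𝓝 (‖f x / E x‖ₑ ^ 2)) := fun x => by
    have hz : Tendsto (fun n => (x : ℂ) + u n * Complex.I) atTop (𝓝 (x : ℂ)) := by
      have : Tendsto (fun n => (x : ℂ) + u n * Complex.I) atTop
          (𝓝 ((x : ℂ) + (0 : ℝ) * Complex.I)) :=
        tendsto_const_nhds.add
          (((Complex.continuous_ofReal.tendsto 0).comp hu0).mul_const _)
      simpa using this
    have hd : Tendsto (fun n => f (x + u n * Complex.I) / E (x + u n * Complex.I)) atTop
        (𝓝 (f x / E x)) :=
      (((h1.continuous.tendsto _).comp hz).div ((E.entire.continuous.tendsto _).comp hz)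
        (E.no_real_zero x))
    exact (ENNReal.continuous_pow 2).continuousAt.tendsto.comp hd.enorm
  have hle : ∫⁻ x : ℝ, ‖f x / E x‖ₑ ^ 2 ≤ C := by
    calc ∫⁻ x : ℝ, ‖f x / E x‖ₑ ^ 2
        = ∫⁻ x : ℝ, liminf (fun n =>
            ‖f (x + u n * Complex.I) / E (x + u n * Complex.I)‖ₑ ^ 2) atTop :=
          lintegral_congr fun x => (hlim x).liminf_eq.symm
      _ ≤ liminf (fun n => ∫⁻ x : ℝ,
            ‖f (x + u n * Complex.I) / E (x + u n * Complex.I)‖ₑ ^ 2) atTop :=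
          lintegral_liminf_le fun n =>
            (continuous_line h2 (hu n)).measurable.enorm.pow_const 2
      _ ≤ C := by
          refine liminf_le_of_frequently_le' (Frequently.of_forall fun n => hC _ (hu n))
  refine lt_of_le_of_lt ?_ (ENNReal.coe_lt_top (r := C))
  simpa using hle

/-- The de Branges space `H(E)` as a type. -/
def DeBrangesSpace (E : HB) : Type := deBrangesSubmodule E

instance (E : HB) : AddCommGroup (DeBrangesSpace E) :=
  inferInstanceAs (AddCommGroup (deBrangesSubmodule E))

instance (E : HB) : Module ℂ (DeBrangesSpace E) :=
  inferInstanceAs (Module ℂ (deBrangesSubmodule E))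

instance (E : HB) : CoeFun (DeBrangesSpace E) (fun _ => ℂ → ℂ) := ⟨fun f => f.1⟩

theorem integrable_inner {E : HB} (f g : DeBrangesSpace E) :
    Integrable (fun x : ℝ => conj (f x / E x) * (g x / E x)) :=
  (memLp_of_mem f.2).star.integrable_mul (memLp_of_mem g.2)

/-- The inner product `⟨f, g⟩ = ∫ conj (f / E) (g / E)` over the real line. -/
@[reducible]
noncomputable def deBrangesCore (E : HB) : InnerProductSpace.Core ℂ (DeBrangesSpace E) where
  inner f g := ∫ x : ℝ, conj (f x / E x) * (g x / E x)
  conj_inner_symm f g := by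
    rw [← integral_conj]
    refine integral_congr_ae (Eventually.of_forall fun x => ?_)
    simp [mul_comm]
  re_inner_nonneg f := by
    have : ∀ x : ℝ, conj (f x / E x) * (f x / E x) = ((‖f x / E x‖ ^ 2 : ℝ) : ℂ) := fun x => by
      rw [mul_comm, Complex.mul_conj, Complex.normSq_eq_norm_sq]
    simp only [this]
    rw [integral_complex_ofReal]
    exact integral_nonneg fun x => by positivity
  add_left f g h := by
    rw [← integral_add (integrable_inner f h) (integrable_inner g h)]
    refine integral_congr_ae (Eventually.of_forall fun x => ?_)
    change conj ((f x + g x) / E x) * (h x / E x) = _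
    simp only [add_div, map_add, add_mul]
  smul_left f g c := by
    rw [← integral_const_mul]
    refine integral_congr_ae (Eventually.of_forall fun x => ?_)
    change conj ((c * f x) / E x) * (g x / E x) = _
    simp only [mul_div_assoc, map_mul, mul_assoc]
  definite f hf := by
    have hsq : ∀ x : ℝ, conj (f x / E x) * (f x / E x) = ((‖f x / E x‖ ^ 2 : ℝ) : ℂ) := fun x => by
      rw [mul_comm, Complex.mul_conj, Complex.normSq_eq_norm_sq]
    have h0 : ∫ x : ℝ, ‖f x / E x‖ ^ 2 = 0 := by
      have h1 : ∫ x : ℝ, conj (f x / E x) * (f x / E x) = 0 := hf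
      simp only [hsq] at h1
      rw [integral_complex_ofReal] at h1
      exact_mod_cast h1
    have hc : Continuous fun x : ℝ => ‖f x / E x‖ ^ 2 := (continuous_div f.2.1).norm.pow 2
    have hi : Integrable fun x : ℝ => ‖f x / E x‖ ^ 2 :=
      (memLp_of_mem f.2).integrable_norm_pow (by norm_num)
    have h2 := (integral_eq_zero_iff_of_nonneg (fun x => by positivity) hi).1 h0
    have h3 : (fun x : ℝ => ‖f x / E x‖ ^ 2) = fun _ => 0 :=
      (hc.ae_eq_iff_eq volume continuous_const).1 h2
    have h4 : ∀ x : ℝ, f x = 0 := fun x => by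
      have := congrFun h3 x
      simpa [E.no_real_zero x] using this
    have h5 : f.1 = fun _ => 0 := by
      have ha : AnalyticOnNhd ℂ f.1 Set.univ := f.2.1.differentiableOn.analyticOnNhd isOpen_univ
      refine ha.eq_of_frequently_eq (z₀ := 0) analyticOnNhd_const ?_
      have ht : Tendsto (fun n : ℕ => ((1 / ((n : ℝ) + 1) : ℝ) : ℂ)) atTop (𝓝[≠] 0) := by
        refine tendsto_nhdsWithin_iff.2 ⟨?_, Eventually.of_forall fun n => ?_⟩
        · have := (Complex.continuous_ofReal.tendsto 0).comp
            (tendsto_one_div_add_atTop_nhds_zero_nat (𝕜 := ℝ))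
          rw [Complex.ofReal_zero] at this
          exact this
        · have : (1 / ((n : ℝ) + 1) : ℝ) ≠ 0 := by positivity
          exact Complex.ofReal_ne_zero.2 this
      exact ht.frequently (Frequently.of_forall fun n => h4 _)
    exact Subtype.ext h5

noncomputable instance (E : HB) : NormedAddCommGroup (DeBrangesSpace E) :=
  (deBrangesCore E).toNormedAddCommGroup

noncomputable instance (E : HB) : InnerProductSpace ℂ (DeBrangesSpace E) :=
  InnerProductSpace.ofCore (deBrangesCore E).toCore

/-- `V` is a de Branges subspace of `H(E)`: it is a linear subspace that is itself a de Branges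
space, with the same norm. -/
def IsDeBrangesSubspace (E : HB) (V : Submodule ℂ (ℂ → ℂ)) : Prop :=
  V ≤ deBrangesSubmodule E ∧ ∃ E' : HB, V = deBrangesSubmodule E' ∧
    ∀ f ∈ V, deBrangesNorm E' f = deBrangesNorm E f

/-! ### Multiplication by the independent variable -/

/-- The domain of the multiplication operator `M`. -/
def multDomain (E : HB) : Set (DeBrangesSpace E) :=
  {F | (fun z => z * F z) ∈ deBrangesSubmodule E}

/-- The graph of the extension `M_θ` of `M`, written with the base point `w₀`. -/
def multExtGraph (E : HB) (θ : ℝ) (w₀ : ℂ) : Set (DeBrangesSpace E × DeBrangesSpace E) :=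
  {p | ∃ F : DeBrangesSpace E, ∀ z : ℂ,
    (z - w₀) * p.1 z = E.S θ w₀ * F z - E.S θ z * F w₀ ∧
    p.2 z = z * p.1 z + F w₀ * E.S θ z}

/-- A linear relation (operator graph) that coincides with its adjoint. -/
def IsSelfAdjointGraph {X : Type*} [NormedAddCommGroup X] [InnerProductSpace ℂ X]
    (G : Set (X × X)) : Prop :=
  ∀ p : X × X, p ∈ G ↔ ∀ q ∈ G, inner ℂ p.2 q.1 = inner ℂ p.1 q.2

/-! ### Nevanlinna functions, meromorphic inner functions, model subspaces -/

/-- The Nevanlinna class. -/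
def IsNevanlinna (Q : ℂ → ℂ) : Prop :=
  DifferentiableOn ℂ Q upperHalf ∧ ∀ z ∈ upperHalf, 0 ≤ (Q z).im

/-- Meromorphic inner functions in the upper half-plane. -/
structure IsMeromorphicInner (Θ : ℂ → ℂ) : Prop where
  mero : ∀ z, MeromorphicAt Θ z
  holo : DifferentiableOn ℂ Θ upperHalf
  bdd : ∃ C : ℝ, ∀ z ∈ upperHalf, ‖Θ z‖ ≤ C
  boundary : ∀ᵐ x : ℝ, Tendsto (fun y : ℝ => ‖Θ (x + y * Complex.I)‖) (𝓝[>] 0) (𝓝 1)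

/-- The level set `σ(Θ) = {Θ = -1}` on the real line. -/
def levelSet (Θ : ℂ → ℂ) : Set ℝ := {x | Θ x = -1}

/-- The measure `μ_Θ`: point masses `2π / |Θ'(γ)|` at the points of the level set. -/
noncomputable def levelMeasure (Θ : ℂ → ℂ) : Measure ℝ :=
  Measure.sum fun γ : levelSet Θ =>
    ENNReal.ofReal (2 * Real.pi / ‖deriv Θ (γ : ℝ)‖) • Measure.dirac (γ : ℝ)

/-- `φ` is the nontangential boundary value of `F` almost everywhere on the real line. -/
def IsBoundaryValue (F : ℂ → ℂ) (φ : ℝ → ℂ) : Prop :=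
  ∀ᵐ x : ℝ, ∀ α : ℝ, 0 < α →
    Tendsto F (𝓝[{z : ℂ | 0 < z.im ∧ |z.re - x| ≤ α * z.im}] (x : ℂ)) (𝓝 (φ x))

/-- `H²` as a subspace of `L²(ℝ)` through nontangential boundary values. -/
def hardySpace : Submodule ℂ (Lp ℂ 2 (volume : Measure ℝ)) where
  carrier := {φ | ∃ F : ℂ → ℂ, MemH2 F ∧ IsBoundaryValue F φ}
  add_mem' := by
    rintro φ ψ ⟨F, hF, h1⟩ ⟨G, hG, h2⟩
    refine ⟨fun z => F z + G z, hF.add hG, ?_⟩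
    filter_upwards [h1, h2, Lp.coeFn_add φ ψ] with x k1 k2 k3 α hα
    rw [k3]
    exact (k1 α hα).add (k2 α hα)
  zero_mem' := by
    refine ⟨fun _ => 0, MemH2.zero, ?_⟩
    filter_upwards [Lp.coeFn_zero ℂ 2 (volume : Measure ℝ)] with x k1 α hα
    rw [k1]
    exact tendsto_const_nhds
  smul_mem' := by
    rintro c φ ⟨F, hF, h1⟩
    refine ⟨fun z => c * F z, hF.smul c, ?_⟩
    filter_upwards [h1, Lp.coeFn_smul c φ] with x k1 k3 α hα
    rw [k3]
    exact (k1 α hα).const_mul c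

/-- The model subspace `K(Θ) = H² ⊖ Θ H²` of `L²(ℝ)`. -/
noncomputable def modelSpace (Θ : ℂ → ℂ) : Submodule ℂ (Lp ℂ 2 (volume : Measure ℝ)) :=
  hardySpace ⊓ (Submodule.span ℂ {ψ : Lp ℂ 2 (volume : Measure ℝ) |
    ∃ F : ℂ → ℂ, MemH2 F ∧ IsBoundaryValue (fun z => Θ z * F z) ψ})ᗮ

/-! ### Screw functions on the real line and the Hilbert space `H(G_g)` -/

/-- The kernel `G_g(t,s) = g(t-s) - g(t) - g(-s) + g(0)`. -/
def screwKernel (g : ℝ → ℂ) (t s : ℝ) : ℂ := g (t - s) - g t - g (-s) + g 0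

/-- Screw functions `g` on the real line with `g(0) = 0`. -/
structure ScrewFunction where
  toFun : ℝ → ℂ
  cont : Continuous toFun
  hermitian : ∀ t, toFun (-t) = conj (toFun t)
  nonneg : ∀ (n : ℕ) (t : Fin n → ℝ) (ξ : Fin n → ℂ),
    0 ≤ (∑ i, ∑ j, screwKernel toFun (t i) (t j) * ξ i * conj (ξ j)).re
  zero : toFun 0 = 0

instance : CoeFun ScrewFunction (fun _ => ℝ → ℂ) := ⟨ScrewFunction.toFun⟩

theorem screwKernel_conj (g : ScrewFunction) (t s : ℝ) :
    conj (screwKernel g t s) = screwKernel g s t := by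
  have h1 : g (s - t) = conj (g (t - s)) := by rw [← g.hermitian]; congr 1; ring
  have h2 : conj (g (-s)) = g s := by rw [← g.hermitian, neg_neg]
  simp only [screwKernel, map_add, map_sub, h1, h2, g.zero, g.hermitian t, map_zero]
  ring

theorem screwKernel_continuous (g : ScrewFunction) :
    Continuous (fun p : ℝ × ℝ => screwKernel g p.1 p.2) := by
  have := g.cont
  unfold screwKernel
  fun_prop

/-- The kernel as an operator-valued matrix. -/
noncomputable def screwMatrix (g : ScrewFunction) : Matrix ℝ ℝ (ℂ →L[ℂ] ℂ) :=
  Matrix.of fun t s => screwKernel g t s • ContinuousLinearMap.id ℂ ℂ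

open scoped ComplexOrder in
theorem screwMatrix_posSemidef (g : ScrewFunction) : (screwMatrix g).PosSemidef := by
  refine ((RKHS.posSemidef_tfae (K := screwMatrix g)).out 0 2).2 (And.intro ?_ fun v => ?_)
  · ext t s
    simp only [screwMatrix, Matrix.conjTranspose_apply, Matrix.of_apply, star_smul]
    rw [show star (screwKernel g s t) = conj (screwKernel g s t) from rfl, screwKernel_conj]
    have hid : star (ContinuousLinearMap.id ℂ ℂ) = ContinuousLinearMap.id ℂ ℂ :=
      star_one (ℂ →L[ℂ] ℂ)
    rw [hid]
  · classical
    let e := v.support.equivFin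
    have h := g.nonneg v.support.card (fun i => ((e.symm i : v.support) : ℝ))
      (fun i => conj (v ((e.symm i : v.support) : ℝ)))
    refine h.trans_eq ?_
    change _ = Complex.re _
    congr 1
    simp only [Finsupp.sum]
    rw [← Finset.sum_coe_sort v.support, ← e.symm.sum_comp]
    refine Finset.sum_congr rfl fun i _ => ?_
    rw [← Finset.sum_coe_sort v.support, ← e.symm.sum_comp]
    refine Finset.sum_congr rfl fun j _ => ?_
    simp only [screwMatrix, Matrix.of_apply, smul_apply,
      ContinuousLinearMap.id_apply, smul_eq_mul, RCLike.inner_apply, map_mul, Complex.conj_conj,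
      screwKernel_conj]
    ring

/-- Continuous compactly supported functions of mean zero. -/
def meanZero : Submodule ℂ (CompactlySupportedContinuousMap ℝ ℂ) where
  carrier := {φ | ∫ t, φ t = 0}
  add_mem' := by
    intro φ ψ h1 h2
    have hφ : Integrable φ := φ.continuous.integrable_of_hasCompactSupport φ.hasCompactSupport
    have hψ : Integrable ψ := ψ.continuous.integrable_of_hasCompactSupport ψ.hasCompactSupport
    change ∫ t, (φ t + ψ t) = 0
    rw [integral_add hφ hψ]
    have h1' : ∫ t, φ t = 0 := h1
    have h2' : ∫ t, ψ t = 0 := h2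
    simp [h1', h2']
  zero_mem' := by simp
  smul_mem' := by
    intro c φ h1
    have h1' : ∫ t, φ t = 0 := h1
    change ∫ t, c * φ t = 0
    rw [integral_const_mul, h1', mul_zero]

/-- The space `L(G_g)`: continuous compactly supported functions of mean zero, to be equipped
with the (semi-)inner product given by `G_g`. -/
def ScrewPre (_g : ScrewFunction) : Type := meanZero

noncomputable instance (g : ScrewFunction) : AddCommGroup (ScrewPre g) :=
  inferInstanceAs (AddCommGroup meanZero)

noncomputable instance (g : ScrewFunction) : Module ℂ (ScrewPre g) :=
  inferInstanceAs (Module ℂ meanZero)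

noncomputable instance (g : ScrewFunction) : CoeFun (ScrewPre g) (fun _ => ℝ → ℂ) := ⟨fun φ => φ.1⟩

theorem ScrewPre.continuous {g : ScrewFunction} (φ : ScrewPre g) : Continuous φ :=
  φ.1.continuous

theorem ScrewPre.hasCompactSupport {g : ScrewFunction} (φ : ScrewPre g) :
    HasCompactSupport φ := φ.1.hasCompactSupport

/-- The form `∬ G_g(t,s) φ₂(s) conj φ₁(t) ds dt`, linear in the second argument. -/
noncomputable def screwForm (g : ScrewFunction) (φ₁ φ₂ : ScrewPre g) : ℂ :=
  ∫ t : ℝ, ∫ s : ℝ, screwKernel g t s * φ₂ s * conj (φ₁ t)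

theorem exists_feature (g : ScrewFunction) :
    ∃ (X : Type) (_ : NormedAddCommGroup X) (_ : InnerProductSpace ℂ X) (_ : CompleteSpace X)
      (e : ℝ → X), Continuous e ∧ ∀ t s, inner ℂ (e t) (e s) = screwKernel g t s := by
  have : Fact (screwMatrix g).PosSemidef := ⟨screwMatrix_posSemidef g⟩
  let X := RKHS.OfKernel (screwMatrix g)
  let e : ℝ → X := fun t => RKHS.kerFun X t (1 : ℂ)
  have he : ∀ t s, inner ℂ (e t) (e s) = screwKernel g t s := fun t s => by
    have h := RKHS.kernel_inner X s t (1 : ℂ) (1 : ℂ)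
    rw [RKHS.OfKernel.kernel_ofKernel] at h
    rw [← h]
    simp [screwMatrix, screwKernel_conj]
  refine ⟨X, inferInstance, inferInstance, inferInstance, e, ?_, he⟩
  have hG := screwKernel_continuous g
  rw [continuous_iff_continuousAt]
  intro t
  rw [ContinuousAt, tendsto_iff_norm_sub_tendsto_zero]
  have hsq : ∀ s, ‖e s - e t‖ ^ 2
      = (screwKernel g s s - screwKernel g s t - screwKernel g t s + screwKernel g t t).re := by
    intro s
    rw [← inner_self_eq_norm_sq (𝕜 := ℂ), inner_sub_sub_self, he, he, he, he]
    rfl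
  have hc : Continuous fun s =>
      (screwKernel g s s - screwKernel g s t - screwKernel g t s + screwKernel g t t).re := by
    refine Complex.continuous_re.comp ?_
    have h1 : Continuous fun s => screwKernel g s s := hG.comp (continuous_id.prodMk continuous_id)
    have h2 : Continuous fun s => screwKernel g s t :=
      hG.comp (continuous_id.prodMk continuous_const)
    have h3 : Continuous fun s => screwKernel g t s :=
      hG.comp (continuous_const.prodMk continuous_id)
    exact ((h1.sub h2).sub h3).add continuous_const
  have h0 : Tendsto (fun s => ‖e s - e t‖ ^ 2) (𝓝 t) (𝓝 0) := by
    simp only [hsq]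
    have := hc.tendsto t
    simpa using this
  have h1 := (Real.continuous_sqrt.tendsto 0).comp h0
  rw [Real.sqrt_zero] at h1
  refine h1.congr fun s => ?_
  exact Real.sqrt_sq (norm_nonneg _)

theorem exists_screwForm_eq (g : ScrewFunction) :
    ∃ (X : Type) (_ : NormedAddCommGroup X) (_ : InnerProductSpace ℂ X)
      (u : ScrewPre g →ₗ[ℂ] X), ∀ φ₁ φ₂, screwForm g φ₁ φ₂ = inner ℂ (u φ₁) (u φ₂) := by
  obtain ⟨X, i1, i2, i3, e, hc, he⟩ := exists_feature g
  have hi : ∀ φ : ScrewPre g, Integrable fun t => φ t • e t := fun φ =>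
    (φ.continuous.smul hc).integrable_of_hasCompactSupport φ.hasCompactSupport.smul_right
  refine ⟨X, i1, i2,
    { toFun := fun φ => ∫ t, φ t • e t
      map_add' := fun φ ψ => ?_
      map_smul' := fun c φ => ?_ }, fun φ₁ φ₂ => ?_⟩
  · rw [← integral_add (hi φ) (hi ψ)]
    refine integral_congr_ae (Eventually.of_forall fun t => ?_)
    exact add_smul (φ t) (ψ t) (e t)
  · rw [RingHom.id_apply, ← integral_smul]
    refine integral_congr_ae (Eventually.of_forall fun t => ?_)
    exact mul_smul c (φ t) (e t)
  · change screwForm g φ₁ φ₂ = inner ℂ (∫ t, φ₁ t • e t) (∫ s, φ₂ s • e s)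
    rw [← inner_conj_symm, ← integral_inner (hi φ₁), ← integral_conj]
    unfold screwForm
    refine integral_congr_ae (Eventually.of_forall fun t => ?_)
    simp only
    rw [inner_conj_symm, inner_smul_left, ← integral_inner (hi φ₂), ← integral_const_mul]
    refine integral_congr_ae (Eventually.of_forall fun s => ?_)
    simp only [inner_smul_right, he]
    ring

/-- The semi-inner product of `L(G_g)`. -/
@[reducible]
noncomputable def screwCore (g : ScrewFunction) : PreInnerProductSpace.Core ℂ (ScrewPre g) where
  inner φ₁ φ₂ := screwForm g φ₁ φ₂
  conj_inner_symm φ₁ φ₂ := by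
    obtain ⟨X, i1, i2, u, hu⟩ := exists_screwForm_eq g
    simp only [hu, inner_conj_symm]
  re_inner_nonneg φ := by
    obtain ⟨X, i1, i2, u, hu⟩ := exists_screwForm_eq g
    simp only [hu]
    exact inner_self_nonneg
  add_left φ ψ χ := by
    obtain ⟨X, i1, i2, u, hu⟩ := exists_screwForm_eq g
    simp only [hu, map_add, inner_add_left]
  smul_left φ ψ c := by
    obtain ⟨X, i1, i2, u, hu⟩ := exists_screwForm_eq g
    simp only [hu, map_smul, inner_smul_left]

noncomputable instance (g : ScrewFunction) : SeminormedAddCommGroup (ScrewPre g) :=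
  @InnerProductSpace.Core.toSeminormedAddCommGroup ℂ (ScrewPre g) _ _ _ (screwCore g)

noncomputable instance (g : ScrewFunction) : InnerProductSpace ℂ (ScrewPre g) :=
  InnerProductSpace.ofCore (screwCore g)

/-- The Hilbert space `H(G_g)`: the (Hausdorff) completion of `L(G_g)`. -/
abbrev ScrewSpace (g : ScrewFunction) : Type := UniformSpace.Completion (ScrewPre g)

/-- The class in `H(G_g)` of a function `φ` in `L(G_g)`. -/
noncomputable def ScrewPre.toSpace {g : ScrewFunction} (φ : ScrewPre g) : ScrewSpace g :=
  (φ : UniformSpace.Completion (ScrewPre g))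

/-- The Fourier transform `∫ φ(t) e^{izt} dt`, `z` complex. -/
noncomputable def fourierC (φ : ℝ → ℂ) (z : ℂ) : ℂ :=
  ∫ t : ℝ, φ t * Complex.exp (Complex.I * z * t)

/-- The transform `Φ₁(φ, z) = ∫ φ(t) (e^{izt} - 1) / z dt`. -/
noncomputable def phiOne (φ : ℝ → ℂ) (z : ℂ) : ℂ :=
  ∫ t : ℝ, φ t *
    (if z = 0 then Complex.I * t else (Complex.exp (Complex.I * z * t) - 1) / z)

/-- The integrand `(e^{itγ} - 1 - itγ / (1 + γ²)) / γ²`, continuously extended to `γ = 0`. -/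
noncomputable def levyKernel (t γ : ℝ) : ℂ :=
  if γ = 0 then -(t : ℂ) ^ 2 / 2 else
    (Complex.exp (Complex.I * t * γ) - 1 - Complex.I * t * γ / (1 + γ ^ 2)) / γ ^ 2

/-- `τ` is a spectral measure of `g` on the real line, with linear coefficient `c`. -/
def IsSpectralMeasure (g : ℝ → ℂ) (c : ℝ) (τ : Measure ℝ) : Prop :=
  Integrable (fun γ : ℝ => 1 / (1 + γ ^ 2)) τ ∧
  ∀ t : ℝ, Integrable (levyKernel t) τ ∧
    g t = g 0 + Complex.I * c * t + ∫ γ, levyKernel t γ ∂τ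

/-- `x` is a screw line of `g`: a continuous curve with
`⟨x(t+u) - x(u), x(s+u) - x(u)⟩ = G_g(t,s)` for all `u`
(`⟨a, b⟩` linear in `a`, that is, `inner ℂ b a`). -/
def IsScrewLineOf {X : Type*} [NormedAddCommGroup X] [InnerProductSpace ℂ X]
    (g : ℝ → ℂ) (x : ℝ → X) : Prop :=
  Continuous x ∧ ∀ u t s : ℝ,
    inner ℂ (x (s + u) - x u) (x (t + u) - x u) = screwKernel g t s

/-! ### Hamiltonians and canonical systems -/

/-- Hamiltonians on an interval `J`. -/
structure IsHamiltonian (H : ℝ → Matrix (Fin 2) (Fin 2) ℝ) (J : Set ℝ) : Prop where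
  nonneg : ∀ᵐ t ∂(volume.restrict J), (H t).PosSemidef
  ne_zero : ∀ᵐ t ∂(volume.restrict J), H t ≠ 0
  symm : ∀ t ∈ J, (H t).IsSymm
  locInt : ∀ i j, LocallyIntegrableOn (fun t => H t i j) J

/-- A real matrix as a complex matrix. -/
def cmat (M : Matrix (Fin 2) (Fin 2) ℝ) : Matrix (Fin 2) (Fin 2) ℂ := M.map (fun x => (x : ℂ))

/-- The symplectic matrix `[[0, -1], [1, 0]]`. -/
def sympl : Matrix (Fin 2) (Fin 2) ℂ := !![0, -1; 1, 0]

/-- `Y(t,z) = ᵗ[A(t,z), B(t,z)]` solves the canonical system `Y' = z J H Y` on the interval `I`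
(for almost every `t`, `Y` locally absolutely continuous; written in integrated form). -/
def IsCanonicalSolution (H : ℝ → Matrix (Fin 2) (Fin 2) ℝ) (I : Set ℝ)
    (Y : ℝ → ℂ → Fin 2 → ℂ) : Prop :=
  ∀ z : ℂ, ContinuousOn (fun t => Y t z) I ∧ ∀ a ∈ I, ∀ b ∈ I, ∀ i : Fin 2,
    Y b z i - Y a z i = z * ∫ s in a..b, ((sympl * cmat (H s)).mulVec (Y s z)) i

/-- `W` is the fundamental solution of `(d/dt) W J = z W H`, `W(0,z) = I`, on `[0, L]`
(in integrated form). -/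
def IsFundamentalSolution (H : ℝ → Matrix (Fin 2) (Fin 2) ℝ) (L : ℝ)
    (W : ℝ → ℂ → Matrix (Fin 2) (Fin 2) ℂ) : Prop :=
  ∀ z : ℂ, W 0 z = 1 ∧ (∀ i j, ContinuousOn (fun t => W t z i j) (Set.Icc 0 L)) ∧
    ∀ t ∈ Set.Icc 0 L, ∀ i j : Fin 2,
      (W t z * sympl) i j - sympl i j = z * ∫ s in (0 : ℝ)..t, (W s z * cmat (H s)) i j

/-- The open interval `(a,b)` is `H`-indivisible of type `θ`. -/
def IsIndivisible (H : ℝ → Matrix (Fin 2) (Fin 2) ℝ) (a b θ : ℝ) : Prop :=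
  ∀ᵐ t ∂(volume.restrict (Set.Ioo a b)),
    Matrix.vecMul ![Real.cos θ, Real.sin θ] (!![0, -1; 1, 0] * H t) = 0

/-- `t` is a regular point of the Hamiltonian `H` on the interval `I`. -/
def IsRegularPoint (H : ℝ → Matrix (Fin 2) (Fin 2) ℝ) (I : Set ℝ) (t : ℝ) : Prop :=
  ¬ ∃ a b θ : ℝ, Set.Ioo a b ⊆ I ∧ t ∈ Set.Ioo a b ∧ IsIndivisible H a b θ

/-- `H` on `(t₀, t₁]` is a structure Hamiltonian of `E`. -/
structure IsStructureHamiltonian (E : HB) (H : ℝ → Matrix (Fin 2) (Fin 2) ℝ) (t₀ t₁ : ℝ) :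
    Prop where
  lt : t₀ < t₁
  ham : IsHamiltonian H (Set.Ioc t₀ t₁)
  limitCircle : ∃ t ∈ Set.Ioo t₀ t₁, IntegrableOn (fun u => (H u).trace) (Set.Ioc t t₁)
  sol : ∃ (Y : ℝ → ℂ → Fin 2 → ℂ) (Et : ℝ → HB),
    IsCanonicalSolution H (Set.Ioc t₀ t₁) Y ∧
    (∀ z, Y t₁ z 0 = E.A z ∧ Y t₁ z 1 = E.B z) ∧
    (∀ t ∈ Set.Ioc t₀ t₁, ∀ z, Et t z = Y t z 0 - Complex.I * Y t z 1) ∧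
    {V | IsDeBrangesSubspace E V} =
      {V | ∃ t ∈ Set.Ioc t₀ t₁, IsRegularPoint H (Set.Ioc t₀ t₁) t ∧
        V = deBrangesSubmodule (Et t)} ∧
    ∀ z : ℂ, Tendsto (fun t => abKernel (fun w => Y t w 0) (fun w => Y t w 1) z z)
      (𝓝[>] t₀) (𝓝 0)

/-- The squared norm `(1/π) ∫ ᵗF H conj F` defining `L²(H)`. -/
noncomputable def hamNormSq (H : ℝ → Matrix (Fin 2) (Fin 2) ℝ) (t₀ t₁ : ℝ)
    (F : ℝ → EuclideanSpace ℂ (Fin 2)) : ℝ :=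
  1 / Real.pi * ∫ t in t₀..t₁,
    ((F t).ofLp ⬝ᵥ (cmat (H t)).mulVec (fun i => conj (F t i))).re

/-- The Weyl transform `(1/π) ∫ [A(t,z) B(t,z)] H(t) F(t) dt`. -/
noncomputable def weylTransform (Y : ℝ → ℂ → Fin 2 → ℂ) (H : ℝ → Matrix (Fin 2) (Fin 2) ℝ)
    (t₀ t₁ : ℝ) (F : ℝ → EuclideanSpace ℂ (Fin 2)) (z : ℂ) : ℂ :=
  1 / Real.pi * ∫ t in t₀..t₁, Y t z ⬝ᵥ (cmat (H t)).mulVec (F t).ofLp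

/-! ### The Paley--Wiener case -/

/-- `E_r(z) = e^{-irz}`. -/
noncomputable def pwHB (r : ℝ) (hr : 0 < r) : HB where
  toFun z := Complex.exp (-(Complex.I * r * z))
  entire := by fun_prop
  sharp_lt z hz := by
    simp only [sharp, RCLike.norm_conj, Complex.norm_exp]
    refine Real.exp_lt_exp.2 ?_
    simp
    nlinarith [mul_pos hr hz]
  no_real_zero x := Complex.exp_ne_zero _

/-- `Θ_r(z) = e^{2irz}`. -/
noncomputable def pwTheta (r : ℝ) (z : ℂ) : ℂ := Complex.exp (2 * Complex.I * r * z)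

/-- The points `π (2n - 1) / (2r)`. -/
noncomputable def node (r : ℝ) (n : ℤ) : ℝ := Real.pi * (2 * n - 1) / (2 * r)

/-- `F_n(z) = i cos(rz) / (√(πr) (z - γ_n))`, an entire function since `cos (r γ_n) = 0`
(`dslope` is the difference quotient, with the limit as its value at `z = γ_n`). -/
noncomputable def pwBasis (r : ℝ) (n : ℤ) : ℂ → ℂ :=
  dslope (fun w => Complex.I * Complex.cos (r * w) / (√(Real.pi * r) : ℝ)) (node r n)

/-- The spectral measure `τ_r = μ_{Θ_r} / π`. -/
noncomputable def pwTau (r : ℝ) : Measure ℝ :=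
  ENNReal.ofReal (1 / Real.pi) • levelMeasure (pwTheta r)

/-- The `n`-th term of the series for the screw function `g_r`. -/
noncomputable def pwScrewTerm (r t : ℝ) (n : ℤ) : ℝ :=
  2 / r * ((1 / node r n ^ 2) * (Real.cos (node r n * t) - 1))

/-- The screw function `g_r` (sum over `n ≥ 1`). -/
noncomputable def pwScrew (r t : ℝ) : ℂ := ((∑' n : ℕ, pwScrewTerm r t (n + 1) : ℝ) : ℂ)

/-- The constant Hamiltonian `H_r = I`. -/
def pwHam (_t : ℝ) : Matrix (Fin 2) (Fin 2) ℝ := 1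

/-- `ᵗ[cos(tz), sin(tz)]`. -/
noncomputable def pwSol (t : ℝ) (z : ℂ) : Fin 2 → ℂ :=
  ![Complex.cos (t * z), Complex.sin (t * z)]

/-- The space `L²(H_r)` for `H_r = I` on `[0, r]`: square integrable `ℂ²`-valued functions with
`‖F‖² = (1/π) ∫₀ʳ (|f|² + |g|²) dt`. -/
abbrev PWHamSpace (r : ℝ) : Type :=
  Lp (EuclideanSpace ℂ (Fin 2)) 2
    (ENNReal.ofReal (1 / Real.pi) • volume.restrict (Set.Ioc 0 r))

/-- `Ψ_F = f - i g` on `[-r, r]`, with `f` extended evenly and `g` extended oddly. -/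
noncomputable def pwPsi (F : ℝ → EuclideanSpace ℂ (Fin 2)) (t : ℝ) : ℂ :=
  F |t| 0 - Complex.I * (SignType.sign t : ℝ) * F |t| 1

/-- The coefficients `(e^{itγ_n} - 1) / γ_n`. -/
noncomputable def pwCoeff (r t : ℝ) (n : ℤ) : ℂ :=
  (Complex.exp (Complex.I * t * node r n) - 1) / node r n

end ScrewPW

open ScrewPW

namespace ScrewPW

open FourierTransform in
theorem continuous_fourierInv {φ : ℝ → ℂ} (h1 : Integrable φ) : Continuous (𝓕⁻ φ) := by
  have h := VectorFourier.fourierIntegral_continuous (e := Real.fourierChar) (μ := volume)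
    (L := -innerₗ ℝ) Real.continuous_fourierChar (by fun_prop) h1
  exact h

open FourierTransform SchwartzMap in
theorem fourierInv_toLp_ae {φ : ℝ → ℂ} (h1 : Integrable φ) (h2 : MemLp φ 2) :
    ((𝓕⁻ (h2.toLp φ) : Lp ℂ 2 (volume : Measure ℝ)) : ℝ → ℂ) =ᵐ[volume] 𝓕⁻ φ := by
  generalize hP : (𝓕⁻ (h2.toLp φ) : Lp ℂ 2 (volume : Measure ℝ)) = P
  have hPl : LocallyIntegrable P volume := (Lp.memLp P).locallyIntegrable (by norm_num)
  have hloc : LocallyIntegrable (fun x => P x - (𝓕⁻ φ) x) volume := by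
    refine hPl.sub ?_
    exact (continuous_fourierInv h1).locallyIntegrable
  have key : ∀ g : ℝ → ℝ, ContDiff ℝ ((⊤ : ℕ∞) : WithTop ℕ∞) g → HasCompactSupport g →
      ∫ x, g x • (P x - (𝓕⁻ φ) x) = 0 := by
    intro g hg hgc
    have hgc' : HasCompactSupport (fun x => (g x : ℂ)) := hgc.comp_left (g := Complex.ofReal) Complex.ofReal_zero
    have hg' : ContDiff ℝ ((⊤ : ℕ∞) : WithTop ℕ∞) (fun x => (g x : ℂ)) :=
      Complex.ofRealCLM.contDiff.comp hg
    let G : 𝓢(ℝ, ℂ) := hgc'.toSchwartzMap hg'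
    have hG : ∀ x, G x = g x := fun x => rfl
    have e1 : inner ℂ (G.toLp 2 volume) P
        = inner ℂ ((𝓕 G).toLp 2 volume) (h2.toLp φ) := by
      rw [← hP, ← SchwartzMap.toLp_fourier_eq, ← Lp.inner_fourier_eq, fourier_fourierInv_eq]
    have e2 : inner ℂ (G.toLp 2 volume) P
        = ∫ x, g x • P x := by
      rw [L2.inner_def]
      refine integral_congr_ae ?_
      filter_upwards [G.coeFn_toLp 2 volume] with x hx
      rw [hx, hG]
      simp [mul_comm]
    have e3 : inner ℂ ((𝓕 G).toLp 2 volume) (h2.toLp φ)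
        = ∫ x, (𝓕⁻ (fun x => (g x : ℂ))) x • φ x := by
      rw [L2.inner_def]
      refine integral_congr_ae ?_
      filter_upwards [(𝓕 G).coeFn_toLp 2 volume, h2.coeFn_toLp] with x hx hx2
      rw [hx, hx2, SchwartzMap.fourier_coe, RCLike.inner_apply, smul_eq_mul, mul_comm]
      congr 1
      rw [Real.fourier_eq', Real.fourierInv_eq', ← integral_conj]
      congr 1
      ext v
      rw [hG, smul_eq_mul, smul_eq_mul, map_mul, ← Complex.exp_conj]
      simp [map_ofNat]
    have e4 : ∫ x, (𝓕⁻ (fun x => (g x : ℂ))) x • φ x = ∫ x, (g x : ℂ) • (𝓕⁻ φ) x := by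
      have := VectorFourier.integral_fourierIntegral_smul_eq_flip (e := Real.fourierChar)
        (L := -innerₗ ℝ) (μ := volume) (ν := volume) (f := fun x => (g x : ℂ)) (g := φ)
        Real.continuous_fourierChar (by fun_prop)
        (hg'.continuous.integrable_of_hasCompactSupport hgc') h1
      have hflip : (-innerₗ ℝ : ℝ →ₗ[ℝ] ℝ →ₗ[ℝ] ℝ).flip = -innerₗ ℝ := by
        ext; simp
      rw [hflip] at this
      exact this
    have i1 : Integrable (fun x => g x • P x) :=
      hPl.integrable_smul_left_of_hasCompactSupport
        hg.continuous hgc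
    have i2 : Integrable (fun x => g x • (𝓕⁻ φ) x) := by
      exact (continuous_fourierInv h1).locallyIntegrable.integrable_smul_left_of_hasCompactSupport hg.continuous hgc
    simp only [smul_sub]
    rw [integral_sub i1 i2, ← e2, e1, e3, e4, sub_eq_zero]
    rfl
  filter_upwards [ae_eq_zero_of_integral_contDiff_smul_eq_zero hloc key] with x hx
  exact sub_eq_zero.1 hx

open FourierTransform in
theorem fourierC_ofReal (φ : ℝ → ℂ) (x : ℝ) :
    fourierC φ x = (𝓕⁻ φ) ((2 * Real.pi)⁻¹ * x) := by
  rw [Real.fourierInv_eq', fourierC]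
  congr 1
  ext t
  rw [smul_eq_mul, mul_comm]
  congr 2
  have : (Real.pi : ℂ) ≠ 0 := by exact_mod_cast Real.pi_ne_zero
  simp
  field_simp

theorem eLpNorm_two_sq {α E : Type*} [MeasurableSpace α] [NormedAddCommGroup E] (f : α → E)
    (μ : Measure α) : eLpNorm f 2 μ ^ 2 = ∫⁻ x, ‖f x‖ₑ ^ 2 ∂μ := by
  rw [eLpNorm_eq_lintegral_rpow_enorm_toReal (by norm_num) (by norm_num)]
  rw [← ENNReal.rpow_natCast, ← ENNReal.rpow_mul]
  simp

theorem memLp_two_iff {α E : Type*} [MeasurableSpace α] [NormedAddCommGroup E] {f : α → E}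
    {μ : Measure α} :
    MemLp f 2 μ ↔ AEStronglyMeasurable f μ ∧ ∫⁻ x, ‖f x‖ₑ ^ 2 ∂μ < ⊤ := by
  rw [MemLp, ← eLpNorm_two_sq, ENNReal.pow_lt_top_iff]
  simp

theorem lintegral_comp_mul_left (f : ℝ → ENNReal) {c : ℝ} (hc : 0 < c) :
    ∫⁻ x, f (c * x) = ENNReal.ofReal c⁻¹ * ∫⁻ x, f x := by
  have h := Real.map_volume_mul_left hc.ne'
  have h2 : ∫⁻ x, f (c * x) = ∫⁻ y, f y ∂(Measure.map (c * ·) volume) :=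
    ((Homeomorph.mulLeft₀ c hc.ne').measurableEmbedding.lintegral_map f).symm
  rw [h2, h, lintegral_smul_measure, abs_of_pos (inv_pos.2 hc), smul_eq_mul]

theorem memLp_comp_mul_left {f : ℝ → ℂ} (hf : MemLp f 2) {c : ℝ} (hc : 0 < c) :
    MemLp (fun x => f (c * x)) 2 := by
  rw [memLp_two_iff] at hf ⊢
  refine ⟨?_, ?_⟩
  · refine hf.1.comp_quasiMeasurePreserving (f := fun x => c * x) ⟨by fun_prop, ?_⟩
    rw [Real.map_volume_mul_left hc.ne']
    exact Measure.smul_absolutelyContinuous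
  · rw [lintegral_comp_mul_left (fun x => ‖f x‖ₑ ^ 2) hc]
    exact ENNReal.mul_lt_top ENNReal.ofReal_lt_top hf.2

open FourierTransform in
theorem memLp_fourierC {φ : ℝ → ℂ} (h1 : Integrable φ) (h2 : MemLp φ 2) :
    MemLp (fun x : ℝ => fourierC φ x) 2 := by
  simp only [fourierC_ofReal]
  refine memLp_comp_mul_left ?_ (by positivity)
  exact (memLp_congr_ae (fourierInv_toLp_ae h1 h2)).1 (Lp.memLp _)

/-- Plancherel's theorem. -/
theorem lintegral_fourierC {φ : ℝ → ℂ} (h1 : Integrable φ) (h2 : MemLp φ 2) :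
    ∫⁻ x : ℝ, ‖fourierC φ x‖ₑ ^ 2 = ENNReal.ofReal (2 * Real.pi) * ∫⁻ t, ‖φ t‖ₑ ^ 2 := by
  open FourierTransform in
  simp only [fourierC_ofReal]
  have e0 := lintegral_comp_mul_left (fun x => ‖(𝓕⁻ φ) x‖ₑ ^ 2)
    (show 0 < (2 * Real.pi)⁻¹ by positivity)
  simp only [inv_inv] at e0
  rw [e0]
  congr 1
  have e : ∫⁻ x, ‖(𝓕⁻ φ) x‖ₑ ^ 2
      = ∫⁻ x, ‖(𝓕⁻ (h2.toLp φ) : Lp ℂ 2 (volume : Measure ℝ)) x‖ₑ ^ 2 := by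
    refine lintegral_congr_ae ?_
    filter_upwards [fourierInv_toLp_ae h1 h2] with x hx
    rw [hx]
  rw [e, ← eLpNorm_two_sq, ← eLpNorm_two_sq, ← Lp.enorm_def]
  have hn : ‖(𝓕⁻ (h2.toLp φ) : Lp ℂ 2 (volume : Measure ℝ))‖ = ‖h2.toLp φ‖ := by
    rw [← Lp.norm_fourier_eq, fourier_fourierInv_eq]
  rw [← ofReal_norm, hn, ofReal_norm, Lp.enorm_toLp]

/-- Every `h ∈ L²` is the Fourier transform of some `Ψ ∈ L²`, in the weak sense. -/
theorem exists_fourierC_preimage {h : ℝ → ℂ} (hh : MemLp h 2) :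
    ∃ Ψ : ℝ → ℂ, MemLp Ψ 2 ∧
      (∫⁻ x, ‖h x‖ₑ ^ 2 = ENNReal.ofReal (2 * Real.pi) * ∫⁻ t, ‖Ψ t‖ₑ ^ 2) ∧
      ∀ g : ℝ → ℂ, Integrable g → MemLp g 2 →
        ∫ x : ℝ, conj (fourierC g x) * h x = 2 * Real.pi * ∫ t, conj (g t) * Ψ t := by
  open FourierTransform in
  have hpi : 0 < 2 * Real.pi := by positivity
  have hh' := memLp_comp_mul_left hh hpi
  let H := hh'.toLp _
  let P : Lp ℂ 2 (volume : Measure ℝ) := 𝓕 H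
  refine ⟨P, Lp.memLp _, ?_, fun g g1 g2 => ?_⟩
  · rw [← eLpNorm_two_sq P, ← Lp.enorm_def, ← ofReal_norm, Lp.norm_fourier_eq,
      ofReal_norm, Lp.enorm_toLp, eLpNorm_two_sq,
      lintegral_comp_mul_left (fun x => ‖h x‖ₑ ^ 2) hpi, ← mul_assoc,
      ← ENNReal.ofReal_mul hpi.le, mul_inv_cancel₀ hpi.ne']
    simp
  · have e1 : inner ℂ (𝓕⁻ (g2.toLp g) : Lp ℂ 2 (volume : Measure ℝ)) H
        = inner ℂ (g2.toLp g) P := by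
      rw [← Lp.inner_fourier_eq, fourier_fourierInv_eq]
    have e2 : inner ℂ (𝓕⁻ (g2.toLp g) : Lp ℂ 2 (volume : Measure ℝ)) H
        = ∫ x, conj ((𝓕⁻ g) x) * h (2 * Real.pi * x) := by
      rw [L2.inner_def]
      refine integral_congr_ae ?_
      filter_upwards [fourierInv_toLp_ae g1 g2, hh'.coeFn_toLp] with x hx hx2
      rw [hx, hx2, RCLike.inner_apply, mul_comm]
    have e3 : inner ℂ (g2.toLp g) P = ∫ t, conj (g t) * P t := by
      rw [L2.inner_def]
      refine integral_congr_ae ?_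
      filter_upwards [g2.coeFn_toLp] with x hx
      rw [hx, RCLike.inner_apply, mul_comm]
    rw [← e3, ← e1, e2]
    have e4 := Measure.integral_comp_mul_left
      (fun x : ℝ => conj (fourierC g x) * h x) (2 * Real.pi)
    have e5 : ∀ x : ℝ, fourierC g ((2 * Real.pi * x : ℝ) : ℂ) = (𝓕⁻ g) x := fun x => by
      rw [fourierC_ofReal]
      field_simp
    simp only [e5] at e4
    rw [e4, abs_of_pos (inv_pos.2 hpi), Complex.real_smul]
    push_cast
    rw [← mul_assoc, mul_inv_cancel₀, one_mul]
    exact_mod_cast hpi.ne'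

/-- Parseval's formula. -/
theorem integral_conj_fourierC_mul {g k : ℝ → ℂ} (g1 : Integrable g) (g2 : MemLp g 2)
    (k1 : Integrable k) (k2 : MemLp k 2) :
    ∫ x : ℝ, conj (fourierC g x) * fourierC k x = 2 * Real.pi * ∫ t, conj (g t) * k t := by
  open FourierTransform in
  have e1 : inner ℂ (𝓕⁻ (g2.toLp g) : Lp ℂ 2 (volume : Measure ℝ)) (𝓕⁻ (k2.toLp k))
      = inner ℂ (g2.toLp g) (k2.toLp k) := by
    rw [← Lp.inner_fourier_eq, fourier_fourierInv_eq, fourier_fourierInv_eq]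
  have e2 : inner ℂ (𝓕⁻ (g2.toLp g) : Lp ℂ 2 (volume : Measure ℝ)) (𝓕⁻ (k2.toLp k))
      = ∫ x, conj ((𝓕⁻ g) x) * (𝓕⁻ k) x := by
    rw [L2.inner_def]
    refine integral_congr_ae ?_
    filter_upwards [fourierInv_toLp_ae g1 g2, fourierInv_toLp_ae k1 k2] with x hx hx2
    rw [hx, hx2, RCLike.inner_apply, mul_comm]
  have e3 : inner ℂ (g2.toLp g) (k2.toLp k) = ∫ t, conj (g t) * k t := by
    rw [L2.inner_def]
    refine integral_congr_ae ?_
    filter_upwards [g2.coeFn_toLp, k2.coeFn_toLp] with x hx hx2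
    rw [hx, hx2, RCLike.inner_apply, mul_comm]
  rw [← e3, ← e1, e2]
  simp only [fourierC_ofReal]
  have hpi : 0 < 2 * Real.pi := by positivity
  have e0 := Measure.integral_comp_mul_left (fun x : ℝ => conj ((𝓕⁻ g) x) * (𝓕⁻ k) x)
    (2 * Real.pi)⁻¹
  simp only [inv_inv, abs_of_pos hpi, Complex.real_smul] at e0
  rw [e0]
  push_cast
  rfl


/-- The area mean value inequality for holomorphic functions. -/
theorem enorm_mul_area_le_lintegral_ball {f : ℂ → ℂ} {c : ℂ} {δ : ℝ} (hδ : 0 < δ)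
    (hf : DifferentiableOn ℂ f (Metric.ball c δ)) :
    ‖f c‖ₑ * ENNReal.ofReal (Real.pi * δ ^ 2) ≤ ∫⁻ w in Metric.ball c δ, ‖f w‖ₑ := by
  let u : ℂ → ENNReal := (Metric.ball 0 δ).indicator fun w => ‖f (c + w)‖ₑ
  have hmaps : Set.MapsTo (fun w => c + w) (Metric.ball 0 δ) (Metric.ball c δ) := fun w hw => by
    simpa [dist_eq_norm] using hw
  have hcont : ContinuousOn (fun w => ‖f (c + w)‖ₑ) (Metric.ball 0 δ) :=
    (hf.continuousOn.comp (by fun_prop) hmaps).enorm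
  have hu : Measurable u := by
    classical
    have := hcont.measurable_piecewise (g := (0 : ℂ → ENNReal))
      continuous_zero.continuousOn measurableSet_ball
    rwa [Set.piecewise_eq_indicator] at this
  have e1 : ∫⁻ w in Metric.ball c δ, ‖f w‖ₑ = ∫⁻ w, u w := by
    rw [← lintegral_indicator measurableSet_ball, ← lintegral_add_left_eq_self _ c]
    refine lintegral_congr fun w => ?_
    by_cases hw : w ∈ Metric.ball (0 : ℂ) δ
    · rw [Set.indicator_of_mem (hmaps hw)]
      change _ = (Metric.ball 0 δ).indicator (fun w => ‖f (c + w)‖ₑ) w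
      rw [Set.indicator_of_mem hw]
    · have hw' : c + w ∉ Metric.ball c δ := by simpa [dist_eq_norm] using hw
      rw [Set.indicator_of_notMem hw']
      change _ = (Metric.ball 0 δ).indicator (fun w => ‖f (c + w)‖ₑ) w
      rw [Set.indicator_of_notMem hw]
  have hpol : ∀ p : ℝ × ℝ, Complex.polarCoord.symm p = circleMap 0 p.1 p.2 := fun p => by
    rw [Complex.polarCoord_symm_apply, circleMap, zero_add, Complex.exp_mul_I]
    push_cast
    rfl
  rw [e1, ← Complex.lintegral_comp_polarCoord_symm, polarCoord_target]
  simp only [hpol, smul_eq_mul]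
  rw [Measure.volume_eq_prod, setLIntegral_prod _ (by
    refine Measurable.aemeasurable ?_
    refine (ENNReal.measurable_ofReal.comp measurable_fst).mul (hu.comp ?_)
    unfold circleMap
    fun_prop)]
  have hin : ∀ ρ ∈ Set.Ioo 0 δ, ‖f c‖ₑ * ENNReal.ofReal (2 * Real.pi * ρ) ≤
      ∫⁻ θ in Set.Ioo (-Real.pi) Real.pi, ENNReal.ofReal ρ * u (circleMap 0 ρ θ) := by
    intro ρ hρ
    have hcl : Metric.closedBall c |ρ| ⊆ Metric.ball c δ := by
      rw [abs_of_pos hρ.1]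
      exact Metric.closedBall_subset_ball hρ.2
    have hav := (((hf.mono hcl).diffContOnCl_ball le_rfl)).circleAverage
    rw [Real.circleAverage_def] at hav
    have hper : ∫ θ in (0 : ℝ)..2 * Real.pi, f (circleMap c ρ θ)
        = ∫ θ in (-Real.pi)..Real.pi, f (circleMap c ρ θ) := by
      have := ((periodic_circleMap c ρ).comp f).intervalIntegral_add_eq 0 (-Real.pi)
      rw [zero_add, show -Real.pi + 2 * Real.pi = Real.pi by ring] at this
      exact this
    rw [hper] at hav
    have hle : ‖f c‖ₑ * ENNReal.ofReal (2 * Real.pi) ≤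
        ∫⁻ θ in Set.Ioc (-Real.pi) Real.pi, ‖f (circleMap c ρ θ)‖ₑ := by
      have h2 : ((2 * Real.pi : ℝ)) • f c = ∫ θ in (-Real.pi)..Real.pi, f (circleMap c ρ θ) := by
        rw [← hav, smul_smul, mul_inv_cancel₀ (by positivity), one_smul]
      have h3 : ‖f c‖ₑ * ENNReal.ofReal (2 * Real.pi)
          = ‖∫ θ in (-Real.pi)..Real.pi, f (circleMap c ρ θ)‖ₑ := by
        rw [← h2, enorm_smul, mul_comm, Real.enorm_of_nonneg (by positivity)]
      rw [h3, intervalIntegral.integral_of_le (by linarith [Real.pi_pos])]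
      exact enorm_integral_le_lintegral_enorm _
    rw [← setLIntegral_congr Ioo_ae_eq_Ioc] at hle
    have hcirc : ∀ θ, u (circleMap 0 ρ θ) = ‖f (circleMap c ρ θ)‖ₑ := fun θ => by
      have : circleMap 0 ρ θ ∈ Metric.ball (0 : ℂ) δ := by
        simp [circleMap, abs_of_pos hρ.1, hρ.2]
      change (Metric.ball 0 δ).indicator (fun w => ‖f (c + w)‖ₑ) _ = _
      rw [Set.indicator_of_mem this]
      simp [circleMap]
    simp only [hcirc]
    rw [lintegral_const_mul' _ _ ENNReal.ofReal_ne_top, ENNReal.ofReal_mul (by positivity),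
      ← mul_assoc, mul_comm]
    exact mul_le_mul' le_rfl hle
  calc ‖f c‖ₑ * ENNReal.ofReal (Real.pi * δ ^ 2)
      = ∫⁻ ρ in Set.Ioo 0 δ, ‖f c‖ₑ * ENNReal.ofReal (2 * Real.pi * ρ) := by
        rw [lintegral_const_mul' _ _ enorm_ne_top]
        congr 1
        rw [← ofReal_integral_eq_lintegral_ofReal]
        · rw [setIntegral_congr_set Ioo_ae_eq_Ioc, ← intervalIntegral.integral_of_le hδ.le,
            intervalIntegral.integral_const_mul, integral_id]
          congr 1
          ring
        · have : Continuous fun ρ : ℝ => 2 * Real.pi * ρ := by fun_prop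
          exact this.integrableOn_Icc.mono_set Set.Ioo_subset_Icc_self
        · filter_upwards [ae_restrict_mem measurableSet_Ioo] with ρ hρ
          have := hρ.1
          positivity
    _ ≤ ∫⁻ ρ in Set.Ioo 0 δ,
          ∫⁻ θ in Set.Ioo (-Real.pi) Real.pi, ENNReal.ofReal ρ * u (circleMap 0 ρ θ) :=
        setLIntegral_mono' measurableSet_Ioo hin
    _ ≤ _ := lintegral_mono_set Set.Ioo_subset_Ioi_self

/-- Functions in `H²` are bounded on every half-plane `δ ≤ Im z`, `δ > 0`. -/
theorem MemH2.exists_bound {F : ℂ → ℂ} (hF : MemH2 F) {δ : ℝ} (hδ : 0 < δ) :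
    ∃ M : ℝ, ∀ z : ℂ, δ ≤ z.im → ‖F z‖ ≤ M := by
  obtain ⟨h1, C, hC⟩ := hF
  let K : ENNReal := ENNReal.ofReal δ ^ 2 * NNReal.pi + C * ENNReal.ofReal (2 * δ)
  have hK : K < ⊤ := by
    refine ENNReal.add_lt_top.2 ⟨?_, ?_⟩
    · exact ENNReal.mul_lt_top (ENNReal.pow_lt_top ENNReal.ofReal_lt_top) ENNReal.coe_lt_top
    · exact ENNReal.mul_lt_top ENNReal.coe_lt_top ENNReal.ofReal_lt_top
  refine ⟨K.toReal / (Real.pi * δ ^ 2), fun c hc => ?_⟩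
  have hsub : Metric.ball c δ ⊆ upperHalf := fun w hw => by
    have h := (Complex.abs_im_le_norm (w - c)).trans_lt (by simpa [dist_eq_norm] using hw)
    rw [Complex.sub_im, abs_lt] at h
    change 0 < w.im
    linarith [h.1]
  have hm := enorm_mul_area_le_lintegral_ball hδ (h1.mono hsub)
  have hle : ∫⁻ w in Metric.ball c δ, ‖F w‖ₑ ≤ K := by
    have hcF : ContinuousOn (fun w => ‖F w‖ₑ ^ 2) upperHalf :=
      (ENNReal.continuous_pow 2).comp_continuousOn h1.continuousOn.enorm
    calc ∫⁻ w in Metric.ball c δ, ‖F w‖ₑ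
        ≤ ∫⁻ w in Metric.ball c δ, (1 + ‖F w‖ₑ ^ 2) := by
          refine lintegral_mono fun w => ?_
          rcases le_total ‖F w‖ₑ 1 with h | h
          · exact h.trans (le_add_right le_rfl)
          · refine le_trans ?_ (le_add_left le_rfl)
            rw [pow_two]
            exact le_mul_of_one_le_left' h
      _ = volume (Metric.ball c δ) + ∫⁻ w in Metric.ball c δ, ‖F w‖ₑ ^ 2 := by
          rw [lintegral_add_left measurable_const, setLIntegral_one]
      _ ≤ K := by
          rw [Complex.volume_ball]
          refine add_le_add le_rfl ?_
          let S : Set (ℝ × ℝ) := Set.univ ×ˢ Set.Ioo (c.im - δ) (c.im + δ)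
          have hS : MeasurableSet S := MeasurableSet.univ.prod measurableSet_Ioo
          have hpre : Metric.ball c δ ⊆ Complex.measurableEquivRealProd ⁻¹' S := fun w hw => by
            have h := (Complex.abs_im_le_norm (w - c)).trans_lt (by simpa [dist_eq_norm] using hw)
            rw [Complex.sub_im, abs_lt] at h
            refine ⟨trivial, ?_, ?_⟩
            · change c.im - δ < w.im
              linarith
            · change w.im < c.im + δ
              linarith
          refine (lintegral_mono_set hpre).trans ?_
          have e : ∫⁻ w in Complex.measurableEquivRealProd ⁻¹' S, ‖F w‖ₑ ^ 2
              = ∫⁻ p in S, ‖F (p.1 + p.2 * Complex.I)‖ₑ ^ 2 := by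
            rw [← Complex.volume_preserving_equiv_real_prod.setLIntegral_comp_preimage_emb
              (MeasurableEquiv.measurableEmbedding _)
              (fun p : ℝ × ℝ => ‖F (p.1 + p.2 * Complex.I)‖ₑ ^ 2)]
            refine lintegral_congr fun w => ?_
            simp [Complex.measurableEquivRealProd_apply, Complex.re_add_im]
          have hmeas : AEMeasurable (fun p : ℝ × ℝ => ‖F (p.1 + p.2 * Complex.I)‖ₑ ^ 2)
              ((volume.prod volume).restrict S) := by
            refine ContinuousOn.aemeasurable ?_ hS
            refine hcF.comp (by fun_prop) fun p hp => ?_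
            have := hp.2.1
            change 0 < ((p.1 : ℂ) + p.2 * Complex.I).im
            simp
            linarith
          rw [e, Measure.volume_eq_prod, setLIntegral_prod_symm _ hmeas]
          simp only [Measure.restrict_univ]
          calc ∫⁻ y in Set.Ioo (c.im - δ) (c.im + δ), ∫⁻ x : ℝ, ‖F (x + y * Complex.I)‖ₑ ^ 2
              ≤ ∫⁻ y in Set.Ioo (c.im - δ) (c.im + δ), (C : ENNReal) := by
                refine setLIntegral_mono' measurableSet_Ioo fun y hy => hC y ?_
                linarith [hy.1]
            _ ≤ _ := by
                rw [setLIntegral_const, Real.volume_Ioo]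
                refine mul_le_mul' le_rfl (ENNReal.ofReal_le_ofReal ?_)
                linarith
  have h3 := hm.trans hle
  rw [le_div_iff₀ (by positivity)]
  have h4 := ENNReal.toReal_mono hK.ne h3
  rwa [ENNReal.toReal_mul, toReal_enorm, ENNReal.toReal_ofReal (by positivity)] at h4


theorem lintegral_mul_enorm_sq_le {α : Type*} [MeasurableSpace α] {μ : Measure α} {a b : α → ℂ}
    (ha : AEStronglyMeasurable a μ) (hb : AEStronglyMeasurable b μ) :
    (∫⁻ x, ‖a x * b x‖ₑ ∂μ) ^ 2 ≤ (∫⁻ x, ‖a x‖ₑ ^ 2 ∂μ) * ∫⁻ x, ‖b x‖ₑ ^ 2 ∂μ := by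
  have h := ENNReal.lintegral_mul_le_Lp_mul_Lq μ Real.HolderConjugate.two_two ha.enorm hb.enorm
  have h2 : ∫⁻ x, ‖a x * b x‖ₑ ∂μ
      ≤ (∫⁻ x, ‖a x‖ₑ ^ 2 ∂μ) ^ (1 / (2 : ℝ)) * (∫⁻ x, ‖b x‖ₑ ^ 2 ∂μ) ^ (1 / (2 : ℝ)) := by
    simpa [enorm_mul] using h
  calc _ ≤ ((∫⁻ x, ‖a x‖ₑ ^ 2 ∂μ) ^ (1 / (2 : ℝ)) * (∫⁻ x, ‖b x‖ₑ ^ 2 ∂μ) ^ (1 / (2 : ℝ))) ^ 2 :=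
        pow_le_pow_left' h2 2
    _ = _ := by
        rw [mul_pow, ← ENNReal.rpow_natCast, ← ENNReal.rpow_natCast, ← ENNReal.rpow_mul,
          ← ENNReal.rpow_mul]
        simp

theorem enorm_integral_mul_sq_le {α : Type*} [MeasurableSpace α] {μ : Measure α} {a b : α → ℂ}
    (ha : AEStronglyMeasurable a μ) (hb : AEStronglyMeasurable b μ) :
    ‖∫ x, a x * b x ∂μ‖ₑ ^ 2 ≤ (∫⁻ x, ‖a x‖ₑ ^ 2 ∂μ) * ∫⁻ x, ‖b x‖ₑ ^ 2 ∂μ :=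
  (pow_le_pow_left' (enorm_integral_le_lintegral_enorm _) 2).trans (lintegral_mul_enorm_sq_le ha hb)

theorem norm_ofReal_sub_sq (x : ℝ) (z : ℂ) : ‖(x : ℂ) - z‖ ^ 2 = (x - z.re) ^ 2 + z.im ^ 2 := by
  rw [← Complex.normSq_eq_norm_sq, Complex.normSq_apply]
  simp
  ring

theorem ofReal_sub_ne_zero {z : ℂ} (hz : z.im ≠ 0) (x : ℝ) : (x : ℂ) - z ≠ 0 := fun h => by
  have := congrArg Complex.im h
  simp at this
  exact hz this

theorem integral_inv_sq_add_sq {b : ℝ} (hb : 0 < b) (a : ℝ) :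
    Integrable (fun x : ℝ => ((x - a) ^ 2 + b ^ 2)⁻¹) ∧
      ∫ x : ℝ, ((x - a) ^ 2 + b ^ 2)⁻¹ = Real.pi / b := by
  have e : (fun x : ℝ => ((x - a) ^ 2 + b ^ 2)⁻¹)
      = fun x => (fun u : ℝ => (b ^ 2)⁻¹ * (1 + (b⁻¹ * u) ^ 2)⁻¹) (x - a) := by
    ext x
    change _ = (b ^ 2)⁻¹ * (1 + (b⁻¹ * (x - a)) ^ 2)⁻¹
    rw [← mul_inv]
    congr 1
    field_simp
    ring
  have i0 : Integrable (fun u : ℝ => (b ^ 2)⁻¹ * (1 + (b⁻¹ * u) ^ 2)⁻¹) :=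
    (integrable_inv_one_add_sq.comp_mul_left' (inv_ne_zero hb.ne')).const_mul _
  rw [e]
  refine ⟨i0.comp_sub_right a, ?_⟩
  rw [integral_sub_right_eq_self (fun u : ℝ => (b ^ 2)⁻¹ * (1 + (b⁻¹ * u) ^ 2)⁻¹) a,
    integral_const_mul,
    Measure.integral_comp_mul_left (fun u : ℝ => (1 + u ^ 2)⁻¹), integral_univ_inv_one_add_sq,
    inv_inv, abs_of_pos hb, smul_eq_mul]
  field_simp

theorem enorm_inv_sub_sq (z : ℂ) (x : ℝ) :
    ‖((x : ℂ) - z)⁻¹‖ₑ ^ 2 = ENNReal.ofReal (((x - z.re) ^ 2 + |z.im| ^ 2)⁻¹) := by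
  rw [← ofReal_norm, ← ENNReal.ofReal_pow (norm_nonneg _), norm_inv, inv_pow, norm_ofReal_sub_sq,
    sq_abs]

theorem lintegral_inv_sub_sq {z : ℂ} (hz : z.im ≠ 0) :
    ∫⁻ x : ℝ, ‖((x : ℂ) - z)⁻¹‖ₑ ^ 2 = ENNReal.ofReal (Real.pi / |z.im|) := by
  obtain ⟨h1, h2⟩ := integral_inv_sq_add_sq (abs_pos.2 hz) z.re
  simp only [enorm_inv_sub_sq]
  rw [← h2, ofReal_integral_eq_lintegral_ofReal h1]
  exact Eventually.of_forall fun x => by positivity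

theorem memLp_inv_sub {z : ℂ} (hz : z.im ≠ 0) : MemLp (fun x : ℝ => ((x : ℂ) - z)⁻¹) 2 := by
  rw [memLp_two_iff]
  refine ⟨?_, ?_⟩
  · refine Continuous.aestronglyMeasurable ?_
    exact Continuous.inv₀ (by fun_prop) (ofReal_sub_ne_zero hz)
  · rw [lintegral_inv_sub_sq hz]
    exact ENNReal.ofReal_lt_top

theorem isOpen_im_gt (η : ℝ) : IsOpen {w : ℂ | η < w.im} :=
  isOpen_lt continuous_const Complex.continuous_im

/-- Cauchy's theorem on the boundary of the half-plane, for functions vanishing at `z`. -/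
theorem integral_div_sub_eq_zero {F : ℂ → ℂ} {η M : ℝ} {C : NNReal} (hη : 0 < η)
    (hF : DifferentiableOn ℂ F {w | -η < w.im}) (hM : ∀ w : ℂ, 0 ≤ w.im → ‖F w‖ ≤ M)
    (hC : ∀ y : ℝ, 0 ≤ y → ∫⁻ x : ℝ, ‖F (x + y * Complex.I)‖ₑ ^ 2 ≤ C)
    {z : ℂ} (hz : 0 < z.im) (hFz : F z = 0) : ∫ x : ℝ, F x * ((x : ℂ) - z)⁻¹ = 0 := by
  have hU := isOpen_im_gt (-η)
  have hzU : z ∈ {w : ℂ | -η < w.im} := by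
    change -η < z.im
    linarith
  let G := dslope F z
  have hG : DifferentiableOn ℂ G {w | -η < w.im} :=
    (Complex.differentiableOn_dslope (hU.mem_nhds hzU)).2 hF
  have hGe : ∀ w, w ≠ z → G w = F w * (w - z)⁻¹ := fun w hw => by
    change dslope F z w = _
    rw [dslope_of_ne _ hw, slope_def_field, hFz, sub_zero, div_eq_mul_inv]
  have hne : ∀ x y : ℝ, y ≠ z.im → (x : ℂ) + y * Complex.I ≠ z := fun x y h h2 => by
    apply h
    rw [← h2]
    simp
  have hline : ∀ y : ℝ, 0 ≤ y → Continuous fun x : ℝ => F (x + y * Complex.I) := fun y hy =>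
    hF.continuousOn.comp_continuous (by fun_prop) fun x => by
      simp
      linarith
  have hFL : MemLp (fun x : ℝ => F x) 2 := by
    rw [memLp_two_iff]
    have h0 := hC 0 le_rfl
    have c0 := hline 0 le_rfl
    simp only [Complex.ofReal_zero, zero_mul, add_zero] at h0 c0
    exact ⟨c0.aestronglyMeasurable, h0.trans_lt ENNReal.coe_lt_top⟩
  have hint : Integrable fun x : ℝ => F x * ((x : ℂ) - z)⁻¹ :=
    hFL.integrable_mul (memLp_inv_sub hz.ne')
  have hlim : Tendsto (fun n : ℕ => ‖∫ x in (-(n : ℝ))..n, F x * ((x : ℂ) - z)⁻¹‖) atTop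
      (𝓝 ‖∫ x : ℝ, F x * ((x : ℂ) - z)⁻¹‖) :=
    (intervalIntegral_tendsto_integral hint
      (tendsto_neg_atTop_atBot.comp tendsto_natCast_atTop_atTop)
      tendsto_natCast_atTop_atTop).norm
  have hbound : ∀ Y : ℝ, z.im < Y →
      ‖∫ x : ℝ, F x * ((x : ℂ) - z)⁻¹‖ ≤ √(C * (Real.pi / (Y - z.im))) := by
    intro Y hY
    have hY0 : 0 < Y := hz.trans hY
    have hvert : Tendsto (fun n : ℕ => √(C * (Real.pi / (Y - z.im)))
        + 2 * (M * ((n : ℝ) - ‖z‖)⁻¹ * Y)) atTop (𝓝 (√(C * (Real.pi / (Y - z.im))) + 2 * (M * 0 * Y))) := by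
      refine tendsto_const_nhds.add (((Tendsto.const_mul M ?_).mul_const Y).const_mul 2)
      exact tendsto_inv_atTop_zero.comp
        (tendsto_atTop_add_const_right _ _ tendsto_natCast_atTop_atTop)
    rw [mul_zero, zero_mul, mul_zero, add_zero] at hvert
    refine le_of_tendsto_of_tendsto hlim hvert ?_
    filter_upwards [tendsto_natCast_atTop_atTop.eventually_gt_atTop ‖z‖] with n hn
    have hrect := Complex.integral_boundary_rect_eq_zero_of_differentiableOn G
      (-(n : ℂ)) ((n : ℂ) + Y * Complex.I) (hG.mono fun w hw => by
        have h := hw.2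
        simp [Set.mem_uIcc] at h
        change -η < w.im
        rcases h with h | h <;> linarith [h.1])
    simp only [Complex.neg_re, Complex.natCast_re, Complex.neg_im, Complex.natCast_im, neg_zero,
      Complex.ofReal_zero, zero_mul, add_zero, Complex.add_re, Complex.mul_re, Complex.ofReal_re,
      Complex.I_re, mul_zero, Complex.ofReal_im, Complex.I_im, mul_one, sub_self, Complex.add_im,
      Complex.mul_im, zero_add, Complex.ofReal_neg, Complex.ofReal_natCast] at hrect
    have hbot : ∫ x in (-(n : ℝ))..n, F x * ((x : ℂ) - z)⁻¹ = ∫ x in (-(n : ℝ))..n, G x := by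
      refine intervalIntegral.integral_congr fun x _ => ?_
      have := hne x 0 hz.ne
      simp only [Complex.ofReal_zero, zero_mul, add_zero] at this
      exact (hGe x this).symm
    have hside : ∀ s : ℝ, |s| = n → ‖∫ y in (0 : ℝ)..Y, G (s + y * Complex.I)‖
        ≤ M * ((n : ℝ) - ‖z‖)⁻¹ * Y := by
      intro s hs
      have h := intervalIntegral.norm_integral_le_of_norm_le_const (a := 0) (b := Y)
        (f := fun y : ℝ => G (s + y * Complex.I)) (C := M * ((n : ℝ) - ‖z‖)⁻¹) fun y hy => by
          rw [Set.uIoc_of_le hY0.le] at hy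
          have h1 : (n : ℝ) ≤ ‖(s : ℂ) + y * Complex.I‖ := by
            have := Complex.abs_re_le_norm ((s : ℂ) + y * Complex.I)
            simpa [hs] using this
          have h2 : (n : ℝ) - ‖z‖ ≤ ‖(s : ℂ) + y * Complex.I - z‖ :=
            (sub_le_sub_right h1 _).trans (norm_sub_norm_le _ _)
          have h3 : (0 : ℝ) < n - ‖z‖ := by linarith
          have h4 : (s : ℂ) + y * Complex.I ≠ z := fun h => by
            rw [h, sub_self, norm_zero] at h2
            linarith
          have h5 := hM ((s : ℂ) + y * Complex.I) (by simpa using hy.1.le)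
          rw [hGe _ h4, norm_mul, norm_inv]
          exact mul_le_mul h5 (inv_anti₀ h3 h2) (by positivity) ((norm_nonneg _).trans h5)
      rwa [sub_zero, abs_of_pos hY0] at h
    have htop : ‖∫ x in (-(n : ℝ))..n, G (x + Y * Complex.I)‖ ≤ √(C * (Real.pi / (Y - z.im))) := by
      have e : ∀ x : ℝ, G (x + Y * Complex.I)
          = F (x + Y * Complex.I) * ((x : ℂ) - (z - Y * Complex.I))⁻¹ := fun x => by
        rw [hGe _ (hne x Y hY.ne')]
        congr 2
        ring
      simp only [e]
      have him : (z - Y * Complex.I).im = -(Y - z.im) := by simp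
      have hpos : 0 < Y - z.im := by linarith
      have him' : (z - Y * Complex.I).im ≠ 0 := by
        rw [him]
        linarith
      have h1 : ‖∫ x in (-(n : ℝ))..n,
          F (x + Y * Complex.I) * ((x : ℂ) - (z - Y * Complex.I))⁻¹‖ₑ ^ 2
          ≤ C * ENNReal.ofReal (Real.pi / (Y - z.im)) := by
        rw [intervalIntegral.integral_of_le (by linarith [Nat.cast_nonneg (α := ℝ) n])]
        refine (enorm_integral_mul_sq_le (hline Y hY0.le).aestronglyMeasurable
          (memLp_inv_sub him').1.restrict).trans ?_
        refine mul_le_mul' ((setLIntegral_le_lintegral _ _).trans (hC Y hY0.le))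
          ((setLIntegral_le_lintegral _ _).trans ?_)
        rw [lintegral_inv_sub_sq him', him, abs_neg, abs_of_pos hpos]
      refine Real.le_sqrt_of_sq_le ?_
      rw [← ENNReal.ofReal_le_ofReal_iff (by positivity), ENNReal.ofReal_pow (norm_nonneg _),
        ofReal_norm, ENNReal.ofReal_mul (by positivity), ENNReal.ofReal_coe_nnreal]
      exact h1
    have hkey : ∫ x in (-(n : ℝ))..n, G x = (∫ x in (-(n : ℝ))..n, G (x + Y * Complex.I))
        - Complex.I * (∫ y in (0 : ℝ)..Y, G (n + y * Complex.I))
        + Complex.I * (∫ y in (0 : ℝ)..Y, G (-n + y * Complex.I)) := by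
      simp only [smul_eq_mul] at hrect
      linear_combination hrect
    rw [hbot, hkey]
    refine (norm_add_le _ _).trans ?_
    refine (add_le_add (norm_sub_le _ _) le_rfl).trans ?_
    rw [norm_mul, norm_mul, Complex.norm_I, one_mul, one_mul]
    have hs1 := hside n (by simp)
    have hs2 := hside (-n) (by simp)
    simp only [Complex.ofReal_neg, Complex.ofReal_natCast] at hs1 hs2
    linarith
  have hz0 : Tendsto (fun Y : ℝ => √(C * (Real.pi / (Y - z.im)))) atTop (𝓝 (√(C * 0))) := by
    refine (Real.continuous_sqrt.tendsto _).comp (Tendsto.const_mul _ ?_)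
    exact tendsto_const_nhds.div_atTop (tendsto_atTop_add_const_right _ _ tendsto_id)
  rw [mul_zero, Real.sqrt_zero] at hz0
  have : ‖∫ x : ℝ, F x * ((x : ℂ) - z)⁻¹‖ ≤ 0 :=
    ge_of_tendsto hz0 ((eventually_gt_atTop z.im).mono hbound)
  exact norm_le_zero_iff.1 this

/-- Cauchy's formula on the boundary of the half-plane. -/
theorem integral_div_sub_eq {F : ℂ → ℂ} {η M : ℝ} {C : NNReal} (hη : 0 < η)
    (hF : DifferentiableOn ℂ F {w | -η < w.im}) (hM : ∀ w : ℂ, 0 ≤ w.im → ‖F w‖ ≤ M)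
    (hC : ∀ y : ℝ, 0 ≤ y → ∫⁻ x : ℝ, ‖F (x + y * Complex.I)‖ₑ ^ 2 ≤ C)
    {z : ℂ} (hz : 0 < z.im) :
    ∫ x : ℝ, F x * ((x : ℂ) - z)⁻¹ = 2 * Real.pi * Complex.I * F z := by
  have hη' : 0 < min η z.im := lt_min hη hz
  let k : ℂ → ℂ := fun w => F z * (z - conj z) * (w - conj z)⁻¹
  let F₁ : ℂ → ℂ := fun w => F w - k w
  have hne : ∀ w : ℂ, -(z.im) < w.im → w - conj z ≠ 0 := fun w hw h => by
    have := congrArg Complex.im h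
    simp at this
    linarith
  have hk : DifferentiableOn ℂ k {w | -(min η z.im) < w.im} := by
    refine DifferentiableOn.const_mul ?_ _
    refine DifferentiableOn.inv (by fun_prop) fun w hw => hne w ?_
    have hw' : -(min η z.im) < w.im := hw
    linarith [min_le_right η z.im]
  have hF₁ : DifferentiableOn ℂ F₁ {w | -(min η z.im) < w.im} := by
    refine (hF.mono fun w hw => ?_).sub hk
    have hw' : -(min η z.im) < w.im := hw
    change -η < w.im
    linarith [min_le_left η z.im]
  have hM₁ : ∀ w : ℂ, 0 ≤ w.im → ‖F₁ w‖ ≤ M + ‖F z * (z - conj z)‖ * (z.im)⁻¹ := fun w hw => by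
    refine (norm_sub_le _ _).trans (add_le_add (hM w hw) ?_)
    change ‖F z * (z - conj z) * (w - conj z)⁻¹‖ ≤ _
    rw [norm_mul, norm_inv]
    refine mul_le_mul_of_nonneg_left (inv_anti₀ hz ?_) (norm_nonneg _)
    have := Complex.abs_im_le_norm (w - conj z)
    simp only [Complex.sub_im, Complex.conj_im, sub_neg_eq_add] at this
    rw [abs_of_pos (by linarith)] at this
    linarith
  let D : NNReal := ‖F z * (z - conj z)‖₊ ^ 2 * (Real.pi / z.im).toNNReal
  have hD : ∀ y : ℝ, 0 ≤ y → ∫⁻ x : ℝ, ‖k (x + y * Complex.I)‖ₑ ^ 2 ≤ D := fun y hy => by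
    have e : ∀ x : ℝ, ‖k (x + y * Complex.I)‖ₑ ^ 2
        = ‖F z * (z - conj z)‖ₑ ^ 2 * ‖((x : ℂ) - (conj z - y * Complex.I))⁻¹‖ₑ ^ 2 := fun x => by
      change ‖F z * (z - conj z) * (x + y * Complex.I - conj z)⁻¹‖ₑ ^ 2 = _
      rw [enorm_mul, mul_pow]
      congr 4
      ring
    have him : (conj z - y * Complex.I).im = -(z.im + y) := by simp; ring
    simp only [e]
    rw [lintegral_const_mul' _ _ (ENNReal.pow_ne_top enorm_ne_top), lintegral_inv_sub_sq (by rw [him]; linarith), him,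
      abs_neg, abs_of_pos (by linarith)]
    change _ ≤ ((‖F z * (z - conj z)‖₊ ^ 2 * (Real.pi / z.im).toNNReal : NNReal) : ENNReal)
    push_cast
    refine mul_le_mul' le_rfl (ENNReal.ofReal_le_ofReal ?_)
    exact div_le_div_of_nonneg_left Real.pi_pos.le hz (by linarith)
  have hC₁ : ∀ y : ℝ, 0 ≤ y → ∫⁻ x : ℝ, ‖F₁ (x + y * Complex.I)‖ₑ ^ 2
      ≤ (2 * C + 2 * D : NNReal) := fun y hy => by
    have key : ∀ x : ℝ, ‖F₁ (x + y * Complex.I)‖ₑ ^ 2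
        ≤ 2 * ‖F (x + y * Complex.I)‖ₑ ^ 2 + 2 * ‖k (x + y * Complex.I)‖ₑ ^ 2 := fun x => by
      change ‖F (x + y * Complex.I) - k (x + y * Complex.I)‖ₑ ^ 2 ≤ _
      set a := F (x + y * Complex.I)
      set b := k (x + y * Complex.I)
      have hab : ‖a - b‖₊ ^ 2 ≤ 2 * ‖a‖₊ ^ 2 + 2 * ‖b‖₊ ^ 2 := by
        rw [← NNReal.coe_le_coe]
        push_cast
        have := norm_sub_le a b
        nlinarith [sq_nonneg (‖a‖ - ‖b‖), norm_nonneg (a - b), norm_nonneg a, norm_nonneg b]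
      simp only [enorm_eq_nnnorm]
      exact_mod_cast hab
    have hm : Measurable fun x : ℝ => 2 * ‖F (x + y * Complex.I)‖ₑ ^ 2 := by
      have : Continuous fun x : ℝ => F (x + y * Complex.I) :=
        hF.continuousOn.comp_continuous (by fun_prop) fun x => by
          simp
          linarith
      exact (this.measurable.enorm.pow_const 2).const_mul 2
    refine (lintegral_mono key).trans ?_
    rw [lintegral_add_left hm, lintegral_const_mul' _ _ (by simp),
      lintegral_const_mul' _ _ (by simp)]
    push_cast
    exact add_le_add (mul_le_mul' le_rfl (hC y hy)) (mul_le_mul' le_rfl (hD y hy))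
  have hF₁z : F₁ z = 0 := by
    change F z - F z * (z - conj z) * (z - conj z)⁻¹ = 0
    rw [mul_assoc, mul_inv_cancel₀ (hne z (by linarith)), mul_one, sub_self]
  have h0 := integral_div_sub_eq_zero hη' hF₁ hM₁ hC₁ hz hF₁z
  have hFL : MemLp (fun x : ℝ => F x) 2 := by
    rw [memLp_two_iff]
    have h0 := hC 0 le_rfl
    have c0 : Continuous fun x : ℝ => F x :=
      hF.continuousOn.comp_continuous (by fun_prop) fun x => by simpa using hη
    simp only [Complex.ofReal_zero, zero_mul, add_zero] at h0
    exact ⟨c0.aestronglyMeasurable, h0.trans_lt ENNReal.coe_lt_top⟩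
  have hint : Integrable fun x : ℝ => F x * ((x : ℂ) - z)⁻¹ :=
    hFL.integrable_mul (memLp_inv_sub hz.ne')
  obtain ⟨p1, p2⟩ := integral_inv_sq_add_sq hz z.re
  have hker : ∀ x : ℝ, k x * ((x : ℂ) - z)⁻¹
      = F z * (z - conj z) * (((x - z.re) ^ 2 + z.im ^ 2)⁻¹ : ℝ) := fun x => by
    change F z * (z - conj z) * ((x : ℂ) - conj z)⁻¹ * ((x : ℂ) - z)⁻¹ = _
    rw [mul_assoc, ← mul_inv]
    congr 1
    rw [← norm_ofReal_sub_sq, Complex.ofReal_inv, ← Complex.normSq_eq_norm_sq,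
      Complex.normSq_eq_conj_mul_self]
    simp
  have hsplit : ∫ x : ℝ, F₁ x * ((x : ℂ) - z)⁻¹ = (∫ x : ℝ, F x * ((x : ℂ) - z)⁻¹)
      - ∫ x : ℝ, F z * (z - conj z) * (((x - z.re) ^ 2 + z.im ^ 2)⁻¹ : ℝ) := by
    have hI : Integrable fun x : ℝ =>
        F z * (z - conj z) * (((x - z.re) ^ 2 + z.im ^ 2)⁻¹ : ℝ) := p1.ofReal.const_mul _
    rw [← integral_sub hint hI]
    refine integral_congr_ae (Eventually.of_forall fun x => ?_)
    change (F x - k x) * ((x : ℂ) - z)⁻¹ = _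
    rw [sub_mul, hker]
  rw [hsplit, integral_const_mul, integral_complex_ofReal, p2, sub_eq_zero] at h0
  rw [h0, Complex.sub_conj]
  have : (z.im : ℂ) ≠ 0 := by exact_mod_cast hz.ne'
  push_cast
  field_simp


/-- The function `t ↦ e^{-yt} Φ(t)`. -/
noncomputable def damp (y : ℝ) (Φ : ℝ → ℂ) (t : ℝ) : ℂ := (Real.exp (-(y * t)) : ℝ) * Φ t

theorem fourierC_damp (Φ : ℝ → ℂ) (y : ℝ) (z : ℂ) :
    fourierC (damp y Φ) z = fourierC Φ (z + y * Complex.I) := by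
  unfold fourierC damp
  congr 1
  ext t
  have : Complex.exp (Complex.I * (z + y * Complex.I) * t)
      = (Real.exp (-(y * t)) : ℝ) * Complex.exp (Complex.I * z * t) := by
    rw [Complex.ofReal_exp, ← Complex.exp_add]
    congr 1
    push_cast
    linear_combination (y : ℂ) * t * Complex.I_sq
  rw [this]
  ring

theorem damp_damp (y y' : ℝ) (Φ : ℝ → ℂ) : damp y (damp y' Φ) = damp (y + y') Φ := by
  ext t
  unfold damp
  rw [← mul_assoc, ← Complex.ofReal_mul, ← Real.exp_add]
  congr 3
  ring

theorem memLp_damp {Φ : ℝ → ℂ} (hΦ : MemLp Φ 2) (h0 : ∀ t ≤ 0, Φ t = 0) {y : ℝ} (hy : 0 ≤ y) :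
    MemLp (damp y Φ) 2 := by
  refine hΦ.of_le ?_ (Eventually.of_forall fun t => ?_)
  · have : Continuous fun t : ℝ => ((Real.exp (-(y * t)) : ℝ) : ℂ) := by fun_prop
    exact this.aestronglyMeasurable.mul hΦ.1
  · rcases le_or_gt t 0 with h | h
    · simp [damp, h0 t h]
    · unfold damp
      rw [norm_mul, Complex.norm_real, Real.norm_of_nonneg (Real.exp_pos _).le]
      refine mul_le_of_le_one_left (norm_nonneg _) (Real.exp_le_one_iff.2 ?_)
      have := mul_nonneg hy h.le
      linarith

theorem integrableOn_exp_neg_mul {y : ℝ} (hy : 0 < y) :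
    IntegrableOn (fun t : ℝ => Real.exp (-(y * t))) (Set.Ioi 0) := by
  simpa using integrableOn_exp_mul_Ioi (neg_lt_zero.2 hy) 0

theorem memLp_indicator_exp {c : ℂ} (hc : c.re < 0) :
    MemLp ((Set.Ioi (0 : ℝ)).indicator fun t : ℝ => Complex.exp (c * t)) 2 ∧
      Integrable ((Set.Ioi (0 : ℝ)).indicator fun t : ℝ => Complex.exp (c * t)) := by
  have hm : Measurable fun t : ℝ => Complex.exp (c * t) := by fun_prop
  constructor
  · rw [memLp_indicator_iff_restrict measurableSet_Ioi,
      memLp_two_iff_integrable_sq_norm hm.aestronglyMeasurable]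
    refine (integrableOn_exp_neg_mul (y := -(2 * c.re)) (by linarith)).congr_fun (fun t _ => ?_)
      measurableSet_Ioi
    simp only [Complex.norm_exp]
    rw [← Real.exp_nat_mul]
    congr 1
    simp
    ring
  · rw [integrable_indicator_iff measurableSet_Ioi]
    refine (integrable_norm_iff hm.aestronglyMeasurable).1 ?_
    refine (integrableOn_exp_neg_mul (y := -c.re) (by linarith)).congr_fun (fun t _ => ?_)
      measurableSet_Ioi
    simp [Complex.norm_exp]

theorem integrable_damp {Φ : ℝ → ℂ} (hΦ : MemLp Φ 2) (h0 : ∀ t ≤ 0, Φ t = 0) {y : ℝ}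
    (hy : 0 < y) : Integrable (damp y Φ) := by
  have h := (memLp_indicator_exp (c := -(y : ℂ)) (by simpa using hy)).1
  refine (h.integrable_mul hΦ).congr (Eventually.of_forall fun t => ?_)
  rcases le_or_gt t 0 with ht | ht
  · simp [damp, h0 t ht]
  · simp [damp, Set.indicator_of_mem (Set.mem_Ioi.2 ht)]

theorem ae_eq_of_fourierC_eq {u v : ℝ → ℂ} (u1 : Integrable u) (u2 : MemLp u 2)
    (v1 : Integrable v) (v2 : MemLp v 2) (h : ∀ x : ℝ, fourierC u x = fourierC v x) :
    u =ᵐ[volume] v := by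
  have hp := lintegral_fourierC (u1.sub v1) (u2.sub v2)
  have h0 : ∀ x : ℝ, fourierC (u - v) x = 0 := fun x => by
    have hu : ∀ w : ℝ → ℂ, Integrable w →
        Integrable fun t : ℝ => w t * Complex.exp (Complex.I * x * t) := fun w hw => by
      refine hw.mul_bdd (c := 1) (by fun_prop) (Eventually.of_forall fun t => ?_)
      rw [Complex.norm_exp]
      simp
    have e : fourierC (u - v) x = fourierC u x - fourierC v x := by
      unfold fourierC
      rw [← integral_sub (hu u u1) (hu v v1)]
      congr 1
      ext t
      simp [sub_mul]
    rw [e, h, sub_self]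
  simp only [h0] at hp
  have h1 : ∫⁻ t, ‖(u - v) t‖ₑ ^ 2 = 0 := by
    have h2 : ENNReal.ofReal (2 * Real.pi) * ∫⁻ t, ‖(u - v) t‖ₑ ^ 2 = 0 := by
      rw [← hp]
      simp
    rcases mul_eq_zero.1 h2 with h3 | h3
    · exfalso
      rw [ENNReal.ofReal_eq_zero] at h3
      linarith [Real.pi_pos]
    · exact h3
  rw [lintegral_eq_zero_iff' ((u1.sub v1).1.enorm.pow_const 2)] at h1
  filter_upwards [h1] with t ht
  have : ‖(u - v) t‖ₑ = 0 := by simpa using ht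
  rw [enorm_eq_zero] at this
  exact sub_eq_zero.1 this

theorem fourierC_congr_ae {u v : ℝ → ℂ} (h : u =ᵐ[volume] v) (z : ℂ) :
    fourierC u z = fourierC v z := by
  refine integral_congr_ae ?_
  filter_upwards [h] with t ht
  rw [ht]

theorem damp_congr_ae {u v : ℝ → ℂ} (h : u =ᵐ[volume] v) (y : ℝ) :
    damp y u =ᵐ[volume] damp y v := by
  filter_upwards [h] with t ht
  unfold damp
  rw [ht]

/-- Representation of an `H²` function on a smaller half-plane. -/
theorem MemH2.exists_fourierC_aux {F : ℂ → ℂ} {C : NNReal}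
    (h1 : DifferentiableOn ℂ F upperHalf)
    (hC : ∀ y : ℝ, 0 < y → ∫⁻ x : ℝ, ‖F (x + y * Complex.I)‖ₑ ^ 2 ≤ C) {δ : ℝ} (hδ : 0 < δ) :
    ∃ Ψ : ℝ → ℂ, MemLp Ψ 2 ∧ (∀ t ≤ 0, Ψ t = 0) ∧
      (ENNReal.ofReal (2 * Real.pi) * ∫⁻ t, ‖Ψ t‖ₑ ^ 2 ≤ C) ∧
      ∀ z : ℂ, 0 < z.im → F (z + δ * Complex.I) = fourierC Ψ z := by
  obtain ⟨M, hM⟩ := MemH2.exists_bound ⟨h1, C, hC⟩ hδ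
  let G : ℂ → ℂ := fun z => F (z + δ * Complex.I)
  have hG : DifferentiableOn ℂ G {w | -δ < w.im} := by
    refine h1.comp (by fun_prop) fun w hw => ?_
    have hw' : -δ < w.im := hw
    change 0 < (w + δ * Complex.I).im
    simp
    linarith
  have hGM : ∀ w : ℂ, 0 ≤ w.im → ‖G w‖ ≤ M := fun w hw => hM _ (by simpa using hw)
  have hGC : ∀ y : ℝ, 0 ≤ y → ∫⁻ x : ℝ, ‖G (x + y * Complex.I)‖ₑ ^ 2 ≤ C := fun y hy => by
    refine le_trans (le_of_eq (lintegral_congr fun x => ?_)) (hC (y + δ) (by linarith))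
    change ‖F (x + y * Complex.I + δ * Complex.I)‖ₑ ^ 2 = _
    congr 3
    push_cast
    ring
  have hGL : MemLp (fun x : ℝ => G x) 2 := by
    rw [memLp_two_iff]
    have h0 := hGC 0 le_rfl
    have c0 : Continuous fun x : ℝ => G x :=
      hG.continuousOn.comp_continuous (by fun_prop) fun x => by simpa using hδ
    simp only [Complex.ofReal_zero, zero_mul, add_zero] at h0
    exact ⟨c0.aestronglyMeasurable, h0.trans_lt ENNReal.coe_lt_top⟩
  obtain ⟨Ψ, p1, p2, p3⟩ := exists_fourierC_preimage hGL
  refine ⟨(Set.Ioi 0).indicator Ψ, p1.indicator measurableSet_Ioi, fun t ht => ?_, ?_,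
    fun z hz => ?_⟩
  · exact Set.indicator_of_notMem (by simpa using ht) _
  · have h0 := hGC 0 le_rfl
    simp only [Complex.ofReal_zero, zero_mul, add_zero] at h0
    rw [p2] at h0
    refine le_trans (mul_le_mul' le_rfl (lintegral_mono fun t => ?_)) h0
    refine pow_le_pow_left' ?_ 2
    exact enorm_indicator_le_enorm_self _ _
  · have hcau := integral_div_sub_eq hδ hG hGM hGC hz
    have hc : (-(Complex.I * conj z)).re < 0 := by simpa using hz
    obtain ⟨g2, g1⟩ := memLp_indicator_exp hc
    have h4 := p3 _ g1 g2
    have hg : ∀ x : ℝ, conj (fourierC ((Set.Ioi (0 : ℝ)).indicator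
        fun t : ℝ => Complex.exp (-(Complex.I * conj z) * t)) x)
        = -Complex.I * ((x : ℂ) - z)⁻¹ := fun x => by
      have hre : (Complex.I * (x - conj z)).re < 0 := by simpa using hz
      have e : fourierC ((Set.Ioi (0 : ℝ)).indicator
          fun t : ℝ => Complex.exp (-(Complex.I * conj z) * t)) x
          = ∫ t in Set.Ioi (0 : ℝ), Complex.exp (Complex.I * (x - conj z) * t) := by
        rw [← integral_indicator measurableSet_Ioi]
        unfold fourierC
        congr 1
        ext t
        by_cases ht : t ∈ Set.Ioi (0 : ℝ)
        · rw [Set.indicator_of_mem ht, Set.indicator_of_mem ht, ← Complex.exp_add]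
          congr 1
          ring
        · rw [Set.indicator_of_notMem ht, Set.indicator_of_notMem ht, zero_mul]
      rw [e, integral_exp_mul_complex_Ioi hre]
      simp only [Complex.ofReal_zero, mul_zero, Complex.exp_zero]
      have hne := ofReal_sub_ne_zero hz.ne' x
      have : -1 / (Complex.I * (x - conj z)) = Complex.I * ((x : ℂ) - conj z)⁻¹ := by
        rw [neg_div, one_div, mul_inv, Complex.inv_I]
        ring
      rw [this]
      simp
    have h5 : ∫ x : ℝ, conj (fourierC ((Set.Ioi (0 : ℝ)).indicator
        fun t : ℝ => Complex.exp (-(Complex.I * conj z) * t)) x) * G x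
        = -Complex.I * ∫ x : ℝ, G x * ((x : ℂ) - z)⁻¹ := by
      rw [← integral_const_mul]
      congr 1
      ext x
      rw [hg]
      ring
    have h6 : ∫ t : ℝ, conj ((Set.Ioi (0 : ℝ)).indicator
        (fun t : ℝ => Complex.exp (-(Complex.I * conj z) * t)) t) * Ψ t
        = fourierC ((Set.Ioi 0).indicator Ψ) z := by
      unfold fourierC
      congr 1
      ext t
      by_cases ht : t ∈ Set.Ioi (0 : ℝ)
      · rw [Set.indicator_of_mem ht, Set.indicator_of_mem ht, ← Complex.exp_conj, mul_comm]
        congr 2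
        simp
      · rw [Set.indicator_of_notMem ht, Set.indicator_of_notMem ht, map_zero, zero_mul, zero_mul]
    rw [h5, h6, hcau] at h4
    have hpi : (2 * Real.pi : ℂ) ≠ 0 := by
      have := Real.pi_ne_zero
      exact_mod_cast (by positivity : (2 * Real.pi : ℝ) ≠ 0)
    refine mul_left_cancel₀ hpi ?_
    rw [← h4]
    change 2 * Real.pi * G z = _
    linear_combination (2 * Real.pi * G z) * Complex.I_sq

/-- The Paley--Wiener theorem for the Hardy space of the upper half-plane. -/
theorem MemH2.exists_fourierC {F : ℂ → ℂ} (hF : MemH2 F) :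
    ∃ Φ : ℝ → ℂ, MemLp Φ 2 ∧ (∀ t ≤ 0, Φ t = 0) ∧ ∀ z : ℂ, 0 < z.im → F z = fourierC Φ z := by
  obtain ⟨h1, C, hC⟩ := hF
  choose Ψ p1 p2 p3 p4 using fun n : ℕ => MemH2.exists_fourierC_aux h1 hC
    (δ := 1 / ((n : ℝ) + 1)) (by positivity)
  let d : ℕ → ℝ := fun n => 1 / ((n : ℝ) + 1)
  have hd : ∀ n, 0 < d n := fun n => by positivity
  have hd1 : ∀ n, d n ≤ 1 := fun n => by
    rw [div_le_one (by positivity)]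
    linarith [Nat.cast_nonneg (α := ℝ) n]
  have hcomp : ∀ n, damp (2 - d n) (Ψ n) =ᵐ[volume] damp 1 (Ψ 0) := fun n => by
    have hpos : 0 < 2 - d n := by linarith [hd1 n]
    refine ae_eq_of_fourierC_eq (integrable_damp (p1 n) (p2 n) hpos)
      (memLp_damp (p1 n) (p2 n) hpos.le) (integrable_damp (p1 0) (p2 0) one_pos)
      (memLp_damp (p1 0) (p2 0) zero_le_one) fun x => ?_
    rw [fourierC_damp, fourierC_damp, ← p4 n _ (by simpa using hpos), ← p4 0 _ (by simp)]
    congr 1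
    simp [d]
    ring
  let Φ : ℝ → ℂ := damp (-1) (Ψ 0)
  have hΦ0 : ∀ t ≤ 0, Φ t = 0 := fun t ht => by simp [Φ, damp, p2 0 t ht]
  have hΦn : ∀ n, damp (d n) Φ =ᵐ[volume] Ψ n := fun n => by
    have := damp_congr_ae (hcomp n) (d n - 2)
    rw [damp_damp, damp_damp] at this
    have e1 : damp (d n - 2 + (2 - d n)) (Ψ n) = Ψ n := by
      ext t
      simp [damp]
    rw [e1] at this
    change damp (d n) (damp (-1) (Ψ 0)) =ᵐ[volume] _
    rw [damp_damp]
    refine EventuallyEq.trans ?_ this.symm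
    rw [show d n + -1 = d n - 2 + 1 by ring]
  have hΦm : AEStronglyMeasurable Φ volume := by
    have : Continuous fun t : ℝ => ((Real.exp (-(-1 * t)) : ℝ) : ℂ) := by fun_prop
    exact this.aestronglyMeasurable.mul (p1 0).1
  have hd0 : Tendsto d atTop (𝓝 0) := tendsto_one_div_add_atTop_nhds_zero_nat
  have hΦ : MemLp Φ 2 := by
    rw [memLp_two_iff]
    refine ⟨hΦm, ?_⟩
    have hlim : ∀ t, Tendsto (fun n => ‖damp (d n) Φ t‖ₑ ^ 2) atTop (𝓝 (‖Φ t‖ₑ ^ 2)) := fun t => by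
      refine (ENNReal.continuous_pow 2).continuousAt.tendsto.comp (Tendsto.enorm ?_)
      have : Continuous fun y : ℝ => damp y Φ t := by
        unfold damp
        fun_prop
      have h := (this.tendsto 0).comp hd0
      have e : damp 0 Φ t = Φ t := by simp [damp]
      rwa [e] at h
    calc ∫⁻ t, ‖Φ t‖ₑ ^ 2 = ∫⁻ t, liminf (fun n => ‖damp (d n) Φ t‖ₑ ^ 2) atTop :=
          lintegral_congr fun t => (hlim t).liminf_eq.symm
      _ ≤ liminf (fun n => ∫⁻ t, ‖damp (d n) Φ t‖ₑ ^ 2) atTop := by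
          refine lintegral_liminf_le' fun n => ?_
          have : Continuous fun t : ℝ => ((Real.exp (-(d n * t)) : ℝ) : ℂ) := by fun_prop
          exact (this.aestronglyMeasurable.mul hΦm).enorm.pow_const 2
      _ ≤ (ENNReal.ofReal (2 * Real.pi))⁻¹ * C := by
          refine liminf_le_of_frequently_le' (Frequently.of_forall fun n => ?_)
          have e : ∫⁻ t, ‖damp (d n) Φ t‖ₑ ^ 2 = ∫⁻ t, ‖Ψ n t‖ₑ ^ 2 :=
            lintegral_congr_ae ((hΦn n).mono fun t ht => by simp only [ht])
          have hpi : ENNReal.ofReal (2 * Real.pi) ≠ 0 := by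
            rw [ne_eq, ENNReal.ofReal_eq_zero]
            linarith [Real.pi_pos]
          rw [e]
          calc ∫⁻ t, ‖Ψ n t‖ₑ ^ 2 = (ENNReal.ofReal (2 * Real.pi))⁻¹ *
                (ENNReal.ofReal (2 * Real.pi) * ∫⁻ t, ‖Ψ n t‖ₑ ^ 2) := by
                rw [← mul_assoc, ENNReal.inv_mul_cancel hpi ENNReal.ofReal_ne_top, one_mul]
            _ ≤ _ := mul_le_mul' le_rfl (p3 n)
      _ < ⊤ := by
          refine ENNReal.mul_lt_top (ENNReal.inv_lt_top.2 ?_) ENNReal.coe_lt_top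
          rw [ENNReal.ofReal_pos]
          positivity
  refine ⟨Φ, hΦ, hΦ0, fun z hz => ?_⟩
  obtain ⟨n, hn⟩ := ((tendsto_order.1 hd0).2 z.im hz).exists
  have h := p4 n (z - d n * Complex.I) (by simpa using hn)
  rw [show z - d n * Complex.I + ((1 / ((n : ℝ) + 1) : ℝ) : ℂ) * Complex.I = z by
    simp [d]] at h
  rw [h, ← fourierC_congr_ae (hΦn n), fourierC_damp]
  congr 1
  ring


theorem memLp_indicator_one {s : Set ℝ} (hs : MeasurableSet s) (hv : volume s ≠ ⊤) :
    Integrable (s.indicator fun _ : ℝ => (1 : ℂ)) ∧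
      MemLp (s.indicator fun _ : ℝ => (1 : ℂ)) 2 :=
  ⟨(integrable_indicator_iff hs).2 (integrableOn_const hv), memLp_indicator_const 2 hs 1 (Or.inr hv)⟩

theorem integral_conj_indicator_one_mul {s : Set ℝ} (hs : MeasurableSet s) (u : ℝ → ℂ) :
    ∫ t, conj (s.indicator (fun _ : ℝ => (1 : ℂ)) t) * u t = ∫ t in s, u t := by
  rw [← integral_indicator hs]
  congr 1
  ext t
  by_cases ht : t ∈ s <;> simp [ht]

theorem ae_eq_of_forall_pairing_eq {u v : ℝ → ℂ} (hu : MemLp u 2) (hv : MemLp v 2)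
    (h : ∀ g : ℝ → ℂ, Integrable g → MemLp g 2 →
      ∫ t, conj (g t) * u t = ∫ t, conj (g t) * v t) : u =ᵐ[volume] v := by
  have hI : ∀ {w : ℝ → ℂ}, MemLp w 2 → ∀ s : Set ℝ, volume s < ⊤ → IntegrableOn w s :=
    fun hw s hs => by
      have : IsFiniteMeasure (volume.restrict s) := ⟨by simpa using hs⟩
      exact (hw.restrict s).integrable (by norm_num)
  refine ae_eq_of_forall_setIntegral_eq_of_sigmaFinite
    (fun s _ hs => hI hu s hs) (fun s _ hs => hI hv s hs) fun s hs hv' => ?_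
  · obtain ⟨h1, h2⟩ := memLp_indicator_one hs hv'.ne
    have := h _ h1 h2
    rwa [integral_conj_indicator_one_mul hs, integral_conj_indicator_one_mul hs] at this

theorem norm_damp_sub_damp_le {Φ : ℝ → ℂ} (h0 : ∀ t ≤ 0, Φ t = 0) {y y' : ℝ} (hy : 0 ≤ y)
    (hy' : 0 ≤ y') (t : ℝ) : ‖damp y Φ t - damp y' Φ t‖ ≤ ‖Φ t‖ := by
  rcases le_or_gt t 0 with ht | ht
  · simp [damp, h0 t ht]
  · unfold damp
    rw [← sub_mul, norm_mul, ← Complex.ofReal_sub, Complex.norm_real, Real.norm_eq_abs]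
    have h1 : Real.exp (-(y * t)) ≤ 1 := Real.exp_le_one_iff.2 (by nlinarith)
    have h2 : Real.exp (-(y' * t)) ≤ 1 := Real.exp_le_one_iff.2 (by nlinarith)
    have : |Real.exp (-(y * t)) - Real.exp (-(y' * t))| ≤ 1 :=
      abs_le.2 ⟨by linarith [Real.exp_pos (-(y * t))], by linarith [Real.exp_pos (-(y' * t))]⟩
    exact mul_le_of_le_one_left (norm_nonneg _) this

theorem aestronglyMeasurable_damp {Φ : ℝ → ℂ} (hΦ : AEStronglyMeasurable Φ volume) (y : ℝ) :
    AEStronglyMeasurable (damp y Φ) volume := by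
  have : Continuous fun t : ℝ => ((Real.exp (-(y * t)) : ℝ) : ℂ) := by fun_prop
  exact this.aestronglyMeasurable.mul hΦ

theorem tendsto_lintegral_damp_sub {Φ : ℝ → ℂ} (hΦ : MemLp Φ 2) (h0 : ∀ t ≤ 0, Φ t = 0)
    {d : ℕ → ℝ} (hd : ∀ n, 0 < d n) (hd0 : Tendsto d atTop (𝓝 0)) {y : ℝ} (hy : 0 ≤ y) :
    Tendsto (fun n => ∫⁻ t, ‖damp y Φ t - damp (d n) Φ t‖ₑ ^ 2) atTop
      (𝓝 (∫⁻ t, ‖damp y Φ t - Φ t‖ₑ ^ 2)) := by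
  refine tendsto_lintegral_of_dominated_convergence' (fun t => ‖Φ t‖ₑ ^ 2)
    (fun n => ?_) (fun n => Eventually.of_forall fun t => ?_) (memLp_two_iff.1 hΦ).2.ne
    (Eventually.of_forall fun t => ?_)
  · exact ((aestronglyMeasurable_damp hΦ.1 _).sub
      (aestronglyMeasurable_damp hΦ.1 _)).enorm.pow_const 2
  · exact pow_le_pow_left' (enorm_le_iff_norm_le.2
      (norm_damp_sub_damp_le h0 hy (hd n).le t)) 2
  · refine (ENNReal.continuous_pow 2).continuousAt.tendsto.comp (Tendsto.enorm ?_)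
    have : Continuous fun y' : ℝ => damp y Φ t - damp y' Φ t := by
      unfold damp
      fun_prop
    have h := (this.tendsto 0).comp hd0
    have e : damp 0 Φ t = Φ t := by simp [damp]
    rwa [e] at h

theorem lintegral_fourierC_line_le {Φ : ℝ → ℂ} (hΦ : MemLp Φ 2) (h0 : ∀ t ≤ 0, Φ t = 0) {y : ℝ}
    (hy : 0 < y) : ∫⁻ x : ℝ, ‖fourierC Φ (x + y * Complex.I)‖ₑ ^ 2
      ≤ ENNReal.ofReal (2 * Real.pi) * ∫⁻ t, ‖Φ t‖ₑ ^ 2 := by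
  simp only [← fourierC_damp]
  rw [lintegral_fourierC (integrable_damp hΦ h0 hy) (memLp_damp hΦ h0 hy.le)]
  refine mul_le_mul' le_rfl (lintegral_mono fun t => pow_le_pow_left' (enorm_le_iff_norm_le.2 ?_) 2)
  rcases le_or_gt t 0 with ht | ht
  · simp [damp, h0 t ht]
  · unfold damp
    rw [norm_mul, Complex.norm_real, Real.norm_of_nonneg (Real.exp_pos _).le]
    exact mul_le_of_le_one_left (norm_nonneg _) (Real.exp_le_one_iff.2 (by nlinarith))

theorem integrable_mul_exp {w : ℝ → ℂ} (hw : Integrable w) (x : ℝ) :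
    Integrable fun t : ℝ => w t * Complex.exp (Complex.I * x * t) := by
  refine hw.mul_bdd (c := 1) (Continuous.aestronglyMeasurable (by fun_prop))
    (Eventually.of_forall fun t => ?_)
  rw [Complex.norm_exp]
  simp

theorem fourierC_sub_ofReal {u v : ℝ → ℂ} (hu : Integrable u) (hv : Integrable v) (x : ℝ) :
    fourierC (fun t => u t - v t) x = fourierC u x - fourierC v x := by
  unfold fourierC
  rw [← integral_sub (integrable_mul_exp hu x) (integrable_mul_exp hv x)]
  simp only [sub_mul]

/-- Boundary values of the Laplace type transform of an `L²` function on the half-line. -/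
theorem boundary_fourierC {Φ h : ℝ → ℂ} (hΦ : MemLp Φ 2) (h0 : ∀ t ≤ 0, Φ t = 0)
    {d : ℕ → ℝ} (hd : ∀ n, 0 < d n) (hd0 : Tendsto d atTop (𝓝 0))
    (hlim : ∀ᵐ x : ℝ, Tendsto (fun n => fourierC Φ (x + d n * Complex.I)) atTop (𝓝 (h x))) :
    MemLp h 2 ∧ (∫⁻ x, ‖h x‖ₑ ^ 2 = ENNReal.ofReal (2 * Real.pi) * ∫⁻ t, ‖Φ t‖ₑ ^ 2) ∧
      ∀ g : ℝ → ℂ, Integrable g → MemLp g 2 →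
        ∫ x : ℝ, conj (fourierC g x) * h x = 2 * Real.pi * ∫ t, conj (g t) * Φ t := by
  let u : ℕ → ℝ → ℂ := fun n => damp (d n) Φ
  have u1 : ∀ n, Integrable (u n) := fun n => integrable_damp hΦ h0 (hd n)
  have u2 : ∀ n, MemLp (u n) 2 := fun n => memLp_damp hΦ h0 (hd n).le
  let F : ℕ → ℝ → ℂ := fun n x => fourierC (u n) x
  have F2 : ∀ n, MemLp (F n) 2 := fun n => memLp_fourierC (u1 n) (u2 n)
  have hlim' : ∀ᵐ x : ℝ, Tendsto (fun n => F n x) atTop (𝓝 (h x)) := by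
    filter_upwards [hlim] with x hx
    simpa only [F, u, fourierC_damp] using hx
  have hm : AEStronglyMeasurable h volume :=
    aestronglyMeasurable_of_tendsto_ae atTop (fun n => (F2 n).1) hlim'
  let e : ℕ → ENNReal := fun n => ∫⁻ t, ‖u n t - Φ t‖ₑ ^ 2
  have he : Tendsto e atTop (𝓝 0) := by
    have := tendsto_lintegral_damp_sub hΦ h0 hd hd0 le_rfl
    have e0 : damp 0 Φ = Φ := by
      ext t
      simp [damp]
    rw [e0] at this
    simpa [e, u, enorm_sub_rev] using this
  have hFh : ∀ n, ∫⁻ x, ‖F n x - h x‖ₑ ^ 2 ≤ ENNReal.ofReal (2 * Real.pi) * e n := fun n => by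
    calc ∫⁻ x, ‖F n x - h x‖ₑ ^ 2
        = ∫⁻ x, liminf (fun m => ‖F n x - F m x‖ₑ ^ 2) atTop := by
          refine lintegral_congr_ae ?_
          filter_upwards [hlim'] with x hx
          refine (Tendsto.liminf_eq ?_).symm
          exact (ENNReal.continuous_pow 2).continuousAt.tendsto.comp (hx.const_sub _).enorm
      _ ≤ liminf (fun m => ∫⁻ x, ‖F n x - F m x‖ₑ ^ 2) atTop :=
          lintegral_liminf_le' fun m => ((F2 n).1.sub (F2 m).1).enorm.pow_const 2
      _ = ENNReal.ofReal (2 * Real.pi) * e n := by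
          refine Tendsto.liminf_eq ?_
          have hP : ∀ m, ∫⁻ x, ‖F n x - F m x‖ₑ ^ 2
              = ENNReal.ofReal (2 * Real.pi) * ∫⁻ t, ‖u n t - u m t‖ₑ ^ 2 := fun m => by
            have := lintegral_fourierC ((u1 n).sub (u1 m)) ((u2 n).sub (u2 m))
            refine Eq.trans ?_ this
            refine lintegral_congr fun x => ?_
            rw [← fourierC_sub_ofReal (u1 n) (u1 m)]
            rfl
          simp only [hP]
          exact ENNReal.Tendsto.const_mul (tendsto_lintegral_damp_sub hΦ h0 hd hd0 (hd n).le)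
            (Or.inr ENNReal.ofReal_ne_top)
  have hdiff : ∀ n, MemLp (fun x => F n x - h x) 2 := fun n => by
    rw [memLp_two_iff]
    refine ⟨(F2 n).1.sub hm, (hFh n).trans_lt (ENNReal.mul_lt_top ENNReal.ofReal_lt_top ?_)⟩
    exact (memLp_two_iff.1 ((u2 n).sub hΦ)).2
  have hh : MemLp h 2 := by
    have := (F2 0).sub (hdiff 0)
    refine (memLp_congr_ae (Eventually.of_forall fun x => ?_)).1 this
    simp
  have hpair : ∀ g : ℝ → ℂ, Integrable g → MemLp g 2 →
        ∫ x : ℝ, conj (fourierC g x) * h x = 2 * Real.pi * ∫ t, conj (g t) * Φ t := by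
    intro g g1 g2
    have G2 := memLp_fourierC g1 g2
    have key : ∀ {a b : ℝ → ℂ} {w : ℕ → ℝ → ℂ} {ε : ℕ → ENNReal}, MemLp a 2 → MemLp b 2 →
        (∀ n, MemLp (w n) 2) → (∀ n, ∫⁻ x, ‖w n x - b x‖ₑ ^ 2 ≤ ε n) → Tendsto ε atTop (𝓝 0) →
        Tendsto (fun n => ∫ x, conj (a x) * w n x) atTop (𝓝 (∫ x, conj (a x) * b x)) := by
      intro a b w ε ha hb hw hε hε0
      have hca : MemLp (fun x => conj (a x)) 2 := ha.star
      rw [tendsto_iff_edist_tendsto_0]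
      have h1 : ∀ n, edist (∫ x, conj (a x) * w n x) (∫ x, conj (a x) * b x) ^ 2
          ≤ (∫⁻ x, ‖conj (a x)‖ₑ ^ 2) * ε n := fun n => by
        have i1 : Integrable fun x => conj (a x) * w n x := hca.integrable_mul (hw n)
        have i2 : Integrable fun x => conj (a x) * b x := hca.integrable_mul hb
        rw [edist_eq_enorm_sub, ← integral_sub i1 i2]
        refine le_trans (le_of_eq ?_) ((enorm_integral_mul_sq_le hca.1 ((hw n).sub hb).1).trans
          (mul_le_mul' le_rfl (hε n)))
        simp only [Pi.sub_apply, mul_sub]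
      have h2 : Tendsto (fun n => edist (∫ x, conj (a x) * w n x) (∫ x, conj (a x) * b x) ^ 2)
          atTop (𝓝 0) := by
        refine tendsto_of_tendsto_of_tendsto_of_le_of_le tendsto_const_nhds ?_
          (fun n => zero_le) h1
        have := ENNReal.Tendsto.const_mul hε0 (Or.inr (memLp_two_iff.1 hca).2.ne)
        rwa [mul_zero] at this
      have h3 := (ENNReal.continuous_rpow_const (y := 1 / 2)).continuousAt.tendsto.comp h2
      simp only [Function.comp_def, one_div] at h3
      rw [ENNReal.zero_rpow_of_pos (by norm_num)] at h3
      refine h3.congr fun n => ?_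
      rw [← ENNReal.rpow_natCast, ← ENNReal.rpow_mul]
      norm_num
    have l1 := key G2 hh F2 hFh (by
      have := ENNReal.Tendsto.const_mul he (a := ENNReal.ofReal (2 * Real.pi))
        (Or.inr ENNReal.ofReal_ne_top)
      rwa [mul_zero] at this)
    have l2 := (key g2 hΦ u2 (fun n => le_rfl) he).const_mul (2 * Real.pi : ℂ)
    refine tendsto_nhds_unique l1 (l2.congr fun n => ?_)
    exact (integral_conj_fourierC_mul g1 g2 (u1 n) (u2 n)).symm
  refine ⟨hh, ?_, hpair⟩
  obtain ⟨Ψ, k1, k2, k3⟩ := exists_fourierC_preimage hh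
  have : Ψ =ᵐ[volume] Φ := ae_eq_of_forall_pairing_eq k1 hΦ fun g g1 g2 => by
    have := (k3 g g1 g2).symm.trans (hpair g g1 g2)
    have hpi : (2 * Real.pi : ℂ) ≠ 0 := by simp [Real.pi_ne_zero]
    exact mul_left_cancel₀ hpi this
  rw [k2]
  congr 1
  refine lintegral_congr_ae ?_
  filter_upwards [this] with t ht
  rw [ht]


/-- Square integrable functions vanishing outside `(-r, r)`. -/
structure PWFun (r : ℝ) (φ : ℝ → ℂ) : Prop where
  memLp : MemLp φ 2
  supp : ∀ t ∉ Set.Ioo (-r) r, φ t = 0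

theorem integrable_of_support {φ : ℝ → ℂ} {a b : ℝ} (h : MemLp φ 2)
    (hs : ∀ t ∉ Set.Ioo a b, φ t = 0) : Integrable φ := by
  have : IntegrableOn φ (Set.Ioo a b) := (h.restrict _).integrable (by norm_num)
  rw [← integrable_indicator_iff measurableSet_Ioo] at this
  refine this.congr (Eventually.of_forall fun t => ?_)
  by_cases ht : t ∈ Set.Ioo a b
  · simp [ht]
  · simp [ht, hs t ht]

theorem PWFun.integrable {r : ℝ} {φ : ℝ → ℂ} (h : PWFun r φ) : Integrable φ :=
  integrable_of_support h.memLp h.supp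

theorem PWFun.mono {r s : ℝ} {φ : ℝ → ℂ} (h : PWFun s φ) (hs : s ≤ r) : PWFun r φ :=
  ⟨h.memLp, fun t ht => h.supp t fun h' => ht ⟨by linarith [h'.1], by linarith [h'.2]⟩⟩

theorem norm_exp_I_mul_le {R : ℝ} {z : ℂ} {t : ℝ} (ht : |t| ≤ R) :
    ‖Complex.exp (Complex.I * z * t)‖ ≤ Real.exp (‖z‖ * R) := by
  rw [Complex.norm_exp]
  refine Real.exp_le_exp.2 ?_
  calc (Complex.I * z * t).re ≤ ‖Complex.I * z * t‖ := Complex.re_le_norm _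
    _ = ‖z‖ * |t| := by simp
    _ ≤ _ := mul_le_mul_of_nonneg_left ht (norm_nonneg _)

theorem integrable_mul_cexp {α : Type*} [MeasurableSpace α] {μ : Measure α} {h : α → ℂ} {l : α → ℝ}
    {R : ℝ} (hh : Integrable h μ) (hl : AEStronglyMeasurable l μ) (hR : ∀ p, h p ≠ 0 → |l p| ≤ R)
    (z : ℂ) : Integrable (fun p => h p * Complex.exp (Complex.I * z * l p)) μ := by
  have hm : AEStronglyMeasurable (fun p => Complex.exp (Complex.I * z * l p)) μ :=
    (Continuous.comp_aestronglyMeasurable (g := fun t : ℝ => Complex.exp (Complex.I * z * t))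
      (by fun_prop) hl)
  refine (hh.norm.mul_const (Real.exp (‖z‖ * R))).mono' (hh.1.mul hm)
    (Eventually.of_forall fun p => ?_)
  rw [norm_mul]
  by_cases hp : h p = 0
  · simp [hp]
  · exact mul_le_mul_of_nonneg_left (norm_exp_I_mul_le (hR p hp)) (norm_nonneg _)

theorem norm_integral_mul_cexp_le {α : Type*} [MeasurableSpace α] {μ : Measure α} {h : α → ℂ}
    {l : α → ℝ} {R : ℝ} (hh : Integrable h μ) (hR : ∀ p, h p ≠ 0 → |l p| ≤ R) (z : ℂ) :
    ‖∫ p, h p * Complex.exp (Complex.I * z * l p) ∂μ‖ ≤ (∫ p, ‖h p‖ ∂μ) * Real.exp (‖z‖ * R) := by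
  rw [← integral_mul_const]
  refine norm_integral_le_of_norm_le (hh.norm.mul_const _) (Eventually.of_forall fun p => ?_)
  rw [norm_mul]
  by_cases hp : h p = 0
  · simp [hp]
  · exact mul_le_mul_of_nonneg_left (norm_exp_I_mul_le (hR p hp)) (norm_nonneg _)

theorem differentiable_integral_mul_cexp {α : Type*} [MeasurableSpace α] {μ : Measure α} {h : α → ℂ}
    {l : α → ℝ} {R : ℝ} (hh : Integrable h μ) (hl : AEStronglyMeasurable l μ)
    (hR : ∀ p, h p ≠ 0 → |l p| ≤ R) :
    Differentiable ℂ fun z => ∫ p, h p * Complex.exp (Complex.I * z * l p) ∂μ := by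
  intro z
  have hm : ∀ w : ℂ, AEStronglyMeasurable (fun p => Complex.exp (Complex.I * w * l p)) μ := fun w =>
    (Continuous.comp_aestronglyMeasurable (g := fun t : ℝ => Complex.exp (Complex.I * w * t))
      (by fun_prop) hl)
  have hm' : AEStronglyMeasurable (fun p => Complex.exp (Complex.I * z * l p) *
      (Complex.I * l p)) μ :=
    (Continuous.comp_aestronglyMeasurable
      (g := fun t : ℝ => Complex.exp (Complex.I * z * t) * (Complex.I * t)) (by fun_prop) hl)
  refine (hasDerivAt_integral_of_dominated_loc_of_deriv_le
    (F' := fun w p => h p * (Complex.exp (Complex.I * w * l p) * (Complex.I * l p)))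
    (bound := fun p => ‖h p‖ * (Real.exp ((‖z‖ + 1) * |R|) * |R|)) (s := Metric.ball z 1)
    (Metric.ball_mem_nhds z one_pos)
    (Eventually.of_forall fun w => hh.1.mul (hm w))
    (integrable_mul_cexp hh hl hR z) (hh.1.mul hm')
    (Eventually.of_forall fun p w hw => ?_)
    (hh.norm.mul_const _) (Eventually.of_forall fun p w hw => ?_)).2.differentiableAt
  · rw [norm_mul]
    by_cases hp : h p = 0
    · simp [hp]
    · refine mul_le_mul_of_nonneg_left ?_ (norm_nonneg _)
      rw [norm_mul]
      have ht' := (hR p hp).trans (le_abs_self R)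
      refine mul_le_mul ((norm_exp_I_mul_le ht').trans (Real.exp_le_exp.2 ?_)) (by simpa using ht')
        (norm_nonneg _) (Real.exp_pos _).le
      refine mul_le_mul_of_nonneg_right ?_ (abs_nonneg _)
      have : ‖w - z‖ < 1 := by simpa [dist_eq_norm] using hw
      have := norm_sub_norm_le w z
      linarith
  · have h1 : HasDerivAt (fun w : ℂ => Complex.I * w * l p) (Complex.I * l p) w := by
      simpa using ((hasDerivAt_id w).const_mul Complex.I).mul_const (l p : ℂ)
    exact h1.cexp.const_mul (h p)

theorem integrable_mul_exp_of_support {φ : ℝ → ℂ} {R : ℝ} (h : Integrable φ)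
    (hs : ∀ t, R < |t| → φ t = 0) (z : ℂ) :
    Integrable fun t : ℝ => φ t * Complex.exp (Complex.I * z * t) :=
  integrable_mul_cexp (l := fun t : ℝ => t) (R := R) h aestronglyMeasurable_id
    (fun t ht => not_lt.1 fun h' => ht (hs t h')) z

theorem differentiable_fourierC {φ : ℝ → ℂ} {R : ℝ} (h : Integrable φ)
    (hs : ∀ t, R < |t| → φ t = 0) : Differentiable ℂ (fourierC φ) :=
  differentiable_integral_mul_cexp (l := fun t : ℝ => t) (R := R) h aestronglyMeasurable_id
    fun t ht => not_lt.1 fun h' => ht (hs t h')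

theorem PWFun.supp' {r : ℝ} {φ : ℝ → ℂ} (h : PWFun r φ) (t : ℝ) (ht : r < |t|) : φ t = 0 :=
  h.supp t fun h' => absurd (abs_lt.2 h') (not_lt.2 ht.le)

theorem PWFun.differentiable {r : ℝ} {φ : ℝ → ℂ} (h : PWFun r φ) :
    Differentiable ℂ (fourierC φ) := differentiable_fourierC h.integrable h.supp'

theorem fourierC_shift (φ : ℝ → ℂ) (a : ℝ) (z : ℂ) :
    fourierC (fun t => φ (t - a)) z = Complex.exp (Complex.I * a * z) * fourierC φ z := by
  unfold fourierC
  rw [← integral_const_mul, ← integral_sub_right_eq_self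
    (fun t : ℝ => Complex.exp (Complex.I * a * z) * (φ t * Complex.exp (Complex.I * z * t))) a]
  congr 1
  ext t
  rw [mul_left_comm, ← Complex.exp_add]
  congr 2
  push_cast
  ring

theorem fourierC_conj_neg (φ : ℝ → ℂ) (z : ℂ) :
    fourierC (fun t => conj (φ (-t))) z = sharp (fourierC φ) z := by
  unfold sharp fourierC
  rw [← integral_conj, ← integral_neg_eq_self (fun t : ℝ => conj (φ t * _))]
  congr 1
  ext t
  rw [map_mul, ← Complex.exp_conj]
  simp

theorem memLp_comp_sub {φ : ℝ → ℂ} (h : MemLp φ 2) (a : ℝ) : MemLp (fun t => φ (t - a)) 2 :=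
  h.comp_measurePreserving (measurePreserving_sub_right volume a)

theorem PWFun.conj_neg {r : ℝ} {φ : ℝ → ℂ} (h : PWFun r φ) : PWFun r fun t => conj (φ (-t)) := by
  refine ⟨(h.memLp.comp_measurePreserving (Measure.measurePreserving_neg volume)).star,
    fun t ht => ?_⟩
  rw [h.supp (-t) fun h' => ht ⟨by linarith [h'.2], by linarith [h'.1]⟩, map_zero]

theorem pwHB_apply (r : ℝ) (hr : 0 < r) (z : ℂ) :
    pwHB r hr z = Complex.exp (-(Complex.I * r * z)) := rfl

theorem div_pwHB (r : ℝ) (hr : 0 < r) (w z : ℂ) :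
    w / pwHB r hr z = Complex.exp (Complex.I * r * z) * w := by
  rw [pwHB_apply, div_eq_mul_inv, ← Complex.exp_neg, neg_neg, mul_comm]

theorem memH2_of_fourierC {F : ℂ → ℂ} (hF : Differentiable ℂ F) {Φ : ℝ → ℂ} (hΦ : MemLp Φ 2)
    (h0 : ∀ t ≤ 0, Φ t = 0) (h : ∀ z : ℂ, 0 < z.im → F z = fourierC Φ z) : MemH2 F := by
  refine ⟨hF.differentiableOn, (ENNReal.ofReal (2 * Real.pi) * ∫⁻ t, ‖Φ t‖ₑ ^ 2).toNNReal,
    fun y hy => ?_⟩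
  rw [ENNReal.coe_toNNReal
    (ENNReal.mul_lt_top ENNReal.ofReal_lt_top (memLp_two_iff.1 hΦ).2).ne]
  refine le_trans (le_of_eq (lintegral_congr fun x => ?_)) (lintegral_fourierC_line_le hΦ h0 hy)
  rw [h _ (by simpa using hy)]

theorem differentiable_div_pwHB {r : ℝ} (hr : 0 < r) {f : ℂ → ℂ} (hf : Differentiable ℂ f) :
    Differentiable ℂ fun z => f z / pwHB r hr z :=
  hf.div (pwHB r hr).entire fun _ => Complex.exp_ne_zero _

theorem PWFun.shift {r : ℝ} {φ : ℝ → ℂ} (h : PWFun r φ) :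
    MemLp (fun t => φ (t - r)) 2 ∧ Integrable (fun t => φ (t - r)) ∧
      (∀ t ≤ 0, φ (t - r) = 0) ∧ ∀ t ≥ 2 * r, φ (t - r) = 0 :=
  ⟨memLp_comp_sub h.memLp r, h.integrable.comp_sub_right r,
    fun t ht => h.supp _ fun h' => by linarith [h'.1],
    fun t ht => h.supp _ fun h' => by linarith [h'.2]⟩

theorem PWFun.fourierC_shift {r : ℝ} (hr : 0 < r) {φ : ℝ → ℂ} (z : ℂ) :
    fourierC (fun t => φ (t - r)) z = fourierC φ z / pwHB r hr z := by
  rw [ScrewPW.fourierC_shift, div_pwHB]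

theorem PWFun.memH2 {r : ℝ} (hr : 0 < r) {φ : ℝ → ℂ} (h : PWFun r φ) :
    MemH2 fun z => fourierC φ z / pwHB r hr z :=
  memH2_of_fourierC (differentiable_div_pwHB hr h.differentiable) h.shift.1 h.shift.2.2.1
    fun z _ => (PWFun.fourierC_shift hr z).symm

theorem PWFun.mem {r : ℝ} (hr : 0 < r) {φ : ℝ → ℂ} (h : PWFun r φ) :
    fourierC φ ∈ deBrangesSubmodule (pwHB r hr) :=
  ⟨h.differentiable, h.memH2 hr,
    (h.conj_neg.memH2 hr).congr fun z => by rw [fourierC_conj_neg]⟩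

theorem eq_of_eq_upperHalf {f g : ℂ → ℂ} (hf : Differentiable ℂ f) (hg : Differentiable ℂ g)
    (h : ∀ z : ℂ, 0 < z.im → f z = g z) : f = g := by
  refine (hf.differentiableOn.analyticOnNhd isOpen_univ).eq_of_eventuallyEq
    (hg.differentiableOn.analyticOnNhd isOpen_univ) (z₀ := Complex.I) ?_
  filter_upwards [(isOpen_im_gt 0).mem_nhds (by simp : (0 : ℝ) < Complex.I.im)] with z hz
  exact h z hz

theorem ae_eq_zero_of_forall_pairing {u : ℝ → ℂ} (hu : MemLp u 2) {s : Set ℝ}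
    (hs : MeasurableSet s)
    (h : ∀ g : ℝ → ℂ, Integrable g → MemLp g 2 → (∀ t ∉ s, g t = 0) → ∫ t, conj (g t) * u t = 0) :
    ∀ᵐ t : ℝ, t ∈ s → u t = 0 := by
  have h1 : s.indicator u =ᵐ[volume] fun _ => 0 := by
    refine ae_eq_of_forall_pairing_eq (hu.indicator hs) MemLp.zero' fun g g1 g2 => ?_
    have := h (s.indicator g) (g1.indicator hs) (g2.indicator hs) fun t ht => by simp [ht]
    simp only [mul_zero, integral_zero]
    rw [← this]
    congr 1
    ext t
    by_cases ht : t ∈ s <;> simp [ht]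
  filter_upwards [h1] with t ht hts
  simpa [hts] using ht

theorem exists_pwFun {r : ℝ} {Φ : ℝ → ℂ} (hΦ : MemLp Φ 2) (h0 : ∀ t ≤ 0, Φ t = 0)
    (h1 : ∀ᵐ t : ℝ, t ∈ Set.Ioi (2 * r) → Φ t = 0) :
    ∃ φ : ℝ → ℂ, PWFun r φ ∧ ∀ z, fourierC Φ z = Complex.exp (Complex.I * r * z) * fourierC φ z := by
  let Φ' := (Set.Ioo 0 (2 * r)).indicator Φ
  have he : Φ =ᵐ[volume] Φ' := by
    have : ∀ᵐ t : ℝ, t ≠ 2 * r := by simp [ae_iff]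
    filter_upwards [h1, this] with t ht ht'
    by_cases h : t ∈ Set.Ioo 0 (2 * r)
    · simp [Φ', h]
    · rw [Set.mem_Ioo, not_and_or, not_lt, not_lt] at h
      rcases h with h | h
      · rw [h0 t h]
        simp only [Φ', Set.indicator_apply]
        rw [if_neg]
        rintro ⟨h', -⟩
        linarith
      · rw [ht (lt_of_le_of_ne h ht'.symm)]
        simp only [Φ', Set.indicator_apply]
        rw [if_neg]
        rintro ⟨-, h'⟩
        linarith
  refine ⟨fun t => Φ' (t + r), ⟨?_, fun t ht => ?_⟩, fun z => ?_⟩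
  · exact (hΦ.indicator measurableSet_Ioo).comp_measurePreserving
      (measurePreserving_add_right volume r)
  · refine Set.indicator_of_notMem (fun h => ht ⟨?_, ?_⟩) _
    · linarith [h.1]
    · linarith [h.2]
  · rw [fourierC_congr_ae he, ← fourierC_shift]
    simp

theorem tendsto_vertical (x : ℝ) {d : ℕ → ℝ} (hd0 : Tendsto d atTop (𝓝 0)) :
    Tendsto (fun n => (x : ℂ) + d n * Complex.I) atTop (𝓝 (x : ℂ)) := by
  have : Tendsto (fun n => (x : ℂ) + d n * Complex.I) atTop
      (𝓝 ((x : ℂ) + (0 : ℝ) * Complex.I)) :=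
    tendsto_const_nhds.add (((Complex.continuous_ofReal.tendsto 0).comp hd0).mul_const _)
  simpa using this

/-- Boundary pairing for an entire function that is of class `H²` in the upper half-plane. -/
theorem boundary_entire {F : ℂ → ℂ} (hc : Continuous F) {Φ : ℝ → ℂ} (hΦ : MemLp Φ 2)
    (h0 : ∀ t ≤ 0, Φ t = 0) (h : ∀ z : ℂ, 0 < z.im → F z = fourierC Φ z) :
    MemLp (fun x : ℝ => F x) 2 ∧
      (∫⁻ x : ℝ, ‖F x‖ₑ ^ 2 = ENNReal.ofReal (2 * Real.pi) * ∫⁻ t, ‖Φ t‖ₑ ^ 2) ∧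
      ∀ g : ℝ → ℂ, Integrable g → MemLp g 2 →
        ∫ x : ℝ, conj (fourierC g x) * F x = 2 * Real.pi * ∫ t, conj (g t) * Φ t := by
  refine boundary_fourierC hΦ h0 (d := fun n : ℕ => 1 / ((n : ℝ) + 1)) (fun n => by positivity)
    tendsto_one_div_add_atTop_nhds_zero_nat (Eventually.of_forall fun x => ?_)
  refine ((hc.tendsto _).comp
    (tendsto_vertical x tendsto_one_div_add_atTop_nhds_zero_nat)).congr fun n => ?_
  rw [Function.comp_apply]
  refine h _ ?_
  simp only [Complex.add_im, Complex.ofReal_im, Complex.mul_im, Complex.ofReal_re, Complex.I_im,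
    Complex.I_re, mul_one, mul_zero, add_zero, zero_add]
  positivity

/-- The Paley--Wiener theorem. -/
theorem exists_pwFun_of_mem {r : ℝ} (hr : 0 < r) {f : ℂ → ℂ}
    (hf : f ∈ deBrangesSubmodule (pwHB r hr)) : ∃ φ, PWFun r φ ∧ ∀ z, f z = fourierC φ z := by
  obtain ⟨hd, h1, h2⟩ := hf
  obtain ⟨Φ₁, a1, a2, a3⟩ := h1.exists_fourierC
  obtain ⟨Φ₂, b1, b2, b3⟩ := h2.exists_fourierC
  have hsc : Continuous (sharp f) :=
    Complex.continuous_conj.comp (hd.continuous.comp Complex.continuous_conj)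
  have hEc : ∀ z, pwHB r hr z ≠ 0 := fun z => Complex.exp_ne_zero _
  obtain ⟨-, -, a4⟩ := boundary_entire
    (hd.continuous.div (pwHB r hr).entire.continuous hEc) a1 a2 a3
  obtain ⟨-, -, b4⟩ := boundary_entire (hsc.div (pwHB r hr).entire.continuous hEc) b1 b2 b3
  have hz : ∀ᵐ t : ℝ, t ∈ Set.Ioi (2 * r) → Φ₁ t = 0 := by
    refine ae_eq_zero_of_forall_pairing a1 measurableSet_Ioi fun g g1 g2 g3 => ?_
    let g' : ℝ → ℂ := fun t => conj (g (2 * r - t))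
    have hmp : MeasurePreserving (fun t : ℝ => 2 * r - t) volume volume :=
      Measure.measurePreserving_sub_left volume (2 * r)
    have g1' : Integrable g' :=
      Complex.conjLIE.integrable_comp_iff.2 (hmp.integrable_comp_of_integrable g1)
    have g2' : MemLp g' 2 := (g2.comp_measurePreserving hmp).star
    have hg' : ∀ x : ℝ, fourierC g' x = Complex.exp (2 * Complex.I * r * x) *
        conj (fourierC g x) := fun x => by
      have e1 : g' = fun t => (fun s => conj (g (-s))) (t - 2 * r) := by
        ext t
        simp [g']
      have := fourierC_shift (fun s => conj (g (-s))) (2 * r) x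
      rw [e1]
      push_cast at this ⊢
      rw [this, fourierC_conj_neg]
      simp only [sharp, Complex.conj_ofReal]
      congr 2
      ring
    have hb := b4 g' g1' g2'
    have e2 : ∫ t, conj (g' t) * Φ₂ t = 0 := by
      rw [← integral_zero ℝ ℂ (μ := volume)]
      congr 1
      ext t
      rcases le_or_gt t 0 with ht | ht
      · simp [b2 t ht]
      · have : g (2 * r - t) = 0 := g3 _ (by simp; linarith)
        simp [g', this]
    rw [e2, mul_zero] at hb
    have ha := a4 g g1 g2
    have e3 : ∫ x : ℝ, conj (fourierC g x) * (f x / pwHB r hr x) = 0 := by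
      have := congrArg conj hb
      rw [← integral_conj, map_zero] at this
      rw [← this]
      congr 1
      ext x
      rw [hg', Pi.div_apply, div_pwHB, div_pwHB]
      simp only [sharp, map_mul, Complex.conj_conj, ← Complex.exp_conj, Complex.conj_ofReal,
        Complex.conj_I, map_ofNat, map_neg, neg_neg]
      rw [show Complex.exp (Complex.I * r * x) = Complex.exp (2 * Complex.I * r * x) *
        Complex.exp (-Complex.I * r * x) by rw [← Complex.exp_add]; congr 1; ring]
      ring
    have hpi : (2 * Real.pi : ℂ) ≠ 0 := by simp [Real.pi_ne_zero]
    exact (mul_eq_zero.1 (ha.symm.trans e3)).resolve_left hpi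
  obtain ⟨φ, hφ, h3⟩ := exists_pwFun a1 a2 hz
  refine ⟨φ, hφ, fun z => congrFun (eq_of_eq_upperHalf hd hφ.differentiable fun w hw => ?_) z⟩
  have := (a3 w hw).trans (h3 w)
  rw [div_pwHB] at this
  exact mul_left_cancel₀ (Complex.exp_ne_zero _) this


theorem deBrangesSpace_ext {E : HB} {f g : DeBrangesSpace E} (h : ∀ z, f z = g z) : f = g :=
  Subtype.ext (funext h)

theorem deBrangesSpace_inner {E : HB} (f g : DeBrangesSpace E) :
    inner ℂ f g = ∫ x : ℝ, conj (f x / E x) * (g x / E x) := rfl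

theorem deBrangesSpace_smul {E : HB} (c : ℂ) (f : DeBrangesSpace E) (z : ℂ) :
    (c • f) z = c * f z := rfl

theorem deBrangesSpace_add {E : HB} (f g : DeBrangesSpace E) (z : ℂ) :
    (f + g) z = f z + g z := rfl

theorem deBrangesSpace_sub {E : HB} (f g : DeBrangesSpace E) (z : ℂ) :
    (f - g) z = f z - g z := rfl

theorem deBrangesSpace_zero {E : HB} (z : ℂ) : (0 : DeBrangesSpace E) z = 0 := rfl

/-- The square integrable functions on `(-r, r]`. -/
abbrev IntervalL2 (r : ℝ) : Type := Lp ℂ 2 (volume.restrict (Set.Ioc (-r) r))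

/-- Extension by zero of a function on `(-r, r)`. -/
noncomputable def zeroExt (r : ℝ) (φ : ℝ → ℂ) : ℝ → ℂ := (Set.Ioo (-r) r).indicator φ

theorem pwFun_zeroExt {r : ℝ} {φ : ℝ → ℂ} (hφ : MemLp φ 2 (volume.restrict (Set.Ioc (-r) r))) :
    PWFun r (zeroExt r φ) := by
  refine ⟨?_, fun t ht => Set.indicator_of_notMem ht _⟩
  rw [zeroExt, memLp_indicator_iff_restrict measurableSet_Ioo]
  exact hφ.mono_measure (Measure.restrict_mono Set.Ioo_subset_Ioc_self le_rfl)

theorem PWFun.zeroExt_eq {r : ℝ} {φ : ℝ → ℂ} (h : PWFun r φ) : zeroExt r φ = φ := by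
  ext t
  by_cases ht : t ∈ Set.Ioo (-r) r
  · simp [zeroExt, ht]
  · simp [zeroExt, ht, h.supp t ht]

theorem zeroExt_congr {r : ℝ} {φ ψ : ℝ → ℂ}
    (h : φ =ᵐ[volume.restrict (Set.Ioc (-r) r)] ψ) : zeroExt r φ =ᵐ[volume] zeroExt r ψ := by
  rw [Filter.EventuallyEq, ae_restrict_iff' measurableSet_Ioc] at h
  filter_upwards [h] with t ht
  by_cases h' : t ∈ Set.Ioo (-r) r
  · simp [zeroExt, h', ht (Set.Ioo_subset_Ioc_self h')]
  · simp [zeroExt, h']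

theorem integral_zeroExt {r : ℝ} (hr : 0 < r) (φ k : ℝ → ℂ) :
    ∫ t, zeroExt r φ t * k t = ∫ t in (-r)..r, φ t * k t := by
  rw [intervalIntegral.integral_of_le (by linarith), integral_Ioc_eq_integral_Ioo,
    ← integral_indicator measurableSet_Ioo]
  congr 1
  ext t
  by_cases h' : t ∈ Set.Ioo (-r) r <;> simp [zeroExt, h']

theorem fourierC_zeroExt {r : ℝ} (hr : 0 < r) (φ : ℝ → ℂ) (z : ℂ) :
    fourierC (zeroExt r φ) z = ∫ t in (-r)..r, φ t * Complex.exp (Complex.I * z * t) :=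
  integral_zeroExt hr φ _

theorem mem_pw_iff {r : ℝ} (hr : 0 < r) (f : ℂ → ℂ) :
    f ∈ deBrangesSubmodule (pwHB r hr) ↔
      ∃ φ : ℝ → ℂ, MemLp φ 2 (volume.restrict (Set.Ioc (-r) r)) ∧
        ∀ z : ℂ, f z = ∫ t in (-r)..r, φ t * Complex.exp (Complex.I * z * t) := by
  constructor
  · intro hf
    obtain ⟨φ, h1, h2⟩ := exists_pwFun_of_mem hr hf
    refine ⟨φ, h1.memLp.restrict _, fun z => ?_⟩
    rw [← fourierC_zeroExt hr, h1.zeroExt_eq, h2]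
  · rintro ⟨φ, h1, h2⟩
    have : f = fourierC (zeroExt r φ) := funext fun z => by rw [h2, fourierC_zeroExt hr]
    rw [this]
    exact (pwFun_zeroExt h1).mem hr

/-- The element of `PW_r` with given density. -/
noncomputable def PWFun.toSpace {r : ℝ} (hr : 0 < r) {φ : ℝ → ℂ} (h : PWFun r φ) :
    DeBrangesSpace (pwHB r hr) := ⟨fourierC φ, h.mem hr⟩

theorem PWFun.toSpace_apply {r : ℝ} (hr : 0 < r) {φ : ℝ → ℂ} (h : PWFun r φ) (z : ℂ) :
    h.toSpace hr z = fourierC φ z := rfl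

theorem conj_div_mul_div (r : ℝ) (hr : 0 < r) (a b : ℂ) (x : ℝ) :
    conj (a / pwHB r hr x) * (b / pwHB r hr x) = conj a * b := by
  rw [div_pwHB, div_pwHB, map_mul, ← Complex.exp_conj]
  simp only [map_mul, Complex.conj_I, Complex.conj_ofReal]
  rw [mul_mul_mul_comm, ← Complex.exp_add]
  simp

theorem inner_pw (r : ℝ) (hr : 0 < r) (f g : DeBrangesSpace (pwHB r hr)) :
    inner ℂ f g = ∫ x : ℝ, conj (f x) * g x := by
  rw [deBrangesSpace_inner]
  simp only [conj_div_mul_div]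

theorem PWFun.inner {r : ℝ} (hr : 0 < r) {φ ψ : ℝ → ℂ} (h : PWFun r φ) (k : PWFun r ψ) :
    inner ℂ (h.toSpace hr) (k.toSpace hr) = 2 * Real.pi * ∫ t, conj (φ t) * ψ t := by
  rw [inner_pw]
  exact integral_conj_fourierC_mul h.integrable h.memLp k.integrable k.memLp

theorem fourierC_add {u v : ℝ → ℂ} {R : ℝ} (hu : Integrable u) (hv : Integrable v)
    (hus : ∀ t, R < |t| → u t = 0) (hvs : ∀ t, R < |t| → v t = 0) (z : ℂ) :
    fourierC (fun t => u t + v t) z = fourierC u z + fourierC v z := by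
  unfold fourierC
  rw [← integral_add (integrable_mul_exp_of_support hu hus z)
    (integrable_mul_exp_of_support hv hvs z)]
  simp only [add_mul]

theorem fourierC_const_mul (c : ℂ) (u : ℝ → ℂ) (z : ℂ) :
    fourierC (fun t => c * u t) z = c * fourierC u z := by
  unfold fourierC
  rw [← integral_const_mul]
  simp only [mul_assoc]

/-- The Fourier transform as a linear map, normalised to be isometric. -/
noncomputable def pwFourierLin (r : ℝ) (hr : 0 < r) :
    IntervalL2 r →ₗ[ℂ] DeBrangesSpace (pwHB r hr) where
  toFun φ := ((1 / √(2 * Real.pi) : ℝ) : ℂ) • (pwFun_zeroExt (Lp.memLp φ)).toSpace hr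
  map_add' φ ψ := by
    rw [← smul_add]
    congr 1
    refine deBrangesSpace_ext fun z => ?_
    rw [deBrangesSpace_add]
    have hφ := pwFun_zeroExt (Lp.memLp φ)
    have hψ := pwFun_zeroExt (Lp.memLp ψ)
    simp only [PWFun.toSpace_apply]
    rw [← fourierC_add hφ.integrable hψ.integrable hφ.supp' hψ.supp',
      fourierC_congr_ae (zeroExt_congr (Lp.coeFn_add φ ψ))]
    congr 1
    ext t
    by_cases h' : t ∈ Set.Ioo (-r) r <;> simp [zeroExt, h']
  map_smul' c φ := by
    rw [RingHom.id_apply, smul_comm c]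
    congr 1
    refine deBrangesSpace_ext fun z => ?_
    rw [deBrangesSpace_smul]
    simp only [PWFun.toSpace_apply]
    rw [← fourierC_const_mul, fourierC_congr_ae (zeroExt_congr (Lp.coeFn_smul c φ))]
    congr 1
    ext t
    by_cases h' : t ∈ Set.Ioo (-r) r <;> simp [zeroExt, h']

theorem sqrt_two_pi_sq : ((√(2 * Real.pi) : ℝ) : ℂ) * ((√(2 * Real.pi) : ℝ) : ℂ) = 2 * Real.pi := by
  rw [← Complex.ofReal_mul, Real.mul_self_sqrt (by positivity)]
  push_cast
  ring

theorem sqrt_two_pi_ne : ((√(2 * Real.pi) : ℝ) : ℂ) ≠ 0 := by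
  have : 0 < √(2 * Real.pi) := by positivity
  exact_mod_cast this.ne'

theorem inner_pwFourierLin (r : ℝ) (hr : 0 < r) (φ ψ : IntervalL2 r) :
    inner ℂ (pwFourierLin r hr φ) (pwFourierLin r hr ψ) = inner ℂ φ ψ := by
  change inner ℂ (((1 / √(2 * Real.pi) : ℝ) : ℂ) • (pwFun_zeroExt (Lp.memLp φ)).toSpace hr)
    (((1 / √(2 * Real.pi) : ℝ) : ℂ) • (pwFun_zeroExt (Lp.memLp ψ)).toSpace hr) = _
  rw [inner_smul_left, inner_smul_right, PWFun.inner, L2.inner_def]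
  have : ∫ t, conj (zeroExt r φ t) * zeroExt r ψ t
      = ∫ t, inner ℂ (φ t) (ψ t) ∂(volume.restrict (Set.Ioc (-r) r)) := by
    rw [integral_Ioc_eq_integral_Ioo, ← integral_indicator measurableSet_Ioo]
    congr 1
    ext t
    by_cases h' : t ∈ Set.Ioo (-r) r <;> simp [zeroExt, h', mul_comm]
  rw [this, Complex.conj_ofReal]
  have h1 := sqrt_two_pi_sq
  have h2 := sqrt_two_pi_ne
  push_cast
  rw [← mul_assoc, ← mul_assoc, ← h1]
  field_simp

/-- The Fourier transform as an isometric isomorphism of `L²(-r, r)` onto `PW_r`. -/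
noncomputable def pwFourier (r : ℝ) (hr : 0 < r) :
    IntervalL2 r ≃ₗᵢ[ℂ] DeBrangesSpace (pwHB r hr) :=
  LinearIsometryEquiv.ofSurjective
    ((pwFourierLin r hr).isometryOfInner (inner_pwFourierLin r hr)) fun f => by
      obtain ⟨φ, h1, h2⟩ := exists_pwFun_of_mem hr f.2
      have h3 : MemLp (fun t => ((√(2 * Real.pi) : ℝ) : ℂ) * φ t) 2
          (volume.restrict (Set.Ioc (-r) r)) := (h1.memLp.const_mul _).restrict _
      refine ⟨h3.toLp _, deBrangesSpace_ext fun z => ?_⟩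
      change _ * fourierC (zeroExt r (h3.toLp _)) z = f z
      rw [fourierC_congr_ae (zeroExt_congr h3.coeFn_toLp)]
      have e : zeroExt r (fun t => ((√(2 * Real.pi) : ℝ) : ℂ) * φ t)
          = fun t => ((√(2 * Real.pi) : ℝ) : ℂ) * φ t := by
        refine PWFun.zeroExt_eq ⟨h1.memLp.const_mul _, fun t ht => ?_⟩
        rw [h1.supp t ht, mul_zero]
      rw [e, fourierC_const_mul, h2]
      have h2 := sqrt_two_pi_ne
      push_cast
      field_simp

theorem pwFourier_apply {r : ℝ} (hr : 0 < r) (φ : IntervalL2 r) (z : ℂ) :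
    pwFourier r hr φ z = ((1 / √(2 * Real.pi) : ℝ) : ℂ) *
      ∫ t in (-r)..r, φ t * Complex.exp (Complex.I * z * t) := by
  rw [← fourierC_zeroExt hr]
  rfl

/-- The density of the reproducing kernel. -/
noncomputable def kernelDensity (r : ℝ) (z : ℂ) : ℝ → ℂ :=
  zeroExt r fun t => Complex.exp (Complex.I * (-conj z) * t) / (2 * Real.pi)

theorem pwFun_zeroExt_of_continuous {r : ℝ} {φ : ℝ → ℂ} (hφ : Continuous φ) :
    PWFun r (zeroExt r φ) := by
  refine pwFun_zeroExt ?_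
  obtain ⟨C, hC⟩ := isCompact_Icc.exists_bound_of_continuousOn (s := Set.Icc (-r) r) hφ.continuousOn
  refine MemLp.of_bound hφ.aestronglyMeasurable C ?_
  rw [ae_restrict_iff' measurableSet_Ioc]
  exact Eventually.of_forall fun t ht => hC t (Set.Ioc_subset_Icc_self ht)

theorem pwFun_kernelDensity (r : ℝ) (z : ℂ) : PWFun r (kernelDensity r z) :=
  pwFun_zeroExt_of_continuous (by fun_prop)

theorem fourierC_kernelDensity {r : ℝ} (hr : 0 < r) (z w : ℂ) :
    fourierC (kernelDensity r z) w = (Real.pi : ℂ)⁻¹ *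
      (if w = conj z then (r : ℂ) else Complex.sin (r * (w - conj z)) / (w - conj z)) := by
  rw [kernelDensity, fourierC_zeroExt hr]
  have hpi : (Real.pi : ℂ) ≠ 0 := by simp [Real.pi_ne_zero]
  have e : ∀ t : ℝ, Complex.exp (Complex.I * (-conj z) * t) / (2 * Real.pi) *
      Complex.exp (Complex.I * w * t)
      = (2 * Real.pi : ℂ)⁻¹ * Complex.exp ((Complex.I * (w - conj z)) * t) := fun t => by
    rw [div_mul_eq_mul_div, ← Complex.exp_add, div_eq_inv_mul]
    congr 2
    ring
  simp only [e]
  rw [intervalIntegral.integral_const_mul]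
  split_ifs with h
  · subst h
    simp
    ring
  · have h' : w - conj z ≠ 0 := sub_ne_zero.2 h
    have h'' : Complex.I * (w - conj z) ≠ 0 := mul_ne_zero Complex.I_ne_zero h'
    rw [integral_exp_mul_complex h'', Complex.sin]
    push_cast
    rw [show Complex.I * (w - conj z) * r = r * (w - conj z) * Complex.I by ring,
      show Complex.I * (w - conj z) * -r = -(r * (w - conj z)) * Complex.I by ring]
    field_simp
    rw [Complex.I_sq]
    ring

theorem pw_A {r : ℝ} (hr : 0 < r) (z : ℂ) : (pwHB r hr).A z = Complex.cos (r * z) := by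
  rw [HB.A, Complex.cos, sharp, pwHB_apply, pwHB_apply, ← Complex.exp_conj, add_comm]
  congr 2
  · congr 1
    simp
    ring
  · congr 1
    ring

theorem pw_B {r : ℝ} (hr : 0 < r) (z : ℂ) : (pwHB r hr).B z = Complex.sin (r * z) := by
  rw [HB.B, Complex.sin, sharp, pwHB_apply, pwHB_apply, ← Complex.exp_conj, mul_comm]
  congr 3
  · congr 1
    ring
  · congr 1
    simp
    ring

theorem abKernel_cos_sin (t : ℝ) (z w : ℂ) :
    abKernel (fun w => Complex.cos (t * w)) (fun w => Complex.sin (t * w)) z w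
      = (Real.pi : ℂ)⁻¹ *
        (if w = conj z then (t : ℂ) else Complex.sin (t * (w - conj z)) / (w - conj z)) := by
  unfold abKernel
  have e : (fun u : ℂ => conj (Complex.cos (t * z)) * Complex.sin (t * u) -
      Complex.cos (t * u) * conj (Complex.sin (t * z))) =
      fun u => Complex.sin (t * (u - conj z)) := by
    ext u
    rw [← Complex.cos_conj, ← Complex.sin_conj, map_mul, Complex.conj_ofReal, mul_sub,
      Complex.sin_sub]
    ring
  rw [e]
  congr 1
  split_ifs with h
  · rw [h, dslope_same]
    have h1 : HasDerivAt (fun u : ℂ => (t : ℂ) * (u - conj z)) (t : ℂ) (conj z) := by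
      simpa using ((hasDerivAt_id (conj z)).sub_const (conj z)).const_mul (t : ℂ)
    rw [h1.csin.deriv]
    simp
  · rw [dslope_of_ne _ h, slope_def_field]
    simp

theorem kernelDensity_reproducing {r : ℝ} (hr : 0 < r) (z : ℂ) (f : DeBrangesSpace (pwHB r hr)) :
    f z = inner ℂ ((pwFun_kernelDensity r z).toSpace hr) f := by
  obtain ⟨φ, h1, h2⟩ := exists_pwFun_of_mem hr f.2
  have hf : f = h1.toSpace hr := deBrangesSpace_ext h2
  rw [hf, PWFun.inner, PWFun.toSpace_apply, fourierC, ← integral_const_mul]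
  congr 1
  ext t
  by_cases ht : t ∈ Set.Ioo (-r) r
  · have hpi : (Real.pi : ℂ) ≠ 0 := by simp [Real.pi_ne_zero]
    simp only [kernelDensity, zeroExt, Set.indicator_of_mem ht, map_div₀, ← Complex.exp_conj,
      map_mul, map_neg, Complex.conj_I, Complex.conj_conj, Complex.conj_ofReal, map_ofNat]
    field_simp
  · simp [h1.supp t ht]

theorem pw_reproducing_kernel (r : ℝ) (hr : 0 < r) (z : ℂ) :
    ∃ k : DeBrangesSpace (pwHB r hr),
        (∀ w : ℂ, k w = abKernel (pwHB r hr).A (pwHB r hr).B z w) ∧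
        (∀ w : ℂ, w ≠ conj z →
          k w = Complex.sin (r * (w - conj z)) / (Real.pi * (w - conj z))) ∧
        ∀ f : DeBrangesSpace (pwHB r hr), f z = inner ℂ k f := by
  refine ⟨(pwFun_kernelDensity r z).toSpace hr, fun w => ?_, fun w hw => ?_,
    kernelDensity_reproducing hr z⟩
  · have hA : (pwHB r hr).A = fun w => Complex.cos (r * w) := funext (pw_A hr)
    have hB : (pwHB r hr).B = fun w => Complex.sin (r * w) := funext (pw_B hr)
    rw [hA, hB, abKernel_cos_sin, PWFun.toSpace_apply, fourierC_kernelDensity hr]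
  · rw [PWFun.toSpace_apply, fourierC_kernelDensity hr, if_neg hw, inv_mul_eq_div, div_div,
      mul_comm (Real.pi : ℂ)]


/-- Division by `E`, as a linear isometry of `H(E)` into `L²(ℝ)`. -/
noncomputable def divIsometry (E : HB) :
    DeBrangesSpace E →ₗᵢ[ℂ] Lp ℂ 2 (volume : Measure ℝ) :=
  LinearMap.isometryOfInner
    { toFun := fun f => (memLp_of_mem f.2).toLp (fun x : ℝ => f x / E x)
      map_add' := fun f g => by
        rw [← MemLp.toLp_add]
        congr 1
        ext x
        exact add_div (f x) (g x) (E x)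
      map_smul' := fun c f => by
        rw [RingHom.id_apply, ← MemLp.toLp_const_smul]
        congr 1
        ext x
        exact mul_div_assoc c (f x) (E x) }
    fun f g => by
      rw [L2.inner_def, deBrangesSpace_inner]
      refine integral_congr_ae ?_
      filter_upwards [(memLp_of_mem f.2).coeFn_toLp, (memLp_of_mem g.2).coeFn_toLp] with x h1 h2
      simp only [LinearMap.coe_mk, AddHom.coe_mk, h1, h2, RCLike.inner_apply]
      exact mul_comm _ _

theorem divIsometry_ae {E : HB} (f : DeBrangesSpace E) :
    (divIsometry E f : ℝ → ℂ) =ᵐ[volume] fun x => f x / E x :=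
  (memLp_of_mem f.2).coeFn_toLp

theorem isBoundaryValue_of_continuous {F : ℂ → ℂ} (hF : Continuous F) {h : ℝ → ℂ}
    (hh : h =ᵐ[volume] fun x => F x) : IsBoundaryValue F h := by
  filter_upwards [hh] with x hx α _
  rw [hx]
  exact (hF.tendsto _).mono_left nhdsWithin_le_nhds

theorem im_vertical (x y : ℝ) : ((x : ℂ) + y * Complex.I).im = y := by simp

theorem IsBoundaryValue.vertical {F : ℂ → ℂ} {h : ℝ → ℂ} (hF : IsBoundaryValue F h) {d : ℕ → ℝ}
    (hd : ∀ n, 0 < d n) (hd0 : Tendsto d atTop (𝓝 0)) :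
    ∀ᵐ x : ℝ, Tendsto (fun n => F (x + d n * Complex.I)) atTop (𝓝 (h x)) := by
  filter_upwards [hF] with x hx
  refine (hx 1 one_pos).comp (tendsto_nhdsWithin_iff.2 ⟨tendsto_vertical x hd0, ?_⟩)
  refine Eventually.of_forall fun n => ?_
  simpa using ⟨hd n, (hd n).le⟩

theorem boundary_hardy {F : ℂ → ℂ} {h Φ : ℝ → ℂ} (hF : IsBoundaryValue F h) (hΦ : MemLp Φ 2)
    (h0 : ∀ t ≤ 0, Φ t = 0) (he : ∀ z : ℂ, 0 < z.im → F z = fourierC Φ z) :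
    ∀ g : ℝ → ℂ, Integrable g → MemLp g 2 →
        ∫ x : ℝ, conj (fourierC g x) * h x = 2 * Real.pi * ∫ t, conj (g t) * Φ t := by
  have hd : ∀ n : ℕ, 0 < 1 / ((n : ℝ) + 1) := fun n => by positivity
  refine (boundary_fourierC hΦ h0 hd tendsto_one_div_add_atTop_nhds_zero_nat ?_).2.2
  filter_upwards [hF.vertical hd tendsto_one_div_add_atTop_nhds_zero_nat] with x hx
  refine hx.congr fun n => he _ ?_
  rw [im_vertical]
  exact hd n

theorem pwTheta_apply (r : ℝ) (z : ℂ) : pwTheta r z = Complex.exp (Complex.I * (2 * r : ℝ) * z) := by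
  rw [pwTheta]
  congr 1
  push_cast
  ring

theorem divIsometry_mem_modelSpace {r : ℝ} (hr : 0 < r) (f : DeBrangesSpace (pwHB r hr)) :
    divIsometry _ f ∈ modelSpace (pwTheta r) := by
  obtain ⟨φ, h1, h2⟩ := exists_pwFun_of_mem hr f.2
  have hc : Continuous fun z => f z / pwHB r hr z :=
    (differentiable_div_pwHB hr f.2.1).continuous
  refine ⟨⟨_, f.2.2.1, isBoundaryValue_of_continuous hc (divIsometry_ae f)⟩, ?_⟩
  rw [SetLike.mem_coe, Submodule.mem_orthogonal]
  intro ψ hψ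
  induction hψ using Submodule.span_induction with
  | zero => simp
  | add x y _ _ hx hy => rw [inner_add_left, hx, hy, add_zero]
  | smul a x _ hx => rw [inner_smul_left, hx, mul_zero]
  | mem ψ hψ =>
    obtain ⟨F, hF, hb⟩ := hψ
    obtain ⟨Φ, a1, a2, a3⟩ := hF.exists_fourierC
    have hp := boundary_hardy hb (memLp_comp_sub a1 (2 * r))
      (fun t ht => a2 _ (by linarith)) (fun z hz => by
        rw [a3 z hz, fourierC_shift, pwTheta_apply])
      _ h1.shift.2.1 h1.shift.1
    have hz : ∫ t, conj (φ (t - r)) * Φ (t - 2 * r) = 0 := by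
      rw [← integral_zero ℝ ℂ (μ := volume)]
      congr 1
      ext t
      rcases le_or_gt (2 * r) t with ht | ht
      · rw [h1.shift.2.2.2 t ht, map_zero, zero_mul]
      · rw [a2 _ (by linarith), mul_zero]
    rw [hz, mul_zero] at hp
    rw [← inner_conj_symm, L2.inner_def]
    refine (congrArg conj (Eq.trans ?_ hp)).trans (map_zero _)
    refine integral_congr_ae ?_
    filter_upwards [divIsometry_ae f] with x hx
    rw [hx, PWFun.fourierC_shift hr, RCLike.inner_apply, ← h2 x]
    exact mul_comm _ _

theorem exists_of_mem_modelSpace {r : ℝ} (hr : 0 < r) {h : Lp ℂ 2 (volume : Measure ℝ)}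
    (hh : h ∈ modelSpace (pwTheta r)) : ∃ f : DeBrangesSpace (pwHB r hr), divIsometry _ f = h := by
  obtain ⟨⟨F, hF, hb⟩, ho⟩ := hh
  obtain ⟨Φ, a1, a2, a3⟩ := hF.exists_fourierC
  have hp := boundary_hardy hb a1 a2 a3
  rw [SetLike.mem_coe, Submodule.mem_orthogonal] at ho
  have hN : ∀ N : ℕ, ∀ᵐ t : ℝ, t ∈ Set.Ioo (2 * r) N → Φ t = 0 := fun N => by
    refine ae_eq_zero_of_forall_pairing a1 measurableSet_Ioo fun g g1 g2 g3 => ?_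
    let g' : ℝ → ℂ := fun t => g (t + 2 * r)
    have hsupp : ∀ t : ℝ, |(N : ℝ)| + |2 * r| < |t| → g' t = 0 := fun t ht => by
      refine g3 _ fun h' => ?_
      have : |t| ≤ |(N : ℝ)| + |2 * r| := by
        rw [abs_le]
        have := abs_nonneg (N : ℝ)
        have := le_abs_self (N : ℝ)
        have := le_abs_self (2 * r)
        have := abs_nonneg (2 * r)
        constructor <;> linarith [h'.1, h'.2]
      linarith
    have hmp := measurePreserving_add_right (volume : Measure ℝ) (2 * r)
    have g1' : Integrable g' := hmp.integrable_comp_of_integrable g1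
    have g2' : MemLp g' 2 := g2.comp_measurePreserving hmp
    have hd : Differentiable ℂ (fourierC g') := differentiable_fourierC g1' hsupp
    have hH : MemH2 (fourierC g') := memH2_of_fourierC hd g2'
      (fun t ht => g3 _ fun h' => by linarith [h'.1]) fun _ _ => rfl
    have hg : ∀ z, fourierC g z = pwTheta r z * fourierC g' z := fun z => by
      rw [pwTheta_apply, ← fourierC_shift]
      simp [g']
    have hθ : Continuous fun z => pwTheta r z * fourierC g' z := by
      refine Continuous.mul ?_ hd.continuous
      unfold pwTheta
      fun_prop
    have hm := memLp_fourierC g1 g2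
    have h0 := ho (hm.toLp _) (Submodule.subset_span ⟨_, hH,
      isBoundaryValue_of_continuous hθ (hm.coeFn_toLp.trans
        (Eventually.of_forall fun x => hg x))⟩)
    rw [L2.inner_def] at h0
    have h1 := hp g g1 g2
    have h2 : ∫ x : ℝ, conj (fourierC g x) * h x = 0 := by
      rw [← h0]
      refine integral_congr_ae ?_
      filter_upwards [hm.coeFn_toLp] with x hx
      rw [hx, RCLike.inner_apply, mul_comm]
    have hpi : (2 * Real.pi : ℂ) ≠ 0 := by simp [Real.pi_ne_zero]
    exact (mul_eq_zero.1 (h1.symm.trans h2)).resolve_left hpi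
  have hz : ∀ᵐ t : ℝ, t ∈ Set.Ioi (2 * r) → Φ t = 0 := by
    filter_upwards [ae_all_iff.2 hN] with t ht ht'
    obtain ⟨N, hN⟩ := exists_nat_gt t
    exact ht N ⟨ht', hN⟩
  obtain ⟨φ, hφ, h3⟩ := exists_pwFun a1 a2 hz
  refine ⟨hφ.toSpace hr, Lp.ext ?_⟩
  have hd : ∀ n : ℕ, 0 < 1 / ((n : ℝ) + 1) := fun n => by positivity
  filter_upwards [divIsometry_ae (hφ.toSpace hr),
    hb.vertical hd tendsto_one_div_add_atTop_nhds_zero_nat] with x h4 h5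
  rw [h4]
  refine tendsto_nhds_unique ?_ h5
  refine (((differentiable_div_pwHB hr hφ.differentiable).continuous.tendsto _).comp
    (tendsto_vertical x tendsto_one_div_add_atTop_nhds_zero_nat)).congr fun n => ?_
  rw [Function.comp_apply, a3 _ ((im_vertical x _).symm ▸ hd n), h3, div_pwHB]

/-- The model space of `Θ_r` is isometric to `PW_r`. -/
noncomputable def modelEquiv (r : ℝ) (hr : 0 < r) :
    modelSpace (pwTheta r) ≃ₗᵢ[ℂ] DeBrangesSpace (pwHB r hr) :=
  (LinearIsometryEquiv.ofSurjective
    { toLinearMap := (divIsometry (pwHB r hr)).toLinearMap.codRestrict _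
        (divIsometry_mem_modelSpace hr)
      norm_map' := fun f => (divIsometry (pwHB r hr)).norm_map f }
    fun h => by
      obtain ⟨f, hf⟩ := exists_of_mem_modelSpace hr h.2
      exact ⟨f, Subtype.ext hf⟩).symm

theorem modelEquiv_symm_coe {r : ℝ} (hr : 0 < r) (f : DeBrangesSpace (pwHB r hr)) :
    ((modelEquiv r hr).symm f : Lp ℂ 2 (volume : Measure ℝ)) = divIsometry _ f := rfl


open InnerProductSpace in
/-- Harnack's inequality in a disc. -/
theorem harnack {u : ℂ → ℝ} {c p : ℂ} {R : ℝ} (hu : HarmonicOnNhd u (Metric.closedBall c R))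
    (h0 : ∀ z ∈ Metric.sphere c R, 0 ≤ u z) (hp : p ∈ Metric.ball c R) :
    u p ≤ (R + ‖p - c‖) / (R - ‖p - c‖) * u c ∧
      u c ≤ (R + ‖p - c‖) / (R - ‖p - c‖) * u p := by
  have hpR : ‖p - c‖ < R := by simpa [dist_eq_norm] using hp
  have hR : 0 < R := (norm_nonneg _).trans_lt hpR
  have habs : |R| = R := abs_of_pos hR
  have e1 := hu.circleAverage_poissonKernel_smul hp
  have e2 : Real.circleAverage u c R = u c := by
    have := hu.circleAverage_poissonKernel_smul (Metric.mem_ball_self hR)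
    rw [← this]
    refine Real.circleAverage_congr_sphere fun z hz => ?_
    rw [habs, mem_sphere_iff_norm] at hz
    have : ‖z - c‖ ^ 2 ≠ 0 := by rw [hz]; positivity
    simp [poissonKernel_def, this]
  have hk : ∀ z ∈ Metric.sphere c R, poissonKernel c p z ≤ (R + ‖p - c‖) / (R - ‖p - c‖) ∧
      (R - ‖p - c‖) / (R + ‖p - c‖) ≤ poissonKernel c p z := fun z hz => by
    rw [poissonKernel_eq_re_herglotzRieszKernel]
    exact ⟨re_herglotzRieszKernel_le hz hp, le_re_herglotzRieszKernel hz hp⟩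
  have hcu : ContinuousOn u (Metric.sphere c R) := fun z hz =>
    (hu z (Metric.sphere_subset_closedBall hz)).1.continuousAt.continuousWithinAt
  have hck : ContinuousOn (poissonKernel c p) (Metric.sphere c R) := by
    have : poissonKernel c p = fun z => (‖z - c‖ ^ 2 - ‖p - c‖ ^ 2) / ‖(z - c) - (p - c)‖ ^ 2 := rfl
    rw [this]
    refine ContinuousOn.div (by fun_prop) (by fun_prop) fun z hz => ?_
    rw [mem_sphere_iff_norm] at hz
    have : z - c - (p - c) ≠ 0 := fun h => by
      rw [sub_eq_zero.1 h] at hz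
      linarith
    exact pow_ne_zero 2 (norm_ne_zero_iff.2 this)
  have i1 : CircleIntegrable (poissonKernel c p • u) c R := by
    refine ContinuousOn.circleIntegrable' ?_
    rw [habs]
    exact hck.smul hcu
  have i2 : ∀ a : ℝ, CircleIntegrable (a • u) c R := fun a => by
    refine ContinuousOn.circleIntegrable' ?_
    rw [habs]
    exact continuousOn_const.smul hcu
  have m1 := Real.circleAverage_mono i1 (i2 ((R + ‖p - c‖) / (R - ‖p - c‖))) fun z hz => by
    rw [habs] at hz
    exact mul_le_mul_of_nonneg_right (hk z hz).1 (h0 z hz)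
  have m2 := Real.circleAverage_mono (i2 ((R - ‖p - c‖) / (R + ‖p - c‖))) i1 fun z hz => by
    rw [habs] at hz
    exact mul_le_mul_of_nonneg_right (hk z hz).2 (h0 z hz)
  rw [e1, Real.circleAverage_smul, e2, smul_eq_mul] at m1 m2
  refine ⟨m1, ?_⟩
  have h3 : 0 < R - ‖p - c‖ := by linarith
  have h4 : 0 < R + ‖p - c‖ := by linarith [norm_nonneg (p - c)]
  rw [div_mul_eq_mul_div, div_le_iff₀ h4] at m2
  rw [div_mul_eq_mul_div, le_div_iff₀ h3]
  linarith

theorem norm_blaschke_sphere {R : ℝ} {u ζ : ℂ} (hu : ‖u‖ = R) :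
    ‖(R : ℂ) ^ 2 - conj ζ * u‖ = R * ‖u - ζ‖ := by
  have : (R : ℂ) ^ 2 = u * conj u := by
    rw [Complex.mul_conj, Complex.normSq_eq_norm_sq, hu]
    push_cast
    rfl
  rw [this, show u * conj u - conj ζ * u = u * conj (u - ζ) by rw [map_sub]; ring, norm_mul, hu,
    RCLike.norm_conj]

theorem norm_blaschke_sq (R : ℝ) (α ζ : ℂ) :
    ‖(R : ℂ) ^ 2 - conj ζ * α‖ ^ 2 - R ^ 2 * ‖α - ζ‖ ^ 2
      = (R ^ 2 - ‖α‖ ^ 2) * (R ^ 2 - ‖ζ‖ ^ 2) := by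
  rw [← Complex.normSq_eq_norm_sq, ← Complex.normSq_eq_norm_sq, ← Complex.normSq_eq_norm_sq,
    ← Complex.normSq_eq_norm_sq, Complex.normSq_apply, Complex.normSq_apply, Complex.normSq_apply,
    Complex.normSq_apply]
  simp [pow_two]
  ring

/-- Division by a Blaschke factor. -/
theorem exists_div_blaschke {F Q : ℂ → ℂ} (hF : Differentiable ℂ F) (hQ : Differentiable ℂ Q)
    {c a ζ : ℂ} {R R' K : ℝ} (hRR : R' < R)
    (h1 : ∀ z ∈ Metric.closedBall c R, ‖F z‖ ≤ 1)
    (h2 : ∀ z ∈ Metric.closedBall c R, ‖Q z * F z‖ ≤ K)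
    (ha : a ∈ Metric.ball c R) (hζ : ζ ∈ Metric.closedBall c R') (hz : F ζ = 0) :
    ∃ G : ℂ → ℂ, Differentiable ℂ G ∧ (∀ z ∈ Metric.closedBall c R, ‖G z‖ ≤ 1) ∧
      (∀ z ∈ Metric.closedBall c R, ‖Q z * G z‖ ≤ K) ∧
      ‖F a‖ ≤ √(1 - (R ^ 2 - ‖a - c‖ ^ 2) * (R ^ 2 - R' ^ 2) / (4 * R ^ 4)) * ‖G a‖ := by
  have haR : ‖a - c‖ < R := by simpa [dist_eq_norm] using ha
  have hζR : ‖ζ - c‖ ≤ R' := by simpa [dist_eq_norm] using hζ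
  have hR : 0 < R := (norm_nonneg _).trans_lt haR
  have hRc : (R : ℂ) ≠ 0 := by exact_mod_cast hR.ne'
  let g := dslope F ζ
  have hg : Differentiable ℂ g := by
    rw [← differentiableOn_univ]
    exact (Complex.differentiableOn_dslope univ_mem).2 hF.differentiableOn
  have hFg : ∀ z, F z = (z - ζ) * g z := fun z => by
    have := sub_smul_dslope F ζ z
    rw [hz, sub_zero, smul_eq_mul] at this
    exact this.symm
  let b : ℂ → ℂ := fun z => ((R : ℂ) ^ 2 - conj (ζ - c) * (z - c)) / R
  let G : ℂ → ℂ := fun z => g z * b z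
  have hb : Differentiable ℂ b := by fun_prop
  have hG : Differentiable ℂ G := hg.mul hb
  have hGs : ∀ z ∈ Metric.sphere c R, ‖G z‖ = ‖F z‖ := fun z hz' => by
    rw [mem_sphere_iff_norm] at hz'
    simp only [G, b]
    rw [hFg, norm_mul, norm_mul, norm_div, norm_blaschke_sphere hz', Complex.norm_real,
      Real.norm_of_nonneg hR.le, mul_div_cancel_left₀ _ hR.ne', sub_sub_sub_cancel_right, mul_comm]
  have hmax : ∀ {k : ℂ → ℂ} {M : ℝ}, Differentiable ℂ k →
      (∀ z ∈ Metric.sphere c R, ‖k z‖ ≤ M) → ∀ z ∈ Metric.closedBall c R, ‖k z‖ ≤ M := by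
    intro k M hk hM z hz'
    refine Complex.norm_le_of_forall_mem_frontier_norm_le (U := Metric.ball c R)
      Metric.isBounded_ball hk.diffContOnCl (fun w hw => hM w ?_) ?_
    · rwa [frontier_ball c hR.ne'] at hw
    · rwa [closure_ball c hR.ne']
  refine ⟨G, hG, hmax hG fun z hz' => ?_, hmax (hQ.mul hG) fun z hz' => ?_, ?_⟩
  · rw [hGs z hz']
    exact h1 z (Metric.sphere_subset_closedBall hz')
  · rw [norm_mul, hGs z hz', ← norm_mul]
    exact h2 z (Metric.sphere_subset_closedBall hz')
  · have e := norm_blaschke_sq R (a - c) (ζ - c)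
    rw [sub_sub_sub_cancel_right] at e
    set B := ‖(R : ℂ) ^ 2 - conj (ζ - c) * (a - c)‖ with hB
    set δ := (R ^ 2 - ‖a - c‖ ^ 2) * (R ^ 2 - R' ^ 2) / (4 * R ^ 4) with hδ
    have hζR' : ‖ζ - c‖ < R := hζR.trans_lt hRR
    have hB2 : B ≤ 2 * R ^ 2 := by
      have h3 := norm_sub_le ((R : ℂ) ^ 2) (conj (ζ - c) * (a - c))
      rw [norm_pow, Complex.norm_real, Real.norm_of_nonneg hR.le, norm_mul, RCLike.norm_conj] at h3
      have h4 : ‖ζ - c‖ * ‖a - c‖ ≤ R * R :=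
        mul_le_mul hζR'.le haR.le (norm_nonneg _) hR.le
      rw [hB]
      nlinarith
    have hB0 : 0 ≤ B := norm_nonneg _
    have hA : 0 ≤ R ^ 2 - ‖a - c‖ ^ 2 := by nlinarith [norm_nonneg (a - c)]
    have hR'0 : 0 ≤ R' := (norm_nonneg _).trans hζR
    have hA' : 0 ≤ R ^ 2 - R' ^ 2 := by nlinarith
    have hA'' : R ^ 2 - R' ^ 2 ≤ R ^ 2 - ‖ζ - c‖ ^ 2 := by nlinarith [norm_nonneg (ζ - c)]
    have hδB : δ * B ^ 2 ≤ (R ^ 2 - ‖a - c‖ ^ 2) * (R ^ 2 - ‖ζ - c‖ ^ 2) := by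
      have h5 : B ^ 2 ≤ 4 * R ^ 4 := by nlinarith
      calc δ * B ^ 2 ≤ δ * (4 * R ^ 4) := mul_le_mul_of_nonneg_left h5 (by positivity)
        _ = (R ^ 2 - ‖a - c‖ ^ 2) * (R ^ 2 - R' ^ 2) := by
          rw [hδ]
          field_simp
        _ ≤ _ := mul_le_mul_of_nonneg_left hA'' hA
    have hkey : R * ‖a - ζ‖ ≤ √(1 - δ) * B := by
      refine le_of_sq_le_sq ?_ (by positivity)
      rw [mul_pow, mul_pow]
      rcases le_or_gt 0 (1 - δ) with h | h
      · rw [Real.sq_sqrt h]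
        linarith
      · rw [Real.sqrt_eq_zero_of_nonpos h.le]
        nlinarith [sq_nonneg B, sq_nonneg (R * ‖a - ζ‖)]
    have hGa : ‖G a‖ = ‖g a‖ * (B / R) := by
      simp only [G, b]
      rw [norm_mul, norm_div, Complex.norm_real, Real.norm_of_nonneg hR.le]
    rw [hGa, hFg, norm_mul]
    calc ‖a - ζ‖ * ‖g a‖ = (R * ‖a - ζ‖) * ‖g a‖ / R := by field_simp
      _ ≤ (√(1 - δ) * B) * ‖g a‖ / R := by gcongr
      _ = _ := by ring

theorem exists_zero_free {Q : ℂ → ℂ} (hQ : Differentiable ℂ Q)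
    {c a : ℂ} {R R' K : ℝ} (hRR : R' < R) (ha : a ∈ Metric.ball c R) {κ : ℝ}
    (hκ : κ = √(1 - (R ^ 2 - ‖a - c‖ ^ 2) * (R ^ 2 - R' ^ 2) / (4 * R ^ 4))) (hκ0 : 0 < κ)
    (hκ1 : κ < 1) (n : ℕ) :
    ∀ F : ℂ → ℂ, Differentiable ℂ F → (∀ z ∈ Metric.closedBall c R, ‖F z‖ ≤ 1) →
      (∀ z ∈ Metric.closedBall c R, ‖Q z * F z‖ ≤ K) → κ ^ n ≤ ‖F a‖ →
      ∃ G : ℂ → ℂ, Differentiable ℂ G ∧ (∀ z ∈ Metric.closedBall c R, ‖G z‖ ≤ 1) ∧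
        (∀ z ∈ Metric.closedBall c R, ‖Q z * G z‖ ≤ K) ∧ ‖F a‖ ≤ ‖G a‖ ∧
        ∀ z ∈ Metric.closedBall c R', G z ≠ 0 := by
  induction n with
  | zero =>
    intro F hF h1 h2 h3
    refine ⟨F, hF, h1, h2, le_rfl, fun ζ hζ hz => ?_⟩
    obtain ⟨G, -, g1, -, g3⟩ := exists_div_blaschke hF hQ hRR h1 h2 ha hζ hz
    rw [← hκ] at g3
    have := g1 a (Metric.ball_subset_closedBall ha)
    rw [pow_zero] at h3
    nlinarith
  | succ n ih =>
    intro F hF h1 h2 h3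
    by_cases hzero : ∃ ζ ∈ Metric.closedBall c R', F ζ = 0
    · obtain ⟨ζ, hζ, hz⟩ := hzero
      obtain ⟨G, g0, g1, g2, g3⟩ := exists_div_blaschke hF hQ hRR h1 h2 ha hζ hz
      rw [← hκ] at g3
      have h4 : κ ^ n ≤ ‖G a‖ := by
        rw [pow_succ] at h3
        have : κ * κ ^ n ≤ κ * ‖G a‖ := by linarith
        exact le_of_mul_le_mul_left this hκ0
      obtain ⟨G', k1, k2, k3, k4, k5⟩ := ih G g0 g1 g2 h4
      refine ⟨G', k1, k2, k3, le_trans ?_ k4, k5⟩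
      nlinarith [norm_nonneg (G a)]
    · push Not at hzero
      exact ⟨F, hF, h1, h2, le_rfl, hzero⟩

/-- The Harnack factor of a point of a disc. -/
noncomputable def harnackFactor (c : ℂ) (R : ℝ) (p : ℂ) : ℝ := (R + ‖p - c‖) / (R - ‖p - c‖)

theorem norm_le_of_quotient_aux {F Q : ℂ → ℂ} (hF : Differentiable ℂ F) (hQ : Differentiable ℂ Q)
    {c a w : ℂ} {R R' K : ℝ} (hRR : R' < R)
    (h1 : ∀ z ∈ Metric.closedBall c R, ‖F z‖ ≤ 1)
    (h2 : ∀ z ∈ Metric.closedBall c R, ‖Q z * F z‖ ≤ K)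
    (ha : a ∈ Metric.ball c R') (hw : w ∈ Metric.ball c R') (hFa : F a ≠ 0) :
    ‖Q w‖ ≤ K * Real.exp (harnackFactor c R' a * harnackFactor c R' w * -Real.log ‖F a‖) := by
  have haR : ‖a - c‖ < R' := by simpa [dist_eq_norm] using ha
  have hwR : ‖w - c‖ < R' := by simpa [dist_eq_norm] using hw
  have hR' : 0 < R' := (norm_nonneg _).trans_lt haR
  have hR : 0 < R := hR'.trans hRR
  set κ := √(1 - (R ^ 2 - ‖a - c‖ ^ 2) * (R ^ 2 - R' ^ 2) / (4 * R ^ 4)) with hκ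
  have hA : 0 < R ^ 2 - ‖a - c‖ ^ 2 := by nlinarith [norm_nonneg (a - c)]
  have hA' : 0 < R ^ 2 - R' ^ 2 := by nlinarith
  have hδ1 : (R ^ 2 - ‖a - c‖ ^ 2) * (R ^ 2 - R' ^ 2) / (4 * R ^ 4) < 1 := by
    rw [div_lt_one (by positivity)]
    have e1 : R ^ 2 - ‖a - c‖ ^ 2 ≤ R ^ 2 := by nlinarith [sq_nonneg ‖a - c‖]
    have e2 : R ^ 2 - R' ^ 2 ≤ R ^ 2 := by nlinarith [sq_nonneg R']
    have := mul_le_mul e1 e2 hA'.le (by positivity)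
    have h4 : 0 < R ^ 4 := by positivity
    nlinarith
  have hδ0 : 0 < (R ^ 2 - ‖a - c‖ ^ 2) * (R ^ 2 - R' ^ 2) / (4 * R ^ 4) := by positivity
  have hκ0 : 0 < κ := Real.sqrt_pos.2 (by linarith)
  have hκ1 : κ < 1 := by
    rw [hκ, Real.sqrt_lt' one_pos]
    linarith
  have ha' : a ∈ Metric.ball c R := Metric.ball_subset_ball hRR.le ha
  have hFa' : 0 < ‖F a‖ := norm_pos_iff.2 hFa
  obtain ⟨n, hn⟩ := exists_pow_lt_of_lt_one hFa' hκ1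
  obtain ⟨G, g0, g1, g2, g3, g4⟩ :=
    exists_zero_free hQ hRR ha' hκ hκ0 hκ1 n F hF h1 h2 hn.le
  have hsub : Metric.closedBall c R' ⊆ Metric.closedBall c R :=
    Metric.closedBall_subset_closedBall hRR.le
  have hu : InnerProductSpace.HarmonicOnNhd (fun z => -Real.log ‖G z‖) (Metric.closedBall c R') :=
    fun z hz => (AnalyticAt.harmonicAt_log_norm (g0.analyticAt z) (g4 z hz)).neg
  have hu0 : ∀ z ∈ Metric.closedBall c R', 0 ≤ -Real.log ‖G z‖ := fun z hz => by
    have := Real.log_nonpos (norm_nonneg _) (g1 z (hsub hz))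
    linarith
  have k1 := (harnack hu (fun z hz => hu0 z (Metric.sphere_subset_closedBall hz)) hw).1
  have k2 := (harnack hu (fun z hz => hu0 z (Metric.sphere_subset_closedBall hz)) ha).2
  change _ ≤ harnackFactor c R' w * _ at k1
  change _ ≤ harnackFactor c R' a * _ at k2
  have hHw : 0 ≤ harnackFactor c R' w :=
    div_nonneg (by linarith [norm_nonneg (w - c)]) (by linarith)
  have hHa : 0 ≤ harnackFactor c R' a :=
    div_nonneg (by linarith [norm_nonneg (a - c)]) (by linarith)
  have k3 : -Real.log ‖G a‖ ≤ -Real.log ‖F a‖ := neg_le_neg (Real.log_le_log hFa' g3)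
  have k4 : -Real.log ‖G w‖ ≤
      harnackFactor c R' a * harnackFactor c R' w * -Real.log ‖F a‖ := by
    calc -Real.log ‖G w‖ ≤ harnackFactor c R' w * (harnackFactor c R' a * -Real.log ‖F a‖) :=
          k1.trans (mul_le_mul_of_nonneg_left
            (k2.trans (mul_le_mul_of_nonneg_left k3 hHa)) hHw)
      _ = _ := by ring
  have hwc := Metric.ball_subset_closedBall hw
  have hGw : 0 < ‖G w‖ := norm_pos_iff.2 (g4 w hwc)
  have h5 := g2 w (hsub hwc)
  rw [norm_mul] at h5
  have hK : 0 ≤ K := (mul_nonneg (norm_nonneg _) (norm_nonneg _)).trans h5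
  have h6 : Real.exp (-Real.log ‖G w‖) = ‖G w‖⁻¹ := by
    rw [Real.exp_neg, Real.exp_log hGw]
  calc ‖Q w‖ ≤ K * ‖G w‖⁻¹ := by
        rw [← div_eq_mul_inv, le_div_iff₀ hGw]
        exact h5
    _ ≤ _ := by
        rw [← h6]
        exact mul_le_mul_of_nonneg_left (Real.exp_le_exp.2 k4) hK

/-- If `F` is bounded by one and `Q F` is bounded in a disc, then `Q` is bounded at a point of the
disc in terms of the size of `F` at another point. -/
theorem norm_le_of_quotient {F Q : ℂ → ℂ} (hF : Differentiable ℂ F) (hQ : Differentiable ℂ Q)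
    {c a w : ℂ} {R K : ℝ}
    (h1 : ∀ z ∈ Metric.closedBall c R, ‖F z‖ ≤ 1)
    (h2 : ∀ z ∈ Metric.closedBall c R, ‖Q z * F z‖ ≤ K)
    (ha : a ∈ Metric.ball c R) (hw : w ∈ Metric.ball c R) (hFa : F a ≠ 0) :
    ‖Q w‖ ≤ K * Real.exp (harnackFactor c R a * harnackFactor c R w * -Real.log ‖F a‖) := by
  have haR : ‖a - c‖ < R := by simpa [dist_eq_norm] using ha
  have hwR : ‖w - c‖ < R := by simpa [dist_eq_norm] using hw
  have hc : ∀ p : ℂ, ‖p - c‖ < R → ContinuousAt (fun s => harnackFactor c s p) R := fun p hp => by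
    unfold harnackFactor
    refine ContinuousAt.div (by fun_prop) (by fun_prop) ?_
    linarith
  have hlim : ContinuousAt (fun s => K * Real.exp (harnackFactor c s a * harnackFactor c s w *
      -Real.log ‖F a‖)) R := by
    have h3 := hc a haR
    have h4 := hc w hwR
    fun_prop
  refine ge_of_tendsto (hlim.tendsto.mono_left (nhdsWithin_le_nhds (s := Set.Iio R))) ?_
  have hm := Ioo_mem_nhdsLT (max_lt haR hwR)
  filter_upwards [hm] with s hs
  refine norm_le_of_quotient_aux hF hQ hs.2 h1 h2 ?_ ?_ hFa
  · simpa [dist_eq_norm] using (le_max_left _ _).trans_lt hs.1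
  · simpa [dist_eq_norm] using (le_max_right _ _).trans_lt hs.1


theorem ae_eq_zero_of_integral_Ioi_eq_zero {φ : ℝ → ℂ} (h : Integrable φ)
    (h0 : ∀ x : ℝ, 0 < x → ∫ t in Set.Ioi x, φ t = 0) : ∀ᵐ t : ℝ, 0 < t → φ t = 0 := by
  filter_upwards [LocallyIntegrable.ae_hasDerivAt_integral h.locallyIntegrable] with x hx hx0
  have h1 : (fun y => ∫ t in (1 : ℝ)..y, φ t) =ᶠ[𝓝 x] fun _ => 0 := by
    filter_upwards [lt_mem_nhds hx0] with y hy
    rw [← intervalIntegral.integral_Ioi_sub_Ioi' h.integrableOn h.integrableOn, h0 1 one_pos,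
      h0 y hy, sub_zero]
  have h2 := (hx 1).congr_of_eventuallyEq h1.symm
  exact h2.unique (hasDerivAt_const x 0)

theorem hasSum_one_sub_exp_neg (x : ℝ) :
    HasSum (fun k : ℕ => (-1 : ℝ) ^ k / (k + 1).factorial * x ^ (k + 1)) (1 - Real.exp (-x)) := by
  have h := NormedSpace.expSeries_div_hasSum_exp (𝔸 := ℝ) (-x)
  rw [← Real.exp_eq_exp_ℝ] at h
  have h1 := ((hasSum_nat_add_iff' 1).2 h).neg
  simp only [Finset.range_one, Finset.sum_singleton, pow_zero, Nat.factorial_zero, Nat.cast_one,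
    div_one, neg_sub] at h1
  refine h1.congr_fun fun k => ?_
  rw [neg_pow x (k + 1), pow_succ (-1 : ℝ) k]
  ring

/-- An integrable function whose exponential moments are bounded vanishes on the half-line. -/
theorem ae_eq_zero_of_exp_moments {φ : ℝ → ℂ} (h : Integrable φ) {T M : ℝ} {N : ℕ}
    (hs : ∀ t, T < t → φ t = 0)
    (hb : ∀ n : ℕ, N ≤ n → ‖∫ t, φ t * (Real.exp (n * t) : ℝ)‖ ≤ M) :
    ∀ᵐ t : ℝ, 0 < t → φ t = 0 := by
  refine ae_eq_zero_of_integral_Ioi_eq_zero h fun x hx => ?_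
  have hexp : ∀ a : ℝ, 0 ≤ a → Integrable fun t => φ t * (Real.exp (a * t) : ℝ) := fun a ha => by
    refine (h.norm.mul_const (Real.exp (a * T))).mono' ?_ (Eventually.of_forall fun t => ?_)
    · exact h.1.mul (Continuous.aestronglyMeasurable (by fun_prop))
    · rw [norm_mul, Complex.norm_real, Real.norm_of_nonneg (Real.exp_pos _).le]
      rcases le_or_gt t T with ht | ht
      · gcongr
      · simp [hs t ht]
  let D : ℕ → ℝ → ℝ := fun n t => 1 - Real.exp (-Real.exp (n * (t - x)))
  have hD : ∀ n t, |D n t| ≤ 1 := fun n t => by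
    have h1 := Real.exp_pos (-Real.exp (n * (t - x)))
    have h2 : Real.exp (-Real.exp (n * (t - x))) ≤ 1 :=
      Real.exp_le_one_iff.2 (neg_nonpos.2 (Real.exp_pos _).le)
    rw [abs_le]
    constructor <;> simp only [D] <;> linarith
  have hlim : Tendsto (fun n : ℕ => ∫ t, φ t * (D n t : ℝ)) atTop
      (𝓝 (∫ t, (Set.Ioi x).indicator φ t)) := by
    refine tendsto_integral_of_dominated_convergence (fun t => ‖φ t‖) (fun n => ?_) h.norm
      (fun n => Eventually.of_forall fun t => ?_) ?_
    · exact h.1.mul (Continuous.aestronglyMeasurable (by fun_prop))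
    · rw [norm_mul, Complex.norm_real]
      exact mul_le_of_le_one_right (norm_nonneg _) (hD n t)
    · have hne : ∀ᵐ t : ℝ, t ≠ x := by simp [ae_iff]
      filter_upwards [hne] with t ht
      have hn : Tendsto (fun n : ℕ => (n : ℝ)) atTop atTop := tendsto_natCast_atTop_atTop
      rcases lt_or_gt_of_ne ht with h' | h'
      · rw [Set.indicator_of_notMem (by simpa using h'.le)]
        have h1 : Tendsto (fun n : ℕ => Real.exp (n * (t - x))) atTop (𝓝 0) :=
          Real.tendsto_exp_atBot.comp (hn.atTop_mul_const_of_neg (by linarith))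
        have h2 : Tendsto (fun n : ℕ => D n t) atTop (𝓝 0) := by
          have := ((Real.continuous_exp.tendsto _).comp h1.neg).const_sub 1
          simpa [D] using this
        have h3 := ((Complex.continuous_ofReal.tendsto _).comp h2).const_mul (φ t)
        simpa using h3
      · rw [Set.indicator_of_mem (by simpa using h')]
        have h1 : Tendsto (fun n : ℕ => Real.exp (n * (t - x))) atTop atTop :=
          Real.tendsto_exp_atTop.comp (hn.atTop_mul_const (by linarith))
        have h2 : Tendsto (fun n : ℕ => D n t) atTop (𝓝 1) := by
          have := (Real.tendsto_exp_neg_atTop_nhds_zero.comp h1).const_sub 1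
          simpa [D] using this
        have h3 := ((Complex.continuous_ofReal.tendsto _).comp h2).const_mul (φ t)
        simpa using h3
  rw [integral_indicator measurableSet_Ioi] at hlim
  refine tendsto_nhds_unique hlim ?_
  have hM : 0 ≤ M := (norm_nonneg _).trans (hb N le_rfl)
  have hbound : ∀ n : ℕ, max N 1 ≤ n →
      ‖∫ t, φ t * (D n t : ℝ)‖ ≤ M * (Real.exp (Real.exp (-(n * x))) - 1) := fun n hn => by
    have hnN : N ≤ n := (le_max_left _ _).trans hn
    have hn1 : 1 ≤ n := (le_max_right _ _).trans hn
    let a : ℕ → ℝ → ℂ := fun k t => φ t *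
      (((-1 : ℝ) ^ k / (k + 1).factorial * Real.exp (n * (t - x)) ^ (k + 1) : ℝ) : ℂ)
    have ea : ∀ k t, a k t = (((-1 : ℝ) ^ k / (k + 1).factorial *
        Real.exp (-(n * x)) ^ (k + 1) : ℝ) : ℂ) *
        (φ t * (Real.exp (((n * (k + 1) : ℕ) : ℝ) * t) : ℝ)) := fun k t => by
      have : Real.exp (n * (t - x)) ^ (k + 1) = Real.exp (-(n * x)) ^ (k + 1) *
          Real.exp (((n * (k + 1) : ℕ) : ℝ) * t) := by
        rw [← Real.exp_nat_mul, ← Real.exp_nat_mul, ← Real.exp_add]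
        congr 1
        push_cast
        ring
      simp only [a]
      rw [this]
      push_cast
      ring
    have ia : ∀ k, Integrable (a k) := fun k => by
      simp only [funext (ea k)]
      exact (hexp _ (by positivity)).const_mul _
    have hsumexp : ∀ y : ℝ, HasSum (fun k : ℕ => y ^ (k + 1) / (k + 1).factorial)
        (Real.exp y - 1) := fun y => by
      have h := NormedSpace.expSeries_div_hasSum_exp (𝔸 := ℝ) y
      rw [← Real.exp_eq_exp_ℝ] at h
      simpa using (hasSum_nat_add_iff' 1).2 h
    have hH : HasSum (fun k => ∫ t, a k t) (∫ t, φ t * (D n t : ℝ)) := by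
      have := hasSum_integral_of_dominated_convergence
        (F := a) (f := fun t => φ t * (D n t : ℝ)) (μ := volume)
        (bound := fun k t => ‖φ t‖ * (Real.exp (n * (T - x)) ^ (k + 1) / (k + 1).factorial))
        (fun k => (ia k).1) (fun k => Eventually.of_forall fun t => ?_)
        (Eventually.of_forall fun t => ((hsumexp _).mul_left _).summable) ?_
        (Eventually.of_forall fun t => ?_)
      · exact this
      · simp only [a]
        rw [norm_mul, Complex.norm_real]
        rcases le_or_gt t T with ht | ht
        · refine mul_le_mul_of_nonneg_left ?_ (norm_nonneg _)
          rw [norm_mul, norm_div, norm_pow, norm_neg, norm_one, one_pow, norm_pow,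
            Real.norm_of_nonneg (Real.exp_pos _).le, Real.norm_natCast, div_mul_eq_mul_div, one_mul]
          gcongr
        · simp [hs t ht]
      · have : (fun t => ∑' k, ‖φ t‖ * (Real.exp (n * (T - x)) ^ (k + 1) / (k + 1).factorial))
            = fun t => ‖φ t‖ * (Real.exp (Real.exp (n * (T - x))) - 1) := by
          ext t
          exact ((hsumexp _).mul_left _).tsum_eq
        rw [this]
        exact h.norm.mul_const _
      · have := (hasSum_one_sub_exp_neg (Real.exp (n * (t - x))))
        exact (Complex.hasSum_ofReal.2 this).mul_left (φ t)
    have hle : ∀ k, ‖∫ t, a k t‖ ≤ M * (Real.exp (-(n * x)) ^ (k + 1) / (k + 1).factorial) :=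
      fun k => by
      simp only [ea]
      rw [integral_const_mul, norm_mul, Complex.norm_real, mul_comm]
      refine mul_le_mul (hb _ ?_) (le_of_eq ?_) (norm_nonneg _) hM
      · exact hnN.trans (Nat.le_mul_of_pos_right n (Nat.succ_pos k))
      · rw [norm_mul, norm_div, norm_pow, norm_neg, norm_one, one_pow, norm_pow,
          Real.norm_of_nonneg (Real.exp_pos _).le, Real.norm_natCast, div_mul_eq_mul_div, one_mul]
    have hS := (hsumexp (Real.exp (-(n * x)))).mul_left M
    rw [← hH.tsum_eq, ← hS.tsum_eq]
    have hsn : Summable fun k => ‖∫ t, a k t‖ :=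
      Summable.of_nonneg_of_le (fun _ => norm_nonneg _) hle hS.summable
    exact (norm_tsum_le_tsum_norm hsn).trans (hsn.tsum_le_tsum hle hS.summable)
  have hn : Tendsto (fun n : ℕ => (n : ℝ)) atTop atTop := tendsto_natCast_atTop_atTop
  have h1 : Tendsto (fun n : ℕ => Real.exp (-(n * x))) atTop (𝓝 0) :=
    Real.tendsto_exp_neg_atTop_nhds_zero.comp (hn.atTop_mul_const hx)
  have h2 : Tendsto (fun n : ℕ => M * (Real.exp (Real.exp (-(n * x))) - 1)) atTop (𝓝 0) := by
    have := (((Real.continuous_exp.tendsto _).comp h1).sub_const 1).const_mul M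
    simpa using this
  exact squeeze_zero_norm' ((eventually_ge_atTop (max N 1)).mono fun n hn => hbound n hn) h2


theorem ae_of_ae_comp_add {p : ℝ → Prop} {a : ℝ} (h : ∀ᵐ t : ℝ, p (t + a)) : ∀ᵐ t : ℝ, p t := by
  filter_upwards [(measurePreserving_sub_right volume a).quasiMeasurePreserving.ae h] with t ht
  simpa using ht

theorem ae_of_ae_comp_neg {p : ℝ → Prop} (h : ∀ᵐ t : ℝ, p (-t)) : ∀ᵐ t : ℝ, p t := by
  filter_upwards [(Measure.measurePreserving_neg (volume : Measure ℝ)).quasiMeasurePreserving.ae h]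
    with t ht
  simpa using ht

/-- `S` is the upper end of the support of `φ`. -/
structure IsSuppTop (φ : ℝ → ℂ) (S : ℝ) : Prop where
  eq_zero : ∀ t, S < t → φ t = 0
  not_ae : ∀ ε > 0, ¬ ∀ᵐ t : ℝ, S - ε < t → φ t = 0

theorem fourierC_neg_mul_I (φ : ℝ → ℂ) (y : ℝ) :
    fourierC φ (-(y * Complex.I)) = ∫ t, φ t * (Real.exp (y * t) : ℝ) := by
  unfold fourierC
  congr 1
  ext t
  rw [Complex.ofReal_exp]
  congr 2
  push_cast
  linear_combination (-(y : ℂ) * t) * Complex.I_sq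

theorem IsSuppTop.exists_nat {φ : ℝ → ℂ} {S ε : ℝ} (h : Integrable φ) (hS : IsSuppTop φ S)
    (hε : 0 < ε) : ∃ n : ℕ, 1 ≤ n ∧
      (∫ t, ‖φ t‖) * Real.exp ((S - ε) * n) ≤ ‖fourierC φ (-(n * Complex.I))‖ := by
  by_contra! hcon
  refine hS.not_ae ε hε ?_
  have key := ae_eq_zero_of_exp_moments (φ := fun t => φ (t + (S - ε))) (T := ε)
    (M := ∫ t, ‖φ t‖) (N := 1) (h.comp_add_right _) (fun t ht => hS.eq_zero _ (by linarith))
    fun n hn => ?_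
  · refine ae_of_ae_comp_add (a := S - ε) ?_
    filter_upwards [key] with t ht ht'
    exact ht (by linarith)
  · have e : ∫ t, φ (t + (S - ε)) * (Real.exp (n * t) : ℝ)
        = (Real.exp (-((S - ε) * n)) : ℝ) * fourierC φ (-(n * Complex.I)) := by
      have := fourierC_neg_mul_I φ n
      push_cast at this
      rw [this, ← integral_const_mul, ← integral_add_right_eq_self
        (fun t : ℝ => ((Real.exp (-((S - ε) * n)) : ℝ) : ℂ) * (φ t * Complex.exp (n * t))) (S - ε)]
      congr 1
      ext t
      rw [mul_left_comm, Complex.ofReal_exp, Complex.ofReal_exp, ← Complex.exp_add]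
      congr 2
      push_cast
      ring
    rw [e, norm_mul, Complex.norm_real, Real.norm_of_nonneg (Real.exp_pos _).le, Real.exp_neg]
    rw [inv_mul_le_iff₀ (Real.exp_pos _), mul_comm (Real.exp _)]
    exact (hcon n hn).le

theorem norm_fourierC_mul_exp_le {φ : ℝ → ℂ} {S : ℝ} (h : Integrable φ) (hS : ∀ t, S < t → φ t = 0)
    {w : ℂ} (hw : w.im ≤ 0) :
    ‖fourierC φ w * Complex.exp (-(Complex.I * S * w))‖ ≤ ∫ t, ‖φ t‖ := by
  unfold fourierC
  rw [← integral_mul_const]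
  refine norm_integral_le_of_norm_le h.norm (Eventually.of_forall fun t => ?_)
  rw [mul_assoc, ← Complex.exp_add, norm_mul, Complex.norm_exp]
  rcases le_or_gt t S with ht | ht
  · refine mul_le_of_le_one_right (norm_nonneg _) (Real.exp_le_one_iff.2 ?_)
    have : (Complex.I * w * t + -(Complex.I * S * w)).re = -w.im * (t - S) := by
      simp
      ring
    rw [this]
    nlinarith
  · simp [hS t ht]

/-- Upper bounds in the lower half-plane for the quotient of a bounded function by a Fourier
transform. -/
theorem IsSuppTop.norm_quotient_le {φ : ℝ → ℂ} {S ε r : ℝ} (h : PWFun r φ) (hS : IsSuppTop φ S)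
    (hε : 0 < ε) {q : ℂ → ℂ} (hq : Differentiable ℂ q) {K : ℝ}
    (hqK : ∀ w : ℂ, w.im ≤ 0 → ‖q w * fourierC φ w‖ ≤ K) :
    ∃ n : ℕ, ∃ C : ℝ, 0 ≤ C ∧ ∀ R : ℝ, n ≤ R → ∀ w ∈ Metric.ball (-(R * Complex.I)) R,
      ‖q w‖ ≤ C * Real.exp (2 * ε * R * harnackFactor (-(R * Complex.I)) R w + S * w.im) := by
  have hi := h.integrable
  set c := ∫ t, ‖φ t‖ with hc
  have hc0 : 0 < c := by
    refine lt_of_le_of_ne (integral_nonneg fun _ => norm_nonneg _) fun h0 => ?_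
    have h1 := (integral_eq_zero_iff_of_nonneg (fun t => norm_nonneg (φ t)) hi.norm).1 h0.symm
    refine hS.not_ae 1 one_pos ?_
    filter_upwards [h1] with t ht _
    simpa using ht
  have hcc : (c : ℂ) ≠ 0 := by exact_mod_cast hc0.ne'
  obtain ⟨n, hn1, hn⟩ := hS.exists_nat hi hε
  have hn1' : (1 : ℝ) ≤ n := by exact_mod_cast hn1
  have hK : 0 ≤ K := (norm_nonneg _).trans (hqK 0 (by simp))
  refine ⟨n, K / c, by positivity, fun R hR w hw => ?_⟩
  have hR0 : 0 < R := by linarith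
  let F : ℂ → ℂ := fun w => fourierC φ w * Complex.exp (-(Complex.I * S * w)) / c
  let Q : ℂ → ℂ := fun w => q w * Complex.exp (Complex.I * S * w) * c
  have hF : Differentiable ℂ F := by
    have := h.differentiable
    fun_prop
  have hQ : Differentiable ℂ Q := by fun_prop
  have him : ∀ z ∈ Metric.closedBall (-(R * Complex.I)) R, z.im ≤ 0 := fun z hz => by
    rw [mem_closedBall_iff_norm] at hz
    have h1 := (Complex.abs_im_le_norm (z - -(R * Complex.I))).trans hz
    have h2 : (z - -(R * Complex.I)).im = z.im + R := by simp
    rw [h2] at h1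
    linarith [le_abs_self (z.im + R)]
  have h1 : ∀ z ∈ Metric.closedBall (-(R * Complex.I)) R, ‖F z‖ ≤ 1 := fun z hz => by
    simp only [F]
    rw [norm_div, Complex.norm_real, Real.norm_of_nonneg hc0.le, div_le_one hc0]
    exact norm_fourierC_mul_exp_le hi hS.eq_zero (him z hz)
  have h2 : ∀ z ∈ Metric.closedBall (-(R * Complex.I)) R, ‖Q z * F z‖ ≤ K := fun z hz => by
    have : Q z * F z = q z * fourierC φ z := by
      simp only [Q, F, Complex.exp_neg]
      have := Complex.exp_ne_zero (Complex.I * S * z)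
      field_simp
    rw [this]
    exact hqK z (him z hz)
  let a : ℂ := -(n * Complex.I)
  have hac : ‖a - -(R * Complex.I)‖ = R - n := by
    have : a - -(R * Complex.I) = ((R - n : ℝ) : ℂ) * Complex.I := by
      simp only [a]
      push_cast
      ring
    rw [this, norm_mul, Complex.norm_I, mul_one, Complex.norm_real,
      Real.norm_of_nonneg (by linarith)]
  have ha : a ∈ Metric.ball (-(R * Complex.I)) R := by
    rw [mem_ball_iff_norm, hac]
    linarith
  have hFa : Real.exp (-(ε * n)) ≤ ‖F a‖ := by
    simp only [F, a]
    rw [norm_div, norm_mul, Complex.norm_real, Real.norm_of_nonneg hc0.le, le_div_iff₀ hc0,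
      Complex.norm_exp]
    have e : (-(Complex.I * S * -(n * Complex.I))).re = -(S * n) := by
      have : -(Complex.I * S * -(n * Complex.I)) = ((-(S * n) : ℝ) : ℂ) := by
        push_cast
        linear_combination ((S : ℂ) * n) * Complex.I_sq
      rw [this, Complex.ofReal_re]
    rw [e]
    calc Real.exp (-(ε * n)) * c = c * Real.exp ((S - ε) * n) * Real.exp (-(S * n)) := by
          rw [mul_assoc, ← Real.exp_add, mul_comm]
          congr 2
          ring
      _ ≤ _ := mul_le_mul_of_nonneg_right hn (Real.exp_pos _).le
  have hFa0 : F a ≠ 0 := norm_pos_iff.1 ((Real.exp_pos _).trans_le hFa)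
  have hlog : -Real.log ‖F a‖ ≤ ε * n := by
    have := Real.log_le_log (Real.exp_pos _) hFa
    rw [Real.log_exp] at this
    linarith
  have key := norm_le_of_quotient hF hQ h1 h2 ha hw hFa0
  have hw' : ‖w - -(R * Complex.I)‖ < R := by simpa [dist_eq_norm] using hw
  have hH : 0 ≤ harnackFactor (-(R * Complex.I)) R w :=
    div_nonneg (by linarith [norm_nonneg (w - -(R * Complex.I))]) (by linarith)
  have hHa : harnackFactor (-(R * Complex.I)) R a ≤ 2 * R / n := by
    unfold harnackFactor
    rw [hac]
    have e : R - (R - n) = (n : ℝ) := by ring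
    rw [e]
    gcongr
    linarith
  have hFa1 : 0 ≤ -Real.log ‖F a‖ := by
    have := Real.log_nonpos (norm_nonneg _) (h1 a (Metric.ball_subset_closedBall ha))
    linarith
  have hexp : harnackFactor (-(R * Complex.I)) R a * harnackFactor (-(R * Complex.I)) R w *
      -Real.log ‖F a‖ ≤ 2 * ε * R * harnackFactor (-(R * Complex.I)) R w := by
    calc _ = harnackFactor (-(R * Complex.I)) R a * -Real.log ‖F a‖ *
          harnackFactor (-(R * Complex.I)) R w := by ring
      _ ≤ (2 * R / n) * (ε * n) * harnackFactor (-(R * Complex.I)) R w := by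
          gcongr
      _ = _ := by field_simp
  have hQw : ‖Q w‖ = ‖q w‖ * Real.exp (-(S * w.im)) * c := by
    simp only [Q]
    rw [norm_mul, norm_mul, Complex.norm_exp, Complex.norm_real, Real.norm_of_nonneg hc0.le]
    congr 3
    simp
  rw [hQw] at key
  calc ‖q w‖ = ‖q w‖ * Real.exp (-(S * w.im)) * c * (Real.exp (S * w.im) / c) := by
        rw [Real.exp_neg]
        have := (Real.exp_pos (S * w.im)).ne'
        field_simp
    _ ≤ (K * Real.exp (2 * ε * R * harnackFactor (-(R * Complex.I)) R w)) *
          (Real.exp (S * w.im) / c) := by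
        refine mul_le_mul_of_nonneg_right (key.trans ?_) (by positivity)
        gcongr
    _ = _ := by
        rw [Real.exp_add]
        ring

theorem IsSuppTop.norm_quotient_axis_le {φ : ℝ → ℂ} {S ε r : ℝ} (h : PWFun r φ)
    (hS : IsSuppTop φ S) (hε : 0 < ε) {q : ℂ → ℂ} (hq : Differentiable ℂ q) {K : ℝ}
    (hqK : ∀ w : ℂ, w.im ≤ 0 → ‖q w * fourierC φ w‖ ≤ K) :
    ∃ n : ℕ, ∃ C : ℝ, 0 ≤ C ∧ ∀ R : ℝ, n ≤ R → 0 < R →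
      ‖q (-(R * Complex.I))‖ ≤ C * Real.exp (-((S - ε) * R)) := by
  obtain ⟨n, C, hC, H⟩ := hS.norm_quotient_le h (half_pos hε) hq hqK
  refine ⟨n, C, hC, fun R hR hR0 => ?_⟩
  refine (H R hR _ (Metric.mem_ball_self hR0)).trans (le_of_eq ?_)
  have : harnackFactor (-(R * Complex.I)) R (-(R * Complex.I)) = 1 := by
    unfold harnackFactor
    rw [sub_self, norm_zero, add_zero, sub_zero, div_self hR0.ne']
  rw [this]
  congr 2
  simp
  ring

theorem IsSuppTop.norm_quotient_ray_le {φ : ℝ → ℂ} {S r : ℝ} (h : PWFun r φ)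
    (hS : IsSuppTop φ S) (hS0 : 0 < S) {q : ℂ → ℂ} (hq : Differentiable ℂ q) {K : ℝ}
    (hqK : ∀ w : ℂ, w.im ≤ 0 → ‖q w * fourierC φ w‖ ≤ K) {ω : ℂ}
    (h1 : ω.re ^ 2 = 1 / 2) (h2 : ω.im ^ 2 = 1 / 2) (h3 : ω.im < 0) :
    ∃ C : ℝ, ∀ ρ : ℝ, 0 ≤ ρ → ‖q (ρ * ω)‖ ≤ C := by
  obtain ⟨n, C, hC, H⟩ := hS.norm_quotient_le (ε := S / 36) h (by positivity) hq hqK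
  have hcont : Continuous fun ρ : ℝ => q (ρ * ω) := hq.continuous.comp (by fun_prop)
  obtain ⟨C', hC'⟩ := (isCompact_Icc (a := (0 : ℝ)) (b := max n 1)).exists_bound_of_continuousOn
    hcont.continuousOn
  refine ⟨max C C', fun ρ hρ => ?_⟩
  rcases le_or_gt ρ (max n 1) with hle | hgt
  · exact (hC' ρ ⟨hρ, hle⟩).trans (le_max_right _ _)
  · have hρn : (n : ℝ) ≤ ρ := (le_max_left _ _).trans hgt.le
    have hρ0 : 0 < ρ := one_pos.trans_le ((le_max_right _ _).trans hgt.le)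
    have him : ω.im ≤ -(7 / 10) := by nlinarith
    have hnorm : ‖ρ * ω - -(ρ * Complex.I)‖ ≤ 4 / 5 * ρ := by
      have e : (ρ : ℂ) * ω - -(ρ * Complex.I) = ρ * (ω + Complex.I) := by ring
      rw [e, norm_mul, Complex.norm_real, Real.norm_of_nonneg hρ, mul_comm]
      refine mul_le_mul_of_nonneg_right ?_ hρ
      refine abs_le_of_sq_le_sq' ?_ (by norm_num) |>.2
      rw [← Complex.normSq_eq_norm_sq, Complex.normSq_apply]
      simp
      nlinarith
    have hmem : (ρ : ℂ) * ω ∈ Metric.ball (-(ρ * Complex.I)) ρ := by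
      rw [mem_ball_iff_norm]
      linarith
    refine (H ρ hρn _ hmem).trans (le_trans ?_ (le_max_left _ _))
    refine mul_le_of_le_one_right hC (Real.exp_le_one_iff.2 ?_)
    have hH : harnackFactor (-(ρ * Complex.I)) ρ (ρ * ω) ≤ 9 := by
      unfold harnackFactor
      rw [div_le_iff₀ (by linarith)]
      linarith
    have e2 : ((ρ : ℂ) * ω).im = ρ * ω.im := by simp
    rw [e2]
    have h4 : 2 * (S / 36) * ρ * harnackFactor (-(ρ * Complex.I)) ρ (ρ * ω)
        ≤ 2 * (S / 36) * ρ * 9 := by gcongr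
    have h5 : S * (ρ * ω.im) ≤ S * (ρ * (-(7 / 10))) := by gcongr
    nlinarith [mul_pos hS0 hρ0]


theorem PWFun.exists_isSuppTop {r s : ℝ} {φ : ℝ → ℂ} (h : PWFun r φ)
    (hs : ¬ ∀ᵐ t : ℝ, s < t → φ t = 0) :
    ∃ (S : ℝ) (φ' : ℝ → ℂ), s ≤ S ∧ PWFun r φ' ∧ φ' =ᵐ[volume] φ ∧ IsSuppTop φ' S := by
  let A : Set ℝ := {x | ¬ ∀ᵐ t : ℝ, x < t → φ t = 0}
  have hA : BddAbove A := ⟨r, fun x hx => by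
    by_contra hxr
    rw [not_le] at hxr
    exact hx (Eventually.of_forall fun t ht => h.supp t fun h' => by linarith [h'.2])⟩
  set S := sSup A with hS
  have hae : ∀ᵐ t : ℝ, S < t → φ t = 0 := by
    have h1 : ∀ n : ℕ, ∀ᵐ t : ℝ, S + 1 / ((n : ℝ) + 1) < t → φ t = 0 := fun n => by
      by_contra hn
      have : 0 < 1 / ((n : ℝ) + 1) := by positivity
      linarith [le_csSup hA hn]
    filter_upwards [ae_all_iff.2 h1] with t ht hSt
    obtain ⟨n, hn⟩ := exists_nat_one_div_lt (sub_pos.2 hSt)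
    exact ht n (by linarith)
  have he : (Set.Iic S).indicator φ =ᵐ[volume] φ := by
    filter_upwards [hae] with t ht
    by_cases h' : t ∈ Set.Iic S
    · simp [h']
    · rw [Set.indicator_of_notMem h', ht (by simpa using h')]
  refine ⟨S, (Set.Iic S).indicator φ, le_csSup hA hs, ⟨h.memLp.indicator measurableSet_Iic,
    fun t ht => ?_⟩, he, fun t ht => Set.indicator_of_notMem (by simpa using ht) _,
    fun ε hε hcon => ?_⟩
  · simp [Set.indicator_apply, h.supp t ht]
  · obtain ⟨x, hx, hx'⟩ := exists_lt_of_lt_csSup ⟨s, hs⟩ (show S - ε < sSup A by linarith)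
    refine hx ?_
    filter_upwards [hcon, he] with t ht het hxt
    rw [← het]
    exact ht (by linarith)

/-- The sign with which the point `u` enters the integral from `0` to `τ`. -/
noncomputable def pathSign (u τ : ℝ) : ℂ := (if 0 < u then 1 else 0) - if τ < u then 1 else 0

theorem norm_pathSign_le (u τ : ℝ) : ‖pathSign u τ‖ ≤ 1 := by
  unfold pathSign
  split_ifs <;> simp

theorem pathSign_eq_zero {u τ : ℝ} (h : |τ| < |u|) : pathSign u τ = 0 := by
  unfold pathSign
  rcases le_or_gt u 0 with hu | hu
  · rw [if_neg hu.not_gt, if_neg, sub_zero]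
    rw [abs_of_nonpos hu] at h
    have := (abs_lt.1 h).1
    linarith
  · rw [if_pos hu, if_pos, sub_self]
    rw [abs_of_pos hu] at h
    exact (abs_lt.1 h).2

theorem measurable_pathSign : Measurable fun p : ℝ × ℝ => pathSign p.1 p.2 := by
  unfold pathSign
  refine Measurable.sub ?_ ?_
  · exact Measurable.ite (measurableSet_lt measurable_const measurable_fst) measurable_const
      measurable_const
  · exact Measurable.ite (measurableSet_lt measurable_snd measurable_fst) measurable_const
      measurable_const

theorem integral_pathSign_mul (τ : ℝ) (h : ℝ → ℂ) :
    ∫ u, pathSign u τ * h u = ∫ u in (0 : ℝ)..τ, h u := by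
  rcases le_or_gt 0 τ with hτ | hτ
  · rw [intervalIntegral.integral_of_le hτ, ← integral_indicator measurableSet_Ioc]
    congr 1
    ext u
    simp only [pathSign, Set.indicator_apply, Set.mem_Ioc]
    by_cases h1 : 0 < u <;> by_cases h2 : τ < u
    · simp [h1, h2, not_le.2 h2]
    · simp [h1, h2, not_lt.1 h2]
    · exact absurd (hτ.trans_lt h2) h1
    · simp [h1, h2]
  · rw [intervalIntegral.integral_of_ge hτ.le, ← integral_indicator measurableSet_Ioc,
      ← integral_neg]
    congr 1
    ext u
    simp only [pathSign, Set.indicator_apply, Set.mem_Ioc]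
    by_cases h1 : 0 < u <;> by_cases h2 : τ < u
    · simp [h1, h2, not_le.2 h1]
    · exact absurd (hτ.trans h1) h2
    · simp [h1, h2, not_lt.1 h1]
    · simp [h1, h2]

/-- The density of `(f(z) - f(w)) / (z - w)` when `f` has density `φ`. -/
noncomputable def diffQuot (φ : ℝ → ℂ) (w : ℂ) (u : ℝ) : ℂ :=
  Complex.I * ∫ τ, φ τ * pathSign u τ * Complex.exp (Complex.I * w * ((τ - u : ℝ) : ℂ))

theorem aestronglyMeasurable_pathSign_mul {φ : ℝ → ℂ} (hφ : AEStronglyMeasurable φ volume) (w : ℂ) :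
    AEStronglyMeasurable (fun p : ℝ × ℝ => φ p.2 * pathSign p.1 p.2 *
      Complex.exp (Complex.I * w * ((p.2 - p.1 : ℝ) : ℂ))) (volume.prod volume) :=
  (hφ.comp_snd.mul measurable_pathSign.aestronglyMeasurable).mul
    (Continuous.aestronglyMeasurable (by fun_prop))

theorem norm_pathSign_mul_le {r : ℝ} {φ : ℝ → ℂ} (h : PWFun r φ) (w : ℂ) (u τ : ℝ) :
    ‖φ τ * pathSign u τ * Complex.exp (Complex.I * w * ((τ - u : ℝ) : ℂ))‖
      ≤ (Set.Icc (-r) r).indicator (fun _ => Real.exp (‖w‖ * (2 * r))) u * ‖φ τ‖ := by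
  by_cases hz : φ τ * pathSign u τ = 0
  · rw [hz, zero_mul, norm_zero]
    exact mul_nonneg (Set.indicator_nonneg (fun _ _ => (Real.exp_pos _).le) _) (norm_nonneg _)
  · have hτ : |τ| ≤ r := not_lt.1 fun h' => hz (by rw [h.supp' τ h', zero_mul])
    have hu : |u| ≤ |τ| := not_lt.1 fun h' => hz (by rw [pathSign_eq_zero h', mul_zero])
    have hur := hu.trans hτ
    rw [Set.indicator_of_mem (Set.mem_Icc.2 (abs_le.1 hur)), norm_mul, norm_mul, mul_comm]
    refine mul_le_mul (norm_exp_I_mul_le ?_) (mul_le_of_le_one_right (norm_nonneg _)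
      (norm_pathSign_le u τ)) (by positivity) (Real.exp_pos _).le
    calc |τ - u| ≤ |τ| + |u| := abs_sub _ _
      _ ≤ 2 * r := by linarith

theorem integrable_indicator_Icc_const (a b c : ℝ) :
    Integrable ((Set.Icc a b).indicator fun _ => c) :=
  (integrable_indicator_iff measurableSet_Icc).2 (integrableOn_const (by simp))

theorem PWFun.diffQuot {r : ℝ} {φ : ℝ → ℂ} (h : PWFun r φ) (w : ℂ) :
    PWFun r (diffQuot φ w) := by
  have hsupp : ∀ t ∉ Set.Ioo (-r) r, ScrewPW.diffQuot φ w t = 0 := fun u hu => by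
    unfold ScrewPW.diffQuot
    rw [show (fun τ => φ τ * pathSign u τ * Complex.exp (Complex.I * w * ((τ - u : ℝ) : ℂ)))
      = fun _ => 0 from funext fun τ => ?_]
    · simp
    · by_cases hτ : τ ∈ Set.Ioo (-r) r
      · rw [pathSign_eq_zero, mul_zero, zero_mul]
        refine (abs_lt.2 hτ).trans_le ?_
        by_contra hcon
        exact hu (abs_lt.1 (not_le.1 hcon))
      · rw [h.supp τ hτ, zero_mul, zero_mul]
  refine ⟨?_, hsupp⟩
  have hm : AEStronglyMeasurable (ScrewPW.diffQuot φ w) volume :=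
    (aestronglyMeasurable_pathSign_mul h.memLp.1 w).integral_prod_right'.const_mul _
  have : ScrewPW.diffQuot φ w = (Set.Icc (-r) r).indicator (ScrewPW.diffQuot φ w) := by
    ext t
    by_cases ht : t ∈ Set.Icc (-r) r
    · simp [ht]
    · rw [Set.indicator_of_notMem ht, hsupp t fun h' => ht (Set.Ioo_subset_Icc_self h')]
  rw [this, memLp_indicator_iff_restrict measurableSet_Icc]
  refine MemLp.of_bound hm.restrict (Real.exp (‖w‖ * (2 * r)) * ∫ τ, ‖φ τ‖) ?_
  rw [ae_restrict_iff' measurableSet_Icc]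
  refine Eventually.of_forall fun u hu => ?_
  unfold ScrewPW.diffQuot
  rw [norm_mul, Complex.norm_I, one_mul, ← integral_const_mul]
  refine norm_integral_le_of_norm_le (h.integrable.norm.const_mul _)
    (Eventually.of_forall fun τ => ?_)
  have := norm_pathSign_mul_le h w u τ
  rwa [Set.indicator_of_mem hu] at this

theorem integral_exp_path (z w : ℂ) (h : z ≠ w) (τ : ℝ) :
    ∫ u in (0 : ℝ)..τ, Complex.exp (Complex.I * w * ((τ - u : ℝ) : ℂ)) *
      Complex.exp (Complex.I * z * u)
      = (Complex.exp (Complex.I * z * τ) - Complex.exp (Complex.I * w * τ)) /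
        (Complex.I * (z - w)) := by
  have e : ∀ u : ℝ, Complex.exp (Complex.I * w * ((τ - u : ℝ) : ℂ)) *
      Complex.exp (Complex.I * z * u) =
      Complex.exp (Complex.I * w * τ) * Complex.exp (Complex.I * (z - w) * u) := fun u => by
    rw [← Complex.exp_add, ← Complex.exp_add]
    congr 1
    push_cast
    ring
  have h' : Complex.I * (z - w) ≠ 0 := mul_ne_zero Complex.I_ne_zero (sub_ne_zero.2 h)
  simp only [e]
  rw [intervalIntegral.integral_const_mul, integral_exp_mul_complex h']
  rw [mul_div_assoc', mul_sub, ← Complex.exp_add, ← Complex.exp_add]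
  simp only [Complex.ofReal_zero, mul_zero, add_zero]
  congr 3
  ring

theorem fourierC_diffQuot {r : ℝ} {φ : ℝ → ℂ} (h : PWFun r φ) {z w : ℂ}
    (hzw : z ≠ w) :
    fourierC (diffQuot φ w) z = (fourierC φ z - fourierC φ w) / (z - w) := by
  have hint : Integrable (fun p : ℝ × ℝ => (φ p.2 * pathSign p.1 p.2 *
      Complex.exp (Complex.I * w * ((p.2 - p.1 : ℝ) : ℂ))) * Complex.exp (Complex.I * z * p.1))
      (volume.prod volume) := by
    refine ((((integrable_indicator_Icc_const (-r) r (Real.exp (‖w‖ * (2 * r)))).mul_prod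
      h.integrable.norm)).mul_const (Real.exp (‖z‖ * r))).mono' ?_ (Eventually.of_forall fun p => ?_)
    · exact (aestronglyMeasurable_pathSign_mul h.memLp.1 w).mul
        (Continuous.aestronglyMeasurable (by fun_prop))
    · rw [norm_mul]
      have h1 := norm_pathSign_mul_le h w p.1 p.2
      by_cases hp : p.1 ∈ Set.Icc (-r) r
      · exact mul_le_mul h1 (norm_exp_I_mul_le (abs_le.2 hp)) (norm_nonneg _)
          ((norm_nonneg _).trans h1)
      · rw [Set.indicator_of_notMem hp, zero_mul] at h1
        rw [le_antisymm h1 (norm_nonneg _), Set.indicator_of_notMem hp]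
        simp
  have e1 : fourierC (diffQuot φ w) z = Complex.I * ∫ u, ∫ τ, (φ τ * pathSign u τ *
      Complex.exp (Complex.I * w * ((τ - u : ℝ) : ℂ))) * Complex.exp (Complex.I * z * u) := by
    unfold fourierC diffQuot
    rw [← integral_const_mul]
    congr 1
    ext u
    rw [mul_assoc, ← integral_mul_const]
  rw [e1, integral_integral_swap hint]
  have e2 : ∀ τ, ∫ u, (φ τ * pathSign u τ *
      Complex.exp (Complex.I * w * ((τ - u : ℝ) : ℂ))) * Complex.exp (Complex.I * z * u)
      = (Complex.I * (z - w))⁻¹ * (φ τ * Complex.exp (Complex.I * z * τ) -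
        φ τ * Complex.exp (Complex.I * w * τ)) := fun τ => by
    have : ∀ u : ℝ, (φ τ * pathSign u τ * Complex.exp (Complex.I * w * ((τ - u : ℝ) : ℂ))) *
        Complex.exp (Complex.I * z * u) = φ τ * (pathSign u τ *
        (Complex.exp (Complex.I * w * ((τ - u : ℝ) : ℂ)) * Complex.exp (Complex.I * z * u))) :=
      fun u => by ring
    simp only [this]
    rw [integral_const_mul, integral_pathSign_mul, integral_exp_path z w hzw]
    ring
  simp only [e2]
  rw [integral_const_mul, integral_sub (integrable_mul_exp_of_support h.integrable h.supp' z)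
    (integrable_mul_exp_of_support h.integrable h.supp' w)]
  have h' : z - w ≠ 0 := sub_ne_zero.2 hzw
  have := Complex.I_ne_zero
  unfold fourierC
  field_simp


/-- The Laplace type transform of a function of two variables along `τ - u`. -/
noncomputable def pairTransform (k : ℝ × ℝ → ℂ) (w : ℂ) : ℂ :=
  ∫ p : ℝ × ℝ, k p * Complex.exp (Complex.I * w * ((p.2 - p.1 : ℝ) : ℂ))

/-- The pairing of `χ` with the difference quotients of `φ`. -/
noncomputable def starFn (χ φ : ℝ → ℂ) (w : ℂ) : ℂ := ∫ u, χ u * diffQuot φ w u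

/-- `χ(u) φ(τ)` restricted to a measurable set. -/
noncomputable def pairOn (s : Set (ℝ × ℝ)) (χ φ : ℝ → ℂ) : ℝ × ℝ → ℂ :=
  s.indicator fun p => χ p.1 * φ p.2

section
variable {r : ℝ} {χ φ : ℝ → ℂ}

theorem integrable_pairOn (hχ : PWFun r χ) (hφ : PWFun r φ) {s : Set (ℝ × ℝ)}
    (hs : MeasurableSet s) : Integrable (pairOn s χ φ) :=
  (hχ.integrable.mul_prod hφ.integrable).indicator hs

theorem abs_sub_le_of_pairOn_ne_zero (hχ : PWFun r χ) (hφ : PWFun r φ) {s : Set (ℝ × ℝ)}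
    (p : ℝ × ℝ) (hp : pairOn s χ φ p ≠ 0) : |p.2 - p.1| ≤ 2 * r := by
  have h1 : χ p.1 * φ p.2 ≠ 0 := fun h => hp (by simp [pairOn, h])
  have h2 : |p.1| ≤ r := not_lt.1 fun h' => h1 (by rw [hχ.supp' _ h', zero_mul])
  have h3 : |p.2| ≤ r := not_lt.1 fun h' => h1 (by rw [hφ.supp' _ h', mul_zero])
  have := abs_sub p.2 p.1
  linarith

theorem differentiable_pairTransform (hχ : PWFun r χ) (hφ : PWFun r φ) {s : Set (ℝ × ℝ)}
    (hs : MeasurableSet s) : Differentiable ℂ (pairTransform (pairOn s χ φ)) :=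
  differentiable_integral_mul_cexp (l := fun p : ℝ × ℝ => p.2 - p.1) (integrable_pairOn hχ hφ hs)
    (Continuous.aestronglyMeasurable (by fun_prop)) (abs_sub_le_of_pairOn_ne_zero hχ hφ)

theorem integrable_pairOn_mul_exp (hχ : PWFun r χ) (hφ : PWFun r φ) {s : Set (ℝ × ℝ)}
    (hs : MeasurableSet s) (w : ℂ) : Integrable fun p : ℝ × ℝ =>
      pairOn s χ φ p * Complex.exp (Complex.I * w * ((p.2 - p.1 : ℝ) : ℂ)) :=
  integrable_mul_cexp (l := fun p : ℝ × ℝ => p.2 - p.1) (integrable_pairOn hχ hφ hs)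
    (Continuous.aestronglyMeasurable (by fun_prop)) (abs_sub_le_of_pairOn_ne_zero hχ hφ) w

theorem norm_pairTransform_le (hχ : PWFun r χ) (hφ : PWFun r φ) {s : Set (ℝ × ℝ)}
    (hs : MeasurableSet s) {w : ℂ} (hw : ∀ p ∈ s, 0 ≤ w.im * (p.2 - p.1)) :
    ‖pairTransform (pairOn s χ φ) w‖ ≤ ∫ p, ‖pairOn s χ φ p‖ := by
  refine norm_integral_le_of_norm_le (integrable_pairOn hχ hφ hs).norm
    (Eventually.of_forall fun p => ?_)
  rw [norm_mul, Complex.norm_exp]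
  by_cases hp : p ∈ s
  · refine mul_le_of_le_one_right (norm_nonneg _) (Real.exp_le_one_iff.2 ?_)
    have : (Complex.I * w * ((p.2 - p.1 : ℝ) : ℂ)).re = -(w.im * (p.2 - p.1)) := by
      rw [Complex.re_mul_ofReal]
      simp
    rw [this]
    linarith [hw p hp]
  · simp [pairOn, hp]

theorem pairTransform_prod {u v : ℝ → ℂ} (w : ℂ) :
    pairTransform (fun p => u p.1 * v p.2) w = fourierC u (-w) * fourierC v w := by
  unfold pairTransform fourierC
  rw [← integral_prod_mul]
  congr 1
  ext p
  rw [mul_mul_mul_comm, ← Complex.exp_add]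
  congr 2
  push_cast
  ring

/-- The set of pairs `(u, τ)` with `τ < u`. -/
def lowerPairs : Set (ℝ × ℝ) := {p | p.2 < p.1}

theorem measurableSet_lowerPairs : MeasurableSet lowerPairs :=
  measurableSet_lt measurable_snd measurable_fst

theorem PWFun.indicator (h : PWFun r χ) {s : Set ℝ} (hs : MeasurableSet s) :
    PWFun r (s.indicator χ) :=
  ⟨h.memLp.indicator hs, fun t ht => by simp [h.supp t ht]⟩

theorem starFn_eq_pairTransform (hχ : PWFun r χ) (hφ : PWFun r φ) (w : ℂ) :
    starFn χ φ w = Complex.I *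
      (pairTransform (fun p => (Set.Ioi 0).indicator χ p.1 * φ p.2) w
        - pairTransform (pairOn lowerPairs χ φ) w) := by
  have i2 := integrable_pairOn_mul_exp hχ hφ measurableSet_lowerPairs w
  have i1 : Integrable fun p : ℝ × ℝ => ((Set.Ioi 0).indicator χ p.1 * φ p.2) *
      Complex.exp (Complex.I * w * ((p.2 - p.1 : ℝ) : ℂ)) := by
    refine (integrable_pairOn_mul_exp (hχ.indicator (s := Set.Ioi 0) measurableSet_Ioi) hφ MeasurableSet.univ
      w).congr (Eventually.of_forall fun p => ?_)
    simp [pairOn]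
  unfold pairTransform
  rw [← integral_sub i1 i2]
  have e : ∀ p : ℝ × ℝ, ((Set.Ioi 0).indicator χ p.1 * φ p.2) *
        Complex.exp (Complex.I * w * ((p.2 - p.1 : ℝ) : ℂ)) -
      pairOn lowerPairs χ φ p * Complex.exp (Complex.I * w * ((p.2 - p.1 : ℝ) : ℂ))
      = χ p.1 * (φ p.2 * pathSign p.1 p.2 *
        Complex.exp (Complex.I * w * ((p.2 - p.1 : ℝ) : ℂ))) := fun p => by
    unfold pairOn lowerPairs pathSign
    simp only [Set.indicator_apply, Set.mem_Ioi, Set.mem_ofPred_eq]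
    split_ifs <;> ring
  have i3 := i1.sub i2
  have i4 : Integrable (fun p : ℝ × ℝ => χ p.1 * (φ p.2 * pathSign p.1 p.2 *
        Complex.exp (Complex.I * w * ((p.2 - p.1 : ℝ) : ℂ)))) :=
    i3.congr (Eventually.of_forall e)
  simp only [e]
  rw [show (volume : Measure (ℝ × ℝ)) = volume.prod volume from rfl, integral_prod _ i4,
    ← integral_const_mul]
  unfold starFn diffQuot
  congr 1
  ext u
  simp only
  rw [integral_const_mul]
  ring

theorem starFn_eq_lower (hχ : PWFun r χ) (hφ : PWFun r φ) (w : ℂ) :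
    starFn χ φ w = Complex.I * (fourierC ((Set.Ioi 0).indicator χ) (-w) * fourierC φ w
        - pairTransform (pairOn lowerPairs χ φ) w) := by
  rw [starFn_eq_pairTransform hχ hφ, pairTransform_prod]

theorem starFn_eq_upper (hχ : PWFun r χ) (hφ : PWFun r φ) (w : ℂ) :
    starFn χ φ w = Complex.I * (pairTransform (pairOn lowerPairsᶜ χ φ) w
      - fourierC ((Set.Iic 0).indicator χ) (-w) * fourierC φ w) := by
  rw [starFn_eq_lower hχ hφ]
  congr 1
  have e1 : fourierC ((Set.Ioi 0).indicator χ) (-w) + fourierC ((Set.Iic 0).indicator χ) (-w)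
      = fourierC χ (-w) := by
    have h1 := hχ.indicator (s := Set.Ioi 0) measurableSet_Ioi
    have h2 := hχ.indicator (s := Set.Iic 0) measurableSet_Iic
    rw [← fourierC_add h1.integrable h2.integrable h1.supp' h2.supp']
    congr 1
    ext t
    by_cases ht : 0 < t <;> simp [ht, not_le.2, not_lt.1]
  have e2 : pairTransform (pairOn lowerPairs χ φ) w + pairTransform (pairOn lowerPairsᶜ χ φ) w
      = fourierC χ (-w) * fourierC φ w := by
    rw [← pairTransform_prod]
    unfold pairTransform
    rw [← integral_add (integrable_pairOn_mul_exp hχ hφ measurableSet_lowerPairs w)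
      (integrable_pairOn_mul_exp hχ hφ measurableSet_lowerPairs.compl w)]
    congr 1
    ext p
    rw [← add_mul]
    congr 1
    exact congrFun (Set.indicator_self_add_compl lowerPairs fun p : ℝ × ℝ => χ p.1 * φ p.2) p
  rw [← e1, add_mul] at e2
  linear_combination -e2

theorem differentiable_starFn (hχ : PWFun r χ) (hφ : PWFun r φ) :
    Differentiable ℂ (starFn χ φ) := by
  rw [funext (starFn_eq_lower hχ hφ)]
  have h1 := differentiable_pairTransform hχ hφ measurableSet_lowerPairs
  have h2 := (hχ.indicator (s := Set.Ioi 0) measurableSet_Ioi).differentiable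
  have h3 := hφ.differentiable
  have h4 : Differentiable ℂ fun w => fourierC ((Set.Ioi 0).indicator χ) (-w) :=
    h2.comp differentiable_neg
  fun_prop

theorem norm_fourierC_le (hφ : PWFun r φ) (w : ℂ) :
    ‖fourierC φ w‖ ≤ (∫ t, ‖φ t‖) * Real.exp (‖w‖ * r) :=
  norm_integral_mul_cexp_le (l := fun t : ℝ => t) hφ.integrable
    (fun t ht => not_lt.1 fun h' => ht (hφ.supp' t h')) w

theorem norm_starFn_le (hχ : PWFun r χ) (hφ : PWFun r φ) :
    ∃ B : ℝ, 0 ≤ B ∧ ∀ w, ‖starFn χ φ w‖ ≤ B * Real.exp (‖w‖ * (2 * r)) := by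
  have h1 := hχ.indicator (s := Set.Ioi 0) measurableSet_Ioi
  refine ⟨(∫ t, ‖(Set.Ioi 0).indicator χ t‖) * (∫ t, ‖φ t‖) +
    ∫ p, ‖pairOn lowerPairs χ φ p‖, by positivity, fun w => ?_⟩
  rw [starFn_eq_lower hχ hφ, norm_mul, Complex.norm_I, one_mul, add_mul]
  refine (norm_sub_le _ _).trans (add_le_add ?_ ?_)
  · rw [norm_mul]
    have h2 := norm_fourierC_le h1 (-w)
    have h3 := norm_fourierC_le hφ w
    rw [norm_neg] at h2
    calc _ ≤ ((∫ t, ‖(Set.Ioi 0).indicator χ t‖) * Real.exp (‖w‖ * r)) *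
          ((∫ t, ‖φ t‖) * Real.exp (‖w‖ * r)) := mul_le_mul h2 h3 (norm_nonneg _) (by positivity)
      _ = _ := by
        rw [mul_mul_mul_comm, ← Real.exp_add]
        congr 2
        ring
  · exact norm_integral_mul_cexp_le (l := fun p : ℝ × ℝ => p.2 - p.1)
      (integrable_pairOn hχ hφ measurableSet_lowerPairs) (abs_sub_le_of_pairOn_ne_zero hχ hφ) w

end

/-- A space of Fourier transforms of functions on `(-r, r)` that is closed under division by zeros
and under `F ↦ F♯`. -/
structure IsDivisionClosed (r : ℝ) (V : Submodule ℂ (ℂ → ℂ)) : Prop where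
  pw : ∀ f ∈ V, ∃ φ, PWFun r φ ∧ f = fourierC φ
  ne : ∃ f ∈ V, f ≠ 0
  div : ∀ f ∈ V, ∀ w, f w = 0 → dslope f w ∈ V
  sharp : ∀ f ∈ V, sharp f ∈ V

/-- `χ` annihilates the densities of the elements of `V`. -/
def Annihilates (r : ℝ) (V : Submodule ℂ (ℂ → ℂ)) (χ : ℝ → ℂ) : Prop :=
  ∀ φ, PWFun r φ → fourierC φ ∈ V → ∫ t, χ t * φ t = 0

theorem IsDivisionClosed.differentiable {r : ℝ} {V : Submodule ℂ (ℂ → ℂ)}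
    (hV : IsDivisionClosed r V) {f : ℂ → ℂ} (hf : f ∈ V) : Differentiable ℂ f := by
  obtain ⟨φ, h1, rfl⟩ := hV.pw f hf
  exact h1.differentiable

theorem starFn_symm {r : ℝ} {V : Submodule ℂ (ℂ → ℂ)} (hV : IsDivisionClosed r V) {χ : ℝ → ℂ}
    (hχ : PWFun r χ) (ho : Annihilates r V χ) {φ γ : ℝ → ℂ} (hφ : PWFun r φ) (hγ : PWFun r γ)
    (hf : fourierC φ ∈ V) (hg : fourierC γ ∈ V) (w : ℂ) :
    starFn χ φ w * fourierC γ w = starFn χ γ w * fourierC φ w := by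
  let a := fourierC γ w
  let b := fourierC φ w
  let h : ℂ → ℂ := a • fourierC φ - b • fourierC γ
  have hh : h ∈ V := V.sub_mem (V.smul_mem _ hf) (V.smul_mem _ hg)
  have hhw : h w = 0 := by simp [h, a, b, mul_comm]
  have hd := hV.div h hh w hhw
  have q1 := hφ.diffQuot w
  have q2 := hγ.diffQuot w
  let η : ℝ → ℂ := fun t => a * diffQuot φ w t + -b * diffQuot γ w t
  have hη : PWFun r η := ⟨(q1.memLp.const_mul a).add (q2.memLp.const_mul (-b)), fun t ht => by
    simp [η, q1.supp t ht, q2.supp t ht]⟩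
  have key : fourierC η = dslope h w := by
    have hne : ∀ z, z ≠ w → fourierC η z = dslope h w z := fun z hz => by
      rw [dslope_of_ne _ hz, slope_def_field, hhw, sub_zero]
      simp only [η]
      rw [fourierC_add (R := r) (q1.integrable.const_mul a) (q2.integrable.const_mul (-b))
        (fun t ht => by rw [q1.supp' t ht, mul_zero]) (fun t ht => by rw [q2.supp' t ht, mul_zero]),
        fourierC_const_mul, fourierC_const_mul, fourierC_diffQuot hφ hz, fourierC_diffQuot hγ hz]
      have : z - w ≠ 0 := sub_ne_zero.2 hz
      simp only [h, Pi.sub_apply, Pi.smul_apply, smul_eq_mul]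
      simp only [a, b]
      field_simp
      ring
    have hc1 : Continuous (fourierC η) := hη.differentiable.continuous
    have hc2 : Continuous (dslope h w) := (hV.differentiable hd).continuous
    exact Continuous.ext_on (dense_compl_singleton w) hc1 hc2 fun z hz => hne z hz
  have h0 := ho η hη (key ▸ hd)
  have i1 : Integrable fun t => χ t * diffQuot φ w t := hχ.memLp.integrable_mul q1.memLp
  have i2 : Integrable fun t => χ t * diffQuot γ w t := hχ.memLp.integrable_mul q2.memLp
  have e : ∫ t, χ t * η t = a * starFn χ φ w - b * starFn χ γ w := by
    unfold starFn
    rw [← integral_const_mul, ← integral_const_mul, ← integral_sub (i1.const_mul a) (i2.const_mul b)]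
    congr 1
    ext t
    simp only [η]
    ring
  rw [e] at h0
  linear_combination h0

theorem IsDivisionClosed.exists_ne_zero {r : ℝ} {V : Submodule ℂ (ℂ → ℂ)}
    (hV : IsDivisionClosed r V) (w : ℂ) : ∃ f ∈ V, f w ≠ 0 := by
  by_contra! hcon
  obtain ⟨f, hf, hf0⟩ := hV.ne
  have hn : ∀ n : ℕ, ∃ g ∈ V, ∀ z, f z = (z - w) ^ n * g z := fun n => by
    induction n with
    | zero => exact ⟨f, hf, fun z => by simp⟩
    | succ n ih =>
      obtain ⟨g, hg, h⟩ := ih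
      refine ⟨dslope g w, hV.div g hg w (hcon g hg), fun z => ?_⟩
      have := sub_smul_dslope g w z
      rw [hcon g hg, sub_zero, smul_eq_mul] at this
      rw [h z, pow_succ, mul_assoc, this]
  have hfa : AnalyticAt ℂ f w := (hV.differentiable hf).analyticAt w
  have htop : analyticOrderAt f w = ⊤ := by
    rw [ENat.eq_top_iff_forall_ge]
    intro n
    rw [natCast_le_analyticOrderAt hfa]
    obtain ⟨g, hg, h⟩ := hn n
    exact ⟨g, (hV.differentiable hg).analyticAt w, Eventually.of_forall fun z => by
      rw [smul_eq_mul, h z]⟩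
  rw [analyticOrderAt_eq_top] at htop
  refine hf0 (((hV.differentiable hf).differentiableOn.analyticOnNhd
    isOpen_univ).eq_of_eventuallyEq (fun z _ => analyticAt_const) (z₀ := w) ?_)
  filter_upwards [htop] with z hz
  simpa using hz


/-- An entire function of exponential type that is bounded on two perpendicular lines is
constant. -/
theorem eq_of_bounded_on_lines {m : ℂ → ℂ} (hm : Differentiable ℂ m) {A B C : ℝ}
    (hexp : ∀ w, ‖m w‖ ≤ A * Real.exp (B * ‖w‖)) {ω : ℂ} (hω : ‖ω‖ = 1)
    (h1 : ∀ ρ : ℝ, ‖m (ρ * ω)‖ ≤ C) (h2 : ∀ ρ : ℝ, ‖m (ρ * (Complex.I * ω))‖ ≤ C) (z w : ℂ) :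
    m z = m w := by
  have hω0 : ω ≠ 0 := norm_ne_zero_iff.1 (by rw [hω]; exact one_ne_zero)
  let k : ℂ → ℂ := fun z => m (z * ω)
  have hk : Differentiable ℂ k := hm.comp (differentiable_id.mul_const ω)
  have hB : ∀ s : Set ℂ, ∃ c < (2 : ℝ), ∃ B,
      k =O[Bornology.cobounded ℂ ⊓ 𝓟 s] fun z => Real.exp (B * ‖z‖ ^ c) := fun s => by
    refine ⟨1, by norm_num, B, Asymptotics.IsBigO.of_bound A (Eventually.of_forall fun z => ?_)⟩
    rw [Real.rpow_one, Real.norm_of_nonneg (Real.exp_pos _).le]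
    have := hexp (z * ω)
    rwa [norm_mul, hω, mul_one] at this
  have hre : ∀ x : ℝ, ‖k x‖ ≤ C := h1
  have him : ∀ x : ℝ, ‖k (x * Complex.I)‖ ≤ C := fun x => by
    simp only [k]
    rw [mul_assoc]
    exact h2 x
  have hbound : ∀ z, ‖k z‖ ≤ C := fun z => by
    rcases le_total 0 z.re with hr | hr <;> rcases le_total 0 z.im with hi | hi
    · exact PhragmenLindelof.quadrant_I hk.diffContOnCl (hB _) (fun x _ => hre x)
        (fun x _ => him x) hr hi
    · exact PhragmenLindelof.quadrant_IV hk.diffContOnCl (hB _) (fun x _ => hre x)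
        (fun x _ => him x) hr hi
    · exact PhragmenLindelof.quadrant_II hk.diffContOnCl (hB _) (fun x _ => hre x)
        (fun x _ => him x) hr hi
    · exact PhragmenLindelof.quadrant_III hk.diffContOnCl (hB _) (fun x _ => hre x)
        (fun x _ => him x) hr hi
  have hb : Bornology.IsBounded (Set.range k) :=
    isBounded_iff_forall_norm_le.2 ⟨C, by rintro _ ⟨z, rfl⟩; exact hbound z⟩
  have := hk.apply_eq_apply_of_bounded hb (z / ω) (w / ω)
  simpa [k, hω0] using this

theorem exists_multiplier {r : ℝ} (hr : 0 < r) {V : Submodule ℂ (ℂ → ℂ)}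
    (hV : IsDivisionClosed r V) {χ : ℝ → ℂ} (hχ : PWFun r χ) (ho : Annihilates r V χ) :
    ∃ m : ℂ → ℂ, Differentiable ℂ m ∧
      (∀ φ, PWFun r φ → fourierC φ ∈ V → ∀ w, m w * fourierC φ w = starFn χ φ w) ∧
      ∃ A B : ℝ, ∀ w, ‖m w‖ ≤ A * Real.exp (B * ‖w‖) := by
  have hex : ∀ w : ℂ, ∃ φ, PWFun r φ ∧ fourierC φ ∈ V ∧ fourierC φ w ≠ 0 := fun w => by
    obtain ⟨f, hf, hfw⟩ := hV.exists_ne_zero w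
    obtain ⟨φ, h1, rfl⟩ := hV.pw f hf
    exact ⟨φ, h1, hf, hfw⟩
  choose p p1 p2 p3 using hex
  let m : ℂ → ℂ := fun w => starFn χ (p w) w / fourierC (p w) w
  have hm : ∀ φ, PWFun r φ → fourierC φ ∈ V → ∀ w, m w * fourierC φ w = starFn χ φ w := by
    intro φ hφ hf w
    have := starFn_symm hV hχ ho hφ (p1 w) hf (p2 w) w
    simp only [m]
    rw [div_mul_eq_mul_div, div_eq_iff (p3 w), this]
  have hd : Differentiable ℂ m := fun w => by
    have h1 : m =ᶠ[𝓝 w] fun z => starFn χ (p w) z / fourierC (p w) z := by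
      have hc := (p1 w).differentiable.continuous.continuousAt (x := w)
      filter_upwards [hc.eventually_ne (p3 w)] with z hz
      rw [eq_div_iff hz]
      exact hm _ (p1 w) (p2 w) z
    exact ((differentiable_starFn hχ (p1 w) w).div ((p1 w).differentiable w)
      (p3 w)).congr_of_eventuallyEq h1
  refine ⟨m, hd, hm, ?_⟩
  let φ := p 0
  have hφ : PWFun r φ := p1 0
  have hf0 : 0 < ‖fourierC φ 0‖ := norm_pos_iff.2 (p3 0)
  set a := ∫ t, ‖φ t‖ with ha
  have ha0 : 0 < a := by
    have := norm_fourierC_le hφ 0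
    rw [norm_zero, zero_mul, Real.exp_zero, mul_one] at this
    exact hf0.trans_le this
  obtain ⟨B, hB0, hB⟩ := norm_starFn_le hχ hφ
  refine ⟨B * a ^ 2 / ‖fourierC φ 0‖ ^ 3 * Real.exp (4 * r), 8 * r, fun w => ?_⟩
  set R := 2 * ‖w‖ + 1 with hR
  have hw0 := norm_nonneg w
  set M := a * Real.exp (r * R) with hM
  have hM0 : 0 < M := by positivity
  have hnorm : ∀ z ∈ Metric.closedBall (0 : ℂ) R, ‖z‖ ≤ R := fun z hz => by simpa using hz
  have h1 : ∀ z ∈ Metric.closedBall (0 : ℂ) R, ‖fourierC φ z / M‖ ≤ 1 := fun z hz => by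
    rw [norm_div, Complex.norm_real, Real.norm_of_nonneg hM0.le, div_le_one hM0]
    refine (norm_fourierC_le hφ z).trans ?_
    rw [hM]
    refine mul_le_mul_of_nonneg_left (Real.exp_le_exp.2 ?_) ha0.le
    rw [mul_comm]
    exact mul_le_mul_of_nonneg_left (hnorm z hz) hr.le
  have hMc : (M : ℂ) ≠ 0 := by exact_mod_cast hM0.ne'
  have h2 : ∀ z ∈ Metric.closedBall (0 : ℂ) R, ‖(m z * M) * (fourierC φ z / M)‖
      ≤ B * Real.exp (R * (2 * r)) := fun z hz => by
    have : (m z * M) * (fourierC φ z / M) = m z * fourierC φ z := by field_simp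
    rw [this, hm φ hφ (p2 0)]
    refine (hB z).trans (mul_le_mul_of_nonneg_left (Real.exp_le_exp.2 ?_) hB0)
    exact mul_le_mul_of_nonneg_right (hnorm z hz) (by positivity)
  have h0 : (0 : ℂ) ∈ Metric.ball (0 : ℂ) R := by
    rw [mem_ball_iff_norm, sub_zero, norm_zero]
    positivity
  have hwm : w ∈ Metric.ball (0 : ℂ) R := by
    rw [mem_ball_iff_norm, sub_zero]
    linarith
  have hF0 : fourierC φ 0 / M ≠ 0 := div_ne_zero (p3 0) hMc
  have key := norm_le_of_quotient (hφ.differentiable.div_const (M : ℂ)) (hd.mul_const (M : ℂ)) h1 h2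
    h0 hwm hF0
  have e1 : harnackFactor 0 R 0 = 1 := by
    unfold harnackFactor
    rw [sub_self, norm_zero, add_zero, sub_zero, div_self (by positivity)]
  have e2 : harnackFactor 0 R w ≤ 3 := by
    unfold harnackFactor
    rw [sub_zero, div_le_iff₀ (by linarith)]
    linarith
  have e3 : 0 ≤ -Real.log ‖fourierC φ 0 / M‖ := by
    have := Real.log_nonpos (norm_nonneg _) (h1 0 (Metric.ball_subset_closedBall h0))
    linarith
  have e4 : Real.exp (harnackFactor 0 R 0 * harnackFactor 0 R w * -Real.log ‖fourierC φ 0 / M‖)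
      ≤ (M / ‖fourierC φ 0‖) ^ 3 := by
    have : (M / ‖fourierC φ 0‖) ^ 3 = Real.exp (3 * -Real.log ‖fourierC φ 0 / M‖) := by
      rw [← Real.log_inv, norm_div, inv_div, Complex.norm_real, Real.norm_of_nonneg hM0.le]
      have h3 := Real.exp_nat_mul (Real.log (M / ‖fourierC φ 0‖)) 3
      push_cast at h3
      rw [h3, Real.exp_log (by positivity)]
    rw [this, e1, one_mul]
    exact Real.exp_le_exp.2 (mul_le_mul_of_nonneg_right e2 e3)
  rw [norm_mul, Complex.norm_real, Real.norm_of_nonneg hM0.le] at key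
  have e5 : ‖m w‖ * M ≤ B * Real.exp (R * (2 * r)) * (M / ‖fourierC φ 0‖) ^ 3 :=
    key.trans (mul_le_mul_of_nonneg_left e4 (by positivity))
  have e6 : B * Real.exp (R * (2 * r)) * (M / ‖fourierC φ 0‖) ^ 3 =
      (B * a ^ 2 / ‖fourierC φ 0‖ ^ 3 * Real.exp (4 * r) * Real.exp (8 * r * ‖w‖)) * M := by
    have h3 : Real.exp (R * (2 * r)) * Real.exp (r * R) ^ 2 =
        Real.exp (4 * r) * Real.exp (8 * r * ‖w‖) := by
      rw [← Real.exp_nat_mul, ← Real.exp_add, ← Real.exp_add, hR]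
      congr 1
      push_cast
      ring
    rw [hM]
    generalize Real.exp (R * (2 * r)) = x₁ at h3 ⊢
    generalize Real.exp (r * R) = x₂ at h3 ⊢
    generalize Real.exp (4 * r) = x₃ at h3 ⊢
    generalize Real.exp (8 * r * ‖w‖) = x₄ at h3 ⊢
    field_simp
    linear_combination B * x₂ * h3
  rw [e6] at e5
  exact le_of_mul_le_mul_right e5 hM0

theorem norm_fourierC_le_of_nonneg {g : ℝ → ℂ} (hg : Integrable g) {z : ℂ}
    (h : ∀ t, g t ≠ 0 → 0 ≤ z.im * t) : ‖fourierC g z‖ ≤ ∫ t, ‖g t‖ := by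
  refine norm_integral_le_of_norm_le hg.norm (Eventually.of_forall fun t => ?_)
  rw [norm_mul, Complex.norm_exp]
  by_cases ht : g t = 0
  · simp [ht]
  · refine mul_le_of_le_one_right (norm_nonneg _) (Real.exp_le_one_iff.2 ?_)
    rw [Complex.re_mul_ofReal]
    simp
    linarith [h t ht]

theorem fourierC_comp_neg (φ : ℝ → ℂ) (z : ℂ) : fourierC (fun t => φ (-t)) z = fourierC φ (-z) := by
  unfold fourierC
  rw [← integral_neg_eq_self (fun t : ℝ => φ t * Complex.exp (Complex.I * -z * t))]
  congr 1
  ext t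
  push_cast
  congr 2
  ring

theorem tendsto_fourierC_imag {g : ℝ → ℂ} (hg : Integrable g) (h0 : ∀ t ≤ 0, g t = 0) :
    Tendsto (fun n : ℕ => fourierC g (n * Complex.I)) atTop (𝓝 0) := by
  have : Tendsto (fun n : ℕ => ∫ t, g t * Complex.exp (Complex.I * (n * Complex.I) * t)) atTop
      (𝓝 (∫ _ : ℝ, (0 : ℂ))) := by
    have hn : ∀ (n : ℕ) (t : ℝ), ‖Complex.exp (Complex.I * (n * Complex.I) * t)‖
        = Real.exp (-(n * t)) := fun n t => by
      rw [Complex.norm_exp, Complex.re_mul_ofReal]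
      simp
    refine tendsto_integral_of_dominated_convergence (fun t => ‖g t‖) (fun n => ?_) hg.norm
      (fun n => Eventually.of_forall fun t => ?_) (Eventually.of_forall fun t => ?_)
    · exact hg.1.mul (Continuous.aestronglyMeasurable (by fun_prop))
    · rw [norm_mul, hn]
      rcases le_or_gt t 0 with ht | ht
      · simp [h0 t ht]
      · exact mul_le_of_le_one_right (norm_nonneg _) (Real.exp_le_one_iff.2 (by
          rw [neg_nonpos]; positivity))
    · rcases le_or_gt t 0 with ht | ht
      · simp [h0 t ht]
      · rw [tendsto_zero_iff_norm_tendsto_zero]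
        simp only [norm_mul, hn]
        have h1 : Tendsto (fun n : ℕ => (n : ℝ) * t) atTop atTop :=
          tendsto_natCast_atTop_atTop.atTop_mul_const ht
        simpa using (Real.tendsto_exp_neg_atTop_nhds_zero.comp h1).const_mul ‖g t‖
  rw [integral_zero] at this
  exact this

/-- An annihilator vanishes up to the end of the support of any density of the space. -/
theorem Annihilates.ae_eq_zero {r : ℝ} (hr : 0 < r) {V : Submodule ℂ (ℂ → ℂ)}
    (hV : IsDivisionClosed r V) {χ : ℝ → ℂ} (hχ : PWFun r χ) (ho : Annihilates r V χ)
    {φ₀ : ℝ → ℂ} (hφ₀ : PWFun r φ₀) (hf₀ : fourierC φ₀ ∈ V) {s : ℝ} (hs : 0 < s)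
    (hns : ¬ ∀ᵐ t : ℝ, s < t → φ₀ t = 0) : ∀ᵐ t : ℝ, 0 < t → t < s → χ t = 0 := by
  obtain ⟨S, φ, hsS, hφ, hae, hS⟩ := hφ₀.exists_isSuppTop hns
  have hf : fourierC φ ∈ V := by
    rw [show fourierC φ = fourierC φ₀ from funext (fourierC_congr_ae hae)]
    exact hf₀
  have hS0 : 0 < S := hs.trans_le hsS
  obtain ⟨m, hm, hmf, A, B, hAB⟩ := exists_multiplier hr hV hχ ho
  have hχp := hχ.indicator (s := Set.Ioi 0) measurableSet_Ioi
  have hχn := hχ.indicator (s := Set.Iic 0) measurableSet_Iic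
  set P : ℂ → ℂ := fun w => fourierC ((Set.Ioi 0).indicator χ) (-w) with hP
  set P' : ℂ → ℂ := fun w => fourierC ((Set.Iic 0).indicator χ) (-w) with hP'
  have hPd : Differentiable ℂ P := hχp.differentiable.comp differentiable_neg
  have hPd' : Differentiable ℂ P' := hχn.differentiable.comp differentiable_neg
  -- lower half-plane
  set q : ℂ → ℂ := fun w => Complex.I * P w - m w with hq
  have hqd : Differentiable ℂ q := (hPd.const_mul _).sub hm
  have hqK : ∀ w : ℂ, w.im ≤ 0 → ‖q w * fourierC φ w‖ ≤ ∫ p, ‖pairOn lowerPairs χ φ p‖ := by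
    intro w hw
    have e : q w * fourierC φ w = Complex.I * pairTransform (pairOn lowerPairs χ φ) w := by
      have h1 := hmf φ hφ hf w
      rw [starFn_eq_lower hχ hφ] at h1
      simp only [hq, hP]
      linear_combination -h1
    rw [e, norm_mul, Complex.norm_I, one_mul]
    refine norm_pairTransform_le hχ hφ measurableSet_lowerPairs fun p hp => ?_
    have : p.2 < p.1 := hp
    exact mul_nonneg_of_nonpos_of_nonpos hw (by linarith)
  have hPb : ∀ w : ℂ, w.im ≤ 0 → ‖P w‖ ≤ ∫ t, ‖(Set.Ioi 0).indicator χ t‖ := fun w hw => by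
    refine norm_fourierC_le_of_nonneg hχp.integrable fun t ht => ?_
    have : 0 < t := by
      by_contra h'
      exact ht (Set.indicator_of_notMem (by simpa using h') _)
    rw [Complex.neg_im]
    exact mul_nonneg (by linarith) this.le
  -- upper half-plane
  set q' : ℂ → ℂ := fun w => m (-w) + Complex.I * P' (-w) with hq'
  have hqd' : Differentiable ℂ q' :=
    (hm.comp differentiable_neg).add ((hPd'.comp differentiable_neg).const_mul _)
  let ψ : ℝ → ℂ := fun t => conj (φ t)
  have hψ : PWFun r ψ := ⟨hφ.memLp.star, fun t ht => by simp [ψ, hφ.supp t ht]⟩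
  have hSψ : IsSuppTop ψ S := ⟨fun t ht => by simp [ψ, hS.eq_zero t ht], fun ε hε h =>
    hS.not_ae ε hε (by filter_upwards [h] with t ht ht'; simpa [ψ] using ht ht')⟩
  let φ' : ℝ → ℂ := fun t => conj (φ (-t))
  have hφ' : PWFun r φ' := hφ.conj_neg
  have hf' : fourierC φ' ∈ V := by
    rw [show fourierC φ' = sharp (fourierC φ) from funext (fourierC_conj_neg φ)]
    exact hV.sharp _ hf
  have hψφ : ∀ w, fourierC ψ w = fourierC φ' (-w) := fun w => by
    rw [← fourierC_comp_neg]
    simp [φ', ψ]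
  have hqK' : ∀ w : ℂ, w.im ≤ 0 →
      ‖q' w * fourierC ψ w‖ ≤ ∫ p, ‖pairOn lowerPairsᶜ χ φ' p‖ := by
    intro w hw
    have e : q' w * fourierC ψ w = Complex.I * pairTransform (pairOn lowerPairsᶜ χ φ') (-w) := by
      have h1 := hmf φ' hφ' hf' (-w)
      rw [starFn_eq_upper hχ hφ'] at h1
      rw [hψφ]
      simp only [hq', hP']
      linear_combination h1
    rw [e, norm_mul, Complex.norm_I, one_mul]
    refine norm_pairTransform_le hχ hφ' measurableSet_lowerPairs.compl fun p hp => ?_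
    have : p.1 ≤ p.2 := not_lt.1 hp
    rw [Complex.neg_im]
    exact mul_nonneg (by linarith) (by linarith)
  have hPb' : ∀ w : ℂ, w.im ≤ 0 → ‖P' (-w)‖ ≤ ∫ t, ‖(Set.Iic 0).indicator χ t‖ := fun w hw => by
    refine norm_fourierC_le_of_nonneg hχn.integrable fun t ht => ?_
    have : t ≤ 0 := by
      by_contra h'
      exact ht (Set.indicator_of_notMem (by simpa using h') _)
    rw [neg_neg]
    exact mul_nonneg_of_nonpos_of_nonpos hw this
  -- the four rays
  set a := √(1 / 2) with ha
  have ha2 : a ^ 2 = 1 / 2 := Real.sq_sqrt (by norm_num)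
  have ha0 : 0 < a := Real.sqrt_pos.2 (by norm_num)
  have hray : ∀ ω : ℂ, ω.re ^ 2 = 1 / 2 → ω.im ^ 2 = 1 / 2 → ω.im < 0 →
      ∃ C : ℝ, ∀ ρ : ℝ, ‖m (ρ * ω)‖ ≤ C := by
    intro ω h1 h2 h3
    obtain ⟨C₁, hC₁⟩ := hS.norm_quotient_ray_le hφ hS0 hqd hqK h1 h2 h3
    obtain ⟨C₂, hC₂⟩ := hSψ.norm_quotient_ray_le hψ hS0 hqd' hqK' h1 h2 h3
    refine ⟨max (C₁ + ∫ t, ‖(Set.Ioi 0).indicator χ t‖) (C₂ + ∫ t, ‖(Set.Iic 0).indicator χ t‖),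
      fun ρ => ?_⟩
    have him : ∀ ρ : ℝ, 0 ≤ ρ → ((ρ : ℂ) * ω).im ≤ 0 := fun ρ hρ => by
      rw [show ((ρ : ℂ) * ω).im = ρ * ω.im by simp]
      exact mul_nonpos_of_nonneg_of_nonpos hρ h3.le
    rcases le_total 0 ρ with hρ | hρ
    · refine le_trans ?_ (le_max_left _ _)
      have e : m (ρ * ω) = Complex.I * P (ρ * ω) - q (ρ * ω) := by
        simp only [hq]
        ring
      rw [e]
      refine (norm_sub_le _ _).trans ?_
      rw [norm_mul, Complex.norm_I, one_mul, add_comm]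
      exact add_le_add (hC₁ ρ hρ) (hPb _ (him ρ hρ))
    · refine le_trans ?_ (le_max_right _ _)
      have hρ' : 0 ≤ -ρ := by linarith
      have e : m (ρ * ω) = q' ((-ρ : ℝ) * ω) - Complex.I * P' (-((-ρ : ℝ) * ω)) := by
        simp only [hq']
        push_cast
        rw [neg_mul, neg_neg]
        ring
      rw [e]
      refine (norm_sub_le _ _).trans ?_
      rw [norm_mul, Complex.norm_I, one_mul]
      exact add_le_add (hC₂ _ hρ') (hPb' _ (him _ hρ'))
  let ω : ℂ := ⟨a, -a⟩
  obtain ⟨C₁, hC₁⟩ := hray ω ha2 (by simpa [ω] using ha2) (by simpa [ω] using ha0)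
  obtain ⟨C₂, hC₂⟩ := hray ⟨-a, -a⟩ (by simpa using ha2) (by simpa using ha2) (by simpa using ha0)
  have hω : ‖ω‖ = 1 := by
    rw [← sq_eq_sq₀ (norm_nonneg _) zero_le_one, ← Complex.normSq_eq_norm_sq, Complex.normSq_apply]
    simp only [ω]
    nlinarith
  have hIω : ∀ ρ : ℝ, (ρ : ℂ) * (Complex.I * ω) = ((-ρ : ℝ) : ℂ) * ⟨-a, -a⟩ := fun ρ => by
    apply Complex.ext <;> simp [ω]
  have hconst := eq_of_bounded_on_lines hm hAB hω
    (fun ρ => (hC₁ ρ).trans (le_max_left C₁ C₂)) fun ρ => by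
      rw [hIω]
      exact (hC₂ _).trans (le_max_right C₁ C₂)
  -- `m` vanishes
  have hn : Tendsto (fun n : ℕ => (n : ℝ)) atTop atTop := tendsto_natCast_atTop_atTop
  have hPlim : Tendsto (fun n : ℕ => P (-(n * Complex.I))) atTop (𝓝 0) := by
    simp only [hP, neg_neg]
    exact tendsto_fourierC_imag hχp.integrable fun t ht =>
      Set.indicator_of_notMem (by simpa using ht) _
  have hqlim : Tendsto (fun n : ℕ => q (-(n * Complex.I))) atTop (𝓝 0) := by
    obtain ⟨n₀, C, hC, H⟩ := hS.norm_quotient_axis_le hφ (half_pos hS0) hqd hqK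
    have h1 : Tendsto (fun n : ℕ => C * Real.exp (-((S - S / 2) * n))) atTop (𝓝 0) := by
      have := (Real.tendsto_exp_neg_atTop_nhds_zero.comp
        (hn.const_mul_atTop (show 0 < S - S / 2 by linarith))).const_mul C
      simpa using this
    refine squeeze_zero_norm' ?_ h1
    filter_upwards [eventually_ge_atTop n₀, eventually_gt_atTop 0] with n h2 h3
    have := H n (by exact_mod_cast h2) (by exact_mod_cast h3)
    simpa using this
  have hm0 : ∀ w, m w = 0 := fun w => by
    have h1 : Tendsto (fun n : ℕ => m (-(n * Complex.I))) atTop (𝓝 0) := by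
      have := (hPlim.const_mul Complex.I).sub hqlim
      simp only [hq, mul_zero, sub_zero, sub_sub_cancel] at this
      exact this
    refine tendsto_nhds_unique ?_ h1
    simp only [fun n : ℕ => hconst (-(n * Complex.I)) w]
    exact tendsto_const_nhds
  have hqP : ∀ w, ‖q w‖ = ‖P w‖ := fun w => by
    simp only [hq]
    rw [hm0, sub_zero, norm_mul, Complex.norm_I, one_mul]
  -- conclusion
  have hfin : ∀ ε : ℝ, 0 < ε → ∀ᵐ t : ℝ, 0 < t → t < S - ε → χ t = 0 := by
    intro ε hε
    obtain ⟨n₀, C, hC, H⟩ := hS.norm_quotient_axis_le hφ hε hqd hqK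
    let η : ℝ → ℂ := fun t => (Set.Ioi 0).indicator χ (S - ε - t)
    have hηi : Integrable η := hχp.integrable.comp_sub_left (S - ε)
    have key := ae_eq_zero_of_exp_moments (T := S - ε) (M := C) (N := max n₀ 1) hηi
      (fun t ht => Set.indicator_of_notMem (by
        rw [Set.mem_Ioi]
        linarith) _) fun n hnn => ?_
    · have h1 : ∀ᵐ t : ℝ, 0 < S - ε - t → η (S - ε - t) = 0 :=
        (Measure.measurePreserving_sub_left volume (S - ε)).quasiMeasurePreserving.ae key
      filter_upwards [h1] with t ht ht0 htS
      have := ht (by linarith)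
      simp only [η, sub_sub_cancel] at this
      rwa [Set.indicator_of_mem (by simpa using ht0)] at this
    · have e : ∫ t, η t * (Real.exp (n * t) : ℝ)
          = (Real.exp ((S - ε) * n) : ℝ) * P (-(n * Complex.I)) := by
        simp only [hP, neg_neg, η]
        unfold fourierC
        rw [← integral_const_mul, ← integral_sub_left_eq_self (fun t : ℝ =>
          ((Real.exp ((S - ε) * n) : ℝ) : ℂ) * ((Set.Ioi 0).indicator χ t *
            Complex.exp (Complex.I * (n * Complex.I) * t))) volume (S - ε)]
        congr 1
        ext t
        rw [mul_left_comm, Complex.ofReal_exp, Complex.ofReal_exp, ← Complex.exp_add]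
        congr 2
        push_cast
        linear_combination -(n * (S - ε - t) : ℂ) * Complex.I_sq
      have hn0 : n₀ ≤ n := (le_max_left _ _).trans hnn
      have hn1 : 0 < n := (le_max_right _ _).trans hnn
      have h2 := H n (by exact_mod_cast hn0) (by exact_mod_cast hn1)
      rw [hqP] at h2
      rw [e, norm_mul, Complex.norm_real, Real.norm_of_nonneg (Real.exp_pos _).le]
      push_cast at h2
      calc _ ≤ Real.exp ((S - ε) * n) * (C * Real.exp (-((S - ε) * n))) :=
            mul_le_mul_of_nonneg_left h2 (Real.exp_pos _).le
        _ = C := by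
            rw [Real.exp_neg]
            have := (Real.exp_pos ((S - ε) * n)).ne'
            field_simp
  filter_upwards [ae_all_iff.2 fun n : ℕ => hfin (1 / ((n : ℝ) + 1)) (by positivity)] with t ht h0 h1
  obtain ⟨n, hn⟩ := exists_nat_one_div_lt (show 0 < S - t by linarith)
  exact ht n h0 (by linarith)


theorem HB.ne_zero (E : HB) {z : ℂ} (hz : 0 ≤ z.im) : E z ≠ 0 := by
  rcases hz.eq_or_lt with h | h
  · have : z = (z.re : ℂ) := by
      apply Complex.ext <;> simp [← h]
    rw [this]
    exact E.no_real_zero _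
  · exact norm_pos_iff.1 ((norm_nonneg _).trans_lt (E.sharp_lt z h))

theorem sharp_sharp (f : ℂ → ℂ) : sharp (sharp f) = f := by
  funext z
  simp [sharp]

theorem differentiable_sharp {f : ℂ → ℂ} (hf : Differentiable ℂ f) : Differentiable ℂ (sharp f) :=
  fun z => by
    have := (hf (conj z)).conj_conj
    rw [Complex.conj_conj] at this
    exact this

theorem sharp_dslope {f : ℂ → ℂ} (w : ℂ) : sharp (dslope f w) = dslope (sharp f) (conj w) := by
  funext z
  by_cases h : z = conj w
  · rw [h, sharp, Complex.conj_conj, dslope_same, dslope_same]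
    have := congrFun (deriv_conj_conj (f := f)) (conj w)
    change _ = deriv (fun x => conj (f (conj x))) _
    simpa [Function.comp_def] using this.symm
  · have h' : conj z ≠ w := fun h' => h (by rw [← h', Complex.conj_conj])
    rw [sharp, dslope_of_ne _ h', dslope_of_ne _ h, slope_def_field, slope_def_field]
    simp [sharp]

theorem differentiable_dslope {f : ℂ → ℂ} (hf : Differentiable ℂ f) (w : ℂ) :
    Differentiable ℂ (dslope f w) := by
  rw [← differentiableOn_univ] at hf ⊢
  exact (Complex.differentiableOn_dslope Filter.univ_mem).2 hf

theorem HB.differentiableOn_div (E : HB) {f : ℂ → ℂ} (hf : Differentiable ℂ f) :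
    DifferentiableOn ℂ (fun z => f z / E z) upperHalf :=
  hf.differentiableOn.div E.entire.differentiableOn fun _ hz => E.ne_zero (le_of_lt hz)

theorem sharp_mem {E : HB} {f : ℂ → ℂ} (hf : f ∈ deBrangesSubmodule E) :
    sharp f ∈ deBrangesSubmodule E :=
  ⟨differentiable_sharp hf.1, hf.2.2, by rw [sharp_sharp]; exact hf.2.1⟩

theorem deBrangesNorm_sharp (E : HB) (f : ℂ → ℂ) :
    deBrangesNorm E (sharp f) = deBrangesNorm E f := by
  refine eLpNorm_congr_norm_ae (Eventually.of_forall fun x => ?_)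
  simp [sharp]

theorem lintegral_line_le_deBrangesNorm {E : HB} {f : ℂ → ℂ} (hf : f ∈ deBrangesSubmodule E)
    {y : ℝ} (hy : 0 < y) :
    ∫⁻ x : ℝ, ‖f (x + y * Complex.I) / E (x + y * Complex.I)‖ₑ ^ 2 ≤ deBrangesNorm E f ^ 2 := by
  obtain ⟨Φ, h1, h2, h3⟩ := hf.2.1.exists_fourierC
  have him : ∀ x y : ℝ, 0 < y → 0 < ((x : ℂ) + y * Complex.I).im := fun x y hy => by simpa using hy
  have key := (boundary_fourierC h1 h2 (h := fun x => f x / E x) (d := fun n : ℕ => 1 / ((n : ℝ) + 1))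
    (fun n => by positivity) tendsto_one_div_add_atTop_nhds_zero_nat
    (Eventually.of_forall fun x => by
      have ht := tendsto_vertical x tendsto_one_div_add_atTop_nhds_zero_nat
      refine ((((hf.1.continuous.tendsto _).comp ht).div ((E.entire.continuous.tendsto _).comp ht)
        (E.no_real_zero x))).congr fun n => ?_
      exact h3 _ (him x _ (by positivity)))).2.1
  rw [deBrangesNorm, eLpNorm_two_sq, key]
  refine le_trans (le_of_eq (lintegral_congr fun x => ?_)) (lintegral_fourierC_line_le h1 h2 hy)
  rw [← h3 _ (him x y hy)]

theorem memH2_of_bound_off_ball (E : HB) {g : ℂ → ℂ} (hg : Differentiable ℂ g) (w : ℂ)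
    {u : ℂ → ENNReal} {C : NNReal} (hu : ∀ y : ℝ, 0 < y → ∫⁻ x : ℝ, u (x + y * Complex.I) ≤ C)
    (h : ∀ z : ℂ, 0 < z.im → 1 ≤ ‖z - w‖ → ‖g z / E z‖ₑ ^ 2 ≤ u z) :
    MemH2 fun z => g z / E z := by
  have hK : IsCompact (Metric.closedBall w 1 ∩ {z : ℂ | 0 ≤ z.im}) :=
    (isCompact_closedBall w 1).inter_right (isClosed_le continuous_const Complex.continuous_im)
  obtain ⟨M, hM⟩ := hK.exists_bound_of_continuousOn (f := fun z => g z / E z)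
    (hg.continuous.continuousOn.div E.entire.continuous.continuousOn fun z hz => E.ne_zero hz.2)
  refine ⟨E.differentiableOn_div hg, C + (M.toNNReal ^ 2) * 2, fun y hy => ?_⟩
  have hp : ∀ x : ℝ, ‖g (x + y * Complex.I) / E (x + y * Complex.I)‖ₑ ^ 2 ≤
      u (x + y * Complex.I) +
        (Set.Icc (w.re - 1) (w.re + 1)).indicator (fun _ => (M.toNNReal : ENNReal) ^ 2) x := by
    intro x
    have him : 0 < ((x : ℂ) + y * Complex.I).im := by simpa using hy
    rcases le_or_gt 1 ‖(x : ℂ) + y * Complex.I - w‖ with h1 | h1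
    · exact (h _ him h1).trans le_self_add
    · have hx : x ∈ Set.Icc (w.re - 1) (w.re + 1) := by
        have := (Complex.abs_re_le_norm _).trans h1.le
        simp only [Complex.sub_re, Complex.add_re, Complex.ofReal_re, Complex.mul_re, Complex.I_re,
          Complex.I_im, Complex.ofReal_im, mul_zero, mul_one, sub_self, add_zero] at this
        rw [abs_le] at this
        constructor <;> linarith
      rw [Set.indicator_of_mem hx]
      refine le_trans (pow_le_pow_left' ?_ 2) le_add_self
      have := hM _ ⟨by rw [Metric.mem_closedBall, dist_eq_norm]; exact h1.le, him.le⟩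
      rw [enorm_eq_nnnorm, ENNReal.coe_le_coe, ← NNReal.coe_le_coe, coe_nnnorm]
      exact this.trans (Real.le_coe_toNNReal M)
  calc _ ≤ ∫⁻ x : ℝ, (u (x + y * Complex.I) +
        (Set.Icc (w.re - 1) (w.re + 1)).indicator (fun _ => (M.toNNReal : ENNReal) ^ 2) x) :=
        lintegral_mono hp
    _ ≤ C + (M.toNNReal : ENNReal) ^ 2 * 2 := by
      rw [lintegral_add_right _ (measurable_const.indicator measurableSet_Icc),
        lintegral_indicator_const measurableSet_Icc, Real.volume_Icc]
      refine add_le_add (hu y hy) (mul_le_mul' le_rfl ?_)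
      rw [show w.re + 1 - (w.re - 1) = 2 by ring]
      simp
    _ = _ := by push_cast; rfl

theorem memH2_dslope {E : HB} {f : ℂ → ℂ} (hd : Differentiable ℂ f)
    (hf : MemH2 fun z => f z / E z) {w : ℂ} (hw : f w = 0) : MemH2 fun z => dslope f w z / E z := by
  obtain ⟨-, C, hC⟩ := hf
  refine memH2_of_bound_off_ball E (differentiable_dslope hd w) w (u := fun z => ‖f z / E z‖ₑ ^ 2)
    hC fun z _ h1 => pow_le_pow_left' (enorm_le_iff_norm_le.2 ?_) 2
  have hne : z ≠ w := by
    rintro rfl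
    simp at h1
    linarith
  rw [dslope_of_ne _ hne, slope_def_field, hw, sub_zero, norm_div, norm_div, norm_div]
  exact div_le_div_of_nonneg_right (div_le_self (norm_nonneg _) h1) (norm_nonneg _)

theorem dslope_mem {E : HB} {f : ℂ → ℂ} (hf : f ∈ deBrangesSubmodule E) {w : ℂ} (hw : f w = 0) :
    dslope f w ∈ deBrangesSubmodule E := by
  refine ⟨differentiable_dslope hf.1 w, memH2_dslope hf.1 hf.2.1 hw, ?_⟩
  rw [sharp_dslope]
  exact memH2_dslope (differentiable_sharp hf.1) hf.2.2 (by simp [sharp, hw])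

theorem lintegral_inv_one_add_sq_le (c : NNReal) :
    ∃ C : NNReal, ∫⁻ x : ℝ, ENNReal.ofReal (c * (1 + x ^ 2)⁻¹) ≤ C := by
  have h := (integrable_inv_one_add_sq.const_mul (c : ℝ)).lintegral_lt_top
  exact ⟨_, (ENNReal.coe_toNNReal h.ne).symm.le⟩

/-- A de Branges space is nonzero. -/
theorem exists_ne_zero_mem (E : HB) : ∃ f ∈ deBrangesSubmodule E, f ≠ 0 := by
  let N : ℂ → ℂ := fun z => E z * conj (E 0) - sharp E z * E 0
  have hN : Differentiable ℂ N :=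
    (E.entire.mul_const _).sub ((differentiable_sharp E.entire).mul_const _)
  have hN0 : N 0 = 0 := by
    simp only [N, sharp, map_zero]
    ring
  have hNs : sharp N = -N := by
    funext z
    simp only [N, sharp, map_sub, map_mul, Complex.conj_conj, Pi.neg_apply]
    ring
  have hb : MemH2 fun z => dslope N 0 z / E z := by
    obtain ⟨C, hC⟩ := lintegral_inv_one_add_sq_le (2 * (2 * ‖E 0‖₊) ^ 2)
    refine memH2_of_bound_off_ball E (differentiable_dslope hN 0) 0
      (u := fun z => ENNReal.ofReal ((2 * (2 * ‖E 0‖₊) ^ 2 : NNReal) * (1 + z.re ^ 2)⁻¹)) (C := C)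
      (fun y _ => by simpa using hC) fun z hz h1 => ?_
    rw [sub_zero] at h1
    have hz0 : z ≠ 0 := by
      rintro rfl
      simp at h1
      linarith
    have hE : 0 < ‖E z‖ := norm_pos_iff.2 (E.ne_zero hz.le)
    rw [dslope_of_ne _ hz0, slope_def_field, hN0, sub_zero, sub_zero]
    have h2 : ‖N z‖ ≤ 2 * ‖E 0‖ * ‖E z‖ := by
      refine (norm_sub_le _ _).trans ?_
      rw [norm_mul, norm_mul, RCLike.norm_conj]
      nlinarith [(E.sharp_lt z hz).le, norm_nonneg (E 0)]
    have h3 : ‖N z / z / E z‖ ≤ 2 * ‖E 0‖ / ‖z‖ := by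
      rw [norm_div, norm_div, div_div, div_le_div_iff₀ (by positivity) (by positivity)]
      nlinarith [norm_nonneg z]
    have h4 : ‖N z / z / E z‖ ^ 2 ≤ 2 * (2 * ‖E 0‖) ^ 2 * (1 + z.re ^ 2)⁻¹ := by
      refine (pow_le_pow_left₀ (norm_nonneg _) h3 2).trans ?_
      rw [div_pow, ← div_eq_mul_inv, div_le_div_iff₀ (by positivity) (by positivity)]
      have h5 : z.re ^ 2 ≤ ‖z‖ ^ 2 := by
        rw [← sq_abs z.re]
        exact pow_le_pow_left₀ (abs_nonneg _) (Complex.abs_re_le_norm z) 2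
      have h6 : 1 ≤ ‖z‖ ^ 2 := one_le_pow₀ h1
      nlinarith [sq_nonneg (2 * ‖E 0‖)]
    rw [← ofReal_norm, ← ENNReal.ofReal_pow (norm_nonneg _)]
    exact ENNReal.ofReal_le_ofReal (by push_cast; exact h4)
  refine ⟨dslope N 0, ⟨differentiable_dslope hN 0, hb, ?_⟩, fun h0 => ?_⟩
  · refine (hb.smul (-1)).congr fun z => ?_
    rw [sharp_dslope, hNs, map_zero, show -N = (-1 : ℂ) • N by simp]
    by_cases hz : z = 0
    · rw [hz, dslope_same, dslope_same, deriv_const_smul _ (hN 0)]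
      simp [neg_div]
    · rw [dslope_of_ne _ hz, dslope_of_ne _ hz, slope_def_field, slope_def_field]
      simp only [Pi.smul_apply, smul_eq_mul]
      ring
  · have h1 : N Complex.I = 0 := by
      have := sub_smul_dslope N 0 Complex.I
      rw [h0, hN0] at this
      simpa using this.symm
    have h2 : ‖E Complex.I‖ * ‖E 0‖ = ‖sharp E Complex.I‖ * ‖E 0‖ := by
      have := congrArg norm (sub_eq_zero.1 h1)
      rwa [norm_mul, norm_mul, RCLike.norm_conj] at this
    have h3 := mul_right_cancel₀ (norm_ne_zero_iff.2 (E.ne_zero (z := 0) (by simp))) h2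
    exact (E.sharp_lt Complex.I (by simp)).ne' h3


instance (r : ℝ) (hr : 0 < r) : CompleteSpace (DeBrangesSpace (pwHB r hr)) :=
  (pwFourier r hr).symm.toIsometryEquiv.completeSpace

theorem enorm_eq_deBrangesNorm {E : HB} (f : DeBrangesSpace E) : ‖f‖ₑ = deBrangesNorm E f := by
  rw [← (divIsometry E).enorm_map f, Lp.enorm_def, deBrangesNorm]
  exact eLpNorm_congr_ae (divIsometry_ae f)

theorem tendsto_eval {r : ℝ} {hr : 0 < r} {f : ℕ → DeBrangesSpace (pwHB r hr)}
    {g : DeBrangesSpace (pwHB r hr)} (h : Tendsto f atTop (𝓝 g)) (z : ℂ) :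
    Tendsto (fun n => f n z) atTop (𝓝 (g z)) := by
  obtain ⟨k, -, -, hk⟩ := pw_reproducing_kernel r hr z
  simp only [hk]
  exact Filter.Tendsto.inner tendsto_const_nhds h

theorem lintegral_line_le_of_tendsto {E : HB} {f : ℕ → ℂ → ℂ} {g : ℂ → ℂ} {C : ENNReal}
    (hf : ∀ n, f n ∈ deBrangesSubmodule E) (hC : ∀ n, deBrangesNorm E (f n) ≤ C)
    (h : ∀ z, Tendsto (fun n => f n z) atTop (𝓝 (g z))) {y : ℝ} (hy : 0 < y) :
    ∫⁻ x : ℝ, ‖g (x + y * Complex.I) / E (x + y * Complex.I)‖ₑ ^ 2 ≤ C ^ 2 := by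
  calc _ = ∫⁻ x : ℝ, liminf (fun n =>
            ‖f n (x + y * Complex.I) / E (x + y * Complex.I)‖ₑ ^ 2) atTop :=
          lintegral_congr fun x => (((ENNReal.continuous_pow 2).continuousAt.tendsto.comp
            ((h _).div_const _).enorm).liminf_eq).symm
    _ ≤ liminf (fun n => ∫⁻ x : ℝ,
            ‖f n (x + y * Complex.I) / E (x + y * Complex.I)‖ₑ ^ 2) atTop :=
          lintegral_liminf_le fun n =>
            (continuous_line (hf n).2.1.holo hy).measurable.enorm.pow_const 2
    _ ≤ C ^ 2 := liminf_le_of_frequently_le' (Frequently.of_forall fun n =>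
          (lintegral_line_le_deBrangesNorm (hf n) hy).trans (pow_le_pow_left' (hC n) 2))

theorem mem_of_tendsto {r : ℝ} {hr : 0 < r} {E : HB}
    (hn : ∀ f ∈ deBrangesSubmodule E, deBrangesNorm E f = deBrangesNorm (pwHB r hr) f)
    {f : ℕ → DeBrangesSpace (pwHB r hr)} {g : DeBrangesSpace (pwHB r hr)}
    (hf : ∀ n, (f n).1 ∈ deBrangesSubmodule E) (h : Tendsto f atTop (𝓝 g)) :
    g.1 ∈ deBrangesSubmodule E := by
  obtain ⟨C, hC⟩ := (Metric.isBounded_range_of_tendsto f h).exists_norm_le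
  have hC' : ∀ n, deBrangesNorm E (f n) ≤ C.toNNReal := fun n => by
    rw [hn _ (hf n), ← enorm_eq_deBrangesNorm, enorm_eq_nnnorm, ENNReal.coe_le_coe,
      ← NNReal.coe_le_coe, coe_nnnorm]
    exact (hC _ ⟨n, rfl⟩).trans (Real.le_coe_toNNReal C)
  refine ⟨g.2.1, ⟨E.differentiableOn_div g.2.1, C.toNNReal ^ 2, fun y hy => ?_⟩,
    ⟨E.differentiableOn_div (differentiable_sharp g.2.1), C.toNNReal ^ 2, fun y hy => ?_⟩⟩
  · have := lintegral_line_le_of_tendsto hf hC' (tendsto_eval h) hy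
    exact_mod_cast this
  · have := lintegral_line_le_of_tendsto (f := fun n => sharp (f n)) (g := sharp g)
      (fun n => sharp_mem (hf n))
      (fun n => (deBrangesNorm_sharp E _).trans_le (hC' n))
      (fun z => (Complex.continuous_conj.tendsto _).comp (tendsto_eval h (conj z))) hy
    exact_mod_cast this

theorem isDivisionClosed {r : ℝ} (hr : 0 < r) {E : HB}
    (hE : deBrangesSubmodule E ≤ deBrangesSubmodule (pwHB r hr)) :
    IsDivisionClosed r (deBrangesSubmodule E) where
  pw f hf := by
    obtain ⟨φ, h1, h2⟩ := exists_pwFun_of_mem hr (hE hf)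
    exact ⟨φ, h1, funext h2⟩
  ne := exists_ne_zero_mem E
  div _ hf _ hw := dslope_mem hf hw
  sharp _ hf := sharp_mem hf

theorem Annihilates.conj_neg {r : ℝ} {V : Submodule ℂ (ℂ → ℂ)} (hV : IsDivisionClosed r V)
    {χ : ℝ → ℂ} (h : Annihilates r V χ) : Annihilates r V fun t => conj (χ (-t)) := by
  intro φ hφ hf
  have h1 := h _ hφ.conj_neg (by
    rw [show fourierC (fun t => conj (φ (-t))) = sharp (fourierC φ) from
      funext (fourierC_conj_neg φ)]
    exact hV.sharp _ hf)
  rw [← integral_neg_eq_self] at h1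
  have h2 := congrArg conj h1
  rw [← integral_conj, map_zero] at h2
  simpa using h2

theorem ae_of_forall_nat_lt {p : ℝ → Prop} {u : ℕ → ℝ} {t : ℝ} (hu : Tendsto u atTop (𝓝 t))
    (h : ∀ n, ∀ᵐ x : ℝ, u n < x → p x) : ∀ᵐ x : ℝ, t < x → p x := by
  filter_upwards [ae_all_iff.2 h] with x hx hlt
  obtain ⟨n, hn⟩ := ((tendsto_order.1 hu).2 x hlt).exists
  exact hx n hn

/-- Division-closed spaces of transforms are, up to closure, Paley--Wiener spaces. -/
theorem IsDivisionClosed.exists_type {r : ℝ} (hr : 0 < r) {V : Submodule ℂ (ℂ → ℂ)}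
    (hV : IsDivisionClosed r V) : ∃ s, 0 < s ∧ s ≤ r ∧
      (∀ f ∈ V, ∃ φ, PWFun s φ ∧ f = fourierC φ) ∧
      ∀ χ, PWFun r χ → Annihilates r V χ → ∀ᵐ t : ℝ, t ∈ Set.Ioo (-s) s → χ t = 0 := by
  let A : Set ℝ := {s | 0 < s ∧ ∃ φ, PWFun r φ ∧ fourierC φ ∈ V ∧ ¬ ∀ᵐ t : ℝ, s < t → φ t = 0}
  have hsym : ∀ φ, PWFun r φ → fourierC φ ∈ V →
      PWFun r (fun t => conj (φ (-t))) ∧ fourierC (fun t => conj (φ (-t))) ∈ V := fun φ h1 h2 => by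
    refine ⟨h1.conj_neg, ?_⟩
    rw [show fourierC (fun t => conj (φ (-t))) = ScrewPW.sharp (fourierC φ) from
      funext (fourierC_conj_neg φ)]
    exact hV.sharp _ h2
  have hAr : ∀ s ∈ A, s ≤ r := by
    rintro s ⟨-, φ, h1, -, h3⟩
    by_contra! h
    exact h3 (Eventually.of_forall fun t ht => h1.supp t fun h' => by linarith [h'.2])
  have hAb : BddAbove A := ⟨r, hAr⟩
  have hpos : ∀ φ, PWFun r φ → fourierC φ ∈ V → A = ∅ → ∀ᵐ t : ℝ, 0 < t → φ t = 0 := by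
    intro φ h1 h2 h3
    refine ae_of_forall_nat_lt (tendsto_one_div_add_atTop_nhds_zero_nat (𝕜 := ℝ)) fun n => ?_
    by_contra h4
    have : (1 / ((n : ℝ) + 1)) ∈ A := ⟨by positivity, φ, h1, h2, h4⟩
    rw [h3] at this
    exact this
  have hAn : A.Nonempty := by
    rw [Set.nonempty_iff_ne_empty]
    intro h3
    obtain ⟨f, hf, hne⟩ := hV.ne
    obtain ⟨φ, h1, rfl⟩ := hV.pw f hf
    have e1 := hpos φ h1 hf h3
    have e2 := hpos _ (hsym φ h1 hf).1 (hsym φ h1 hf).2 h3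
    have e3 : ∀ᵐ t : ℝ, 0 < -t → conj (φ t) = 0 :=
      ae_of_ae_comp_neg (by simpa using e2)
    have e4 : ∀ᵐ t : ℝ, t ≠ 0 := by simp [ae_iff]
    have e5 : φ =ᵐ[volume] fun _ => 0 := by
      filter_upwards [e1, e3, e4] with t h5 h6 h7
      rcases lt_or_gt_of_ne h7 with h | h
      · simpa using h6 (by linarith)
      · exact h5 h
    apply hne
    funext z
    rw [fourierC_congr_ae e5]
    simp [fourierC]
  obtain ⟨s₀, hs₀⟩ := hAn
  have hs₀' : s₀ ≤ sSup A := le_csSup hAb hs₀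
  have htop : ∀ φ, PWFun r φ → fourierC φ ∈ V → ∀ᵐ t : ℝ, sSup A < t → φ t = 0 := by
    intro φ h1 h2
    have hlim : Tendsto (fun n : ℕ => sSup A + 1 / ((n : ℝ) + 1)) atTop (𝓝 (sSup A)) := by
      simpa using (tendsto_one_div_add_atTop_nhds_zero_nat (𝕜 := ℝ)).const_add (sSup A)
    refine ae_of_forall_nat_lt hlim fun n => ?_
    by_contra h4
    have hp : (0 : ℝ) < 1 / ((n : ℝ) + 1) := by positivity
    have := le_csSup hAb (show sSup A + 1 / ((n : ℝ) + 1) ∈ A from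
      ⟨by linarith [hs₀.1], φ, h1, h2, h4⟩)
    linarith
  have hzero : ∀ χ, PWFun r χ → Annihilates r V χ → ∀ᵐ t : ℝ, 0 < t → t < sSup A → χ t = 0 := by
    intro χ h1 h2
    obtain ⟨u, -, hu, hu'⟩ := exists_seq_tendsto_sSup ⟨s₀, hs₀⟩ hAb
    have h3 : ∀ n, ∀ᵐ t : ℝ, 0 < t → t < u n → χ t = 0 := fun n => by
      obtain ⟨h4, φ, h5, h6, h7⟩ := hu' n
      exact h2.ae_eq_zero hr hV h1 h5 h6 h4 h7
    filter_upwards [ae_all_iff.2 h3] with t ht h4 h5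
    obtain ⟨n, hn⟩ := ((tendsto_order.1 hu).1 t h5).exists
    exact ht n h4 hn
  refine ⟨sSup A, hs₀.1.trans_le hs₀', csSup_le ⟨s₀, hs₀⟩ hAr, fun f hf => ?_, fun χ h1 h2 => ?_⟩
  · obtain ⟨φ, h1, rfl⟩ := hV.pw f hf
    refine ⟨(Set.Ioo (-sSup A) (sSup A)).indicator φ, ⟨h1.memLp.indicator measurableSet_Ioo,
      fun t ht => Set.indicator_of_notMem ht _⟩, funext (fourierC_congr_ae ?_)⟩
    have e1 := htop φ h1 hf
    have e3 : ∀ᵐ t : ℝ, sSup A < -t → conj (φ t) = 0 :=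
      ae_of_ae_comp_neg (by simpa using htop _ (hsym φ h1 hf).1 (hsym φ h1 hf).2)
    have e4 : ∀ᵐ t : ℝ, t ≠ sSup A := by simp [ae_iff]
    have e5 : ∀ᵐ t : ℝ, t ≠ -sSup A := by simp [ae_iff]
    filter_upwards [e1, e3, e4, e5] with t h3 h4 h5 h6
    by_cases h : t ∈ Set.Ioo (-sSup A) (sSup A)
    · rw [Set.indicator_of_mem h]
    · rw [Set.indicator_of_notMem h]
      rw [Set.mem_Ioo, not_and_or, not_lt, not_lt] at h
      rcases h with h | h
      · simpa using h4 (by linarith [lt_of_le_of_ne h h6])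
      · exact h3 (lt_of_le_of_ne h h5.symm)
  · have e3 : ∀ᵐ t : ℝ, 0 < -t → -t < sSup A → conj (χ t) = 0 :=
      ae_of_ae_comp_neg (by simpa using hzero _ h1.conj_neg (h2.conj_neg hV))
    have e4 : ∀ᵐ t : ℝ, t ≠ 0 := by simp [ae_iff]
    filter_upwards [hzero χ h1 h2, e3, e4] with t h5 h6 h7 h8
    rcases lt_or_gt_of_ne h7 with h | h
    · simpa using h6 (by linarith) (by linarith [h8.1])
    · exact h5 h h8.2

theorem isDeBrangesSubspace_pw {r s : ℝ} (hr : 0 < r) (hs : 0 < s) (h : s ≤ r) :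
    IsDeBrangesSubspace (pwHB r hr) (deBrangesSubmodule (pwHB s hs)) := by
  refine ⟨fun f hf => ?_, pwHB s hs, rfl, fun f _ => eLpNorm_congr_norm_ae
    (Eventually.of_forall fun x => ?_)⟩
  · obtain ⟨φ, h1, h2⟩ := exists_pwFun_of_mem hs hf
    rw [show f = fourierC φ from funext h2]
    exact (h1.mono h).mem hr
  · have : ∀ (u : ℝ) (hu : 0 < u), ‖pwHB u hu x‖ = 1 := fun u hu => by
      rw [pwHB_apply, Complex.norm_exp]
      simp
    rw [norm_div, norm_div, this, this]

/-- The de Branges subspaces of a Paley--Wiener space are the smaller Paley--Wiener spaces. -/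
theorem isDeBrangesSubspace_pw_iff {r : ℝ} (hr : 0 < r) {V : Submodule ℂ (ℂ → ℂ)} :
    IsDeBrangesSubspace (pwHB r hr) V ↔
      ∃ (s : ℝ) (hs : 0 < s), s ≤ r ∧ V = deBrangesSubmodule (pwHB s hs) := by
  constructor
  · rintro ⟨hle, E, rfl, hn⟩
    have hV := isDivisionClosed hr hle
    obtain ⟨s, hs, hsr, h1, h2⟩ := hV.exists_type hr
    refine ⟨s, hs, hsr, le_antisymm (fun f hf => ?_) fun f hf => ?_⟩
    · obtain ⟨φ, h3, rfl⟩ := h1 f hf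
      exact h3.mem hs
    · obtain ⟨φ, h3, h4⟩ := exists_pwFun_of_mem hs hf
      obtain rfl : f = fourierC φ := funext h4
      let V' : Submodule ℂ (DeBrangesSpace (pwHB r hr)) :=
        (deBrangesSubmodule E).comap (deBrangesSubmodule (pwHB r hr)).subtype
      have hmem : ∀ g, g ∈ V' ↔ g.1 ∈ deBrangesSubmodule E := fun g => Iff.rfl
      have hcl : IsClosed (V' : Set (DeBrangesSpace (pwHB r hr))) := by
        refine isClosed_of_closure_subset fun g hg => ?_
        obtain ⟨u, hu, hlim⟩ := mem_closure_iff_seq_limit.1 hg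
        exact mem_of_tendsto hn hu hlim
      have : CompleteSpace V' := hcl.completeSpace_coe
      have hk : (h3.mono hsr).toSpace hr ∈ V' := by
        rw [← V'.orthogonal_orthogonal, Submodule.mem_orthogonal]
        intro g hg
        obtain ⟨ψ, h5, h6⟩ := exists_pwFun_of_mem hr g.2
        obtain rfl : g = h5.toSpace hr := deBrangesSpace_ext h6
        have ha : Annihilates r (deBrangesSubmodule E) fun t => conj (ψ t) := by
          intro χ h7 h8
          have h9 := (Submodule.mem_orthogonal' _ _).1 hg (h7.toSpace hr) h8
          rw [PWFun.inner] at h9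
          simpa [Real.pi_ne_zero] using h9
        have h10 := h2 (fun t => conj (ψ t))
          ⟨h5.memLp.star, fun t ht => by rw [h5.supp t ht, map_zero]⟩ ha
        rw [PWFun.inner, integral_eq_zero_of_ae, mul_zero]
        filter_upwards [h10] with t ht
        by_cases h : t ∈ Set.Ioo (-s) s
        · rw [ht h, zero_mul, Pi.zero_apply]
        · simp [h3.supp t h]
      exact hk
  · rintro ⟨s, hs, h, rfl⟩
    exact isDeBrangesSubspace_pw hr hs h


theorem cmat_pwHam (t : ℝ) : cmat (pwHam t) = 1 := by
  ext i j
  fin_cases i <;> fin_cases j <;> simp [cmat, pwHam]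

theorem sympl_mulVec_pwSol (t : ℝ) (z : ℂ) :
    (sympl * cmat (pwHam t)).mulVec (pwSol t z) = ![-Complex.sin (t * z), Complex.cos (t * z)] := by
  rw [cmat_pwHam, mul_one]
  ext i
  fin_cases i <;> simp [sympl, pwSol, Matrix.mulVec, dotProduct, Fin.sum_univ_two]

theorem hasDerivAt_cos_mul (z : ℂ) (t : ℝ) :
    HasDerivAt (fun t : ℝ => Complex.cos (t * z)) (z * -Complex.sin (t * z)) t := by
  have h : HasDerivAt (fun t : ℂ => Complex.cos (t * z)) (z * -Complex.sin (t * z)) (t : ℂ) := by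
    have := (Complex.hasDerivAt_cos ((t : ℂ) * z)).comp (t : ℂ) ((hasDerivAt_id (t : ℂ)).mul_const z)
    refine this.congr_deriv ?_
    ring
  exact h.comp_ofReal

theorem hasDerivAt_sin_mul (z : ℂ) (t : ℝ) :
    HasDerivAt (fun t : ℝ => Complex.sin (t * z)) (z * Complex.cos (t * z)) t := by
  have h : HasDerivAt (fun t : ℂ => Complex.sin (t * z)) (z * Complex.cos (t * z)) (t : ℂ) := by
    have := (Complex.hasDerivAt_sin ((t : ℂ) * z)).comp (t : ℂ) ((hasDerivAt_id (t : ℂ)).mul_const z)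
    refine this.congr_deriv ?_
    ring
  exact h.comp_ofReal

theorem mul_integral_sin (z : ℂ) (a b : ℝ) :
    z * ∫ s in a..b, -Complex.sin (s * z) = Complex.cos (b * z) - Complex.cos (a * z) := by
  rw [← intervalIntegral.integral_const_mul]
  exact intervalIntegral.integral_eq_sub_of_hasDerivAt (fun t _ => hasDerivAt_cos_mul z t)
    (Continuous.intervalIntegrable (by fun_prop) _ _)

theorem mul_integral_cos (z : ℂ) (a b : ℝ) :
    z * ∫ s in a..b, Complex.cos (s * z) = Complex.sin (b * z) - Complex.sin (a * z) := by
  rw [← intervalIntegral.integral_const_mul]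
  exact intervalIntegral.integral_eq_sub_of_hasDerivAt (fun t _ => hasDerivAt_sin_mul z t)
    (Continuous.intervalIntegrable (by fun_prop) _ _)

theorem isCanonicalSolution_pwSol (I : Set ℝ) : IsCanonicalSolution pwHam I pwSol := by
  refine fun z => ⟨Continuous.continuousOn ?_, fun a _ b _ i => ?_⟩
  · refine continuous_pi fun i => ?_
    fin_cases i <;> simp only [pwSol, Fin.zero_eta, Fin.mk_one, Matrix.cons_val_zero,
      Matrix.cons_val_one] <;> fun_prop
  · simp only [sympl_mulVec_pwSol]
    fin_cases i
    · simpa [pwSol] using (mul_integral_sin z a b).symm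
    · simpa [pwSol] using (mul_integral_cos z a b).symm

theorem isFundamentalSolution_rotation (r : ℝ) : IsFundamentalSolution pwHam r (fun t z =>
    !![Complex.cos (t * z), Complex.sin (t * z); -Complex.sin (t * z), Complex.cos (t * z)]) := by
  refine fun z => ⟨?_, fun i j => Continuous.continuousOn ?_, fun t _ i j => ?_⟩
  · ext i j
    fin_cases i <;> fin_cases j <;> simp
  · fin_cases i <;> fin_cases j <;> simp <;> fun_prop
  · simp only [cmat_pwHam, mul_one]
    have h1 := mul_integral_sin z 0 t
    have h2 := mul_integral_cos z 0 t
    simp only [Complex.ofReal_zero, zero_mul, Complex.cos_zero, Complex.sin_zero, sub_zero] at h1 h2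
    fin_cases i <;> fin_cases j
    · simpa [sympl, Matrix.mul_apply, Fin.sum_univ_two] using h2.symm
    · simp only [sympl, Matrix.mul_apply, Fin.sum_univ_two]
      simp at h1 ⊢
      linear_combination h1
    · simp only [sympl, Matrix.mul_apply, Fin.sum_univ_two]
      simp at h1 ⊢
      rw [h1]
    · simpa [sympl, Matrix.mul_apply, Fin.sum_univ_two] using h2.symm

theorem isRegularPoint_pwHam (I : Set ℝ) (t : ℝ) : IsRegularPoint pwHam I t := by
  rintro ⟨a, b, θ, -, ht, h⟩
  have hne : (ae (volume.restrict (Set.Ioo a b))).NeBot := by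
    rw [ae_neBot, Ne, Measure.restrict_eq_zero, Real.volume_Ioo]
    simpa using ht.1.trans ht.2
  obtain ⟨s, hs⟩ := h.exists
  rw [pwHam, mul_one] at hs
  have h0 := congrFun hs 0
  have h1 := congrFun hs 1
  simp [Matrix.vecMul, dotProduct, Fin.sum_univ_two] at h0 h1
  have := Real.sin_sq_add_cos_sq θ
  rw [h0, h1] at this
  norm_num at this

theorem isHamiltonian_pwHam (I : Set ℝ) : IsHamiltonian pwHam I where
  nonneg := Eventually.of_forall fun _ => Matrix.PosSemidef.one
  ne_zero := Eventually.of_forall fun _ => one_ne_zero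
  symm _ _ := Matrix.transpose_one
  locInt i j := (locallyIntegrable_const (pwHam 0 i j)).locallyIntegrableOn I

theorem tendsto_abKernel_cos_sin (z : ℂ) :
    Tendsto (fun t => abKernel (fun w => pwSol t w 0) (fun w => pwSol t w 1) z z)
      (𝓝[>] 0) (𝓝 0) := by
  refine Tendsto.mono_left ?_ nhdsWithin_le_nhds
  simp only [pwSol, Matrix.cons_val_zero, Matrix.cons_val_one, abKernel_cos_sin]
  have hc : Continuous fun t : ℝ => (Real.pi : ℂ)⁻¹ * (if z = conj z then (t : ℂ) else
      Complex.sin (t * (z - conj z)) / (z - conj z)) := by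
    split_ifs <;> fun_prop
  simpa using hc.tendsto 0

theorem isStructureHamiltonian_pwHam (r : ℝ) (hr : 0 < r) :
    IsStructureHamiltonian (pwHB r hr) pwHam 0 r where
  lt := hr
  ham := isHamiltonian_pwHam _
  limitCircle := ⟨r / 2, ⟨by linarith, by linarith⟩,
    integrableOn_const (C := (pwHam 0).trace) (by simp)⟩
  sol := by
    refine ⟨pwSol, fun t => if ht : 0 < t then pwHB t ht else pwHB r hr,
      isCanonicalSolution_pwSol _, fun z => ⟨?_, ?_⟩, fun t ht z => ?_, ?_,
      tendsto_abKernel_cos_sin⟩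
    · simp [pwSol, pw_A]
    · simp [pwSol, pw_B]
    · simp only [dif_pos ht.1, pwSol, Matrix.cons_val_zero, Matrix.cons_val_one]
      have h1 := Complex.exp_mul_I (-((t : ℂ) * z))
      rw [Complex.cos_neg, Complex.sin_neg] at h1
      rw [pwHB_apply, show -(Complex.I * t * z) = -((t : ℂ) * z) * Complex.I by ring, h1]
      ring
    · ext V
      simp only [Set.mem_ofPred_eq, isDeBrangesSubspace_pw_iff]
      constructor
      · rintro ⟨s, hs, h, rfl⟩
        exact ⟨s, ⟨hs, h⟩, isRegularPoint_pwHam _ _, by rw [dif_pos hs]⟩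
      · rintro ⟨s, ⟨hs, h⟩, -, hV⟩
        rw [dif_pos hs] at hV
        exact ⟨s, hs, h, hV⟩


theorem node_ne_zero {r : ℝ} (hr : 0 < r) (n : ℤ) : node r n ≠ 0 := by
  have h : (2 * (n : ℝ) - 1) ≠ 0 := by
    have : (2 * n - 1 : ℤ) ≠ 0 := by omega
    exact_mod_cast this
  exact div_ne_zero (mul_ne_zero Real.pi_ne_zero h) (by positivity)

theorem node_reflect (r : ℝ) (n : ℤ) : node r (1 - n) = -node r n := by
  simp only [node]
  push_cast
  ring

theorem node_injective {r : ℝ} (hr : 0 < r) : Function.Injective (node r) := by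
  intro n m h
  simp only [node] at h
  rw [div_left_inj' (by positivity)] at h
  have := mul_left_cancel₀ Real.pi_ne_zero h
  have h2 : (n : ℝ) = m := by linarith
  exact_mod_cast h2

theorem r_mul_node {r : ℝ} (hr : 0 < r) (n : ℤ) : r * node r n = Real.pi * n - Real.pi / 2 := by
  simp only [node]
  field_simp

theorem summable_node_inv_sq {r : ℝ} (hr : 0 < r) : Summable fun n : ℤ => 1 / node r n ^ 2 := by
  have h := (Real.summable_one_div_int_add_rpow (-(1 / 2)) 2).2 (by norm_num)
  refine (h.mul_left ((r / Real.pi) ^ 2)).congr fun n => ?_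
  have e : node r n = Real.pi / r * (n + -(1 / 2)) := by
    simp only [node]
    field_simp
    ring
  rw [Real.rpow_two, sq_abs, e]
  by_cases h0 : (n : ℝ) + -(1 / 2) = 0
  · rw [h0]; simp
  · have := Real.pi_ne_zero
    field_simp

theorem pwTheta_node {r : ℝ} (hr : 0 < r) (n : ℤ) : pwTheta r (node r n) = -1 := by
  have h := r_mul_node hr n
  have h' : (r : ℂ) * node r n = Real.pi * n - Real.pi / 2 := by exact_mod_cast congrArg Complex.ofReal h
  rw [pwTheta, show 2 * Complex.I * r * (node r n : ℂ) =
    n * (2 * Real.pi * Complex.I) - Real.pi * Complex.I by linear_combination 2 * Complex.I * h',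
    Complex.exp_sub, Complex.exp_int_mul_two_pi_mul_I, Complex.exp_pi_mul_I]
  norm_num

theorem pwTheta_eq_neg_one_iff {r : ℝ} (hr : 0 < r) (z : ℂ) :
    pwTheta r z = -1 ↔ ∃ n : ℤ, z = node r n := by
  constructor
  · intro h
    rw [pwTheta, ← Complex.exp_pi_mul_I, Complex.exp_eq_exp_iff_exists_int] at h
    obtain ⟨n, hn⟩ := h
    refine ⟨n + 1, ?_⟩
    have hrc : (r : ℂ) ≠ 0 := Complex.ofReal_ne_zero.2 hr.ne'
    have h2 : (2 : ℂ) * r * z = Real.pi + n * (2 * Real.pi) := by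
      apply mul_right_cancel₀ Complex.I_ne_zero
      linear_combination hn
    simp only [node]
    push_cast
    field_simp
    linear_combination h2
  · rintro ⟨n, rfl⟩
    exact pwTheta_node hr n

theorem levelSet_pwTheta {r : ℝ} (hr : 0 < r) : levelSet (pwTheta r) = Set.range (node r) := by
  ext x
  rw [levelSet, Set.mem_ofPred_eq, pwTheta_eq_neg_one_iff hr]
  simp only [Set.mem_range, Complex.ofReal_inj, eq_comm]

theorem hasDerivAt_pwTheta (r : ℝ) (z : ℂ) :
    HasDerivAt (pwTheta r) (2 * Complex.I * r * pwTheta r z) z := by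
  have := (Complex.hasDerivAt_exp (2 * Complex.I * r * z)).comp z
    ((hasDerivAt_id z).const_mul (2 * Complex.I * r))
  refine this.congr_deriv ?_
  rw [pwTheta]
  ring

theorem norm_deriv_pwTheta_node {r : ℝ} (hr : 0 < r) (n : ℤ) :
    ‖deriv (pwTheta r) (node r n)‖ = 2 * r := by
  rw [(hasDerivAt_pwTheta r _).deriv, pwTheta_node hr]
  simp [abs_of_pos hr]

theorem level_weight {r : ℝ} (hr : 0 < r) (n : ℤ) :
    2 * Real.pi / ‖deriv (pwTheta r) (node r n)‖ = Real.pi / r := by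
  rw [norm_deriv_pwTheta_node hr]
  field_simp

theorem levelMeasure_pwTheta {r : ℝ} (hr : 0 < r) :
    levelMeasure (pwTheta r) = Measure.sum fun n : ℤ =>
      ENNReal.ofReal (Real.pi / r) • Measure.dirac (node r n) := by
  let e : ℤ ≃ levelSet (pwTheta r) :=
    (Equiv.ofInjective (node r) (node_injective hr)).trans (Equiv.setCongr (levelSet_pwTheta hr).symm)
  have he : ∀ n, ((e n : levelSet (pwTheta r)) : ℝ) = node r n := fun n => rfl
  ext s hs
  rw [levelMeasure, Measure.sum_apply _ hs, Measure.sum_apply _ hs, ← e.tsum_eq]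
  refine tsum_congr fun n => ?_
  rw [he, level_weight hr]

theorem pwTau_eq {r : ℝ} (hr : 0 < r) :
    pwTau r = Measure.sum fun n : ℤ => ENNReal.ofReal (1 / r) • Measure.dirac (node r n) := by
  rw [pwTau, levelMeasure_pwTheta hr]
  ext s hs
  rw [Measure.smul_apply, Measure.sum_apply _ hs, Measure.sum_apply _ hs, smul_eq_mul,
    ← ENNReal.tsum_mul_left]
  refine tsum_congr fun n => ?_
  rw [Measure.smul_apply, Measure.smul_apply, smul_eq_mul, smul_eq_mul, ← mul_assoc,
    ← ENNReal.ofReal_mul (by positivity)]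
  congr 2
  have := Real.pi_ne_zero
  field_simp

theorem norm_pwTheta (r : ℝ) (z : ℂ) : ‖pwTheta r z‖ = Real.exp (-(2 * r * z.im)) := by
  rw [pwTheta, Complex.norm_exp]
  congr 1
  simp

theorem isMeromorphicInner_pwTheta {r : ℝ} (hr : 0 < r) : IsMeromorphicInner (pwTheta r) where
  mero z := by
    have : Differentiable ℂ (pwTheta r) := fun z => (hasDerivAt_pwTheta r z).differentiableAt
    exact (this.analyticAt z).meromorphicAt
  holo := fun z _ => (hasDerivAt_pwTheta r z).differentiableAt.differentiableWithinAt
  bdd := ⟨1, fun z hz => by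
    have : 0 < z.im := hz
    rw [norm_pwTheta, Real.exp_le_one_iff, neg_nonpos]
    positivity⟩
  boundary := Eventually.of_forall fun x => by
    refine Tendsto.mono_left ?_ nhdsWithin_le_nhds
    have hc : Continuous fun y : ℝ => ‖pwTheta r (x + y * Complex.I)‖ := by
      unfold pwTheta
      fun_prop
    have h := hc.tendsto 0
    simpa [norm_pwTheta] using h

theorem pwTheta_eq_div {r : ℝ} (hr : 0 < r) (z : ℂ) :
    pwTheta r z = sharp (pwHB r hr) z / pwHB r hr z := by
  rw [div_pwHB, sharp, pwHB_apply, ← Complex.exp_conj, ← Complex.exp_add, pwTheta]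
  congr 1
  simp
  ring

theorem pw_S {r : ℝ} (hr : 0 < r) (θ : ℝ) (z : ℂ) :
    (pwHB r hr).S θ z = -2 * Complex.I * Complex.sin (r * z - θ) := by
  rw [HB.S, sharp, pwHB_apply, pwHB_apply, ← Complex.exp_conj, ← Complex.exp_add,
    ← Complex.exp_add, Complex.sin]
  have e1 : (θ : ℂ) * Complex.I + -(Complex.I * r * z) = -(r * z - θ) * Complex.I := by ring
  have e2 : -((θ : ℂ) * Complex.I) + conj (-(Complex.I * r * conj z)) = (r * z - θ) * Complex.I := by
    simp
    ring
  rw [e1, e2]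
  linear_combination (Complex.exp (-(r * z - θ) * Complex.I) -
    Complex.exp ((r * z - θ) * Complex.I)) * Complex.I_sq

theorem tendsto_fourierC_ofReal (φ : ℝ → ℂ) :
    Tendsto (fun x : ℝ => fourierC φ x) atTop (𝓝 0) := by
  have h2 : Tendsto (fun x : ℝ => -(x / (2 * Real.pi))) atTop atBot :=
    tendsto_neg_atTop_atBot.comp (tendsto_id.atTop_div_const Real.two_pi_pos)
  have h3 := ((Real.tendsto_integral_exp_smul_cocompact φ).mono_left atBot_le_cocompact).comp h2
  refine h3.congr fun x => ?_
  rw [Function.comp_apply, fourierC]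
  refine integral_congr_ae (Eventually.of_forall fun t => ?_)
  simp only [Circle.smul_def, Real.fourierChar_apply, smul_eq_mul]
  rw [mul_comm]
  congr 2
  push_cast
  have : (Real.pi : ℂ) ≠ 0 := by exact_mod_cast Real.pi_ne_zero
  field_simp

theorem pw_S_notMem {r : ℝ} (hr : 0 < r) (θ : ℝ) :
    (pwHB r hr).S θ ∉ deBrangesSubmodule (pwHB r hr) := by
  intro h
  obtain ⟨φ, h1, h2⟩ := exists_pwFun_of_mem hr h
  have h3 := tendsto_fourierC_ofReal φ
  simp only [← h2, pw_S] at h3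
  have h4 : Tendsto (fun n : ℕ => (θ + Real.pi / 2 + n * (2 * Real.pi)) / r) atTop atTop :=
    (tendsto_atTop_add_const_left _ _
      (tendsto_natCast_atTop_atTop.atTop_mul_const Real.two_pi_pos)).atTop_div_const hr
  have h5 := h3.comp h4
  have h6 : ∀ n : ℕ, -2 * Complex.I * Complex.sin
      (r * (((θ + Real.pi / 2 + n * (2 * Real.pi)) / r : ℝ) : ℂ) - θ) = -2 * Complex.I := fun n => by
    have hrc : (r : ℂ) ≠ 0 := Complex.ofReal_ne_zero.2 hr.ne'
    have : (r : ℂ) * (((θ + Real.pi / 2 + n * (2 * Real.pi)) / r : ℝ) : ℂ) - θ =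
        Real.pi / 2 + n * (2 * Real.pi) := by
      push_cast
      field_simp
      ring
    rw [this, Complex.sin_add_nat_mul_two_pi, Complex.sin_pi_div_two, mul_one]
  have h7 : Tendsto (fun _ : ℕ => -2 * Complex.I) atTop (𝓝 0) :=
    h5.congr fun n => h6 n
  have := tendsto_nhds_unique h7 tendsto_const_nhds
  simp at this


theorem one_add_pwTheta (r : ℝ) (z : ℂ) :
    1 + pwTheta r z = 2 * Complex.exp (Complex.I * r * z) * Complex.cos (r * z) := by
  rw [Complex.cos, pwTheta, show 2 * Complex.I * r * z = Complex.I * r * z + Complex.I * r * z by ring,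
    Complex.exp_add, show (r : ℂ) * z * Complex.I = Complex.I * r * z by ring,
    show -((r : ℂ) * z) * Complex.I = -(Complex.I * r * z) by ring, Complex.exp_neg]
  have := Complex.exp_ne_zero (Complex.I * r * z)
  field_simp
  ring

theorem I_mul_one_sub_pwTheta (r : ℝ) (z : ℂ) :
    Complex.I * (1 - pwTheta r z) = 2 * Complex.exp (Complex.I * r * z) * Complex.sin (r * z) := by
  rw [Complex.sin, pwTheta, show 2 * Complex.I * r * z = Complex.I * r * z + Complex.I * r * z by ring,
    Complex.exp_add, show (r : ℂ) * z * Complex.I = Complex.I * r * z by ring,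
    show -((r : ℂ) * z) * Complex.I = -(Complex.I * r * z) by ring, Complex.exp_neg]
  have := Complex.exp_ne_zero (Complex.I * r * z)
  field_simp

theorem pw_Q_eq_tan (r : ℝ) (z : ℂ) :
    Complex.I * (1 - pwTheta r z) / (1 + pwTheta r z) = Complex.tan (r * z) := by
  rw [one_add_pwTheta, I_mul_one_sub_pwTheta, Complex.tan, mul_div_mul_left]
  exact mul_ne_zero two_ne_zero (Complex.exp_ne_zero _)

theorem cos_eq_zero_iff_node {r : ℝ} (hr : 0 < r) (z : ℂ) :
    Complex.cos (r * z) = 0 ↔ ∃ n : ℤ, z = node r n := by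
  rw [← pwTheta_eq_neg_one_iff hr, eq_neg_iff_add_eq_zero, add_comm, one_add_pwTheta, mul_eq_zero,
    mul_eq_zero]
  simp [Complex.exp_ne_zero]

theorem ne_node_of_im_pos {r : ℝ} {z : ℂ} (hz : 0 < z.im) (n : ℤ) : z ≠ node r n := by
  rintro rfl
  simp at hz

theorem norm_pwTheta_lt_one {r : ℝ} (hr : 0 < r) {z : ℂ} (hz : 0 < z.im) : ‖pwTheta r z‖ < 1 := by
  rw [norm_pwTheta, Real.exp_lt_one_iff, neg_lt_zero]
  positivity

theorem isNevanlinna_tan {r : ℝ} (hr : 0 < r) : IsNevanlinna fun z => Complex.tan (r * z) := by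
  refine ⟨fun z hz => ?_, fun z hz => ?_⟩
  · have h : Complex.cos (r * z) ≠ 0 := fun h0 => by
      obtain ⟨n, hn⟩ := (cos_eq_zero_iff_node hr z).1 h0
      exact ne_node_of_im_pos hz n hn
    exact ((Complex.differentiableAt_tan.2 h).comp z
      (differentiableAt_id.const_mul (r : ℂ))).differentiableWithinAt
  · have h := norm_pwTheta_lt_one hr (z := z) hz
    have h' : Complex.normSq (pwTheta r z) < 1 := by
      rw [Complex.normSq_eq_norm_sq]
      nlinarith [norm_nonneg (pwTheta r z)]
    simp only [← pw_Q_eq_tan, Complex.div_im]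
    generalize pwTheta r z = w at h'
    rw [Complex.normSq_apply] at h'
    rw [← sub_div]
    refine div_nonneg ?_ (Complex.normSq_nonneg _)
    simp
    nlinarith

theorem tendsto_tan_div {r : ℝ} (hr : 0 < r) :
    Tendsto (fun y : ℝ => Complex.tan (r * (y * Complex.I)) / y) atTop (𝓝 0) := by
  refine squeeze_zero_norm' (a := fun y : ℝ => 1 / y) ?_ (tendsto_const_nhds.div_atTop tendsto_id)
  filter_upwards [eventually_gt_atTop 0] with y hy
  rw [norm_div, Complex.norm_real, Real.norm_of_nonneg hy.le]
  refine div_le_div_of_nonneg_right ?_ hy.le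
  rw [← pw_Q_eq_tan, norm_div, norm_mul, Complex.norm_I, one_mul]
  have e : pwTheta r (y * Complex.I) = ((Real.exp (-(2 * r * y)) : ℝ) : ℂ) := by
    rw [pwTheta, Complex.ofReal_exp]
    congr 1
    push_cast
    linear_combination 2 * r * y * Complex.I_sq
  have h1 : Real.exp (-(2 * r * y)) ≤ 1 := by
    rw [Real.exp_le_one_iff, neg_nonpos]
    positivity
  have h0 := Real.exp_pos (-(2 * r * y))
  rw [e]
  generalize Real.exp (-(2 * r * y)) = u at h0 h1
  rw [← Complex.ofReal_one, ← Complex.ofReal_sub, ← Complex.ofReal_add, Complex.norm_real,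
    Complex.norm_real, Real.norm_of_nonneg (by linarith), Real.norm_of_nonneg (by linarith),
    div_le_one (by linarith)]
  linarith

theorem cot_pi_mul (r : ℝ) (z : ℂ) :
    Complex.cot (Real.pi * (1 / 2 + r * z / Real.pi)) = -Complex.tan (r * z) := by
  have hpi : (Real.pi : ℂ) ≠ 0 := by exact_mod_cast Real.pi_ne_zero
  rw [show (Real.pi : ℂ) * (1 / 2 + r * z / Real.pi) = r * z + Real.pi / 2 by field_simp; ring,
    Complex.cot, Complex.cos_add_pi_div_two, Complex.sin_add_pi_div_two, Complex.tan, neg_div]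

theorem sum_Icc_neg_eq {M : Type*} [AddCommGroup M] (f : ℤ → M) (N : ℕ) :
    ∑ n ∈ Finset.Icc (-(N : ℤ)) N, f n =
      f 0 + ∑ n ∈ Finset.range N, (f (n + 1) + f (-(n + 1))) := by
  induction N with
  | zero => simp
  | succ N ih =>
    rw [Nat.cast_add, Nat.cast_one, Finset.sum_Icc_succ_eq_add_endpoints, ih, Finset.sum_range_succ]
    abel

theorem tendsto_tan {r : ℝ} (hr : 0 < r) {z : ℂ} (hz : ∀ n : ℤ, z ≠ node r n) :
    Tendsto (fun N : ℕ => (1 / r : ℂ) * ∑ n ∈ Finset.Icc (-(N : ℤ)) N, 1 / (node r n - z))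
      atTop (𝓝 (Complex.tan (r * z))) := by
  have hpi : (Real.pi : ℂ) ≠ 0 := by exact_mod_cast Real.pi_ne_zero
  have hrc : (r : ℂ) ≠ 0 := Complex.ofReal_ne_zero.2 hr.ne'
  set x : ℂ := 1 / 2 + r * z / Real.pi with hx
  have hnx : ∀ n : ℤ, (node r n : ℂ) - z = Real.pi / r * (n - x) := fun n => by
    simp only [node, hx]
    push_cast
    field_simp
    ring
  have hxc : x ∈ Complex.integerComplement := by
    rw [Complex.mem_integerComplement_iff]
    rintro ⟨n, hn⟩
    refine hz n ?_
    have := hnx n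
    rw [hn, sub_self, mul_zero, sub_eq_zero] at this
    exact this.symm
  have h1 := (tendsto_logDeriv_euler_cot_sub hxc).const_add (1 / x)
  rw [hx, cot_pi_mul, ← hx] at h1
  have h2 := h1.const_mul (-(1 / Real.pi : ℂ))
  have e : -(1 / Real.pi : ℂ) * (1 / x + (Real.pi * -Complex.tan (r * z) - 1 / x)) =
      Complex.tan (r * z) := by
    field_simp
    ring
  rw [e] at h2
  refine h2.congr fun N => ?_
  rw [sum_Icc_neg_eq]
  have e2 : ∀ n : ℤ, 1 / ((node r n : ℂ) - z) = -(r / Real.pi) * (1 / (x - n)) := fun n => by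
    rw [hnx, ← neg_sub x, one_div, one_div, mul_inv, inv_neg, inv_div]
    ring
  simp only [e2, cotTerm, ← mul_add, ← Finset.mul_sum, Int.cast_zero, sub_zero]
  push_cast
  simp only [sub_neg_eq_add]
  field_simp

theorem tendsto_sum_Icc_of_hasSum {M : Type*} [AddCommMonoid M] [TopologicalSpace M] {f : ℤ → M}
    {a : M} (h : HasSum f a) :
    Tendsto (fun N : ℕ => ∑ n ∈ Finset.Icc (-(N : ℤ)) N, f n) atTop (𝓝 a) := by
  have h' : Tendsto (fun s => ∑ n ∈ s, f n) atTop (𝓝 a) := by simpa [HasSum] using h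
  refine h'.comp (tendsto_atTop_finset_of_monotone (fun a b hab => ?_) fun n => ?_)
  · exact Finset.Icc_subset_Icc (by omega) (by omega)
  · exact ⟨n.natAbs, by rw [Finset.mem_Icc]; omega⟩

theorem sum_Icc_of_odd {M : Type*} [AddCommGroup M] {f : ℤ → M} (h : ∀ n, f (1 - n) = -f n)
    (N : ℕ) : ∑ n ∈ Finset.Icc (-(N : ℤ)) N, f n = f (-N) := by
  induction N with
  | zero => simp
  | succ N ih =>
    rw [Nat.cast_add, Nat.cast_one, Finset.sum_Icc_succ_eq_add_endpoints, ih]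
    have := h (-N)
    rw [sub_neg_eq_add, add_comm] at this
    rw [this]
    abel

theorem HasSum.reflect {M : Type*} [AddCommMonoid M] [TopologicalSpace M] {f : ℤ → M} {a : M}
    (h : HasSum f a) : HasSum (fun n => f (1 - n)) a :=
  (Equiv.subLeft (1 : ℤ)).hasSum_iff.2 h

theorem hasSum_of_odd {f : ℤ → ℂ} (h : ∀ n, f (1 - n) = -f n) (hf : Summable f) :
    HasSum f 0 := by
  obtain ⟨a, ha⟩ := hf
  have h1 := HasSum.reflect ha
  simp only [h] at h1
  rwa [self_eq_neg.1 (h1.unique ha.neg)] at ha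

theorem tendsto_norm_node {r : ℝ} (hr : 0 < r) (C : ℝ) : ∀ᶠ n in cofinite, C ≤ |node r n| := by
  have h := (summable_node_inv_sq hr).tendsto_cofinite_zero
  have h1 : (0 : ℝ) < 1 / (C ^ 2 + 1) := by positivity
  filter_upwards [(tendsto_order.1 h).2 _ h1] with n hn
  have h2 : 0 < node r n ^ 2 := by have := node_ne_zero hr n; positivity
  rw [one_div_lt_one_div h2 (by positivity)] at hn
  exact (le_abs_self C).trans (sq_le_sq.1 (by linarith))

theorem tendsto_node_neg_nat {r : ℝ} (hr : 0 < r) :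
    Tendsto (fun N : ℕ => 1 / (node r (-N) : ℂ)) atTop (𝓝 0) := by
  have h : Tendsto (fun n : ℤ => 1 / (node r n : ℂ)) cofinite (𝓝 0) := by
    rw [tendsto_zero_iff_norm_tendsto_zero]
    have h1 := (summable_node_inv_sq hr).tendsto_cofinite_zero
    have h2 := (Real.continuous_sqrt.tendsto 0).comp h1
    rw [Real.sqrt_zero] at h2
    refine h2.congr fun n => ?_
    rw [Function.comp_apply, Real.sqrt_div zero_le_one, Real.sqrt_one, Real.sqrt_sq_eq_abs, norm_div,
      norm_one, Complex.norm_real, Real.norm_eq_abs]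
  refine h.comp ?_
  rw [← Nat.cofinite_eq_atTop]
  exact Function.Injective.tendsto_cofinite fun a b hab => by simpa using hab

theorem tendsto_sum_inv_node {r : ℝ} (hr : 0 < r) :
    Tendsto (fun N : ℕ => ∑ n ∈ Finset.Icc (-(N : ℤ)) N, 1 / (node r n : ℂ)) atTop (𝓝 0) := by
  refine (tendsto_node_neg_nat hr).congr fun N => ?_
  rw [sum_Icc_of_odd fun n => ?_]
  rw [node_reflect]
  push_cast
  rw [one_div_neg_eq_neg_one_div]

theorem summable_node_mul_sub {r : ℝ} (hr : 0 < r) (z : ℂ) :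
    Summable fun n : ℤ => 1 / ((node r n : ℂ) * (node r n - z)) := by
  refine Summable.of_norm_bounded_eventually ((summable_node_inv_sq hr).mul_left 2) ?_
  filter_upwards [tendsto_norm_node hr (2 * ‖z‖)] with n hn
  have h0 : 0 < |node r n| := abs_pos.2 (node_ne_zero hr n)
  have h1 : |node r n| / 2 ≤ ‖(node r n : ℂ) - z‖ := by
    have := norm_sub_norm_le (node r n : ℂ) z
    rw [Complex.norm_real, Real.norm_eq_abs] at this
    linarith
  rw [norm_div, norm_one, norm_mul, Complex.norm_real, Real.norm_eq_abs, ← sq_abs (node r n)]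
  calc 1 / (|node r n| * ‖(node r n : ℂ) - z‖) ≤ 1 / (|node r n| * (|node r n| / 2)) :=
        one_div_le_one_div_of_le (by positivity) (mul_le_mul_of_nonneg_left h1 h0.le)
    _ = 2 * (1 / |node r n| ^ 2) := by field_simp

theorem hasSum_tan {r : ℝ} (hr : 0 < r) {z : ℂ} (hz : ∀ n : ℤ, z ≠ node r n) :
    HasSum (fun n : ℤ => (1 / r : ℂ) * (z / (node r n * (node r n - z))))
      (Complex.tan (r * z)) := by
  have hs : Summable fun n : ℤ => (1 / r : ℂ) * (z / (node r n * (node r n - z))) := by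
    refine ((summable_node_mul_sub hr z).mul_left ((1 / r : ℂ) * z)).congr fun n => ?_
    ring
  have h1 := tendsto_sum_Icc_of_hasSum hs.hasSum
  have h2 := (tendsto_tan hr hz).sub ((tendsto_sum_inv_node hr).const_mul (1 / r : ℂ))
  rw [mul_zero, sub_zero] at h2
  have h3 : Tendsto (fun N : ℕ => ∑ n ∈ Finset.Icc (-(N : ℤ)) N,
      (1 / r : ℂ) * (z / (node r n * (node r n - z)))) atTop (𝓝 (Complex.tan (r * z))) := by
    refine h2.congr fun N => ?_
    rw [← Finset.mul_sum, ← mul_sub, ← Finset.sum_sub_distrib]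
    congr 1
    refine Finset.sum_congr rfl fun n _ => ?_
    have h4 : (node r n : ℂ) - z ≠ 0 := sub_ne_zero.2 (hz n).symm
    have h5 : (node r n : ℂ) ≠ 0 := Complex.ofReal_ne_zero.2 (node_ne_zero hr n)
    field_simp
    ring
  rw [← tendsto_nhds_unique h1 h3]
  exact hs.hasSum

theorem summable_norm_mul_pwTau_iff {r : ℝ} {f : ℝ → ℂ} (hr : 0 < r) :
    Integrable f (pwTau r) ↔ Summable fun n : ℤ => ‖f (node r n)‖ := by
  rw [pwTau_eq hr, integrable_sum_dirac_iff fun _ => ENNReal.ofReal_ne_top]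
  rw [summable_mul_left_iff]
  rw [ENNReal.toReal_ofReal (by positivity)]
  positivity

theorem hasSum_integral_pwTau {r : ℝ} {f : ℝ → ℂ} (hr : 0 < r)
    (hf : Summable fun n : ℤ => ‖f (node r n)‖) :
    HasSum (fun n : ℤ => (1 / r : ℂ) * f (node r n)) (∫ γ, f γ ∂(pwTau r)) := by
  have := hasSum_integral_sum_dirac (x := node r) (c := fun _ : ℤ => ENNReal.ofReal (1 / r)) (f := f)
    (fun _ => ENNReal.ofReal_ne_top) (hf.mul_left _)
  rw [← pwTau_eq hr] at this
  refine this.congr_fun fun n => ?_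
  rw [ENNReal.toReal_ofReal (by positivity)]
  simp

theorem summable_odd_part {r : ℝ} (hr : 0 < r) :
    Summable fun n : ℤ => 1 / ((node r n : ℂ) * (1 + (node r n : ℂ) ^ 2)) := by
  refine Summable.of_norm_bounded (summable_node_inv_sq hr) fun n => ?_
  have h0 : 0 < |node r n| := abs_pos.2 (node_ne_zero hr n)
  have e : ‖(1 : ℂ) + (node r n : ℂ) ^ 2‖ = 1 + |node r n| ^ 2 := by
    rw [sq_abs, ← Complex.ofReal_pow, ← Complex.ofReal_one, ← Complex.ofReal_add, Complex.norm_real,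
      Real.norm_of_nonneg (by positivity)]
  rw [norm_div, norm_one, norm_mul, e, Complex.norm_real, Real.norm_eq_abs, ← sq_abs (node r n)]
  exact one_div_le_one_div_of_le (by positivity) (by nlinarith [sq_nonneg (|node r n| - 1)])

theorem hasSum_odd_part {r : ℝ} (hr : 0 < r) :
    HasSum (fun n : ℤ => 1 / ((node r n : ℂ) * (1 + (node r n : ℂ) ^ 2))) 0 := by
  refine hasSum_of_odd (fun n => ?_) (summable_odd_part hr)
  rw [node_reflect]
  push_cast
  rw [neg_sq, neg_mul, one_div_neg_eq_neg_one_div]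

theorem tan_integral_rep {r : ℝ} (hr : 0 < r) {z : ℂ} (hz : z ∈ upperHalf) :
    Integrable (fun γ : ℝ => 1 / ((γ : ℂ) - z) - γ / (1 + (γ : ℂ) ^ 2)) (pwTau r) ∧
      Complex.tan (r * z) =
        ∫ γ : ℝ, (1 / ((γ : ℂ) - z) - γ / (1 + (γ : ℂ) ^ 2)) ∂(pwTau r) := by
  have hne := ne_node_of_im_pos (r := r) (z := z) hz
  have e : ∀ n : ℤ, 1 / ((node r n : ℂ) - z) - node r n / (1 + (node r n : ℂ) ^ 2) =
      z / (node r n * (node r n - z)) + 1 / ((node r n : ℂ) * (1 + (node r n : ℂ) ^ 2)) := fun n => by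
    have h4 : (node r n : ℂ) - z ≠ 0 := sub_ne_zero.2 (hne n).symm
    have h5 : (node r n : ℂ) ≠ 0 := Complex.ofReal_ne_zero.2 (node_ne_zero hr n)
    have h6 : (1 : ℂ) + (node r n : ℂ) ^ 2 ≠ 0 := by
      rw [← Complex.ofReal_pow, ← Complex.ofReal_one, ← Complex.ofReal_add]
      exact Complex.ofReal_ne_zero.2 (by positivity)
    field_simp
    ring
  have hs : Summable fun n : ℤ =>
      ‖1 / ((node r n : ℂ) - z) - node r n / (1 + (node r n : ℂ) ^ 2)‖ := by
    simp only [e]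
    refine Summable.norm (Summable.add ?_ (summable_odd_part hr))
    refine ((summable_node_mul_sub hr z).mul_left z).congr fun n => ?_
    ring
  refine ⟨(summable_norm_mul_pwTau_iff hr).2 hs, ?_⟩
  have h1 := hasSum_integral_pwTau (f := fun γ : ℝ => 1 / ((γ : ℂ) - z) - γ / (1 + (γ : ℂ) ^ 2)) hr hs
  have h2 := (hasSum_tan hr hne).add ((hasSum_odd_part hr).mul_left (1 / r : ℂ))
  rw [mul_zero, add_zero] at h2
  refine h2.unique ?_
  simp only [e, mul_add (1 / r : ℂ)] at h1
  exact h1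


theorem norm_exp_I_mul_sub_one_le (t γ : ℝ) : ‖Complex.exp (Complex.I * t * γ) - 1‖ ≤ 2 := by
  refine (norm_sub_le _ _).trans ?_
  rw [Complex.norm_exp]
  simp
  norm_num

theorem norm_pwCoeff_sq_le (r t : ℝ) (n : ℤ) : ‖pwCoeff r t n‖ ^ 2 ≤ 4 * (1 / node r n ^ 2) := by
  rw [pwCoeff, norm_div, div_pow, Complex.norm_real, Real.norm_eq_abs, sq_abs, mul_one_div]
  refine div_le_div_of_nonneg_right ?_ (sq_nonneg _)
  have := norm_exp_I_mul_sub_one_le t (node r n)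
  nlinarith [norm_nonneg (Complex.exp (Complex.I * t * node r n) - 1)]

theorem conj_exp_I_mul (t γ : ℝ) :
    conj (Complex.exp (Complex.I * t * γ)) = Complex.exp (-(Complex.I * t * γ)) := by
  rw [← Complex.exp_conj]
  simp

theorem summable_pwScrewTerm {r : ℝ} (hr : 0 < r) (t : ℝ) :
    Summable fun n : ℤ => pwScrewTerm r t n := by
  refine Summable.mul_left _ (Summable.of_norm_bounded ((summable_node_inv_sq hr).mul_left 2)
    fun n => ?_)
  rw [norm_mul, Real.norm_of_nonneg (by positivity), mul_comm]
  refine mul_le_mul_of_nonneg_right ?_ (by positivity)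
  rw [Real.norm_eq_abs, abs_le]
  constructor <;> linarith [Real.cos_le_one (node r n * t), Real.neg_one_le_cos (node r n * t)]

theorem summable_pwScrewTerm_nat {r : ℝ} (hr : 0 < r) (t : ℝ) :
    Summable fun n : ℕ => pwScrewTerm r t (n + 1) :=
  (summable_pwScrewTerm hr t).comp_injective (i := fun n : ℕ => (n : ℤ) + 1) fun a b h => by
    simpa using h

theorem pwScrewTerm_reflect (r t : ℝ) (n : ℤ) : pwScrewTerm r t (1 - n) = pwScrewTerm r t n := by
  rw [pwScrewTerm, pwScrewTerm, node_reflect, neg_sq, neg_mul, Real.cos_neg]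

theorem hasSum_pwScrewTerm {r : ℝ} (hr : 0 < r) (t : ℝ) :
    HasSum (fun n : ℤ => (pwScrewTerm r t n : ℂ)) (2 * pwScrew r t) := by
  have h := Complex.hasSum_ofReal.2 (summable_pwScrewTerm_nat hr t).hasSum
  have h1 : HasSum (fun n : ℤ => (pwScrewTerm r t (n + 1) : ℂ)) (pwScrew r t + pwScrew r t) := by
    refine HasSum.of_nat_of_neg_add_one h ?_
    refine h.congr_fun fun n => ?_
    rw [show (-((n : ℤ) + 1) + 1) = 1 - ((n : ℤ) + 1) by ring, pwScrewTerm_reflect]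
  rw [two_mul]
  exact (Equiv.addRight (1 : ℤ)).hasSum_iff.1 h1

theorem summable_inv_sq_mul {r : ℝ} (hr : 0 < r) {f : ℤ → ℂ} {C : ℝ} (hf : ∀ n, ‖f n‖ ≤ C) :
    Summable fun n : ℤ => f n / (node r n : ℂ) ^ 2 := by
  refine Summable.of_norm_bounded ((summable_node_inv_sq hr).mul_left C) fun n => ?_
  rw [norm_div, norm_pow, Complex.norm_real, Real.norm_eq_abs, sq_abs, mul_one_div]
  exact div_le_div_of_nonneg_right (hf n) (sq_nonneg _)

theorem hasSum_pwScrew {r : ℝ} (hr : 0 < r) (t : ℝ) :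
    HasSum (fun n : ℤ => (1 / r : ℂ) * ((Complex.exp (Complex.I * t * node r n) - 1) /
      (node r n : ℂ) ^ 2)) (pwScrew r t) := by
  have h1 := (hasSum_pwScrewTerm hr t).mul_left (1 / 2 : ℂ)
  have h2 : HasSum (fun n : ℤ => (Complex.sin (node r n * t)) / (node r n : ℂ) ^ 2) 0 := by
    refine hasSum_of_odd (fun n => ?_) (summable_inv_sq_mul hr (C := 1) fun n => ?_)
    · rw [node_reflect]
      push_cast
      rw [neg_sq, neg_mul, Complex.sin_neg, neg_div]
    · rw [← Complex.ofReal_mul, ← Complex.ofReal_sin, Complex.norm_real, Real.norm_eq_abs]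
      exact Real.abs_sin_le_one _
  have h3 := h1.add (h2.mul_left (Complex.I / r))
  rw [mul_zero, add_zero, ← mul_assoc, one_div, inv_mul_cancel₀ two_ne_zero, one_mul] at h3
  refine h3.congr_fun fun n => ?_
  rw [show Complex.I * t * node r n = (node r n * t) * Complex.I by ring, Complex.exp_mul_I,
    pwScrewTerm]
  have hrc : (r : ℂ) ≠ 0 := Complex.ofReal_ne_zero.2 hr.ne'
  have h5 : (node r n : ℂ) ≠ 0 := Complex.ofReal_ne_zero.2 (node_ne_zero hr n)
  push_cast
  field_simp
  ring

theorem pwScrew_neg (r t : ℝ) : pwScrew r (-t) = pwScrew r t := by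
  simp only [pwScrew, pwScrewTerm, mul_neg, Real.cos_neg]

theorem pwScrew_zero (r : ℝ) : pwScrew r 0 = 0 := by
  simp [pwScrew, pwScrewTerm]

theorem hasSum_screwKernel {r : ℝ} (hr : 0 < r) (t s : ℝ) :
    HasSum (fun n : ℤ => (1 / r : ℂ) * (pwCoeff r t n * conj (pwCoeff r s n)))
      (screwKernel (pwScrew r) t s) := by
  have h := (((hasSum_pwScrew hr (t - s)).sub (hasSum_pwScrew hr t)).sub
    (hasSum_pwScrew hr (-s))).add (hasSum_pwScrew hr 0)
  refine h.congr_fun fun n => ?_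
  have h5 : (node r n : ℂ) ≠ 0 := Complex.ofReal_ne_zero.2 (node_ne_zero hr n)
  rw [pwCoeff, pwCoeff, map_div₀, map_sub, conj_exp_I_mul, map_one, Complex.conj_ofReal]
  push_cast
  rw [show Complex.I * (t - s) * node r n = Complex.I * t * node r n + -(Complex.I * s * node r n) by
    ring, Complex.exp_add,
    show Complex.I * -s * node r n = -(Complex.I * s * node r n) by ring]
  simp only [mul_zero, zero_mul, Complex.exp_zero, sub_self, zero_div, add_zero]
  field_simp
  ring

theorem norm_screwTerm_le {r : ℝ} (hr : 0 < r) (t : ℝ) (n : ℤ) :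
    ‖(1 / r : ℂ) * ((Complex.exp (Complex.I * t * node r n) - 1) / (node r n : ℂ) ^ 2)‖ ≤
      1 / r * 2 * (1 / node r n ^ 2) := by
  rw [norm_mul, norm_div, norm_div, norm_pow, Complex.norm_real, Complex.norm_real,
    Real.norm_of_nonneg hr.le, Real.norm_eq_abs, sq_abs, norm_one, mul_assoc _ (2 : ℝ),
    mul_one_div]
  have h := div_le_div_of_nonneg_right (norm_exp_I_mul_sub_one_le t (node r n))
    (sq_nonneg (node r n))
  exact mul_le_mul_of_nonneg_left h (one_div_pos.2 hr).le

theorem continuous_pwScrew {r : ℝ} (hr : 0 < r) : Continuous (pwScrew r) := by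
  have h : pwScrew r = fun t : ℝ => ∑' n : ℤ, (1 / r : ℂ) *
      ((Complex.exp (Complex.I * t * node r n) - 1) / (node r n : ℂ) ^ 2) :=
    funext fun t => (hasSum_pwScrew hr t).tsum_eq.symm
  rw [h]
  refine continuous_tsum (fun n => by fun_prop) ((summable_node_inv_sq hr).mul_left (1 / r * 2))
    fun n t => norm_screwTerm_le hr t n

/-- The screw function `g_r`. -/
noncomputable def pwScrewFunction (r : ℝ) (hr : 0 < r) : ScrewFunction where
  toFun := pwScrew r
  cont := continuous_pwScrew hr
  hermitian t := by
    rw [pwScrew_neg, pwScrew, Complex.conj_ofReal]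
  nonneg n t ξ := by
    have h := hasSum_sum fun i (_ : i ∈ Finset.univ) => hasSum_sum fun j (_ : j ∈ Finset.univ) =>
      ((hasSum_screwKernel hr (t i) (t j)).mul_right (ξ i)).mul_right (conj (ξ j))
    refine ((Complex.hasSum_re h).nonneg fun m => ?_)
    have e : (∑ i, ∑ j, (1 / r : ℂ) * (pwCoeff r (t i) m * conj (pwCoeff r (t j) m)) * ξ i *
        conj (ξ j)) = ((1 / r * ‖∑ i, pwCoeff r (t i) m * ξ i‖ ^ 2 : ℝ) : ℂ) := by
      push_cast
      rw [← Complex.mul_conj', map_sum, Finset.sum_mul_sum, Finset.mul_sum]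
      refine Finset.sum_congr rfl fun i _ => ?_
      rw [Finset.mul_sum]
      refine Finset.sum_congr rfl fun j _ => ?_
      rw [map_mul]
      ring
    rw [e, Complex.ofReal_re]
    positivity
  zero := pwScrew_zero r

theorem isSpectralMeasure_pwTau {r : ℝ} (hr : 0 < r) :
    IsSpectralMeasure (pwScrewFunction r hr) 0 (pwTau r) := by
  have h0 : ∀ n : ℤ, levyKernel 0 (node r n) = 0 := fun n => by
    simp [levyKernel, node_ne_zero hr n]
  have e : ∀ (t : ℝ) (n : ℤ), levyKernel t (node r n) =
      (Complex.exp (Complex.I * t * node r n) - 1) / (node r n : ℂ) ^ 2 -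
        Complex.I * t * (1 / ((node r n : ℂ) * (1 + (node r n : ℂ) ^ 2))) := fun t n => by
    have h5 : (node r n : ℂ) ≠ 0 := Complex.ofReal_ne_zero.2 (node_ne_zero hr n)
    have h6 : (1 : ℂ) + (node r n : ℂ) ^ 2 ≠ 0 := by
      rw [← Complex.ofReal_pow, ← Complex.ofReal_one, ← Complex.ofReal_add]
      exact Complex.ofReal_ne_zero.2 (by positivity)
    rw [levyKernel, if_neg (node_ne_zero hr n)]
    field_simp
  have hs : ∀ t : ℝ, Summable fun n : ℤ => ‖levyKernel t (node r n)‖ := fun t => by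
    simp only [e]
    exact ((summable_inv_sq_mul hr (fun n => norm_exp_I_mul_sub_one_le t (node r n))).sub
      ((summable_odd_part hr).mul_left _)).norm
  refine ⟨?_, fun t => ⟨(summable_norm_mul_pwTau_iff hr).2 (hs t), ?_⟩⟩
  · have : Integrable (fun γ : ℝ => ((1 / (1 + γ ^ 2) : ℝ) : ℂ)) (pwTau r) := by
      refine (summable_norm_mul_pwTau_iff hr).2 ?_
      refine Summable.of_nonneg_of_le (fun _ => norm_nonneg _) (fun n => ?_) (summable_node_inv_sq hr)
      have h2 : 0 < node r n ^ 2 := by have := node_ne_zero hr n; positivity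
      rw [Complex.norm_real, Real.norm_of_nonneg (by positivity)]
      exact one_div_le_one_div_of_le h2 (by linarith)
    exact this.re
  · have h1 := hasSum_integral_pwTau hr (hs t)
    have h2 := (hasSum_pwScrew hr t).sub
      (((hasSum_odd_part hr).mul_left (Complex.I * t)).mul_left (1 / r : ℂ))
    have h3 : ∫ γ, levyKernel t γ ∂(pwTau r) = pwScrew r t := by
      refine (h2.unique ?_).symm.trans (by ring)
      simpa only [e, mul_sub] using h1
    rw [h3]
    change pwScrew r t = pwScrew r 0 + _ + _
    rw [pwScrew_zero]
    simp

theorem laplace_pwScrew {r : ℝ} (hr : 0 < r) {z : ℂ} (hz : z ∈ upperHalf) :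
    Integrable (fun t : ℝ => pwScrew r t * Complex.exp (Complex.I * z * t))
        (volume.restrict (Set.Ioi 0)) ∧
      ∫ t in Set.Ioi (0 : ℝ), pwScrew r t * Complex.exp (Complex.I * z * t) =
        -(Complex.I / z ^ 2) * Complex.tan (r * z) := by
  have hz' : 0 < z.im := hz
  have hz0 : z ≠ 0 := by rintro rfl; simp at hz'
  have hI : ∀ γ : ℝ, (Complex.I * (z + γ)).re < 0 := fun γ => by simpa using hz'
  have hi : ∀ γ : ℝ, IntegrableOn (fun t : ℝ => Complex.exp (Complex.I * (z + γ) * t))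
      (Set.Ioi 0) := fun γ => integrableOn_exp_mul_complex_Ioi (hI γ) 0
  have hv : ∀ γ : ℝ, ∫ t in Set.Ioi (0 : ℝ), Complex.exp (Complex.I * (z + γ) * t) =
      Complex.I / (z + γ) := fun γ => by
    rw [integral_exp_mul_complex_Ioi (hI γ) 0]
    have : z + γ ≠ 0 := fun h => by
      have := hI γ
      rw [h] at this
      simp at this
    simp only [Complex.ofReal_zero, mul_zero, Complex.exp_zero]
    field_simp
    simp
  have hi0 : IntegrableOn (fun t : ℝ => Complex.exp (Complex.I * z * t)) (Set.Ioi 0) := by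
    simpa using hi 0
  have hv0 : ∫ t in Set.Ioi (0 : ℝ), Complex.exp (Complex.I * z * t) = Complex.I / z := by
    simpa using hv 0
  let F : ℤ → ℝ → ℂ := fun n t => (1 / r : ℂ) * ((Complex.exp (Complex.I * t * node r n) - 1) /
      (node r n : ℂ) ^ 2) * Complex.exp (Complex.I * z * t)
  have hF : ∀ n, F n = fun t : ℝ => (1 / r / (node r n : ℂ) ^ 2) *
      (Complex.exp (Complex.I * (z + node r n) * t) - Complex.exp (Complex.I * z * t)) := fun n => by
    funext t
    simp only [F]
    rw [show Complex.I * (z + node r n) * t = Complex.I * t * node r n + Complex.I * z * t by ring,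
      Complex.exp_add]
    ring
  have hFi : ∀ n, Integrable (F n) (volume.restrict (Set.Ioi 0)) := fun n => by
    rw [hF]
    exact ((hi _).sub hi0).const_mul _
  have hFn : ∀ n t, ‖F n t‖ ≤ 1 / r * 2 * (1 / node r n ^ 2) * ‖Complex.exp (Complex.I * z * t)‖ := by
    intro n t
    simp only [F]
    rw [norm_mul]
    refine mul_le_mul_of_nonneg_right ?_ (norm_nonneg _)
    exact norm_screwTerm_le hr t n
  have hsum : Summable fun n => ∫ t in Set.Ioi (0 : ℝ), ‖F n t‖ := by
    refine Summable.of_nonneg_of_le (fun n => integral_nonneg fun t => norm_nonneg _) (fun n => ?_)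
      (((summable_node_inv_sq hr).mul_left (1 / r * 2)).mul_right
        (∫ t in Set.Ioi (0 : ℝ), ‖Complex.exp (Complex.I * z * t)‖))
    rw [← integral_const_mul]
    exact integral_mono (hFi n).norm (hi0.norm.const_mul _) (hFn n)
  have hts : ∀ t, ∑' n, F n t = pwScrew r t * Complex.exp (Complex.I * z * t) := fun t =>
    ((hasSum_pwScrew hr t).mul_right _).tsum_eq
  have key := hasSum_integral_of_summable_integral_norm (F := F) hFi hsum
  simp only [hts] at key
  refine ⟨?_, ?_⟩
  · refine (hi0.norm.const_mul (∑' n, 1 / r * 2 * (1 / node r n ^ 2))).mono'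
      (((continuous_pwScrew hr).mul (by fun_prop)).aestronglyMeasurable)
      (Eventually.of_forall fun t => ?_)
    rw [← hts]
    refine tsum_of_norm_bounded ?_ fun n => hFn n t
    exact (((summable_node_inv_sq hr).mul_left (1 / r * 2)).hasSum).mul_right _
  · have h2 := (HasSum.reflect (hasSum_tan hr (ne_node_of_im_pos (r := r) hz'))).mul_left
      (-(Complex.I / z ^ 2))
    have e : (fun n => ∫ t in Set.Ioi (0 : ℝ), F n t) = fun n => -(Complex.I / z ^ 2) *
        ((1 / r : ℂ) * (z / (node r (1 - n) * (node r (1 - n) - z)))) := ?_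
    · rw [e] at key
      exact key.unique h2
    funext n
    have h5 : (node r n : ℂ) ≠ 0 := Complex.ofReal_ne_zero.2 (node_ne_zero hr n)
    have hrc : (r : ℂ) ≠ 0 := Complex.ofReal_ne_zero.2 hr.ne'
    have h6 : z + node r n ≠ 0 := fun h => by
      have := hI (node r n)
      rw [h] at this
      simp at this
    rw [hF, integral_const_mul, integral_sub (hi _) hi0, hv, hv0, node_reflect]
    push_cast
    rw [show -(node r n : ℂ) - z = -(z + node r n) by ring, neg_mul_neg]
    field_simp
    ring


variable {r : ℝ}

theorem sqrt_pi_mul_pos (hr : 0 < r) : 0 < √(Real.pi * r) := Real.sqrt_pos.2 (by positivity)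

theorem sq_sqrt_pi_mul (hr : 0 < r) : √(Real.pi * r) ^ 2 = Real.pi * r := Real.sq_sqrt (by positivity)

theorem sqrt_pi_div (hr : 0 < r) : √(Real.pi / r) = √(Real.pi * r) / r := by
  rw [show Real.pi / r = Real.pi * r / r ^ 2 by field_simp, Real.sqrt_div' _ (sq_nonneg r),
    Real.sqrt_sq hr.le]

theorem sqrt_div_pi (hr : 0 < r) : √(r / Real.pi) = r / √(Real.pi * r) := by
  have h := sqrt_pi_mul_pos hr
  rw [show r / Real.pi = r ^ 2 / (Real.pi * r) by field_simp, Real.sqrt_div (sq_nonneg r),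
    Real.sqrt_sq hr.le]

theorem pwHB_node (hr : 0 < r) (n : ℤ) : pwHB r hr (node r n) = Complex.I * (-1) ^ n := by
  have h : (r : ℂ) * node r n = Real.pi * n - Real.pi / 2 := by
    exact_mod_cast congrArg Complex.ofReal (r_mul_node hr n)
  rw [pwHB_apply, show -(Complex.I * r * (node r n : ℂ)) =
    Real.pi / 2 * Complex.I + n * (-(Real.pi * Complex.I)) by linear_combination -Complex.I * h,
    Complex.exp_add, Complex.exp_int_mul, Complex.exp_pi_div_two_mul_I, Complex.exp_neg,
    Complex.exp_pi_mul_I]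
  norm_num

theorem neg_one_zpow_mul_self (n : ℤ) : ((-1 : ℂ) ^ n) * (-1) ^ n = 1 := by
  rw [← mul_zpow]
  norm_num

theorem conj_neg_one_zpow (n : ℤ) : conj ((-1 : ℂ) ^ n) = (-1) ^ n := by
  rw [map_zpow₀, map_neg, map_one]

theorem sin_sub_node (hr : 0 < r) (n : ℤ) (z : ℂ) :
    Complex.sin (r * (z - node r n)) = (-1) ^ n * Complex.cos (r * z) := by
  have h : (r : ℂ) * node r n = Real.pi * n - Real.pi / 2 := by
    exact_mod_cast congrArg Complex.ofReal (r_mul_node hr n)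
  have h1 : Complex.cos (n * Real.pi) = (-1) ^ n := by
    have := congrArg Complex.ofReal (Real.cos_int_mul_pi n)
    push_cast at this
    exact this
  rw [show (r : ℂ) * (z - node r n) = r * z - n * Real.pi + Real.pi / 2 by linear_combination -h,
    Complex.sin_add_pi_div_two, Complex.cos_sub, h1, Complex.sin_int_mul_pi]
  ring

theorem cos_mul_node (hr : 0 < r) (n : ℤ) : Complex.cos (r * node r n) = 0 :=
  (cos_eq_zero_iff_node hr _).2 ⟨n, rfl⟩

/-- The constant relating the `n`-th basis function and the reproducing kernel at `γ_n`. -/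
noncomputable def basisConst (r : ℝ) (n : ℤ) : ℂ := Complex.I * (-1) ^ n * (√(Real.pi / r) : ℝ)

/-- The `n`-th basis function as an element of the Paley--Wiener space. -/
noncomputable def basisVec (r : ℝ) (hr : 0 < r) (n : ℤ) : DeBrangesSpace (pwHB r hr) :=
  basisConst r n • (pwFun_kernelDensity r (node r n)).toSpace hr

theorem basisVec_apply (hr : 0 < r) (n : ℤ) (z : ℂ) :
    basisVec r hr n z = basisConst r n * fourierC (kernelDensity r (node r n)) z := by
  rw [basisVec, deBrangesSpace_smul, PWFun.toSpace_apply]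

theorem basisVec_of_ne (hr : 0 < r) (n : ℤ) {z : ℂ} (hz : z ≠ node r n) : basisVec r hr n z =
    Complex.I * Complex.cos (r * z) / ((√(Real.pi * r) : ℝ) * (z - node r n)) := by
  have hs : ((√(Real.pi * r) : ℝ) : ℂ) ≠ 0 := Complex.ofReal_ne_zero.2 (sqrt_pi_mul_pos hr).ne'
  have hs2 : ((√(Real.pi * r) : ℝ) : ℂ) ^ 2 = Real.pi * r := by
    rw [← Complex.ofReal_pow, sq_sqrt_pi_mul hr, Complex.ofReal_mul]
  have hrc : (r : ℂ) ≠ 0 := Complex.ofReal_ne_zero.2 hr.ne'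
  have hpi : (Real.pi : ℂ) ≠ 0 := Complex.ofReal_ne_zero.2 Real.pi_ne_zero
  have hz' : z - node r n ≠ 0 := sub_ne_zero.2 hz
  rw [basisVec_apply, fourierC_kernelDensity hr, Complex.conj_ofReal, if_neg hz, sin_sub_node hr,
    basisConst, sqrt_pi_div hr, Complex.ofReal_div]
  field_simp
  rw [hs2]
  linear_combination (Complex.cos (r * z) * Real.pi * r) * neg_one_zpow_mul_self n

theorem basisVec_mul_sub (hr : 0 < r) (n : ℤ) (z : ℂ) : basisVec r hr n z * (z - node r n) =
    Complex.I / (√(Real.pi * r) : ℝ) * Complex.cos (r * z) := by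
  by_cases hz : z = node r n
  · rw [hz, sub_self, cos_mul_node hr, mul_zero, mul_zero]
  · have hs : ((√(Real.pi * r) : ℝ) : ℂ) ≠ 0 := Complex.ofReal_ne_zero.2 (sqrt_pi_mul_pos hr).ne'
    have hz' : z - node r n ≠ 0 := sub_ne_zero.2 hz
    rw [basisVec_of_ne hr n hz]
    field_simp

theorem basisVec_eq_pwBasis (hr : 0 < r) (n : ℤ) (z : ℂ) : basisVec r hr n z = pwBasis r n z := by
  have hd : Differentiable ℂ fun w : ℂ =>
      Complex.I * Complex.cos (r * w) / (√(Real.pi * r) : ℝ) := by fun_prop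
  refine congrFun (Continuous.ext_on (dense_compl_singleton (node r n : ℂ))
    (basisVec r hr n).2.1.continuous (differentiable_dslope hd (node r n)).continuous
    fun z hz => ?_) z
  have hz' : z - node r n ≠ 0 := sub_ne_zero.2 hz
  rw [basisVec_of_ne hr n hz, dslope_of_ne _ hz, slope_def_field, cos_mul_node hr, mul_zero, zero_div,
    sub_zero, div_div]

theorem conj_basisConst (hr : 0 < r) (n : ℤ) :
    conj (basisConst r n) = (√(Real.pi / r) : ℝ) * (pwHB r hr (node r n))⁻¹ := by
  rw [pwHB_node, basisConst, map_mul, map_mul, Complex.conj_I, conj_neg_one_zpow,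
    Complex.conj_ofReal, mul_inv, Complex.inv_I, inv_eq_of_mul_eq_one_left (neg_one_zpow_mul_self n)]
  ring

theorem inner_basisVec (hr : 0 < r) (n : ℤ) (f : DeBrangesSpace (pwHB r hr)) :
    inner ℂ (basisVec r hr n) f =
      (√(Real.pi / r) : ℝ) * (f (node r n) / pwHB r hr (node r n)) := by
  rw [basisVec, inner_smul_left, ← kernelDensity_reproducing hr, conj_basisConst hr]
  ring

theorem basisVec_node_self (hr : 0 < r) (n : ℤ) : basisVec r hr n (node r n) =
    (√(r / Real.pi) : ℝ) * pwHB r hr (node r n) := by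
  have hs : ((√(Real.pi * r) : ℝ) : ℂ) ≠ 0 := Complex.ofReal_ne_zero.2 (sqrt_pi_mul_pos hr).ne'
  have hs2 : ((√(Real.pi * r) : ℝ) : ℂ) ^ 2 = Real.pi * r := by
    rw [← Complex.ofReal_pow, sq_sqrt_pi_mul hr, Complex.ofReal_mul]
  have hrc : (r : ℂ) ≠ 0 := Complex.ofReal_ne_zero.2 hr.ne'
  have hpi : (Real.pi : ℂ) ≠ 0 := Complex.ofReal_ne_zero.2 Real.pi_ne_zero
  rw [basisVec_apply, fourierC_kernelDensity hr, Complex.conj_ofReal, if_pos rfl, pwHB_node,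
    basisConst, sqrt_pi_div hr, sqrt_div_pi hr]
  push_cast
  field_simp
  rw [hs2, mul_comm]

theorem basisVec_node_of_ne (hr : 0 < r) {n m : ℤ} (h : m ≠ n) :
    basisVec r hr n (node r m) = 0 := by
  rw [basisVec_of_ne hr n fun h' => h (node_injective hr (by exact_mod_cast h')), cos_mul_node hr]
  simp

theorem orthonormal_basisVec (hr : 0 < r) : Orthonormal ℂ (basisVec r hr) := by
  rw [orthonormal_iff_ite]
  intro n m
  rw [inner_basisVec]
  split_ifs with h
  · subst h
    have h1 : pwHB r hr (node r n) ≠ 0 := Complex.exp_ne_zero _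
    rw [basisVec_node_self, mul_div_cancel_right₀ _ h1, ← Complex.ofReal_mul,
      ← Real.sqrt_mul (by positivity), show Real.pi / r * (r / Real.pi) = 1 by
        have := Real.pi_ne_zero
        field_simp, Real.sqrt_one, Complex.ofReal_one]
  · rw [basisVec_node_of_ne hr h, zero_div, mul_zero]

theorem eq_zero_of_node (hr : 0 < r) {f : DeBrangesSpace (pwHB r hr)}
    (h : ∀ n : ℤ, f (node r n) = 0) : f = 0 := by
  obtain ⟨φ, h1, h2⟩ := exists_pwFun_of_mem hr f.2
  obtain rfl : f = h1.toSpace hr := deBrangesSpace_ext h2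
  have hlt : -r < r := by linarith
  let u : ℝ → ℂ := fun t => Complex.exp (-(Complex.I * Real.pi * t / (2 * r)))
  have hu : ∀ t, ‖u t‖ = 1 := fun t => by
    have : -(Complex.I * Real.pi * t / (2 * r)) = ((-(Real.pi * t / (2 * r)) : ℝ) : ℂ) * Complex.I := by
      push_cast; ring
    simp only [u]
    rw [this, Complex.norm_exp_ofReal_mul_I]
  have huc : Continuous u := by fun_prop
  let g : ℝ → ℂ := fun t => u t * φ t
  have hg : ∀ t, ‖g t‖ = ‖φ t‖ := fun t => by simp only [g]; rw [norm_mul, hu, one_mul]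
  have hgm : MemLp g 2 (volume.restrict (Set.Ioc (-r) r)) :=
    (h1.memLp.restrict _).of_le (huc.aestronglyMeasurable.mul h1.memLp.1.restrict)
      (Eventually.of_forall fun t => (hg t).le)
  have hc : ∀ n : ℤ, fourierCoeffOn hlt g n = 0 := fun n => by
    have h3 := h (-n)
    rw [PWFun.toSpace_apply, fourierC] at h3
    rw [fourierCoeffOn_eq_integral, intervalIntegral.integral_of_le hlt.le]
    rw [← setIntegral_eq_integral_of_forall_compl_eq_zero (s := Set.Ioc (-r) r) fun t ht => by
      rw [h1.supp t fun h' => ht ⟨h'.1, h'.2.le⟩, zero_mul]] at h3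
    rw [smul_eq_zero]
    right
    rw [← h3]
    congr 1
    ext t
    simp only [g, u, smul_eq_mul]
    rw [fourier_coe_apply, ← mul_assoc, ← Complex.exp_add, mul_comm]
    congr 2
    have hrc : (r : ℂ) ≠ 0 := Complex.ofReal_ne_zero.2 hr.ne'
    simp only [node]
    push_cast
    field_simp
    ring
  have h4 := hasSum_sq_fourierCoeffOn hlt hgm
  simp only [hc, norm_zero, hg] at h4
  have h5 := h4.unique (a₂ := 0) (by simp)
  rw [smul_eq_zero, intervalIntegral.integral_of_le hlt.le,
    setIntegral_eq_integral_of_forall_compl_eq_zero fun t ht => by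
      rw [h1.supp t fun h' => ht ⟨h'.1, h'.2.le⟩]; simp] at h5
  have h6 := h5.resolve_left (inv_ne_zero (by linarith))
  rw [← inner_self_eq_zero (𝕜 := ℂ), PWFun.inner]
  have e : ∀ t, conj (φ t) * φ t = ((‖φ t‖ ^ 2 : ℝ) : ℂ) := fun t => by
    rw [Complex.conj_mul']
    push_cast
    rfl
  simp only [e]
  rw [integral_complex_ofReal, h6]
  simp

/-- The orthonormal basis of the Paley--Wiener space. -/
noncomputable def pwHilbertBasis (r : ℝ) (hr : 0 < r) :
    HilbertBasis ℤ ℂ (DeBrangesSpace (pwHB r hr)) :=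
  HilbertBasis.mkOfOrthogonalEqBot (orthonormal_basisVec hr) (by
    rw [Submodule.eq_bot_iff]
    intro f hf
    refine eq_zero_of_node hr fun n => ?_
    have h := (Submodule.mem_orthogonal _ _).1 hf _ (Submodule.subset_span ⟨n, rfl⟩)
    rw [inner_basisVec] at h
    have h1 : pwHB r hr (node r n) ≠ 0 := Complex.exp_ne_zero _
    have h2 : ((√(Real.pi / r) : ℝ) : ℂ) ≠ 0 :=
      Complex.ofReal_ne_zero.2 (Real.sqrt_pos.2 (by positivity)).ne'
    simpa [h1, h2] using h)

theorem pwHilbertBasis_apply (hr : 0 < r) (n : ℤ) : pwHilbertBasis r hr n = basisVec r hr n :=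
  congrFun (HilbertBasis.coe_mkOfOrthogonalEqBot _ _) n

theorem pwHilbertBasis_repr (hr : 0 < r) (f : DeBrangesSpace (pwHB r hr)) (n : ℤ) :
    (pwHilbertBasis r hr).repr f n =
      (√(Real.pi / r) : ℝ) * (f (node r n) / pwHB r hr (node r n)) := by
  rw [HilbertBasis.repr_apply_apply, pwHilbertBasis_apply, inner_basisVec]

theorem tendsto_basisVec_div (hr : 0 < r) (n m : ℤ) :
    Tendsto (fun z => basisVec r hr n z / pwHB r hr z) (𝓝[≠] (node r m : ℂ))
      (𝓝 (basisVec r hr n (node r m) / pwHB r hr (node r m))) :=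
  ((((basisVec r hr n).2.1.continuous.tendsto _).div ((pwHB r hr).entire.continuous.tendsto _)
    (Complex.exp_ne_zero _))).mono_left nhdsWithin_le_nhds


/-- Equal point masses `c` at the points `x n`. -/
noncomputable def atomic (x : ℤ → ℝ) (c : ℝ) : Measure ℝ :=
  Measure.sum fun n => ENNReal.ofReal c • Measure.dirac (x n)

section
variable {x : ℤ → ℝ} {c : ℝ}

theorem ae_atomic_iff (hc : 0 < c) {p : ℝ → Prop} :
    (∀ᵐ γ ∂(atomic x c), p γ) ↔ ∀ n, p (x n) := by
  rw [atomic, Measure.ae_sum_iff]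
  refine forall_congr' fun n => ?_
  rw [Measure.ae_ennreal_smul_measure_eq (ENNReal.ofReal_pos.2 hc).ne', ae_dirac_eq]
  exact eventually_pure

theorem eLpNorm_atomic_sq (f : ℝ → ℂ) :
    eLpNorm f 2 (atomic x c) ^ 2 = ∑' n, ENNReal.ofReal c * ‖f (x n)‖ₑ ^ 2 := by
  rw [eLpNorm_two_sq, atomic, lintegral_sum_measure]
  refine tsum_congr fun n => ?_
  rw [lintegral_smul_measure, lintegral_dirac, smul_eq_mul]

theorem enorm_sqrt_mul_sq (hc : 0 < c) (w : ℂ) :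
    ENNReal.ofReal c * ‖w‖ₑ ^ 2 = ENNReal.ofReal (‖(√c : ℝ) * w‖ ^ 2) := by
  rw [norm_mul, Complex.norm_real, mul_pow, Real.norm_eq_abs, sq_abs, Real.sq_sqrt hc.le,
    ENNReal.ofReal_mul hc.le, ENNReal.ofReal_pow (norm_nonneg _), ofReal_norm]

theorem memℓp_two_iff_tsum (u : ℤ → ℂ) :
    Memℓp u 2 ↔ ∑' n, ENNReal.ofReal (‖u n‖ ^ 2) ≠ ⊤ := by
  rw [memℓp_gen_iff (by norm_num)]
  simp only [ENNReal.toReal_ofNat, Real.rpow_two]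
  constructor
  · intro h
    rw [← ENNReal.ofReal_tsum_of_nonneg (fun _ => by positivity) h]
    exact ENNReal.ofReal_ne_top
  · intro h
    refine (ENNReal.summable_toReal h).congr fun n => ?_
    rw [ENNReal.toReal_ofReal (by positivity)]

theorem aestronglyMeasurable_atomic (f : ℝ → ℂ) : AEStronglyMeasurable f (atomic x c) := by
  rw [atomic, aestronglyMeasurable_sum_measure_iff]
  exact fun n => (aestronglyMeasurable_dirac).mono_ac (Measure.smul_absolutelyContinuous)

theorem memLp_atomic_iff (hc : 0 < c) (f : ℝ → ℂ) :
    MemLp f 2 (atomic x c) ↔ Memℓp (fun n => ((√c : ℝ) : ℂ) * f (x n)) 2 := by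
  have h2 : eLpNorm f 2 (atomic x c) ≠ ⊤ ↔ eLpNorm f 2 (atomic x c) ^ 2 ≠ ⊤ := by simp
  rw [memℓp_two_iff_tsum, MemLp, and_iff_right (aestronglyMeasurable_atomic f),
    lt_top_iff_ne_top, h2, eLpNorm_atomic_sq]
  simp only [enorm_sqrt_mul_sq hc]

/-- `L²` of equal point masses is `ℓ²`. -/
noncomputable def atomicIsometry (x : ℤ → ℝ) (hc : 0 < c) :
    Lp ℂ 2 (atomic x c) →ₗᵢ[ℂ] lp (fun _ : ℤ => ℂ) 2 where
  toFun f := ⟨fun n => (√c : ℝ) * f (x n), (memLp_atomic_iff hc f).1 (Lp.memLp f)⟩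
  map_add' f g := by
    have h := (ae_atomic_iff hc).1 (Lp.coeFn_add f g)
    ext n
    change (√c : ℝ) * (f + g) (x n) = (√c : ℝ) * f (x n) + (√c : ℝ) * g (x n)
    rw [h n, Pi.add_apply, mul_add]
  map_smul' a f := by
    have h := (ae_atomic_iff hc).1 (Lp.coeFn_smul a f)
    ext n
    change (√c : ℝ) * (a • f) (x n) = a * ((√c : ℝ) * f (x n))
    rw [h n, Pi.smul_apply, smul_eq_mul]
    ring
  norm_map' f := by
    have h1 := (memℓp_gen_iff (p := 2) (by norm_num)).1 ((memLp_atomic_iff hc f).1 (Lp.memLp f))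
    simp only [ENNReal.toReal_ofNat, Real.rpow_two] at h1
    refine (sq_eq_sq₀ (norm_nonneg _) (norm_nonneg _)).1 ?_
    have h2 := lp.norm_rpow_eq_tsum (p := 2) (by norm_num)
      (⟨fun n => (√c : ℝ) * f (x n), (memLp_atomic_iff hc f).1 (Lp.memLp f)⟩ :
        lp (fun _ : ℤ => ℂ) 2)
    simp only [ENNReal.toReal_ofNat, Real.rpow_two] at h2
    change ‖(⟨fun n => (√c : ℝ) * f (x n), _⟩ : lp (fun _ : ℤ => ℂ) 2)‖ ^ 2 = _
    rw [h2, Lp.norm_def, ← ENNReal.toReal_pow, eLpNorm_atomic_sq]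
    simp only [enorm_sqrt_mul_sq hc]
    rw [← ENNReal.ofReal_tsum_of_nonneg (fun _ => by positivity) h1,
      ENNReal.toReal_ofReal (tsum_nonneg fun _ => by positivity)]

theorem atomicIsometry_surjective (hx : Function.Injective x) (hc : 0 < c) :
    Function.Surjective (atomicIsometry x hc) := by
  intro a
  have hs : ((√c : ℝ) : ℂ) ≠ 0 := Complex.ofReal_ne_zero.2 (Real.sqrt_pos.2 hc).ne'
  have h0 : ∀ n, ((√c : ℝ) : ℂ) * Function.extend x (fun n => a n / (√c : ℝ)) 0 (x n) = a n :=
    fun n => by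
      rw [hx.extend_apply]
      field_simp
  have h1 : MemLp (Function.extend x (fun n => a n / (√c : ℝ)) 0) 2 (atomic x c) := by
    rw [memLp_atomic_iff hc]
    simp only [h0]
    exact a.2
  refine ⟨h1.toLp _, ?_⟩
  have h2 := (ae_atomic_iff hc).1 h1.coeFn_toLp
  ext n
  change (√c : ℝ) * (h1.toLp _) (x n) = a n
  rw [h2 n, h0]

/-- `L²` of equal point masses is `ℓ²`. -/
noncomputable def atomicEquiv (hx : Function.Injective x) (hc : 0 < c) :
    Lp ℂ 2 (atomic x c) ≃ₗᵢ[ℂ] lp (fun _ : ℤ => ℂ) 2 :=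
  LinearIsometryEquiv.ofSurjective _ (atomicIsometry_surjective hx hc)

theorem atomicEquiv_apply (hx : Function.Injective x) (hc : 0 < c) (f : Lp ℂ 2 (atomic x c))
    (n : ℤ) : atomicEquiv hx hc f n = (√c : ℝ) * f (x n) := rfl

end

variable {r : ℝ}

theorem exists_levelEquiv (hr : 0 < r) :
    ∃ e : Lp ℂ 2 (levelMeasure (pwTheta r)) ≃ₗᵢ[ℂ] lp (fun _ : ℤ => ℂ) 2,
      (∀ f n, e f n = (√(Real.pi / r) : ℝ) * f (node r n)) ∧
      ∀ p : ℝ → Prop, (∀ᵐ γ ∂(levelMeasure (pwTheta r)), p γ) ↔ ∀ n, p (node r n) := by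
  have hc : 0 < Real.pi / r := by positivity
  rw [show levelMeasure (pwTheta r) = atomic (node r) (Real.pi / r) from levelMeasure_pwTheta hr]
  exact ⟨atomicEquiv (node_injective hr) hc, atomicEquiv_apply _ _, fun p => ae_atomic_iff hc⟩

theorem exists_tauEquiv (hr : 0 < r) :
    ∃ e : Lp ℂ 2 (pwTau r) ≃ₗᵢ[ℂ] lp (fun _ : ℤ => ℂ) 2,
      (∀ f n, e f n = (√(1 / r) : ℝ) * f (node r n)) ∧
      ∀ p : ℝ → Prop, (∀ᵐ γ ∂(pwTau r), p γ) ↔ ∀ n, p (node r n) := by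
  have hc : 0 < 1 / r := by positivity
  rw [show pwTau r = atomic (node r) (1 / r) from pwTau_eq hr]
  exact ⟨atomicEquiv (node_injective hr) hc, atomicEquiv_apply _ _, fun p => ae_atomic_iff hc⟩

/-! ### The self-adjoint extension of multiplication by the variable -/

theorem pw_S_pi_div_two (hr : 0 < r) (z : ℂ) :
    (pwHB r hr).S (Real.pi / 2) z = 2 * Complex.I * Complex.cos (r * z) := by
  rw [pw_S]
  push_cast
  rw [Complex.sin_sub_pi_div_two]
  ring

theorem repr_eq_iff_node (hr : 0 < r) (f g : DeBrangesSpace (pwHB r hr)) (n : ℤ) :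
    (pwHilbertBasis r hr).repr g n = node r n * (pwHilbertBasis r hr).repr f n ↔
      g (node r n) = node r n * f (node r n) := by
  rw [pwHilbertBasis_repr, pwHilbertBasis_repr]
  have h1 : pwHB r hr (node r n) ≠ 0 := Complex.exp_ne_zero _
  have h2 : ((√(Real.pi / r) : ℝ) : ℂ) ≠ 0 :=
    Complex.ofReal_ne_zero.2 (Real.sqrt_pos.2 (by positivity)).ne'
  constructor
  · intro h
    field_simp at h
    exact h
  · intro h
    rw [h]
    ring

theorem hasSum_eval {hr : 0 < r} {f : ℤ → DeBrangesSpace (pwHB r hr)}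
    {g : DeBrangesSpace (pwHB r hr)} (h : HasSum f g) (z : ℂ) : HasSum (fun n => f n z) (g z) := by
  obtain ⟨k, -, -, hk⟩ := pw_reproducing_kernel r hr z
  simp only [hk]
  exact h.mapL (innerSL ℂ k)

theorem hasSum_expansion (hr : 0 < r) (f : DeBrangesSpace (pwHB r hr)) (z : ℂ) :
    HasSum (fun n => (pwHilbertBasis r hr).repr f n * basisVec r hr n z) (f z) := by
  have h := hasSum_eval ((pwHilbertBasis r hr).hasSum_repr f) z
  simpa only [pwHilbertBasis_apply, deBrangesSpace_smul] using h

theorem sub_mul_eq_of_node (hr : 0 < r) {f g : DeBrangesSpace (pwHB r hr)}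
    (h : ∀ n : ℤ, g (node r n) = node r n * f (node r n)) (z : ℂ) :
    g z - z * f z = g 0 * Complex.cos (r * z) := by
  have key : ∀ z, HasSum (fun n => -((pwHilbertBasis r hr).repr f n *
      (Complex.I / (√(Real.pi * r) : ℝ) * Complex.cos (r * z)))) (g z - z * f z) := fun z => by
    refine ((hasSum_expansion hr g z).sub ((hasSum_expansion hr f z).mul_left z)).congr_fun
      fun n => ?_
    rw [(repr_eq_iff_node hr f g n).2 (h n), ← basisVec_mul_sub hr n]
    ring
  have h0 := key 0
  simp only [mul_zero, Complex.cos_zero, mul_one, zero_mul, sub_zero] at h0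
  refine (key z).unique ((h0.mul_right (Complex.cos (r * z))).congr_fun fun n => ?_)
  ring

theorem mem_multExtGraph_iff (hr : 0 < r) {w₀ : ℂ} (hw : (pwHB r hr).S (Real.pi / 2) w₀ ≠ 0)
    (p : DeBrangesSpace (pwHB r hr) × DeBrangesSpace (pwHB r hr)) :
    p ∈ multExtGraph (pwHB r hr) (Real.pi / 2) w₀ ↔
      ∀ n : ℤ, p.2 (node r n) = node r n * p.1 (node r n) := by
  constructor
  · rintro ⟨F, hF⟩ n
    rw [(hF _).2, pw_S_pi_div_two, cos_mul_node hr, mul_zero, mul_zero, add_zero]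
  · intro h
    have hd := sub_mul_eq_of_node hr h
    refine ⟨((pwHB r hr).S (Real.pi / 2) w₀)⁻¹ • (p.2 - w₀ • p.1), fun z => ?_⟩
    simp only [deBrangesSpace_smul, deBrangesSpace_sub]
    rw [hd w₀]
    simp only [pw_S_pi_div_two] at hw ⊢
    have hc : Complex.cos (r * w₀) ≠ 0 := fun h => hw (by rw [h, mul_zero])
    have hI := Complex.I_ne_zero
    have hz := hd z
    generalize Complex.cos (r * z) = u at hz ⊢
    generalize Complex.cos (r * w₀) = v at hc ⊢
    constructor
    · field_simp
      linear_combination -hz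
    · field_simp
      linear_combination hz

theorem isSelfAdjointGraph_multExt (hr : 0 < r) {w₀ : ℂ}
    (hw : (pwHB r hr).S (Real.pi / 2) w₀ ≠ 0) :
    IsSelfAdjointGraph (multExtGraph (pwHB r hr) (Real.pi / 2) w₀) := by
  intro p
  have hin : ∀ f g : DeBrangesSpace (pwHB r hr), HasSum (fun n =>
      conj ((pwHilbertBasis r hr).repr f n) * (pwHilbertBasis r hr).repr g n) (inner ℂ f g) :=
    fun f g => by
      rw [← (pwHilbertBasis r hr).repr.inner_map_map]
      refine (lp.hasSum_inner _ _).congr_fun fun n => ?_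
      rw [RCLike.inner_apply, mul_comm]
  constructor
  · intro hp q hq
    rw [mem_multExtGraph_iff hr hw] at hp hq
    refine (hin p.2 q.1).unique ((hin p.1 q.2).congr_fun fun n => ?_)
    rw [(repr_eq_iff_node hr _ _ n).2 (hp n), (repr_eq_iff_node hr _ _ n).2 (hq n), map_mul,
      Complex.conj_ofReal]
    ring
  · intro h
    rw [mem_multExtGraph_iff hr hw]
    intro n
    have hb : (basisVec r hr n, (node r n : ℂ) • basisVec r hr n) ∈
        multExtGraph (pwHB r hr) (Real.pi / 2) w₀ := by
      rw [mem_multExtGraph_iff hr hw]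
      intro m
      simp only [deBrangesSpace_smul]
      by_cases hm : m = n
      · rw [hm]
      · rw [basisVec_node_of_ne hr hm, mul_zero, mul_zero]
    have h1 := congrArg conj (h _ hb)
    simp only [inner_smul_right, map_mul, inner_conj_symm, Complex.conj_ofReal] at h1
    rw [← repr_eq_iff_node, HilbertBasis.repr_apply_apply, HilbertBasis.repr_apply_apply,
      pwHilbertBasis_apply, h1]

theorem mem_multExtGraph_basisVec (hr : 0 < r) {w₀ : ℂ}
    (hw : (pwHB r hr).S (Real.pi / 2) w₀ ≠ 0) (n : ℤ) :
    (basisVec r hr n, (node r n : ℂ) • basisVec r hr n) ∈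
      multExtGraph (pwHB r hr) (Real.pi / 2) w₀ := by
  rw [mem_multExtGraph_iff hr hw]
  intro m
  simp only [deBrangesSpace_smul]
  by_cases hm : m = n
  · rw [hm]
  · rw [basisVec_node_of_ne hr hm, mul_zero, mul_zero]

theorem dense_multDomain (hr : 0 < r) : Dense (multDomain (pwHB r hr)) := by
  let D : Submodule ℂ (DeBrangesSpace (pwHB r hr)) :=
    { carrier := multDomain (pwHB r hr)
      add_mem' := fun {a b} ha hb => by
        have h := (deBrangesSubmodule (pwHB r hr)).add_mem (x := fun z => z * a z)
          (y := fun z => z * b z) ha hb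
        refine (congrArg (· ∈ deBrangesSubmodule (pwHB r hr)) (funext fun z => ?_)).mp h
        simp only [Pi.add_apply, deBrangesSpace_add]
        ring
      zero_mem' := by
        refine (congrArg (· ∈ deBrangesSubmodule (pwHB r hr)) (funext fun z => ?_)).mp
          (Submodule.zero_mem _)
        simp only [Pi.zero_apply, deBrangesSpace_zero, mul_zero]
      smul_mem' := fun c a ha => by
        have h := (deBrangesSubmodule (pwHB r hr)).smul_mem (x := fun z => z * a z) c ha
        refine (congrArg (· ∈ deBrangesSubmodule (pwHB r hr)) (funext fun z => ?_)).mp h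
        simp only [Pi.smul_apply, deBrangesSpace_smul, smul_eq_mul]
        ring }
  change Dense (D : Set (DeBrangesSpace (pwHB r hr)))
  rw [Submodule.dense_iff_topologicalClosure_eq_top, Submodule.topologicalClosure_eq_top_iff,
    Submodule.eq_bot_iff]
  intro v hv
  have hD : ∀ n m : ℤ, basisVec r hr n - basisVec r hr m ∈ D := fun n m => by
    refine (congrArg (· ∈ deBrangesSubmodule (pwHB r hr)) (funext fun z => ?_)).mp
      ((node r n : ℂ) • basisVec r hr n - (node r m : ℂ) • basisVec r hr m).2
    simp only [deBrangesSpace_sub, deBrangesSpace_smul]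
    linear_combination basisVec_mul_sub hr m z - basisVec_mul_sub hr n z
  have heq : ∀ n : ℤ, (pwHilbertBasis r hr).repr v n = (pwHilbertBasis r hr).repr v 0 := fun n => by
    have h := (Submodule.mem_orthogonal _ _).1 hv _ (hD n 0)
    rw [inner_sub_left, sub_eq_zero] at h
    rw [HilbertBasis.repr_apply_apply, HilbertBasis.repr_apply_apply, pwHilbertBasis_apply,
      pwHilbertBasis_apply, h]
  have hs := (memℓp_gen_iff (p := 2) (by norm_num)).1 ((pwHilbertBasis r hr).repr v).2
  simp only [heq] at hs
  have h0 := (summable_const_iff _).1 hs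
  simp only [ENNReal.toReal_ofNat, Real.rpow_two, sq_eq_zero_iff, norm_eq_zero] at h0
  rw [← (pwHilbertBasis r hr).repr.map_eq_zero_iff]
  ext n
  rw [heq, h0]
  rfl


variable {r : ℝ}

theorem summable_pwCoeff_sq (hr : 0 < r) (t : ℝ) : Summable fun n : ℤ => ‖pwCoeff r t n‖ ^ 2 :=
  Summable.of_nonneg_of_le (fun _ => by positivity) (norm_pwCoeff_sq_le r t)
    ((summable_node_inv_sq hr).mul_left 4)

/-- The screw line in `ℓ²`. -/
noncomputable def screwVec (r : ℝ) (hr : 0 < r) (t : ℝ) : lp (fun _ : ℤ => ℂ) 2 :=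
  ⟨fun n => (1 / √r : ℝ) * pwCoeff r t n, (memℓp_gen_iff (by norm_num)).2 (by
    simp only [ENNReal.toReal_ofNat, Real.rpow_two, norm_mul, mul_pow]
    exact (summable_pwCoeff_sq hr t).mul_left _)⟩

theorem screwVec_apply (hr : 0 < r) (t : ℝ) (n : ℤ) :
    screwVec r hr t n = (1 / √r : ℝ) * pwCoeff r t n := rfl

theorem one_div_sqrt_mul_self (hr : 0 < r) :
    ((1 / √r : ℝ) : ℂ) * ((1 / √r : ℝ) : ℂ) = 1 / r := by
  rw [← Complex.ofReal_mul, one_div_mul_one_div, Real.mul_self_sqrt hr.le]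
  push_cast
  rfl

theorem screwKernel_symm (g : ScrewFunction) (h : ∀ t, g (-t) = g t) (t s : ℝ) :
    screwKernel g t s = screwKernel g s t := by
  rw [screwKernel, screwKernel, h, h, ← h (t - s), neg_sub]
  ring

theorem inner_screwVec (hr : 0 < r) (t s : ℝ) :
    inner ℂ (screwVec r hr t) (screwVec r hr s) = screwKernel (pwScrewFunction r hr) t s := by
  rw [screwKernel_symm _ (pwScrew_neg r)]
  refine (lp.hasSum_inner _ _).unique ((hasSum_screwKernel hr s t).congr_fun fun n => ?_)
  rw [RCLike.inner_apply, screwVec_apply, screwVec_apply, map_mul, Complex.conj_ofReal,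
    ← one_div_sqrt_mul_self hr]
  ring

theorem continuous_of_inner_eq {X : Type*} [NormedAddCommGroup X] [InnerProductSpace ℂ X]
    (g : ScrewFunction) {e : ℝ → X} (he : ∀ t s, inner ℂ (e t) (e s) = screwKernel g t s) :
    Continuous e := by
  have hG := screwKernel_continuous g
  rw [continuous_iff_continuousAt]
  intro t
  rw [ContinuousAt, tendsto_iff_norm_sub_tendsto_zero]
  have hsq : ∀ s, ‖e s - e t‖ ^ 2
      = (screwKernel g s s - screwKernel g s t - screwKernel g t s + screwKernel g t t).re := by
    intro s
    rw [← inner_self_eq_norm_sq (𝕜 := ℂ), inner_sub_sub_self, he, he, he, he]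
    rfl
  have hc : Continuous fun s =>
      (screwKernel g s s - screwKernel g s t - screwKernel g t s + screwKernel g t t).re := by
    refine Complex.continuous_re.comp ?_
    have h1 : Continuous fun s => screwKernel g s s := hG.comp (continuous_id.prodMk continuous_id)
    have h2 : Continuous fun s => screwKernel g s t :=
      hG.comp (continuous_id.prodMk continuous_const)
    have h3 : Continuous fun s => screwKernel g t s :=
      hG.comp (continuous_const.prodMk continuous_id)
    exact ((h1.sub h2).sub h3).add continuous_const
  have h0 : Tendsto (fun s => ‖e s - e t‖ ^ 2) (𝓝 t) (𝓝 0) := by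
    simp only [hsq]
    have := hc.tendsto t
    simpa using this
  have h1 := (Real.continuous_sqrt.tendsto 0).comp h0
  rw [Real.sqrt_zero] at h1
  refine h1.congr fun s => ?_
  exact Real.sqrt_sq (norm_nonneg _)

theorem continuous_screwVec (hr : 0 < r) : Continuous (screwVec r hr) :=
  continuous_of_inner_eq _ (inner_screwVec hr)

theorem integrable_smul_screwVec (hr : 0 < r) {g : ScrewFunction} (φ : ScrewPre g) :
    Integrable fun t => φ t • screwVec r hr t :=
  (φ.continuous.smul (continuous_screwVec hr)).integrable_of_hasCompactSupport
    φ.hasCompactSupport.smul_right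

/-- `φ ↦ ∫ φ(t) e(t) dt` for the screw line `e` in `ℓ²`. -/
noncomputable def screwLin (r : ℝ) (hr : 0 < r) :
    ScrewPre (pwScrewFunction r hr) →ₗ[ℂ] lp (fun _ : ℤ => ℂ) 2 where
  toFun φ := ∫ t, φ t • screwVec r hr t
  map_add' φ ψ := by
    rw [← integral_add (integrable_smul_screwVec hr φ) (integrable_smul_screwVec hr ψ)]
    refine integral_congr_ae (Eventually.of_forall fun t => ?_)
    exact add_smul (φ t) (ψ t) (screwVec r hr t)
  map_smul' c φ := by
    rw [RingHom.id_apply, ← integral_smul]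
    refine integral_congr_ae (Eventually.of_forall fun t => ?_)
    exact mul_smul c (φ t) (screwVec r hr t)

theorem screwLin_apply (hr : 0 < r) (φ : ScrewPre (pwScrewFunction r hr)) :
    screwLin r hr φ = ∫ t, φ t • screwVec r hr t := rfl

theorem inner_screwLin (hr : 0 < r) (φ ψ : ScrewPre (pwScrewFunction r hr)) :
    inner ℂ (screwLin r hr φ) (screwLin r hr ψ) = inner ℂ φ ψ := by
  change _ = screwForm _ φ ψ
  rw [screwLin_apply, screwLin_apply, ← inner_conj_symm,
    ← integral_inner (integrable_smul_screwVec hr φ), ← integral_conj]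
  unfold screwForm
  refine integral_congr_ae (Eventually.of_forall fun t => ?_)
  simp only
  rw [inner_conj_symm, inner_smul_left, ← integral_inner (integrable_smul_screwVec hr ψ),
    ← integral_const_mul]
  refine integral_congr_ae (Eventually.of_forall fun s => ?_)
  simp only [inner_smul_right, inner_screwVec]
  ring

theorem screwLin_coord (hr : 0 < r) (φ : ScrewPre (pwScrewFunction r hr)) (n : ℤ) :
    screwLin r hr φ n = (1 / √r : ℝ) * (fourierC φ (node r n) / node r n) := by
  have h := (lp.evalCLM ℂ (fun _ : ℤ => ℂ) 2 n).integral_comp_comm (integrable_smul_screwVec hr φ)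
  have h1 : screwLin r hr φ n = ∫ t, φ t * ((1 / √r : ℝ) * pwCoeff r t n) := h.symm
  have hint : ∫ t, φ t = 0 := φ.2
  have hi : Integrable φ := φ.continuous.integrable_of_hasCompactSupport φ.hasCompactSupport
  have hi2 : Integrable fun t : ℝ => φ t * Complex.exp (Complex.I * node r n * t) :=
    (φ.continuous.mul (by fun_prop)).integrable_of_hasCompactSupport φ.hasCompactSupport.mul_right
  have h2 : fourierC φ (node r n) = ∫ t, φ t * (Complex.exp (Complex.I * node r n * t) - 1) := by
    simp only [mul_sub, mul_one]
    rw [integral_sub hi2 hi, hint, sub_zero]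
    rfl
  have h3 : ∀ t : ℝ, φ t * ((1 / √r : ℝ) * pwCoeff r t n) = (1 / √r : ℝ) / node r n *
      (φ t * (Complex.exp (Complex.I * node r n * t) - 1)) := fun t => by
    rw [pwCoeff, show Complex.I * t * (node r n : ℂ) = Complex.I * node r n * t by ring]
    ring
  rw [h1, h2, integral_congr_ae (Eventually.of_forall h3), integral_const_mul]
  ring

/-- The isometric embedding of `L(G_g)` into `ℓ²`. -/
noncomputable def screwPreIsometry (r : ℝ) (hr : 0 < r) :
    ScrewPre (pwScrewFunction r hr) →ₗᵢ[ℂ] lp (fun _ : ℤ => ℂ) 2 where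
  toLinearMap := screwLin r hr
  norm_map' φ := by
    rw [norm_eq_sqrt_re_inner (𝕜 := ℂ), norm_eq_sqrt_re_inner (𝕜 := ℂ), inner_screwLin]

theorem integral_exp_period (hr : 0 < r) (k : ℤ) :
    ∫ t in (0 : ℝ)..4 * r, Complex.exp (Complex.I * (Real.pi * k / (2 * r)) * t) =
      if k = 0 then 4 * (r : ℂ) else 0 := by
  have hrc : (r : ℂ) ≠ 0 := Complex.ofReal_ne_zero.2 hr.ne'
  have hpi : (Real.pi : ℂ) ≠ 0 := Complex.ofReal_ne_zero.2 Real.pi_ne_zero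
  split_ifs with h
  · subst h
    simp
  · have hk : (k : ℂ) ≠ 0 := Int.cast_ne_zero.2 h
    have hc : Complex.I * (Real.pi * k / (2 * r)) ≠ 0 := 
      mul_ne_zero Complex.I_ne_zero (div_ne_zero (mul_ne_zero hpi hk) (mul_ne_zero two_ne_zero hrc))
    rw [integral_exp_mul_complex hc]
    have : Complex.I * (Real.pi * k / (2 * r)) * ((4 * r : ℝ) : ℂ) = k * (2 * Real.pi * Complex.I) := by
      push_cast
      field_simp
      ring
    rw [this, Complex.exp_int_mul_two_pi_mul_I]
    simp

theorem eq_zero_of_inner_screwVec (hr : 0 < r) {v : lp (fun _ : ℤ => ℂ) 2}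
    (h : ∀ t, inner ℂ v (screwVec r hr t) = 0) : v = 0 := by
  have hr4 : (0 : ℝ) ≤ 4 * r := by linarith
  ext m
  let w : lp (fun _ : ℤ => ℂ) 2 := ∫ t in (0 : ℝ)..4 * r,
    Complex.exp (-(Complex.I * node r m * t)) • screwVec r hr t
  have hc : Continuous fun t : ℝ => Complex.exp (-(Complex.I * node r m * t)) • screwVec r hr t :=
    (show Continuous fun t : ℝ => Complex.exp (-(Complex.I * node r m * t)) by fun_prop).smul
      (continuous_screwVec hr)
  have hw : ∀ L : lp (fun _ : ℤ => ℂ) 2 →L[ℂ] ℂ, L w = ∫ t in (0 : ℝ)..4 * r,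
      Complex.exp (-(Complex.I * node r m * t)) * L (screwVec r hr t) := fun L => by
    rw [← L.intervalIntegral_comp_comm (hc.intervalIntegrable _ _)]
    simp only [map_smul, smul_eq_mul]
  have h1 : inner ℂ v w = 0 := by
    have := hw (innerSL ℂ v)
    simpa [h] using this
  have h2 : ∀ n, w n = if n = m then (1 / √r : ℝ) * (4 * r / node r m) else 0 := fun n => by
    have h3 : w n = ∫ t in (0 : ℝ)..4 * r, Complex.exp (-(Complex.I * node r m * t)) *
      ((1 / √r : ℝ) * pwCoeff r t n) := hw (lp.evalCLM ℂ (fun _ : ℤ => ℂ) 2 n)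
    have e : ∀ t : ℝ, Complex.exp (-(Complex.I * node r m * t)) * ((1 / √r : ℝ) * pwCoeff r t n) =
        (1 / √r : ℝ) / node r n *
          (Complex.exp (Complex.I * (Real.pi * (2 * (n - m) : ℤ) / (2 * r)) * t) -
            Complex.exp (Complex.I * (Real.pi * (1 - 2 * m : ℤ) / (2 * r)) * t)) := fun t => by
      have e1 : Complex.I * (Real.pi * (2 * (n - m) : ℤ) / (2 * r)) * t =
          -(Complex.I * node r m * t) + Complex.I * t * node r n := by
        simp only [node]
        push_cast
        ring
      have e2 : Complex.I * (Real.pi * (1 - 2 * m : ℤ) / (2 * r)) * t =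
          -(Complex.I * node r m * t) := by
        simp only [node]
        push_cast
        ring
      rw [e1, e2, Complex.exp_add, pwCoeff]
      ring
    rw [h3]
    simp only [e]
    rw [intervalIntegral.integral_const_mul, intervalIntegral.integral_sub
      (Continuous.intervalIntegrable (by fun_prop) _ _)
      (Continuous.intervalIntegrable (by fun_prop) _ _),
      integral_exp_period hr, integral_exp_period hr, if_neg (by omega : (1 - 2 * m : ℤ) ≠ 0)]
    by_cases hnm : n = m
    · subst hnm
      simp
      ring
    · rw [if_neg (by omega), if_neg hnm]
      simp
  have h3 := lp.hasSum_inner (𝕜 := ℂ) v w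
  rw [h1] at h3
  have h4 := h3.unique (hasSum_single m fun n hn => by rw [h2, if_neg hn, Complex.ofReal_zero, inner_zero_right])
  rw [h2, if_pos rfl, RCLike.inner_apply] at h4
  have hrc : (r : ℂ) ≠ 0 := Complex.ofReal_ne_zero.2 hr.ne'
  have hn : (node r m : ℂ) ≠ 0 := Complex.ofReal_ne_zero.2 (node_ne_zero hr m)
  have hs : (√r : ℂ) ≠ 0 := Complex.ofReal_ne_zero.2 (Real.sqrt_pos.2 hr).ne'
  have h5 := h4.symm
  rw [mul_eq_zero] at h5
  rcases h5 with h5 | h5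
  · simp [hrc, hn, hs] at h5
  · simpa using h5

theorem eq_const_of_integral_meanZero {h : ℝ → ℂ} (hc : Continuous h)
    (H : ∀ φ ∈ meanZero, ∫ t, φ t * h t = 0) : ∃ c, ∀ t, h t = c := by
  let ρ : ContDiffBump (0 : ℝ) := default
  let ρ' : ℝ → ℝ := ρ.normed volume
  have hρc : Continuous ρ' := ρ.continuous_normed
  have hρs : HasCompactSupport ρ' := ρ.hasCompactSupport_normed
  have hρ1 : ∫ t, ρ' t = 1 := ρ.integral_normed
  have hi : ∀ u : ℝ → ℝ, Continuous u → HasCompactSupport u → Integrable fun t => (u t : ℂ) * h t :=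
    fun u h1 h2 => ((Complex.continuous_ofReal.comp h1).mul hc).integrable_of_hasCompactSupport
      ((h2.comp_left (g := Complex.ofReal) Complex.ofReal_zero).mul_right)
  refine ⟨∫ t, (ρ' t : ℂ) * h t, ?_⟩
  set c := ∫ t, (ρ' t : ℂ) * h t with hcdef
  have hae : ∀ᵐ t : ℝ, h t - c = 0 := by
    refine ae_eq_zero_of_integral_contDiff_smul_eq_zero
      (hc.sub continuous_const).locallyIntegrable fun g hg hgs => ?_
    have hgc := hg.continuous
    let a : ℝ := ∫ t, g t
    let φ : CompactlySupportedContinuousMap ℝ ℂ :=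
      ⟨⟨fun t => ((g t - a * ρ' t : ℝ) : ℂ), by fun_prop⟩,
        (hgs.sub (hρs.mul_left (f := fun _ => a))).comp_left (g := Complex.ofReal) Complex.ofReal_zero⟩
    have hφ : φ ∈ meanZero := by
      change ∫ t, ((g t - a * ρ' t : ℝ) : ℂ) = 0
      rw [integral_complex_ofReal, integral_sub (hgc.integrable_of_hasCompactSupport hgs)
        ((hρc.integrable_of_hasCompactSupport hρs).const_mul a), integral_const_mul, hρ1, mul_one,
        sub_self, Complex.ofReal_zero]
    have h1 : ∫ t, ((g t - a * ρ' t : ℝ) : ℂ) * h t = 0 := H φ hφ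
    have h2 : ∀ t, ((g t - a * ρ' t : ℝ) : ℂ) * h t = g t * h t - a * (ρ' t * h t) := fun t => by
      push_cast
      ring
    simp only [h2] at h1
    rw [integral_sub (hi g hgc hgs) ((hi ρ' hρc hρs).const_mul _), integral_const_mul, ← hcdef,
      sub_eq_zero] at h1
    have h3 : ∀ t, g t • (h t - c) = g t * h t - g t * c := fun t => by
      rw [Complex.real_smul]
      ring
    simp only [h3]
    have h4 : Integrable fun t => (g t : ℂ) * c :=
      (hgc.integrable_of_hasCompactSupport hgs).ofReal.mul_const c
    rw [integral_sub (hi g hgc hgs) h4, h1, integral_mul_const,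
      integral_complex_ofReal, sub_self]
  have h4 := (hc.sub continuous_const).ae_eq_iff_eq volume continuous_const (g := fun _ => (0 : ℂ))
    |>.1 hae
  exact fun t => sub_eq_zero.1 (congrFun h4 t)

/-- The extension of the embedding to `H(G_g)`. -/
noncomputable def screwIsometry (r : ℝ) (hr : 0 < r) :
    ScrewSpace (pwScrewFunction r hr) →ₗᵢ[ℂ] lp (fun _ : ℤ => ℂ) 2 where
  toLinearMap := ((screwPreIsometry r hr).toContinuousLinearMap.extend
    (UniformSpace.Completion.toComplL (𝕜 := ℂ))).toLinearMap
  norm_map' ξ := by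
    refine UniformSpace.Completion.induction_on ξ (isClosed_eq ?_ continuous_norm) fun φ => ?_
    · exact (ContinuousLinearMap.continuous _).norm
    · rw [UniformSpace.Completion.norm_coe, ← (screwPreIsometry r hr).norm_map]
      congr 1
      exact ContinuousLinearMap.extend_eq _ UniformSpace.Completion.denseRange_coe
        (UniformSpace.Completion.isUniformInducing_coe _) φ

theorem screwIsometry_coe (hr : 0 < r) (φ : ScrewPre (pwScrewFunction r hr)) :
    screwIsometry r hr φ.toSpace = screwLin r hr φ :=
  ContinuousLinearMap.extend_eq (screwPreIsometry r hr).toContinuousLinearMap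
    (e := UniformSpace.Completion.toComplL (𝕜 := ℂ)) UniformSpace.Completion.denseRange_coe
        (UniformSpace.Completion.isUniformInducing_coe _) φ

theorem screwIsometry_surjective (hr : 0 < r) : Function.Surjective (screwIsometry r hr) := by
  let K := LinearMap.range (screwIsometry r hr).toLinearMap
  have hcl : IsClosed (K : Set (lp (fun _ : ℤ => ℂ) 2)) :=
    (screwIsometry r hr).isometry.isClosedEmbedding.isClosed_range
  have htop : K.topologicalClosure = ⊤ := by
    rw [Submodule.topologicalClosure_eq_top_iff, Submodule.eq_bot_iff]
    intro v hv
    have hc : Continuous fun t => inner ℂ v (screwVec r hr t) :=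
      continuous_const.inner (continuous_screwVec hr)
    obtain ⟨c, h1⟩ := eq_const_of_integral_meanZero hc fun φ hφ => by
      let φ' : ScrewPre (pwScrewFunction r hr) := ⟨φ, hφ⟩
      have h2 := (Submodule.mem_orthogonal' _ _).1 hv (screwIsometry r hr φ'.toSpace) ⟨_, rfl⟩
      rw [screwIsometry_coe, screwLin_apply, ← integral_inner (integrable_smul_screwVec hr φ')] at h2
      simpa only [inner_smul_right] using h2
    refine eq_zero_of_inner_screwVec hr fun t => ?_
    have h0 : screwVec r hr 0 = 0 := by
      ext n
      simp [screwVec_apply, pwCoeff]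
    rw [h1 t, ← h1 0, h0, inner_zero_right]
  rw [hcl.submodule_topologicalClosure_eq] at htop
  exact LinearMap.range_eq_top.1 htop

/-- The coordinates `H(G_g) ≃ ℓ²`. -/
noncomputable def screwEquiv (r : ℝ) (hr : 0 < r) :
    ScrewSpace (pwScrewFunction r hr) ≃ₗᵢ[ℂ] lp (fun _ : ℤ => ℂ) 2 :=
  LinearIsometryEquiv.ofSurjective _ (screwIsometry_surjective hr)

theorem screwEquiv_coe (hr : 0 < r) (φ : ScrewPre (pwScrewFunction r hr)) :
    screwEquiv r hr φ.toSpace = ∫ t, φ t • screwVec r hr t :=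
  screwIsometry_coe hr φ

theorem screwEquiv_coord (hr : 0 < r) (φ : ScrewPre (pwScrewFunction r hr)) (n : ℤ) :
    screwEquiv r hr φ.toSpace n = (1 / √r : ℝ) * (fourierC φ (node r n) / node r n) := by
  rw [← screwLin_coord]
  exact congrArg (fun a : lp (fun _ : ℤ => ℂ) 2 => a n) (screwIsometry_coe hr φ)


variable {r : ℝ}

/-! ### The isometries between `H(G_g)`, `L²(τ)`, `L²(μ)`, `PW` and the screw line -/

noncomputable def levelEquiv (r : ℝ) (hr : 0 < r) :
    Lp ℂ 2 (levelMeasure (pwTheta r)) ≃ₗᵢ[ℂ] lp (fun _ : ℤ => ℂ) 2 :=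
  (exists_levelEquiv hr).choose

theorem levelEquiv_apply (hr : 0 < r) (f : Lp ℂ 2 (levelMeasure (pwTheta r))) (n : ℤ) :
    levelEquiv r hr f n = (√(Real.pi / r) : ℝ) * f (node r n) :=
  (exists_levelEquiv hr).choose_spec.1 f n

theorem ae_levelMeasure_iff (hr : 0 < r) (p : ℝ → Prop) :
    (∀ᵐ γ ∂(levelMeasure (pwTheta r)), p γ) ↔ ∀ n, p (node r n) :=
  (exists_levelEquiv hr).choose_spec.2 p

noncomputable def tauEquiv (r : ℝ) (hr : 0 < r) :
    Lp ℂ 2 (pwTau r) ≃ₗᵢ[ℂ] lp (fun _ : ℤ => ℂ) 2 :=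
  (exists_tauEquiv hr).choose

theorem tauEquiv_apply (hr : 0 < r) (f : Lp ℂ 2 (pwTau r)) (n : ℤ) :
    tauEquiv r hr f n = (√(1 / r) : ℝ) * f (node r n) :=
  (exists_tauEquiv hr).choose_spec.1 f n

theorem ae_pwTau_iff (hr : 0 < r) (p : ℝ → Prop) :
    (∀ᵐ γ ∂(pwTau r), p γ) ↔ ∀ n, p (node r n) :=
  (exists_tauEquiv hr).choose_spec.2 p

theorem sqrt_pi_div_ne_zero (hr : 0 < r) : ((√(Real.pi / r) : ℝ) : ℂ) ≠ 0 :=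
  Complex.ofReal_ne_zero.2 (Real.sqrt_pos.2 (by positivity)).ne'

/-- Restriction of `f / E` to the level set. -/
noncomputable def restrictEquiv (r : ℝ) (hr : 0 < r) :
    DeBrangesSpace (pwHB r hr) ≃ₗᵢ[ℂ] Lp ℂ 2 (levelMeasure (pwTheta r)) :=
  (pwHilbertBasis r hr).repr.trans (levelEquiv r hr).symm

theorem restrictEquiv_ae (hr : 0 < r) (f : DeBrangesSpace (pwHB r hr)) :
    (restrictEquiv r hr f : ℝ → ℂ) =ᵐ[levelMeasure (pwTheta r)] fun x => f x / pwHB r hr x := by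
  refine (ae_levelMeasure_iff hr _).2 fun n => ?_
  refine mul_left_cancel₀ (sqrt_pi_div_ne_zero hr) ?_
  rw [← levelEquiv_apply hr, ← pwHilbertBasis_repr hr, restrictEquiv, LinearIsometryEquiv.trans_apply,
    LinearIsometryEquiv.apply_symm_apply]

/-- Multiplication by `1 / √π` from `L²(τ)` to `L²(μ)`. -/
noncomputable def tauLevelEquiv (r : ℝ) (hr : 0 < r) :
    Lp ℂ 2 (pwTau r) ≃ₗᵢ[ℂ] Lp ℂ 2 (levelMeasure (pwTheta r)) :=
  (tauEquiv r hr).trans (levelEquiv r hr).symm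

theorem sqrt_pi_div_mul (hr : 0 < r) :
    ((√(Real.pi / r) : ℝ) : ℂ) * ((1 / √Real.pi : ℝ) : ℂ) = ((√(1 / r) : ℝ) : ℂ) := by
  have h : √Real.pi ≠ 0 := (Real.sqrt_pos.2 Real.pi_pos).ne'
  rw [← Complex.ofReal_mul, Real.sqrt_div Real.pi_pos.le, Real.sqrt_div zero_le_one, Real.sqrt_one]
  congr 1
  field_simp

theorem tauLevelEquiv_ae (hr : 0 < r) (h : Lp ℂ 2 (pwTau r)) :
    (tauLevelEquiv r hr h : ℝ → ℂ) =ᵐ[levelMeasure (pwTheta r)]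
      fun γ => (1 / √Real.pi : ℝ) * h γ := by
  refine (ae_levelMeasure_iff hr _).2 fun n => ?_
  refine mul_left_cancel₀ (sqrt_pi_div_ne_zero hr) ?_
  rw [← levelEquiv_apply hr, tauLevelEquiv, LinearIsometryEquiv.trans_apply,
    LinearIsometryEquiv.apply_symm_apply, tauEquiv_apply, ← mul_assoc, sqrt_pi_div_mul hr]

/-- The map `Φ₁ : H(G_g) → L²(τ)`. -/
noncomputable def phiEquiv (r : ℝ) (hr : 0 < r) :
    ScrewSpace (pwScrewFunction r hr) ≃ₗᵢ[ℂ] Lp ℂ 2 (pwTau r) :=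
  (screwEquiv r hr).trans (tauEquiv r hr).symm

theorem sqrt_one_div (r : ℝ) : √(1 / r) = 1 / √r := by
  rw [Real.sqrt_div zero_le_one, Real.sqrt_one]

theorem screwEquiv_eq_phiEquiv (hr : 0 < r) (ξ : ScrewSpace (pwScrewFunction r hr)) (n : ℤ) :
    screwEquiv r hr ξ n = (1 / √r : ℝ) * phiEquiv r hr ξ (node r n) := by
  rw [← sqrt_one_div, ← tauEquiv_apply hr, phiEquiv, LinearIsometryEquiv.trans_apply,
    LinearIsometryEquiv.apply_symm_apply]

theorem phiOne_eq {g : ScrewFunction} (φ : ScrewPre g) {z : ℂ} (hz : z ≠ 0) :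
    phiOne φ z = fourierC φ z / z := by
  have hint : ∫ t, φ t = 0 := φ.2
  have hi : Integrable φ := φ.continuous.integrable_of_hasCompactSupport φ.hasCompactSupport
  have hi2 : Integrable fun t : ℝ => φ t * Complex.exp (Complex.I * z * t) :=
    (φ.continuous.mul (by fun_prop)).integrable_of_hasCompactSupport φ.hasCompactSupport.mul_right
  have h1 : ∀ t : ℝ, φ t * (if z = 0 then Complex.I * t else
      (Complex.exp (Complex.I * z * t) - 1) / z) =
      (φ t * Complex.exp (Complex.I * z * t) - φ t) / z := fun t => by
    rw [if_neg hz]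
    ring
  rw [phiOne, integral_congr_ae (Eventually.of_forall h1), integral_div, integral_sub hi2 hi, hint,
    sub_zero, fourierC]

theorem phiEquiv_ae (hr : 0 < r) (φ : ScrewPre (pwScrewFunction r hr)) :
    (phiEquiv r hr φ.toSpace : ℝ → ℂ) =ᵐ[pwTau r] fun γ => phiOne φ γ := by
  refine (ae_pwTau_iff hr _).2 fun n => ?_
  have hs : ((1 / √r : ℝ) : ℂ) ≠ 0 := Complex.ofReal_ne_zero.2 (by positivity)
  refine mul_left_cancel₀ hs ?_
  rw [← screwEquiv_eq_phiEquiv, screwEquiv_coord,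
    ← phiOne_eq φ (Complex.ofReal_ne_zero.2 (node_ne_zero hr n))]

theorem hasSum_norm_toSpace (hr : 0 < r) (φ : ScrewPre (pwScrewFunction r hr)) : HasSum
    (fun n : ℤ => 1 / r * ((1 / node r n ^ 2) * ‖fourierC φ (node r n)‖ ^ 2))
    (‖φ.toSpace‖ ^ 2) := by
  have h := lp.hasSum_norm (p := 2) (by norm_num) (screwEquiv r hr φ.toSpace)
  simp only [ENNReal.toReal_ofNat, Real.rpow_two, LinearIsometryEquiv.norm_map] at h
  refine h.congr_fun fun n => ?_
  rw [screwEquiv_coord, norm_mul, norm_div, Complex.norm_real, Complex.norm_real, Real.norm_eq_abs,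
    Real.norm_eq_abs, mul_pow, div_pow, sq_abs, sq_abs, div_pow, Real.sq_sqrt hr.le]
  ring

/-- The map `φ ↦ (1 / √π) E P̂_φ`. -/
noncomputable def screwPWEquiv (r : ℝ) (hr : 0 < r) :
    ScrewSpace (pwScrewFunction r hr) ≃ₗᵢ[ℂ] DeBrangesSpace (pwHB r hr) :=
  (screwEquiv r hr).trans (pwHilbertBasis r hr).repr.symm

theorem restrictEquiv_screwPWEquiv (hr : 0 < r) (ξ : ScrewSpace (pwScrewFunction r hr)) :
    restrictEquiv r hr (screwPWEquiv r hr ξ) = tauLevelEquiv r hr (phiEquiv r hr ξ) := by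
  simp only [restrictEquiv, screwPWEquiv, tauLevelEquiv, phiEquiv, LinearIsometryEquiv.trans_apply,
    LinearIsometryEquiv.apply_symm_apply]

theorem hasSum_screwPWEquiv (hr : 0 < r) (ξ : ScrewSpace (pwScrewFunction r hr)) : HasSum
    (fun n : ℤ => ((1 / √r : ℝ) * (phiEquiv r hr ξ : ℝ → ℂ) (node r n) : ℂ) • pwHilbertBasis r hr n)
    (screwPWEquiv r hr ξ) := by
  refine ((pwHilbertBasis r hr).hasSum_repr_symm (screwEquiv r hr ξ)).congr_fun fun n => ?_
  rw [screwEquiv_eq_phiEquiv]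

theorem hasSum_screwPWEquiv_coe (hr : 0 < r) (φ : ScrewPre (pwScrewFunction r hr)) (z : ℂ) : HasSum
    (fun n : ℤ => (1 / √r : ℝ) * (fourierC φ (node r n) / node r n) * pwHilbertBasis r hr n z)
    (screwPWEquiv r hr φ.toSpace z) := by
  have h := hasSum_eval ((pwHilbertBasis r hr).hasSum_repr_symm (screwEquiv r hr φ.toSpace)) z
  refine h.congr_fun fun n => ?_
  rw [deBrangesSpace_smul, screwEquiv_coord]

/-- The line `𝔖_t` in `PW`. -/
noncomputable def screwLinePW (r : ℝ) (hr : 0 < r) (t : ℝ) : DeBrangesSpace (pwHB r hr) :=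
  ((√Real.pi : ℝ) : ℂ) • (pwHilbertBasis r hr).repr.symm (screwVec r hr t)

/-- The line `𝔖_t` in `K(Θ)`. -/
noncomputable def screwLine (r : ℝ) (hr : 0 < r) (t : ℝ) : modelSpace (pwTheta r) :=
  (modelEquiv r hr).symm (screwLinePW r hr t)

theorem sqrt_pi_mul_one_div (r : ℝ) :
    ((√Real.pi : ℝ) : ℂ) * ((1 / √r : ℝ) : ℂ) = ((√(Real.pi / r) : ℝ) : ℂ) := by
  rw [← Complex.ofReal_mul, Real.sqrt_div Real.pi_pos.le, mul_one_div]

theorem hasSum_screwLinePW (hr : 0 < r) (t : ℝ) : HasSum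
    (fun n : ℤ => ((√(Real.pi / r) : ℝ) * pwCoeff r t n : ℂ) • pwHilbertBasis r hr n)
    (screwLinePW r hr t) := by
  refine (((pwHilbertBasis r hr).hasSum_repr_symm (screwVec r hr t)).const_smul
    ((√Real.pi : ℝ) : ℂ)).congr_fun fun n => ?_
  rw [smul_smul, screwVec_apply, ← mul_assoc, sqrt_pi_mul_one_div]

theorem hasSum_screwLine (hr : 0 < r) (t : ℝ) : HasSum
    (fun n : ℤ => ((√(Real.pi / r) : ℝ) * pwCoeff r t n : ℂ) •
      (modelEquiv r hr).symm (pwHilbertBasis r hr n)) (screwLine r hr t) := by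
  refine ((hasSum_screwLinePW hr t).mapL
    (modelEquiv r hr).symm.toContinuousLinearEquiv.toContinuousLinearMap).congr_fun fun n => ?_
  exact (map_smul (modelEquiv r hr).symm _ _).symm

theorem hasSum_screwLine_ae (hr : 0 < r) (t : ℝ) : ∀ᵐ x : ℝ, HasSum
    (fun n : ℤ => (√(Real.pi / r) : ℝ) * pwCoeff r t n *
      (Complex.I * (1 + pwTheta r x) / (2 * (√(Real.pi * r) : ℝ) * (x - node r n))))
    ((screwLine r hr t : Lp ℂ 2 (volume : Measure ℝ)) x) := by
  have hne : ∀ᵐ x : ℝ, x ∉ Set.range (node r) :=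
    (Set.countable_range (node r)).ae_notMem volume
  filter_upwards [divIsometry_ae (screwLinePW r hr t), hne] with x h1 h2
  rw [screwLine, modelEquiv_symm_coe, h1]
  refine ((hasSum_eval (hasSum_screwLinePW hr t) x).div_const _).congr_fun fun n => ?_
  have h3 : (x : ℂ) ≠ node r n := fun h => h2 ⟨n, (Complex.ofReal_injective h).symm⟩
  rw [deBrangesSpace_smul, pwHilbertBasis_apply, mul_div_assoc, div_pwHB, basisVec_of_ne hr n h3,
    one_add_pwTheta]
  have h4 : ((√(Real.pi * r) : ℝ) : ℂ) ≠ 0 := Complex.ofReal_ne_zero.2 (sqrt_pi_mul_pos hr).ne'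
  have h5 := sub_ne_zero.2 h3
  generalize Complex.exp (Complex.I * r * x) = a
  generalize Complex.cos (r * x) = b
  field_simp

theorem one_div_sqrt_pi_smul_screwLine (hr : 0 < r) (t : ℝ) :
    ((1 / √Real.pi : ℝ) : ℂ) • screwLine r hr t =
      (modelEquiv r hr).symm ((pwHilbertBasis r hr).repr.symm (screwVec r hr t)) := by
  have h : √Real.pi ≠ 0 := (Real.sqrt_pos.2 Real.pi_pos).ne'
  rw [screwLine, screwLinePW, map_smul, smul_smul, ← Complex.ofReal_mul, one_div_mul_cancel h,
    Complex.ofReal_one, one_smul]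

theorem isScrewLineOf_screwLine (hr : 0 < r) :
    IsScrewLineOf (pwScrewFunction r hr) (fun t => ((1 / √Real.pi : ℝ) : ℂ) • screwLine r hr t) := by
  simp only [one_div_sqrt_pi_smul_screwLine hr]
  refine ⟨(modelEquiv r hr).symm.continuous.comp
    ((pwHilbertBasis r hr).repr.symm.continuous.comp (continuous_screwVec hr)), fun u t s => ?_⟩
  simp only [← map_sub, LinearIsometryEquiv.inner_map_map, inner_sub_left, inner_sub_right,
    inner_screwVec]
  have h0 : pwScrewFunction r hr 0 = 0 := (pwScrewFunction r hr).zero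
  have hs := pwScrew_neg r
  have e1 : pwScrewFunction r hr (s + u - (t + u)) = pwScrewFunction r hr (t - s) := by
    rw [show s + u - (t + u) = -(t - s) by ring]
    exact hs _
  have e2 : pwScrewFunction r hr (-s) = pwScrewFunction r hr s := hs _
  have e3 : pwScrewFunction r hr (u - (t + u)) = pwScrewFunction r hr t := by
    rw [show u - (t + u) = -t by ring]
    exact hs _
  simp only [screwKernel, e1, e2, e3, sub_self, h0, add_sub_cancel_right]
  ring

theorem screwLine_integral (hr : 0 < r) (φ : ScrewPre (pwScrewFunction r hr)) :
    ((modelEquiv r hr).symm (screwPWEquiv r hr φ.toSpace) : Lp ℂ 2 (volume : Measure ℝ)) =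
      ((1 / √Real.pi : ℝ) : ℂ) • ∫ t : ℝ, φ t • (screwLine r hr t : Lp ℂ 2 (volume : Measure ℝ)) := by
  let A : lp (fun _ : ℤ => ℂ) 2 →L[ℂ] Lp ℂ 2 (volume : Measure ℝ) :=
    (divIsometry (pwHB r hr)).toContinuousLinearMap.comp
      (pwHilbertBasis r hr).repr.symm.toContinuousLinearEquiv.toContinuousLinearMap
  have h1 := A.integral_comp_comm (integrable_smul_screwVec hr φ)
  have h2 : ((modelEquiv r hr).symm (screwPWEquiv r hr φ.toSpace) : Lp ℂ 2 (volume : Measure ℝ)) =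
      A (∫ t, φ t • screwVec r hr t) := by
    rw [← screwEquiv_coe]
    rfl
  rw [h2, ← h1, ← integral_smul]
  congr 1
  ext1 t
  have h3 : ((1 / √Real.pi : ℝ) : ℂ) • (screwLine r hr t : Lp ℂ 2 (volume : Measure ℝ)) =
      A (screwVec r hr t) :=
    congrArg Subtype.val (one_div_sqrt_pi_smul_screwLine hr t)
  rw [map_smul, smul_comm, h3]


variable {r : ℝ}

/-! ### The space `L²(H)` and the Weyl transform -/

/-- The measure of `L²(H_r)`. -/
noncomputable abbrev hamMeasure (r : ℝ) : Measure ℝ :=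
  ENNReal.ofReal (1 / Real.pi) • volume.restrict (Set.Ioc 0 r)

theorem hamMeasure_const_ne_zero : ENNReal.ofReal (1 / Real.pi) ≠ 0 :=
  (ENNReal.ofReal_pos.2 (by positivity)).ne'

theorem ae_hamMeasure_iff (r : ℝ) (p : ℝ → Prop) :
    (∀ᵐ t ∂(hamMeasure r), p t) ↔ ∀ᵐ t ∂(volume.restrict (Set.Ioc 0 r)), p t := by
  rw [Measure.ae_ennreal_smul_measure_eq hamMeasure_const_ne_zero]

theorem memLp_hamMeasure_iff {E : Type*} [NormedAddCommGroup E] {f : ℝ → E} :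
    MemLp f 2 (hamMeasure r) ↔ MemLp f 2 (volume.restrict (Set.Ioc 0 r)) := by
  refine ⟨fun h => h.of_measure_le_smul (c := ENNReal.ofReal Real.pi) ENNReal.ofReal_ne_top ?_,
    fun h => h.smul_measure ENNReal.ofReal_ne_top⟩
  rw [smul_smul, ← ENNReal.ofReal_mul Real.pi_pos.le, mul_one_div_cancel Real.pi_ne_zero,
    ENNReal.ofReal_one, one_smul]

theorem norm_sq_Lp {E α : Type*} [NormedAddCommGroup E] [InnerProductSpace ℂ E]
    [MeasurableSpace α] {μ : Measure α} (f : Lp E 2 μ) : ‖f‖ ^ 2 = ∫ a, ‖f a‖ ^ 2 ∂μ := by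
  have h : (inner ℂ f f : ℂ) = ((∫ a, ‖f a‖ ^ 2 ∂μ : ℝ) : ℂ) := by
    rw [L2.inner_def, ← integral_complex_ofReal]
    refine integral_congr_ae (Eventually.of_forall fun a => ?_)
    simp only
    rw [inner_self_eq_norm_sq_to_K]
    norm_num
  rw [inner_self_eq_norm_sq_to_K] at h
  refine Complex.ofReal_injective (Eq.trans ?_ h)
  push_cast
  rfl

theorem map_abs_restrict (hr : 0 < r) : Measure.map (fun t : ℝ => |t|)
    (volume.restrict (Set.Ioc (-r) r)) = 2 • volume.restrict (Set.Ioc 0 r) := by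
  have hm : Measurable fun t : ℝ => |t| := measurable_abs
  rw [← Set.Ioc_union_Ioc_eq_Ioc (by linarith : -r ≤ 0) hr.le,
    Measure.restrict_union (Set.Ioc_disjoint_Ioc_of_le le_rfl) measurableSet_Ioc,
    Measure.map_add _ _ hm, two_smul]
  congr 1
  · have h1 : Measure.map (fun t : ℝ => |t|) (volume.restrict (Set.Ioc (-r) 0)) =
        Measure.map (fun t : ℝ => -t) (volume.restrict (Set.Ioc (-r) 0)) := by
      refine Measure.map_congr ((ae_restrict_iff' measurableSet_Ioc).2 ?_)
      exact Eventually.of_forall fun t ht => abs_of_nonpos ht.2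
    have h2 := ((Measure.measurePreserving_neg (volume : Measure ℝ)).restrict_preimage
      (s := Set.Ico 0 r) measurableSet_Ico).map_eq
    have h3 : (Neg.neg ⁻¹' Set.Ico 0 r : Set ℝ) = Set.Ioc (-r) 0 := by
      ext t
      simp only [Set.mem_preimage, Set.mem_Ico, Set.mem_Ioc]
      constructor <;> rintro ⟨_, _⟩ <;> constructor <;> linarith
    rw [h3] at h2
    rw [h1]
    exact h2.trans (Measure.restrict_congr_set Ico_ae_eq_Ioc)
  · have h1 : Measure.map (fun t : ℝ => |t|) (volume.restrict (Set.Ioc 0 r)) =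
        Measure.map id (volume.restrict (Set.Ioc 0 r)) := by
      refine Measure.map_congr ((ae_restrict_iff' measurableSet_Ioc).2 ?_)
      exact Eventually.of_forall fun t ht => abs_of_pos ht.1
    rw [h1, Measure.map_id]

theorem ae_abs (hr : 0 < r) {p : ℝ → Prop} (h : ∀ᵐ t ∂(volume.restrict (Set.Ioc 0 r)), p t) :
    ∀ᵐ t ∂(volume.restrict (Set.Ioc (-r) r)), p |t| := by
  have h1 : ∀ᵐ t ∂(Measure.map (fun t : ℝ => |t|) (volume.restrict (Set.Ioc (-r) r))), p t := by
    rw [map_abs_restrict hr, two_smul, ae_add_measure_iff]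
    exact ⟨h, h⟩
  exact ae_of_ae_map measurable_abs.aemeasurable h1

theorem memLp_comp_abs (hr : 0 < r) {E : Type*} [NormedAddCommGroup E] {f : ℝ → E}
    (hf : MemLp f 2 (volume.restrict (Set.Ioc 0 r))) :
    MemLp (fun t => f |t|) 2 (volume.restrict (Set.Ioc (-r) r)) := by
  refine MemLp.comp_of_map (f := fun t : ℝ => |t|) ?_ measurable_abs.aemeasurable
  rw [map_abs_restrict hr]
  refine hf.of_measure_le_smul (c := 2) (by norm_num) ?_
  rw [two_smul, two_smul]

theorem memLp_ham (F : PWHamSpace r) : MemLp F 2 (volume.restrict (Set.Ioc 0 r)) :=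
  memLp_hamMeasure_iff.1 (Lp.memLp F)

theorem memLp_coord {μ : Measure ℝ} {F : ℝ → EuclideanSpace ℂ (Fin 2)} (hF : MemLp F 2 μ)
    (i : Fin 2) : MemLp (fun t => F t i) 2 μ :=
  (EuclideanSpace.proj (𝕜 := ℂ) (ι := Fin 2) i).comp_memLp' hF

theorem memLp_pair {μ : Measure ℝ} {f g : ℝ → ℂ} (hf : MemLp f 2 μ) (hg : MemLp g 2 μ) :
    MemLp (fun t => !₂[f t, g t]) 2 μ := by
  have h1 := (ContinuousLinearMap.toSpanSingleton ℂ
    (EuclideanSpace.single (0 : Fin 2) (1 : ℂ))).comp_memLp' hf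
  have h2 := (ContinuousLinearMap.toSpanSingleton ℂ
    (EuclideanSpace.single (1 : Fin 2) (1 : ℂ))).comp_memLp' hg
  refine (h1.add h2).ae_eq (Eventually.of_forall fun t => ?_)
  ext i
  fin_cases i <;> simp

theorem memLp_pwPsi (hr : 0 < r) (F : PWHamSpace r) :
    MemLp (pwPsi F) 2 (volume.restrict (Set.Ioc (-r) r)) := by
  have h := memLp_comp_abs hr (memLp_ham F)
  have h1 := memLp_coord h 1
  have hs : Measurable fun t : ℝ => (SignType.sign t : ℝ) :=
    by
      have h2 : (fun t : ℝ => (SignType.sign t : ℝ)) =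
          fun t => if 0 < t then 1 else if t < 0 then -1 else 0 := by
        ext t
        rcases lt_trichotomy t 0 with h | h | h <;> simp [h, h.le]
      rw [h2]
      exact Measurable.ite measurableSet_Ioi measurable_const
        (Measurable.ite measurableSet_Iio measurable_const measurable_const)
  refine (memLp_coord h 0).sub (h1.of_le_mul (c := 1) ?_ (Eventually.of_forall fun t => ?_))
  · exact (((Complex.measurable_ofReal.comp hs).const_mul Complex.I).aestronglyMeasurable).mul
      h1.aestronglyMeasurable
  · rw [norm_mul, norm_mul, Complex.norm_I, one_mul, Complex.norm_real]
    refine mul_le_mul_of_nonneg_right ?_ (norm_nonneg _)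
    rcases lt_trichotomy t 0 with h | h | h <;> simp [h]

theorem pwPsi_of_pos (F : ℝ → EuclideanSpace ℂ (Fin 2)) {t : ℝ} (ht : 0 < t) :
    pwPsi F t = F t 0 - Complex.I * F t 1 := by
  simp [pwPsi, abs_of_pos ht, sign_pos ht]

theorem pwPsi_neg_of_pos (F : ℝ → EuclideanSpace ℂ (Fin 2)) {t : ℝ} (ht : 0 < t) :
    pwPsi F (-t) = F t 0 + Complex.I * F t 1 := by
  simp [pwPsi, abs_of_pos ht, Left.sign_neg, sign_pos ht]

theorem integral_symm_interval {E : Type*} [NormedAddCommGroup E] [NormedSpace ℝ E] (hr : 0 < r)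
    {h : ℝ → E} (hi : IntegrableOn h (Set.Ioc (-r) r)) :
    ∫ t in (-r)..r, h t = ∫ t in (0 : ℝ)..r, (h t + h (-t)) := by
  have h0 : IntervalIntegrable h volume (-r) r :=
    (intervalIntegrable_iff_integrableOn_Ioc_of_le (by linarith)).2 hi
  have h1 : IntervalIntegrable h volume (-r) 0 := h0.mono_set (by
    rw [Set.uIcc_of_le (by linarith), Set.uIcc_of_le (by linarith)]
    exact Set.Icc_subset_Icc le_rfl hr.le)
  have h2 : IntervalIntegrable h volume 0 r := h0.mono_set (by
    rw [Set.uIcc_of_le hr.le, Set.uIcc_of_le (by linarith)]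
    exact Set.Icc_subset_Icc (by linarith) le_rfl)
  have h3 : IntervalIntegrable (fun t => h (-t)) volume 0 r := by
    simpa using (IntervalIntegrable.comp_sub_left h1 0).symm
  rw [intervalIntegral.integral_add h2 h3, intervalIntegral.integral_comp_neg, neg_zero, add_comm,
    intervalIntegral.integral_add_adjacent_intervals h1 h2]

theorem norm_sq_ham (hr : 0 < r) (F : PWHamSpace r) :
    ‖F‖ ^ 2 = 1 / Real.pi * ∫ t in (0 : ℝ)..r, ‖F t‖ ^ 2 := by
  rw [norm_sq_Lp, integral_smul_measure, ENNReal.toReal_ofReal (by positivity),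
    intervalIntegral.integral_of_le hr.le, smul_eq_mul]

theorem hamNormSq_eq (hr : 0 < r) (F : PWHamSpace r) : ‖F‖ ^ 2 = hamNormSq pwHam 0 r F := by
  rw [norm_sq_ham hr, hamNormSq]
  congr 2
  ext t
  rw [cmat_pwHam, Matrix.one_mulVec, EuclideanSpace.norm_sq_eq]
  simp only [dotProduct, Fin.sum_univ_two, Complex.mul_conj, Complex.normSq_eq_norm_sq,
    Complex.add_re, Complex.ofReal_re]

/-- `F ↦ Ψ_F` as a linear map. -/
noncomputable def psiLin (r : ℝ) (hr : 0 < r) : PWHamSpace r →ₗ[ℂ] IntervalL2 r where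
  toFun F := (memLp_pwPsi hr F).toLp _
  map_add' F G := by
    rw [← MemLp.toLp_add, MemLp.toLp_eq_toLp_iff]
    filter_upwards [ae_abs hr ((ae_hamMeasure_iff r _).1 (Lp.coeFn_add F G))] with t ht
    simp only [pwPsi, Pi.add_apply, ht, PiLp.add_apply]
    ring
  map_smul' c F := by
    rw [RingHom.id_apply, ← MemLp.toLp_const_smul, MemLp.toLp_eq_toLp_iff]
    filter_upwards [ae_abs hr ((ae_hamMeasure_iff r _).1 (Lp.coeFn_smul c F))] with t ht
    simp only [pwPsi, Pi.smul_apply, ht, PiLp.smul_apply, smul_eq_mul]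
    ring

theorem psiLin_ae (hr : 0 < r) (F : PWHamSpace r) :
    (psiLin r hr F : ℝ → ℂ) =ᵐ[volume.restrict (Set.Ioc (-r) r)] pwPsi F :=
  (memLp_pwPsi hr F).coeFn_toLp

theorem norm_sq_psiLin (hr : 0 < r) (F : PWHamSpace r) :
    ‖F‖ ^ 2 = 1 / (2 * Real.pi) * ‖psiLin r hr F‖ ^ 2 := by
  have h1 : ‖psiLin r hr F‖ ^ 2 = ∫ t in (-r)..r, ‖pwPsi F t‖ ^ 2 := by
    rw [norm_sq_Lp, intervalIntegral.integral_of_le (by linarith)]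
    refine integral_congr_ae ?_
    filter_upwards [psiLin_ae hr F] with t ht
    rw [ht]
  rw [h1, norm_sq_ham hr,
    integral_symm_interval hr ((memLp_pwPsi hr F).integrable_norm_pow (by norm_num))]
  have h2 : ∫ t in (0 : ℝ)..r, (‖pwPsi F t‖ ^ 2 + ‖pwPsi F (-t)‖ ^ 2) =
      ∫ t in (0 : ℝ)..r, 2 * ‖F t‖ ^ 2 := by
    refine intervalIntegral.integral_congr_ae (Eventually.of_forall fun t ht => ?_)
    rw [Set.uIoc_of_le hr.le] at ht
    rw [pwPsi_of_pos _ ht.1, pwPsi_neg_of_pos _ ht.1, EuclideanSpace.norm_sq_eq,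
      Fin.sum_univ_two]
    have h := parallelogram_law_with_norm ℂ (F t 0) (Complex.I * F t 1)
    rw [norm_mul, Complex.norm_I, one_mul] at h
    linarith
  rw [h2, intervalIntegral.integral_const_mul]
  field_simp

theorem psiLin_surjective (hr : 0 < r) : Function.Surjective (psiLin r hr) := by
  intro ψ
  have hψ : MemLp ψ 2 (volume.restrict (Set.Ioc (-r) r)) := Lp.memLp ψ
  have h1 : MemLp ψ 2 (volume.restrict (Set.Ioc 0 r)) :=
    hψ.mono_measure (Measure.restrict_mono (Set.Ioc_subset_Ioc_left (by linarith)) le_rfl)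
  have h2 : MemLp (fun t => ψ (-t)) 2 (volume.restrict (Set.Ioc 0 r)) := by
    have h3 := (Measure.measurePreserving_neg (volume : Measure ℝ)).restrict_preimage
      (s := Set.Ico (-r) 0) measurableSet_Ico
    have h4 : (Neg.neg ⁻¹' Set.Ico (-r) 0 : Set ℝ) = Set.Ioc 0 r := by
      ext t
      simp only [Set.mem_preimage, Set.mem_Ico, Set.mem_Ioc]
      constructor <;> rintro ⟨_, _⟩ <;> constructor <;> linarith
    rw [h4] at h3
    refine (hψ.mono_measure ?_).comp_measurePreserving h3
    rw [Measure.restrict_congr_set (Ico_ae_eq_Ioc (a := -r) (b := (0 : ℝ)))]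
    exact Measure.restrict_mono (Set.Ioc_subset_Ioc_right hr.le) le_rfl
  have hF : MemLp (fun t => !₂[(1 / 2 : ℂ) * (ψ t + ψ (-t)),
      (Complex.I / 2 : ℂ) * (ψ t - ψ (-t))]) 2 (hamMeasure r) :=
    memLp_hamMeasure_iff.2 (memLp_pair ((h1.add h2).const_mul _) ((h1.sub h2).const_mul _))
  obtain ⟨G, hG⟩ : ∃ G : PWHamSpace r, G =ᵐ[hamMeasure r] fun t =>
      !₂[(1 / 2 : ℂ) * (ψ t + ψ (-t)), (Complex.I / 2 : ℂ) * (ψ t - ψ (-t))] :=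
    ⟨hF.toLp _, hF.coeFn_toLp⟩
  refine ⟨G, ?_⟩
  refine Lp.ext ((psiLin_ae hr _).trans ?_)
  have h0 : ∀ᵐ t ∂(volume.restrict (Set.Ioc (-r) r)), t ≠ 0 :=
    ae_restrict_of_ae (Measure.ae_ne volume 0)
  filter_upwards [ae_abs hr ((ae_hamMeasure_iff r _).1 hG), h0] with t ht h0
  rcases lt_or_gt_of_ne h0 with h | h
  · rw [pwPsi, ht, abs_of_neg h, sign_neg h]
    simp
    linear_combination (1 / 2 * (ψ (-t) - ψ t)) * Complex.I_sq
  · rw [pwPsi, ht, abs_of_pos h, sign_pos h]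
    simp
    linear_combination (-1 / 2 * (ψ t - ψ (-t))) * Complex.I_sq

/-- `F ↦ Ψ_F` as a linear isomorphism. -/
noncomputable def psiEquiv (r : ℝ) (hr : 0 < r) : PWHamSpace r ≃ₗ[ℂ] IntervalL2 r :=
  LinearEquiv.ofBijective (psiLin r hr) ⟨(injective_iff_map_eq_zero _).2 fun F hF => by
    have h := norm_sq_psiLin hr F
    rw [hF, norm_zero] at h
    simpa using h, psiLin_surjective hr⟩

/-- The Weyl transform. -/
noncomputable def weylEquiv (r : ℝ) (hr : 0 < r) : PWHamSpace r ≃ₗᵢ[ℂ] DeBrangesSpace (pwHB r hr) where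
  toLinearEquiv := ((psiEquiv r hr).trans (LinearEquiv.smulOfNeZero ℂ _
    ((1 / √(2 * Real.pi) : ℝ) : ℂ) (Complex.ofReal_ne_zero.2 (by positivity)))).trans
      (pwFourier r hr).toLinearEquiv
  norm_map' F := by
    change ‖pwFourier r hr (((1 / √(2 * Real.pi) : ℝ) : ℂ) • psiLin r hr F)‖ = ‖F‖
    rw [LinearIsometryEquiv.norm_map, norm_smul, Complex.norm_real, Real.norm_eq_abs,
      abs_of_nonneg (by positivity), ← sq_eq_sq₀ (by positivity) (norm_nonneg _), mul_pow, div_pow,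
      Real.sq_sqrt (by positivity), one_pow, norm_sq_psiLin hr]

theorem weylEquiv_psi (hr : 0 < r) (F : PWHamSpace r) (z : ℂ) : weylEquiv r hr F z =
    1 / (2 * Real.pi) * ∫ t in (-r)..r, pwPsi F t * Complex.exp (Complex.I * z * t) := by
  change pwFourier r hr (((1 / √(2 * Real.pi) : ℝ) : ℂ) • psiLin r hr F) z = _
  rw [map_smul, deBrangesSpace_smul, pwFourier_apply, ← mul_assoc, ← sqrt_two_pi_sq]
  congr 1
  · push_cast
    field_simp
  · rw [intervalIntegral.integral_of_le (by linarith), intervalIntegral.integral_of_le (by linarith)]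
    refine integral_congr_ae ?_
    filter_upwards [psiLin_ae hr F] with t ht
    rw [ht]

theorem weylEquiv_apply (hr : 0 < r) (F : PWHamSpace r) (z : ℂ) : weylEquiv r hr F z =
    1 / Real.pi * ∫ t in (0 : ℝ)..r, (F t 0 * Complex.cos (t * z) + F t 1 * Complex.sin (t * z)) := by
  have hi : IntegrableOn (fun t => pwPsi F t * Complex.exp (Complex.I * z * t)) (Set.Ioc (-r) r) := by
    have h1 : IntegrableOn (pwPsi F) (Set.Ioc (-r) r) :=
      (memLp_pwPsi hr F).integrable (by norm_num)
    rw [← integrableOn_Icc_iff_integrableOn_Ioc] at h1 ⊢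
    exact h1.mul_continuousOn (by fun_prop) isCompact_Icc
  rw [weylEquiv_psi, integral_symm_interval hr hi]
  have h2 : ∫ t in (0 : ℝ)..r, (pwPsi F t * Complex.exp (Complex.I * z * t) +
      pwPsi F (-t) * Complex.exp (Complex.I * z * (-t : ℝ))) =
      ∫ t in (0 : ℝ)..r, 2 * (F t 0 * Complex.cos (t * z) + F t 1 * Complex.sin (t * z)) := by
    refine intervalIntegral.integral_congr_ae (Eventually.of_forall fun t ht => ?_)
    rw [Set.uIoc_of_le hr.le] at ht
    rw [pwPsi_of_pos _ ht.1, pwPsi_neg_of_pos _ ht.1,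
      show Complex.I * z * t = (t * z) * Complex.I by ring,
      show Complex.I * z * (-t : ℝ) = (-(t * z)) * Complex.I by push_cast; ring,
      Complex.exp_mul_I, Complex.exp_mul_I, Complex.cos_neg, Complex.sin_neg]
    linear_combination (-2 * F t 1 * Complex.sin (t * z)) * Complex.I_sq
  have : (Real.pi : ℂ) ≠ 0 := Complex.ofReal_ne_zero.2 Real.pi_ne_zero
  rw [h2, intervalIntegral.integral_const_mul, ← mul_assoc]
  congr 1
  field_simp

theorem weylTransform_eq (r : ℝ) (F : ℝ → EuclideanSpace ℂ (Fin 2)) (z : ℂ) :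
    weylTransform pwSol pwHam 0 r F z = 1 / Real.pi *
      ∫ t in (0 : ℝ)..r, (F t 0 * Complex.cos (t * z) + F t 1 * Complex.sin (t * z)) := by
  rw [weylTransform]
  congr 2
  ext t
  rw [cmat_pwHam, Matrix.one_mulVec]
  simp only [pwSol, dotProduct, Fin.sum_univ_two, Matrix.cons_val_zero, Matrix.cons_val_one]
  ring


variable {r : ℝ}

/-- The elements of `L²(H_r)` represented by functions continuous on `[0, r)` that vanish near
`r`. -/
def contHam (r : ℝ) (hr : 0 < r) : Submodule ℂ (PWHamSpace r) where
  carrier := {F | ∃ F₀ : ℝ → EuclideanSpace ℂ (Fin 2),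
    ContinuousOn F₀ (Set.Ico 0 r) ∧ (∃ c < r, ∀ t ∈ Set.Ico 0 r, c < t → F₀ t = 0) ∧
    (F : ℝ → EuclideanSpace ℂ (Fin 2)) =ᵐ[volume.restrict (Set.Ico 0 r)] F₀}
  add_mem' := by
    rintro F G ⟨F₀, h1, ⟨c, hc, h2⟩, h3⟩ ⟨G₀, k1, ⟨d, hd, k2⟩, k3⟩
    refine ⟨F₀ + G₀, h1.add k1, ⟨max c d, max_lt hc hd, fun t ht hct => ?_⟩, ?_⟩
    · rw [Pi.add_apply, h2 t ht ((le_max_left _ _).trans_lt hct),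
        k2 t ht ((le_max_right _ _).trans_lt hct), add_zero]
    · have h4 := (ae_hamMeasure_iff r _).1 (Lp.coeFn_add F G)
      rw [Measure.restrict_congr_set (Ico_ae_eq_Ioc (a := (0 : ℝ)) (b := r))] at h3 k3 ⊢
      exact EventuallyEq.trans h4 (h3.add k3)
  zero_mem' := by
    refine ⟨0, continuousOn_const, ⟨0, hr, fun _ _ _ => rfl⟩, ?_⟩
    rw [Measure.restrict_congr_set (Ico_ae_eq_Ioc (a := (0 : ℝ)) (b := r))]
    exact (ae_hamMeasure_iff r _).1 (Lp.coeFn_zero _ _ _)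
  smul_mem' := by
    rintro a F ⟨F₀, h1, ⟨c, hc, h2⟩, h3⟩
    refine ⟨a • F₀, h1.const_smul a, ⟨c, hc, fun t ht hct => ?_⟩, ?_⟩
    · rw [Pi.smul_apply, h2 t ht hct, smul_zero]
    · have h4 := (ae_hamMeasure_iff r _).1 (Lp.coeFn_smul a F)
      rw [Measure.restrict_congr_set (Ico_ae_eq_Ioc (a := (0 : ℝ)) (b := r))] at h3 ⊢
      exact EventuallyEq.trans h4 (h3.const_smul a)

theorem dense_contHam (hr : 0 < r) : Dense (contHam r hr : Set (PWHamSpace r)) := by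
  rw [Submodule.dense_iff_topologicalClosure_eq_top, Submodule.topologicalClosure_eq_top_iff,
    Submodule.eq_bot_iff]
  intro v hv
  have key : ∀ i : Fin 2, ∀ᵐ t ∂(volume.restrict (Set.Ioc 0 r)), v t i = 0 := fun i => by
    have hvi : MemLp (fun t => conj (v t i)) 2 (volume.restrict (Set.Ioc 0 r)) :=
      (memLp_coord (memLp_ham v) i).star
    have h1 : ∀ᵐ t ∂(volume.restrict (Set.Ioc 0 r)), t ∈ Set.Ioo 0 r → conj (v t i) = 0 := by
      refine isOpen_Ioo.ae_eq_zero_of_integral_contDiff_smul_eq_zero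
        ((hvi.integrable (by norm_num)).locallyIntegrable.locallyIntegrableOn _) fun g hg hgs hgU => ?_
      let F₀ : ℝ → EuclideanSpace ℂ (Fin 2) := fun t => (g t : ℂ) • EuclideanSpace.single i 1
      have hF₀ : Continuous F₀ := (Complex.continuous_ofReal.comp hg.continuous).smul continuous_const
      have hF₁ : HasCompactSupport F₀ :=
        (hgs.comp_left (g := Complex.ofReal) Complex.ofReal_zero).smul_right
      have hm : MemLp F₀ 2 (hamMeasure r) :=
        memLp_hamMeasure_iff.2 ((hF₀.memLp_of_hasCompactSupport hF₁).restrict _)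
      have hmem : hm.toLp F₀ ∈ contHam r hr := by
        refine ⟨F₀, hF₀.continuousOn, ?_, ?_⟩
        · have hrs : r ∉ tsupport g := fun h => lt_irrefl r (hgU h).2
          obtain ⟨ε, hε, h2⟩ := Metric.mem_nhds_iff.1
            ((isClosed_tsupport g).isOpen_compl.mem_nhds hrs)
          refine ⟨r - ε, by linarith, fun t ht hct => ?_⟩
          have h3 : t ∉ tsupport g := h2 (by
            rw [Metric.mem_ball, Real.dist_eq, abs_lt]
            constructor <;> linarith [ht.2])
          simp [F₀, image_eq_zero_of_notMem_tsupport h3]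
        · rw [Measure.restrict_congr_set (Ico_ae_eq_Ioc (a := (0 : ℝ)) (b := r))]
          exact (ae_hamMeasure_iff r _).1 hm.coeFn_toLp
      have h2 := (Submodule.mem_orthogonal' _ _).1 hv _ hmem
      rw [L2.inner_def, integral_smul_measure, smul_eq_zero] at h2
      have h3 := h2.resolve_left (by
        rw [ENNReal.toReal_ofReal (by positivity)]
        positivity)
      rw [← h3]
      refine integral_congr_ae ?_
      filter_upwards [(ae_hamMeasure_iff r _).1 hm.coeFn_toLp] with t ht
      rw [ht]
      simp only [F₀]
      rw [inner_smul_right, EuclideanSpace.inner_single_right, one_mul, Complex.real_smul]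
    have h2 : ∀ᵐ t ∂(volume.restrict (Set.Ioc 0 r)), t ∈ Set.Ioo 0 r := by
      rw [← Measure.restrict_congr_set (Ioo_ae_eq_Ioc (a := (0 : ℝ)) (b := r))]
      exact ae_restrict_mem measurableSet_Ioo
    filter_upwards [h1, h2] with t h1 h2
    simpa using h1 h2
  refine Lp.ext (EventuallyEq.trans ?_ (Lp.coeFn_zero _ _ _).symm)
  refine (ae_hamMeasure_iff r _).2 ?_
  filter_upwards [key 0, key 1] with t h0 h1
  ext i
  fin_cases i
  · exact h0
  · exact h1

/-! ### The kernel of `L` -/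

theorem abs_sin_nat_mul_le (n : ℕ) (y : ℝ) : |Real.sin (n * y)| ≤ n * |Real.sin y| := by
  induction n with
  | zero => simp
  | succ n ih =>
    rw [Nat.cast_succ, add_mul, one_mul, Real.sin_add]
    have h1 : |Real.sin (n * y) * Real.cos y| ≤ n * |Real.sin y| * 1 := by
      rw [abs_mul]
      exact mul_le_mul ih (Real.abs_cos_le_one _) (abs_nonneg _) (by positivity)
    have h2 : |Real.cos (n * y) * Real.sin y| ≤ 1 * |Real.sin y| := by
      rw [abs_mul]
      exact mul_le_mul_of_nonneg_right (Real.abs_cos_le_one _) (abs_nonneg _)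
    have := abs_add_le (Real.sin (n * y) * Real.cos y) (Real.cos (n * y) * Real.sin y)
    linarith

theorem sin_mul_sum_sin_odd (y : ℝ) (n : ℕ) :
    Real.sin y * ∑ k ∈ Finset.range n, Real.sin ((2 * k + 1 : ℕ) * y) = Real.sin (n * y) ^ 2 := by
  induction n with
  | zero => simp
  | succ n ih =>
    rw [Finset.sum_range_succ, mul_add, ih]
    have e1 : ((2 * n + 1 : ℕ) : ℝ) * y = n * y + (n * y + y) := by push_cast; ring
    have e2 : ((n + 1 : ℕ) : ℝ) * y = n * y + y := by push_cast; ring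
    rw [e1, e2, Real.sin_add, Real.sin_add, Real.cos_add]
    have h1 := Real.sin_sq_add_cos_sq (n * y)
    have h2 := Real.sin_sq_add_cos_sq y
    linear_combination (-(Real.sin (n * y) ^ 2)) * h2 + 0 * h1

theorem abs_sum_sin_odd_le {y : ℝ} (hy : Real.sin y ≠ 0) (n : ℕ) :
    |∑ k ∈ Finset.range n, Real.sin ((2 * k + 1 : ℕ) * y)| ≤ 1 / |Real.sin y| := by
  rw [le_div_iff₀ (abs_pos.2 hy), ← abs_mul, mul_comm, sin_mul_sum_sin_odd, abs_pow]
  exact pow_le_one₀ (abs_nonneg _) (Real.abs_sin_le_one _)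

/-- Abel's inequality. -/
theorem abs_sum_mul_le_of_antitone {f d : ℕ → ℝ} {B : ℝ} (hf : Antitone f) (hf0 : ∀ n, 0 ≤ f n)
    (hd : ∀ n, |∑ k ∈ Finset.range n, d k| ≤ B) (m n : ℕ) :
    |∑ k ∈ Finset.range (m + n), f k * d k - ∑ k ∈ Finset.range m, f k * d k| ≤ 2 * f m * B := by
  have hB : 0 ≤ B := (abs_nonneg _).trans (hd 0)
  have key : ∀ n, |∑ k ∈ Finset.range (m + n), f k * d k - ∑ k ∈ Finset.range m, f k * d k -
      f (m + n) * ∑ k ∈ Finset.range (m + n), d k + f m * ∑ k ∈ Finset.range m, d k| ≤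
      (f m - f (m + n)) * B := fun n => by
    induction n with
    | zero => simp
    | succ n ih =>
      have h1 : |(f (m + n) - f (m + n + 1)) * ∑ k ∈ Finset.range (m + n + 1), d k| ≤
          (f (m + n) - f (m + n + 1)) * B := by
        have h2 : 0 ≤ f (m + n) - f (m + n + 1) := sub_nonneg.2 (hf (Nat.le_succ _))
        rw [abs_mul, abs_of_nonneg h2]
        exact mul_le_mul_of_nonneg_left (hd _) h2
      rw [← add_assoc]
      refine le_trans (le_of_eq ?_) ((abs_add_le _ _).trans ((add_le_add ih h1).trans_eq (by ring)))
      congr 1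
      rw [Finset.sum_range_succ, Finset.sum_range_succ]
      ring
  have h1 := key n
  have h2 : |f (m + n) * ∑ k ∈ Finset.range (m + n), d k| ≤ f (m + n) * B := by
    rw [abs_mul, abs_of_nonneg (hf0 _)]
    exact mul_le_mul_of_nonneg_left (hd _) (hf0 _)
  have h3 : |f m * ∑ k ∈ Finset.range m, d k| ≤ f m * B := by
    rw [abs_mul, abs_of_nonneg (hf0 _)]
    exact mul_le_mul_of_nonneg_left (hd _) (hf0 _)
  rw [abs_le] at *
  constructor <;> linarith [h1.1, h1.2, h2.1, h2.2, h3.1, h3.2]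

theorem antitone_one_div_odd : Antitone fun k : ℕ => 1 / ((2 * k + 1 : ℕ) : ℝ) := fun a b hab => by
  refine one_div_le_one_div_of_le (by positivity) ?_
  exact_mod_cast (by omega : 2 * a + 1 ≤ 2 * b + 1)

/-- The partial sums of the square wave are uniformly bounded. -/
theorem abs_sum_square_wave_le (y : ℝ) (n : ℕ) :
    |∑ k ∈ Finset.range n, 1 / ((2 * k + 1 : ℕ) : ℝ) * Real.sin ((2 * k + 1 : ℕ) * y)| ≤ 3 := by
  have hsmall : ∀ m : ℕ,
      |∑ k ∈ Finset.range m, 1 / ((2 * k + 1 : ℕ) : ℝ) * Real.sin ((2 * k + 1 : ℕ) * y)| ≤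
        m * |Real.sin y| := fun m => by
    refine (Finset.abs_sum_le_sum_abs _ _).trans ?_
    refine (Finset.sum_le_card_nsmul _ _ |Real.sin y| fun k _ => ?_).trans_eq (by simp)
    have hk : (0 : ℝ) < ((2 * k + 1 : ℕ) : ℝ) := by positivity
    rw [abs_mul, abs_of_pos (one_div_pos.2 hk), one_div_mul_eq_div, div_le_iff₀ hk, mul_comm |Real.sin y|]
    exact abs_sin_nat_mul_le _ _
  by_cases hy : Real.sin y = 0
  · refine (hsmall n).trans ?_
    rw [hy]
    simp
  have hq : 0 < |Real.sin y| := abs_pos.2 hy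
  obtain ⟨m, hm1, hm2⟩ : ∃ m : ℕ, m * |Real.sin y| ≤ 1 ∧ 1 ≤ (m + 1) * |Real.sin y| := by
    refine ⟨⌊1 / |Real.sin y|⌋₊, ?_, ?_⟩
    · rw [← le_div_iff₀ hq]
      exact Nat.floor_le (by positivity)
    · rw [← div_le_iff₀ hq]
      exact (Nat.lt_floor_add_one _).le
  rcases le_total n m with h | h
  · refine (hsmall n).trans ?_
    have : (n : ℝ) * |Real.sin y| ≤ m * |Real.sin y| :=
      mul_le_mul_of_nonneg_right (by exact_mod_cast h) hq.le
    linarith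
  · obtain ⟨j, rfl⟩ := Nat.exists_eq_add_of_le h
    have h1 := abs_sum_mul_le_of_antitone antitone_one_div_odd (fun k => by positivity)
      (abs_sum_sin_odd_le hy) m j
    have h2 := hsmall m
    have h3 : 2 * (1 / ((2 * m + 1 : ℕ) : ℝ)) * (1 / |Real.sin y|) ≤ 2 := by
      rw [mul_assoc, one_div_mul_one_div]
      have h4 : 1 / (((2 * m + 1 : ℕ) : ℝ) * |Real.sin y|) ≤ 1 := by
        rw [div_le_one (by positivity)]
        refine hm2.trans (mul_le_mul_of_nonneg_right ?_ hq.le)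
        exact_mod_cast (by omega : m + 1 ≤ 2 * m + 1)
      linarith
    rw [abs_le] at *
    constructor <;> linarith [h1.1, h1.2, h2.1, h2.2]

theorem exists_tendsto_square_wave (y : ℝ) : ∃ a : ℝ, Tendsto (fun n : ℕ =>
    ∑ k ∈ Finset.range n, 1 / ((2 * k + 1 : ℕ) : ℝ) * Real.sin ((2 * k + 1 : ℕ) * y)) atTop (𝓝 a) := by
  by_cases hy : Real.sin y = 0
  · refine ⟨0, tendsto_const_nhds.congr fun n => (Finset.sum_eq_zero fun k _ => ?_).symm⟩
    have := abs_sin_nat_mul_le (2 * k + 1) y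
    rw [hy, abs_zero, mul_zero, abs_nonpos_iff] at this
    rw [this, mul_zero]
  · refine cauchySeq_tendsto_of_complete
      (antitone_one_div_odd.cauchySeq_series_mul_of_tendsto_zero_of_bounded ?_
        (abs_sum_sin_odd_le hy))
    refine tendsto_const_nhds.div_atTop (tendsto_natCast_atTop_atTop.comp ?_)
    exact tendsto_atTop_mono (fun n : ℕ => (by omega : n ≤ 2 * n + 1)) tendsto_id

/-- The symmetric partial sums of `∑ e^{iγ_n x} / γ_n`. -/
noncomputable def nodeSum (r : ℝ) (N : ℕ) (x : ℝ) : ℂ :=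
  ∑ n ∈ Finset.Icc (-(N : ℤ)) N, Complex.exp (Complex.I * x * node r n) / node r n

theorem node_natCast_add_one (r : ℝ) (k : ℕ) :
    node r (k + 1) = Real.pi / (2 * r) * (2 * k + 1 : ℕ) := by
  rw [node]
  push_cast
  ring

theorem nodeSum_eq (hr : 0 < r) (N : ℕ) (x : ℝ) : nodeSum r N x =
    ((4 * r / Real.pi * ∑ k ∈ Finset.range N, 1 / ((2 * k + 1 : ℕ) : ℝ) *
      Real.sin ((2 * k + 1 : ℕ) * (Real.pi / (2 * r) * x)) : ℝ) : ℂ) * Complex.I -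
      Complex.exp (-(Complex.I * x * node r (N + 1))) / node r (N + 1) := by
  have href : ∀ k : ℤ, node r (-k) = -node r (k + 1) := fun k => by
    rw [node, node]
    push_cast
    ring
  have h1 : ∀ k : ℕ, Complex.exp (Complex.I * x * node r (k + 1)) / node r (k + 1) -
      Complex.exp (-(Complex.I * x * node r (k + 1))) / node r (k + 1) =
      ((4 * r / Real.pi * (1 / ((2 * k + 1 : ℕ) : ℝ) *
        Real.sin ((2 * k + 1 : ℕ) * (Real.pi / (2 * r) * x))) : ℝ) : ℂ) * Complex.I := fun k => by
    rw [node_natCast_add_one, show (2 * k + 1 : ℕ) * (Real.pi / (2 * r) * x) =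
      x * (Real.pi / (2 * r) * (2 * k + 1 : ℕ)) by ring]
    have hk : ((2 * k + 1 : ℕ) : ℂ) ≠ 0 := Nat.cast_ne_zero.2 (by omega)
    have hrc : (r : ℂ) ≠ 0 := Complex.ofReal_ne_zero.2 hr.ne'
    have hpi : (Real.pi : ℂ) ≠ 0 := Complex.ofReal_ne_zero.2 Real.pi_ne_zero
    generalize hγ : Real.pi / (2 * r) * ((2 * k + 1 : ℕ) : ℝ) = γ
    have hγ' : (γ : ℂ) = Real.pi / (2 * r) * ((2 * k + 1 : ℕ) : ℂ) := by
      rw [← hγ]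
      push_cast
      ring
    have e : Complex.exp (Complex.I * x * γ) - Complex.exp (-(Complex.I * x * γ)) =
        2 * Complex.I * Complex.sin (x * γ) := by
      rw [show Complex.I * x * γ = (x * γ) * Complex.I by ring, ← neg_mul, Complex.exp_mul_I,
        Complex.exp_mul_I, Complex.cos_neg, Complex.sin_neg]
      ring
    rw [← sub_div, e, Complex.ofReal_mul, Complex.ofReal_mul, Complex.ofReal_sin, Complex.ofReal_mul]
    push_cast at hγ' hk ⊢
    rw [hγ']
    field_simp
    ring
  rw [nodeSum, sum_Icc_neg_eq]
  induction N with
  | zero =>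
    have := href 0
    simp only [neg_zero, zero_add] at this
    rw [this]
    simp [div_neg]
  | succ N ih =>
    rw [Finset.sum_range_succ, Finset.sum_range_succ, mul_add, Complex.ofReal_add, add_mul, ← h1 N,
      ← add_assoc, ih, href (N + 1)]
    push_cast
    simp only [mul_neg, div_neg]
    ring


variable {r : ℝ}

theorem norm_exp_div_node (hr : 0 < r) (N : ℕ) (x : ℝ) :
    ‖Complex.exp (-(Complex.I * x * node r (N + 1))) / node r (N + 1)‖ =
      2 * r / Real.pi * (1 / ((2 * N + 1 : ℕ) : ℝ)) := by
  have h1 : ‖Complex.exp (-(Complex.I * x * node r (N + 1)))‖ = 1 := by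
    rw [show -(Complex.I * x * (node r (N + 1) : ℂ)) = ((-(x * node r (N + 1)) : ℝ) : ℂ) * Complex.I by
      push_cast
      ring]
    exact Complex.norm_exp_ofReal_mul_I _
  have h2 : (0 : ℝ) < ((2 * N + 1 : ℕ) : ℝ) := by positivity
  rw [norm_div, h1, Complex.norm_real, node_natCast_add_one, Real.norm_eq_abs,
    abs_of_pos (by positivity)]
  field_simp

theorem norm_nodeSum_le (hr : 0 < r) (N : ℕ) (x : ℝ) : ‖nodeSum r N x‖ ≤ 14 * r / Real.pi := by
  have h1 := abs_sum_square_wave_le (Real.pi / (2 * r) * x) N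
  have h2 : 1 / ((2 * N + 1 : ℕ) : ℝ) ≤ 1 := by
    rw [div_le_one (by positivity)]
    exact_mod_cast (by omega : 1 ≤ 2 * N + 1)
  rw [nodeSum_eq hr]
  refine (norm_sub_le _ _).trans ?_
  rw [norm_exp_div_node hr, norm_mul, Complex.norm_I, mul_one, Complex.norm_real, Real.norm_eq_abs,
    abs_mul, abs_of_pos (by positivity : 0 < 4 * r / Real.pi)]
  have h3 := mul_le_mul_of_nonneg_left h1 (by positivity : 0 ≤ 4 * r / Real.pi)
  have h4 := mul_le_mul_of_nonneg_left h2 (by positivity : 0 ≤ 2 * r / Real.pi)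
  refine (add_le_add h3 h4).trans_eq ?_
  ring

theorem exists_tendsto_nodeSum (hr : 0 < r) (x : ℝ) :
    ∃ a, Tendsto (fun N => nodeSum r N x) atTop (𝓝 a) := by
  obtain ⟨a, ha⟩ := exists_tendsto_square_wave (Real.pi / (2 * r) * x)
  refine ⟨((4 * r / Real.pi * a : ℝ) : ℂ) * Complex.I - 0, ?_⟩
  simp only [nodeSum_eq hr]
  refine (((Complex.continuous_ofReal.tendsto _).comp (ha.const_mul _)).mul_const _).sub ?_
  rw [tendsto_zero_iff_norm_tendsto_zero]
  simp only [norm_exp_div_node hr]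
  rw [← mul_zero (2 * r / Real.pi)]
  refine (tendsto_const_nhds.div_atTop (tendsto_natCast_atTop_atTop.comp ?_)).const_mul _
  exact tendsto_atTop_mono (fun n : ℕ => (by omega : n ≤ 2 * n + 1)) tendsto_id

/-- The sum of `∑ e^{iγ_n x} / γ_n`. -/
noncomputable def nodeLimit (r : ℝ) (hr : 0 < r) (x : ℝ) : ℂ := (exists_tendsto_nodeSum hr x).choose

theorem tendsto_nodeSum (hr : 0 < r) (x : ℝ) :
    Tendsto (fun N => nodeSum r N x) atTop (𝓝 (nodeLimit r hr x)) :=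
  (exists_tendsto_nodeSum hr x).choose_spec

/-- `ᵗ[cos(tγ), sin(tγ)]` as a vector. -/
noncomputable def solVec (t γ : ℝ) : EuclideanSpace ℂ (Fin 2) := WithLp.toLp 2 (pwSol t γ)

theorem solVec_eq (t γ : ℝ) : solVec t γ =
    Complex.exp (Complex.I * t * γ) • !₂[(1 / 2 : ℂ), -Complex.I / 2] +
      Complex.exp (-(Complex.I * t * γ)) • !₂[(1 / 2 : ℂ), Complex.I / 2] := by
  rw [show Complex.I * t * γ = (t * γ) * Complex.I by ring, ← neg_mul, Complex.exp_mul_I,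
    Complex.exp_mul_I, Complex.cos_neg, Complex.sin_neg]
  ext i
  fin_cases i
  · simp [solVec, pwSol]
    ring
  · simp [solVec, pwSol]
    linear_combination Complex.sin (t * γ) * Complex.I_sq

theorem continuous_solVec (γ : ℝ) : Continuous fun t => solVec t γ := by
  simp only [solVec_eq]
  fun_prop

/-- The partial sums of the kernel of `L`. -/
noncomputable def kernelSum (r : ℝ) (N : ℕ) (t s : ℝ) : EuclideanSpace ℂ (Fin 2) :=
  ∑ n ∈ Finset.Icc (-(N : ℤ)) N,
    (pwCoeff r s n * (Complex.I * (√Real.pi : ℝ) / r * (-1) ^ n)) • solVec t (node r n)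

theorem kernelSum_apply (r : ℝ) (N : ℕ) (t s : ℝ) (i : Fin 2) : kernelSum r N t s i =
    Complex.I * (√Real.pi : ℝ) / r * ∑ n ∈ Finset.Icc (-(N : ℤ)) N,
      (-1 : ℂ) ^ n * pwCoeff r s n * pwSol t (node r n) i := by
  rw [kernelSum, WithLp.ofLp_sum, Finset.sum_apply, Finset.mul_sum]
  refine Finset.sum_congr rfl fun n _ => ?_
  rw [PiLp.smul_apply, smul_eq_mul, solVec]
  ring

theorem kernelSum_eq (hr : 0 < r) (N : ℕ) (t s : ℝ) : kernelSum r N t s =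
    ((√Real.pi : ℝ) / r : ℂ) •
      ((nodeSum r N (s + t - r) - nodeSum r N (t - r)) • !₂[(1 / 2 : ℂ), -Complex.I / 2] +
        (nodeSum r N (s - t - r) - nodeSum r N (-t - r)) • !₂[(1 / 2 : ℂ), Complex.I / 2]) := by
  simp only [kernelSum, nodeSum, ← Finset.sum_sub_distrib, Finset.sum_smul, ← Finset.sum_add_distrib,
    Finset.smul_sum]
  refine Finset.sum_congr rfl fun n _ => ?_
  have h1 := pwHB_node hr n
  rw [pwHB_apply] at h1
  have e : ∀ a b : ℝ, Complex.exp (Complex.I * (a + b - r : ℝ) * node r n) =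
      Complex.exp (Complex.I * a * node r n) * Complex.exp (Complex.I * b * node r n) *
        (Complex.I * (-1) ^ n) := fun a b => by
    rw [← h1, ← Complex.exp_add, ← Complex.exp_add]
    congr 1
    push_cast
    ring
  have e2 := e 0 t
  have e3 := e s (-t)
  have e4 := e 0 (-t)
  rw [zero_add] at e2 e4
  rw [← sub_eq_add_neg] at e3
  have e5 : Complex.exp (Complex.I * (-t : ℝ) * node r n) =
      Complex.exp (-(Complex.I * t * node r n)) := by
    congr 1
    push_cast
    ring
  rw [e, e2, e3, e4, e5, solVec_eq, pwCoeff]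
  simp only [smul_add, smul_smul, Complex.ofReal_zero, mul_zero, zero_mul, Complex.exp_zero]
  congr 2 <;> ring

/-- The kernel of `L`. -/
noncomputable def kernelLimit (r : ℝ) (hr : 0 < r) (t s : ℝ) : EuclideanSpace ℂ (Fin 2) :=
  ((√Real.pi : ℝ) / r : ℂ) •
    ((nodeLimit r hr (s + t - r) - nodeLimit r hr (t - r)) • !₂[(1 / 2 : ℂ), -Complex.I / 2] +
      (nodeLimit r hr (s - t - r) - nodeLimit r hr (-t - r)) • !₂[(1 / 2 : ℂ), Complex.I / 2])

theorem tendsto_kernelSum (hr : 0 < r) (t s : ℝ) :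
    Tendsto (fun N => kernelSum r N t s) atTop (𝓝 (kernelLimit r hr t s)) := by
  simp only [kernelSum_eq hr]
  have h := tendsto_nodeSum hr
  exact ((((h _).sub (h _)).smul_const _).add (((h _).sub (h _)).smul_const _)).const_smul _

theorem exists_norm_kernelSum_le (hr : 0 < r) : ∃ C, ∀ N t s, ‖kernelSum r N t s‖ ≤ C := by
  refine ⟨‖((√Real.pi : ℝ) / r : ℂ)‖ * ((14 * r / Real.pi + 14 * r / Real.pi) *
    ‖!₂[(1 / 2 : ℂ), -Complex.I / 2]‖ + (14 * r / Real.pi + 14 * r / Real.pi) *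
    ‖!₂[(1 / 2 : ℂ), Complex.I / 2]‖), fun N t s => ?_⟩
  have h : ∀ x y : ℝ, ‖nodeSum r N x - nodeSum r N y‖ ≤ 14 * r / Real.pi + 14 * r / Real.pi :=
    fun x y => (norm_sub_le _ _).trans (add_le_add (norm_nodeSum_le hr N x) (norm_nodeSum_le hr N y))
  rw [kernelSum_eq hr, norm_smul]
  refine mul_le_mul_of_nonneg_left ((norm_add_le _ _).trans ?_) (norm_nonneg _)
  rw [norm_smul, norm_smul]
  exact add_le_add (mul_le_mul_of_nonneg_right (h _ _) (norm_nonneg _))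
    (mul_le_mul_of_nonneg_right (h _ _) (norm_nonneg _))

theorem continuous_pwCoeff (r : ℝ) (n : ℤ) : Continuous fun s => pwCoeff r s n := by
  unfold pwCoeff
  fun_prop

theorem integral_mul_pwCoeff (hr : 0 < r) {g : ScrewFunction} (φ : ScrewPre g) (n : ℤ) :
    ∫ s, φ s * pwCoeff r s n = fourierC φ (node r n) / node r n := by
  have hn : (node r n : ℂ) ≠ 0 := Complex.ofReal_ne_zero.2 (node_ne_zero hr n)
  rw [← phiOne_eq φ hn]
  refine integral_congr_ae (Eventually.of_forall fun s => ?_)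
  simp only
  rw [if_neg hn, pwCoeff, show Complex.I * s * (node r n : ℂ) = Complex.I * node r n * s by ring]

theorem integral_smul_kernelSum (hr : 0 < r) {g : ScrewFunction} (φ : ScrewPre g) (N : ℕ) (t : ℝ) :
    ∫ s, φ s • kernelSum r N t s = ∑ n ∈ Finset.Icc (-(N : ℤ)) N,
      (fourierC φ (node r n) / node r n * (Complex.I * (√Real.pi : ℝ) / r * (-1) ^ n)) •
        solVec t (node r n) := by
  simp only [kernelSum, Finset.smul_sum, smul_smul, ← mul_assoc (φ _)]
  rw [integral_finsetSum]
  · refine Finset.sum_congr rfl fun n _ => ?_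
    rw [integral_smul_const, integral_mul_const, integral_mul_pwCoeff hr]
  · intro n _
    exact ((φ.continuous.mul (continuous_pwCoeff r n)).mul continuous_const |>.smul
      continuous_const).integrable_of_hasCompactSupport
        ((φ.hasCompactSupport.mul_right).mul_right.smul_right)

theorem tendsto_integral_kernelSum (hr : 0 < r) {g : ScrewFunction} (φ : ScrewPre g) (t : ℝ) :
    Tendsto (fun N => ∫ s, φ s • kernelSum r N t s) atTop (𝓝 (∫ s, φ s • kernelLimit r hr t s)) := by
  obtain ⟨C, hC⟩ := exists_norm_kernelSum_le hr
  have hi : Integrable φ := φ.continuous.integrable_of_hasCompactSupport φ.hasCompactSupport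
  refine tendsto_integral_of_dominated_convergence (fun s => ‖φ s‖ * C) (fun N => ?_)
    (hi.norm.mul_const C) (fun N => Eventually.of_forall fun s => ?_)
    (Eventually.of_forall fun s => (tendsto_kernelSum hr t s).const_smul _)
  · have h : Continuous fun s => kernelSum r N t s :=
      continuous_finsetSum _ fun n _ =>
        ((continuous_pwCoeff r n).mul continuous_const).smul continuous_const
    exact (φ.continuous.smul h).aestronglyMeasurable
  · rw [norm_smul]
    exact mul_le_mul_of_nonneg_left (hC N t s) (norm_nonneg _)

theorem memLp_solVec (r : ℝ) (c : ℂ) (γ : ℝ) : MemLp (fun t => c • solVec t γ) 2 (hamMeasure r) := by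
  have hc : Continuous fun t => c • solVec t γ := (continuous_solVec γ).const_smul c
  obtain ⟨C, hC⟩ := isCompact_Icc.exists_bound_of_continuousOn (s := Set.Icc 0 r) hc.continuousOn
  refine memLp_hamMeasure_iff.2 (MemLp.of_bound hc.aestronglyMeasurable C ?_)
  rw [ae_restrict_iff' measurableSet_Ioc]
  exact Eventually.of_forall fun t ht => hC t (Set.Ioc_subset_Icc_self ht)

theorem integral_cos_node (hr : 0 < r) (n m : ℤ) :
    ∫ t in (0 : ℝ)..r, Complex.cos ((node r m - node r n) * t) = if m = n then (r : ℂ) else 0 := by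
  split_ifs with h
  · subst h
    simp
  · have h1 : (node r m - node r n : ℂ) ≠ 0 :=
      sub_ne_zero.2 fun h' => h (node_injective hr (by exact_mod_cast h'))
    rw [integral_cos_mul_complex h1]
    have h2 : ((node r m - node r n : ℂ)) * r = ((m - n : ℤ) : ℂ) * Real.pi := by
      have h3 : (r : ℂ) * node r m = Real.pi * m - Real.pi / 2 := by
        exact_mod_cast congrArg Complex.ofReal (r_mul_node hr m)
      have h4 : (r : ℂ) * node r n = Real.pi * n - Real.pi / 2 := by
        exact_mod_cast congrArg Complex.ofReal (r_mul_node hr n)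
      push_cast
      linear_combination h3 - h4
    rw [h2, Complex.sin_int_mul_pi]
    simp

theorem weylEquiv_symm_basis (hr : 0 < r) (n : ℤ) :
    ((weylEquiv r hr).symm (pwHilbertBasis r hr n) : ℝ → EuclideanSpace ℂ (Fin 2)) =ᵐ[hamMeasure r]
      fun t => ((√(Real.pi / r) : ℝ) * (Complex.I * (-1) ^ n) : ℂ) • solVec t (node r n) := by
  have hm := memLp_solVec r ((√(Real.pi / r) : ℝ) * (Complex.I * (-1) ^ n) : ℂ) (node r n)
  obtain ⟨G, hG⟩ : ∃ G : PWHamSpace r, G =ᵐ[hamMeasure r]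
      fun t => ((√(Real.pi / r) : ℝ) * (Complex.I * (-1) ^ n) : ℂ) • solVec t (node r n) :=
    ⟨hm.toLp _, hm.coeFn_toLp⟩
  suffices h : (weylEquiv r hr).symm (pwHilbertBasis r hr n) = G by rwa [h]
  rw [LinearIsometryEquiv.symm_apply_eq, ← sub_eq_zero]
  refine eq_zero_of_node hr fun m => ?_
  rw [deBrangesSpace_sub, sub_eq_zero, weylEquiv_apply, pwHilbertBasis_apply]
  have h1 : ∫ t in (0 : ℝ)..r, (G t 0 * Complex.cos (t * node r m) + G t 1 * Complex.sin (t * node r m)) =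
      ∫ t in (0 : ℝ)..r, ((√(Real.pi / r) : ℝ) * (Complex.I * (-1) ^ n) : ℂ) *
        Complex.cos ((node r m - node r n) * t) := by
    rw [intervalIntegral.integral_of_le hr.le, intervalIntegral.integral_of_le hr.le]
    refine integral_congr_ae ?_
    filter_upwards [(ae_hamMeasure_iff r _).1 hG] with t ht
    rw [ht, sub_mul, Complex.cos_sub, PiLp.smul_apply, PiLp.smul_apply]
    simp only [solVec, pwSol, Matrix.cons_val_zero, Matrix.cons_val_one, smul_eq_mul]
    rw [mul_comm (t : ℂ), mul_comm (t : ℂ)]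
    ring
  rw [h1, intervalIntegral.integral_const_mul, integral_cos_node hr]
  split_ifs with h
  · subst h
    have hs : ((√(Real.pi * r) : ℝ) : ℂ) ≠ 0 := Complex.ofReal_ne_zero.2 (sqrt_pi_mul_pos hr).ne'
    have hs2 : ((√(Real.pi * r) : ℝ) : ℂ) ^ 2 = Real.pi * r := by
      rw [← Complex.ofReal_pow, sq_sqrt_pi_mul hr, Complex.ofReal_mul]
    have hrc : (r : ℂ) ≠ 0 := Complex.ofReal_ne_zero.2 hr.ne'
    have hpi : (Real.pi : ℂ) ≠ 0 := Complex.ofReal_ne_zero.2 Real.pi_ne_zero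
    rw [basisVec_node_self, pwHB_node, sqrt_div_pi hr, sqrt_pi_div hr]
    push_cast
    field_simp
    rw [hs2]
    ring
  · rw [basisVec_node_of_ne hr h]
    simp

/-- The map `L`. -/
noncomputable def screwHamEquiv (r : ℝ) (hr : 0 < r) :
    ScrewSpace (pwScrewFunction r hr) ≃ₗᵢ[ℂ] PWHamSpace r :=
  (screwPWEquiv r hr).trans (weylEquiv r hr).symm

theorem screwHamEquiv_ae (hr : 0 < r) (φ : ScrewPre (pwScrewFunction r hr)) :
    (screwHamEquiv r hr φ.toSpace : ℝ → EuclideanSpace ℂ (Fin 2)) =ᵐ[volume.restrict (Set.Ioc 0 r)]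
      fun t => ∫ s, φ s • kernelLimit r hr t s := by
  have h1 : HasSum (fun n : ℤ => screwEquiv r hr φ.toSpace n •
      (weylEquiv r hr).symm (pwHilbertBasis r hr n)) (screwHamEquiv r hr φ.toSpace) := by
    refine (((pwHilbertBasis r hr).hasSum_repr_symm (screwEquiv r hr φ.toSpace)).mapL
      (weylEquiv r hr).symm.toContinuousLinearEquiv.toContinuousLinearMap).congr_fun fun n => ?_
    exact (map_smul (weylEquiv r hr).symm _ _).symm
  have h2 := tendsto_sum_Icc_of_hasSum h1
  obtain ⟨ns, hns, h3⟩ := (tendstoInMeasure_of_tendsto_Lp h2).exists_seq_tendsto_ae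
  have h4 : ∀ N : ℕ, ((∑ n ∈ Finset.Icc (-(N : ℤ)) N, screwEquiv r hr φ.toSpace n •
      (weylEquiv r hr).symm (pwHilbertBasis r hr n) : PWHamSpace r) :
      ℝ → EuclideanSpace ℂ (Fin 2)) =ᵐ[hamMeasure r] fun t => ∫ s, φ s • kernelSum r N t s := by
    intro N
    have h5 : ∀ᵐ t ∂(hamMeasure r), ∀ n : ℤ, (screwEquiv r hr φ.toSpace n •
        (weylEquiv r hr).symm (pwHilbertBasis r hr n) : PWHamSpace r) t =
        (fourierC φ (node r n) / node r n * (Complex.I * (√Real.pi : ℝ) / r * (-1) ^ n)) •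
        solVec t (node r n) := by
      refine ae_all_iff.2 fun n => ?_
      filter_upwards [weylEquiv_symm_basis hr n, Lp.coeFn_smul (screwEquiv r hr φ.toSpace n)
        ((weylEquiv r hr).symm (pwHilbertBasis r hr n))] with t h6 h7
      rw [h7, Pi.smul_apply, h6, smul_smul, screwEquiv_coord, ← sqrt_pi_mul_one_div]
      congr 1
      linear_combination (fourierC φ (node r n) / node r n * ((√Real.pi : ℝ) : ℂ) *
        (Complex.I * (-1) ^ n)) * one_div_sqrt_mul_self hr
    filter_upwards [Lp.coeFn_finsetSum (Finset.Icc (-(N : ℤ)) N) fun n => (screwEquiv r hr φ.toSpace n •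
        (weylEquiv r hr).symm (pwHilbertBasis r hr n) : PWHamSpace r), h5] with t h6 h7
    rw [h6, integral_smul_kernelSum hr]
    simp only [Finset.sum_apply, h7]
  refine (ae_hamMeasure_iff r _).1 ?_
  filter_upwards [h3, ae_all_iff.2 h4] with t h5 h6
  simp only [h6] at h5
  exact tendsto_nhds_unique h5 ((tendsto_integral_kernelSum hr φ t).comp hns.tendsto_atTop)

end ScrewPW


theorem mainTheorem5 (r : ℝ) (hr : 0 < r) :
    -- the functions attached to `E_r`
    ((∀ z : ℂ, (pwHB r hr).A z = Complex.cos (r * z)) ∧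
      (∀ z : ℂ, (pwHB r hr).B z = Complex.sin (r * z)) ∧
      (∀ z : ℂ, pwTheta r z = sharp (pwHB r hr) z / pwHB r hr z) ∧
      IsMeromorphicInner (pwTheta r) ∧
      levelSet (pwTheta r) = Set.range (node r) ∧
      (∀ n : ℤ, 2 * Real.pi / ‖deriv (pwTheta r) (node r n)‖ = Real.pi / r) ∧
      levelMeasure (pwTheta r) = Measure.sum fun n : ℤ =>
        ENNReal.ofReal (Real.pi / r) • Measure.dirac (node r n)) ∧
    -- the Paley--Wiener space and its reproducing kernel
    ((∀ f : ℂ → ℂ, f ∈ deBrangesSubmodule (pwHB r hr) ↔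
        ∃ φ : ℝ → ℂ, MemLp φ 2 (volume.restrict (Set.Ioc (-r) r)) ∧
          ∀ z : ℂ, f z = ∫ t in (-r)..r, φ t * Complex.exp (Complex.I * z * t)) ∧
      (∀ z : ℂ, ∃ k : DeBrangesSpace (pwHB r hr),
        (∀ w : ℂ, k w = abKernel (pwHB r hr).A (pwHB r hr).B z w) ∧
        (∀ w : ℂ, w ≠ conj z →
          k w = Complex.sin (r * (w - conj z)) / (Real.pi * (w - conj z))) ∧
        ∀ f : DeBrangesSpace (pwHB r hr), f z = inner ℂ k f)) ∧
    -- multiplication by the independent variable and its extension for `θ = π / 2`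
    ((∀ (θ : ℝ) (z : ℂ), (pwHB r hr).S θ z = -2 * Complex.I * Complex.sin (r * z - θ)) ∧
      (∀ θ : ℝ, (pwHB r hr).S θ ∉ deBrangesSubmodule (pwHB r hr)) ∧
      Dense (multDomain (pwHB r hr)) ∧
      ∀ w₀ : ℂ, (pwHB r hr).S (Real.pi / 2) w₀ ≠ 0 →
        IsSelfAdjointGraph (multExtGraph (pwHB r hr) (Real.pi / 2) w₀) ∧
        (∀ F G : DeBrangesSpace (pwHB r hr), (∀ z : ℂ, G z = z * F z) →
          (F, G) ∈ multExtGraph (pwHB r hr) (Real.pi / 2) w₀) ∧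
        ∀ (n : ℤ) (F : DeBrangesSpace (pwHB r hr)), (∀ z : ℂ, F z = pwBasis r n z) →
          (F, (node r n : ℂ) • F) ∈ multExtGraph (pwHB r hr) (Real.pi / 2) w₀) ∧
    -- the structure Hamiltonian `H_r = I`
    (IsCanonicalSolution pwHam (Set.Icc 0 r) pwSol ∧
      (∀ z : ℂ, pwSol r z 0 = (pwHB r hr).A z ∧ pwSol r z 1 = (pwHB r hr).B z) ∧
      IsStructureHamiltonian (pwHB r hr) pwHam 0 r ∧
      IsFundamentalSolution pwHam r (fun t z =>
        !![Complex.cos (t * z), Complex.sin (t * z); -Complex.sin (t * z), Complex.cos (t * z)])) ∧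
    -- the Nevanlinna function `Q_r`
    ((∀ z : ℂ, Complex.I * (1 - pwTheta r z) / (1 + pwTheta r z) = Complex.tan (r * z)) ∧
      IsNevanlinna (fun z => Complex.tan (r * z)) ∧
      (∀ z : ℂ, (∀ n : ℤ, z ≠ node r n) →
        Tendsto (fun N : ℕ => (1 / r : ℂ) * ∑ n ∈ Finset.Icc (-(N : ℤ)) N, 1 / (node r n - z))
          atTop (𝓝 (Complex.tan (r * z)))) ∧
      (∀ z ∈ upperHalf,
        Integrable (fun γ : ℝ => 1 / ((γ : ℂ) - z) - γ / (1 + (γ : ℂ) ^ 2)) (pwTau r) ∧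
        Complex.tan (r * z) =
          ∫ γ : ℝ, (1 / ((γ : ℂ) - z) - γ / (1 + (γ : ℂ) ^ 2)) ∂(pwTau r)) ∧
      Tendsto (fun y : ℝ => Complex.tan (r * (y * Complex.I)) / y) atTop (𝓝 0)) ∧
    -- the isometric isomorphisms between `PW_r`, `K(Θ_r)`, `L²(μ)` and `L²(H_r)`
    ∃ (b : HilbertBasis ℤ ℂ (DeBrangesSpace (pwHB r hr)))
      (J : modelSpace (pwTheta r) ≃ₗᵢ[ℂ] DeBrangesSpace (pwHB r hr))
      (R : DeBrangesSpace (pwHB r hr) ≃ₗᵢ[ℂ] Lp ℂ 2 (levelMeasure (pwTheta r)))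
      (W : PWHamSpace r ≃ₗᵢ[ℂ] DeBrangesSpace (pwHB r hr))
      (U : PWHamSpace r ≃ₗ[ℂ] Lp ℂ 2 (volume.restrict (Set.Ioc (-r) r))),
    -- the orthonormal basis `F_n`
    ((∀ (n : ℤ) (z : ℂ), b n z = pwBasis r n z) ∧
      (∀ (n : ℤ) (z : ℂ), z ≠ node r n → b n z =
        Complex.I * Complex.cos (r * z) / ((√(Real.pi * r) : ℝ) * (z - node r n))) ∧
      (∀ n : ℤ, Tendsto (fun z => b n z / pwHB r hr z) (𝓝[≠] (node r n : ℂ))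
        (𝓝 ((√(r / Real.pi) : ℝ) : ℂ))) ∧
      (∀ n m : ℤ, m ≠ n →
        Tendsto (fun z => b n z / pwHB r hr z) (𝓝[≠] (node r m : ℂ)) (𝓝 0))) ∧
    -- `PW_r ≅ K(Θ_r)` by division by `E_r`, and restriction to the level set
    ((∀ f : DeBrangesSpace (pwHB r hr),
        ((J.symm f : Lp ℂ 2 (volume : Measure ℝ)) : ℝ → ℂ) =ᵐ[volume]
          fun x => f x / pwHB r hr x) ∧
      (∀ f : DeBrangesSpace (pwHB r hr),
        (R f : ℝ → ℂ) =ᵐ[levelMeasure (pwTheta r)] fun x => f x / pwHB r hr x)) ∧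
    -- `L²(H_r)` and the Weyl transform
    ((∀ F : PWHamSpace r, ‖F‖ ^ 2 = hamNormSq pwHam 0 r F) ∧
      Dense {F : PWHamSpace r | ∃ F₀ : ℝ → EuclideanSpace ℂ (Fin 2),
        ContinuousOn F₀ (Set.Ico 0 r) ∧ (∃ c < r, ∀ t ∈ Set.Ico 0 r, c < t → F₀ t = 0) ∧
        (F : ℝ → EuclideanSpace ℂ (Fin 2)) =ᵐ[volume.restrict (Set.Ico 0 r)] F₀} ∧
      (∀ (F : PWHamSpace r) (z : ℂ), W F z = weylTransform pwSol pwHam 0 r F z) ∧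
      (∀ (F : PWHamSpace r) (z : ℂ), W F z = 1 / Real.pi *
        ∫ t in (0 : ℝ)..r, (F t 0 * Complex.cos (t * z) + F t 1 * Complex.sin (t * z))) ∧
      (∀ F : PWHamSpace r,
        (U F : ℝ → ℂ) =ᵐ[volume.restrict (Set.Ioc (-r) r)] pwPsi F) ∧
      (∀ F : PWHamSpace r, ‖F‖ ^ 2 = 1 / (2 * Real.pi) * ‖U F‖ ^ 2) ∧
      (∀ (F : PWHamSpace r) (z : ℂ), W F z = 1 / (2 * Real.pi) *
        ∫ t in (-r)..r, pwPsi F t * Complex.exp (Complex.I * z * t))) ∧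
    -- the screw function `g_r`
    (∀ t : ℝ, Summable fun n : ℕ => pwScrewTerm r t (n + 1)) ∧
    ∃ g : ScrewFunction, (∀ t : ℝ, g t = pwScrew r t) ∧
      IsSpectralMeasure g 0 (pwTau r) ∧
      (∀ z ∈ upperHalf,
        Integrable (fun t : ℝ => g t * Complex.exp (Complex.I * z * t))
          (volume.restrict (Set.Ioi 0)) ∧
        ∫ t in Set.Ioi (0 : ℝ), g t * Complex.exp (Complex.I * z * t) =
          -(Complex.I / z ^ 2) * Complex.tan (r * z)) ∧
    -- the isometric isomorphisms starting from `H(G_{g_r})`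
    ∃ (Φ : ScrewSpace g ≃ₗᵢ[ℂ] Lp ℂ 2 (pwTau r))
      (M : Lp ℂ 2 (pwTau r) ≃ₗᵢ[ℂ] Lp ℂ 2 (levelMeasure (pwTheta r)))
      (S : ℝ → modelSpace (pwTheta r))
      (T : ScrewSpace g ≃ₗᵢ[ℂ] DeBrangesSpace (pwHB r hr))
      (L : ScrewSpace g ≃ₗᵢ[ℂ] PWHamSpace r)
      (K : ℝ → ℝ → EuclideanSpace ℂ (Fin 2)),
    -- the norm of `H(G_{g_r})` and the maps `Φ₁` and multiplication by `1 / √π`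
    ((∀ φ : ScrewPre g, HasSum
        (fun n : ℤ => 1 / r * ((1 / node r n ^ 2) * ‖fourierC φ (node r n)‖ ^ 2))
        (‖φ.toSpace‖ ^ 2)) ∧
      (∀ φ : ScrewPre g, (Φ φ.toSpace : ℝ → ℂ) =ᵐ[pwTau r] fun γ => phiOne φ γ) ∧
      (∀ h : Lp ℂ 2 (pwTau r), (M h : ℝ → ℂ) =ᵐ[levelMeasure (pwTheta r)]
        fun γ => (1 / √Real.pi : ℝ) * h γ)) ∧
    -- the screw line in `K(Θ_r)`
    (IsScrewLineOf g (fun t => ((1 / √Real.pi : ℝ) : ℂ) • S t) ∧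
      (∀ t : ℝ, HasSum
        (fun n : ℤ => ((√(Real.pi / r) : ℝ) * pwCoeff r t n : ℂ) • J.symm (b n)) (S t)) ∧
      (∀ t : ℝ, ∀ᵐ x : ℝ, HasSum
        (fun n : ℤ => (√(Real.pi / r) : ℝ) * pwCoeff r t n *
          (Complex.I * (1 + pwTheta r x) / (2 * (√(Real.pi * r) : ℝ) * (x - node r n))))
        ((S t : Lp ℂ 2 (volume : Measure ℝ)) x))) ∧
    -- the map `φ ↦ (1 / √π) E_r P̂_φ` onto `PW_r`
    ((∀ φ : ScrewPre g, (J.symm (T φ.toSpace) : Lp ℂ 2 (volume : Measure ℝ)) =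
        ((1 / √Real.pi : ℝ) : ℂ) •
          ∫ t : ℝ, φ t • (S t : Lp ℂ 2 (volume : Measure ℝ))) ∧
      (∀ (φ : ScrewPre g) (z : ℂ), HasSum
        (fun n : ℤ => (1 / √r : ℝ) * (fourierC φ (node r n) / node r n) * b n z)
        (T φ.toSpace z)) ∧
      (∀ ξ : ScrewSpace g, HasSum
        (fun n : ℤ => ((1 / √r : ℝ) * (Φ ξ : ℝ → ℂ) (node r n) : ℂ) • b n) (T ξ))) ∧
    -- the map `L_r` given by its kernel
    ((∀ (t s : ℝ) (i : Fin 2), Tendsto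
        (fun N : ℕ => Complex.I * (√Real.pi : ℝ) / r * ∑ n ∈ Finset.Icc (-(N : ℤ)) N,
          (-1 : ℂ) ^ n * pwCoeff r s n * pwSol t (node r n) i)
        atTop (𝓝 (K t s i))) ∧
      (∀ φ : ScrewPre g, (L φ.toSpace : ℝ → EuclideanSpace ℂ (Fin 2)) =ᵐ[
          volume.restrict (Set.Ioc 0 r)] fun t => ∫ s : ℝ, φ s • K t s)) ∧
    -- the commutative diagram
    (∀ ξ : ScrewSpace g, W (L ξ) = T ξ) ∧
    (∀ ξ : ScrewSpace g, R (T ξ) = M (Φ ξ)) := by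
  have hb : ∀ n z, pwHilbertBasis r hr n z = basisVec r hr n z := fun n z => by
    rw [pwHilbertBasis_apply]
  have hK : ∀ (t s : ℝ) (i : Fin 2), Tendsto
      (fun N : ℕ => Complex.I * (√Real.pi : ℝ) / r * ∑ n ∈ Finset.Icc (-(N : ℤ)) N,
        (-1 : ℂ) ^ n * pwCoeff r s n * pwSol t (node r n) i)
      atTop (𝓝 (kernelLimit r hr t s i)) := fun t s i => by
    simp only [← kernelSum_apply]
    exact ((EuclideanSpace.proj (𝕜 := ℂ) (ι := Fin 2) i).continuous.tendsto _).comp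
      (tendsto_kernelSum hr t s)
  refine ⟨⟨pw_A hr, pw_B hr, pwTheta_eq_div hr, isMeromorphicInner_pwTheta hr, levelSet_pwTheta hr,
    level_weight hr, levelMeasure_pwTheta hr⟩, ⟨mem_pw_iff hr, pw_reproducing_kernel r hr⟩,
    ⟨pw_S hr, pw_S_notMem hr, dense_multDomain hr, fun w₀ hw => ⟨isSelfAdjointGraph_multExt hr hw,
      fun F G h => (mem_multExtGraph_iff hr hw _).2 fun n => h _, fun n F h => ?_⟩⟩,
    ⟨isCanonicalSolution_pwSol _, fun z => ⟨(pw_A hr z).symm, (pw_B hr z).symm⟩,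
      isStructureHamiltonian_pwHam r hr, isFundamentalSolution_rotation r⟩,
    ⟨pw_Q_eq_tan r, isNevanlinna_tan hr, fun z hz => tendsto_tan hr hz,
      fun z hz => tan_integral_rep hr hz, tendsto_tan_div hr⟩,
    pwHilbertBasis r hr, modelEquiv r hr, restrictEquiv r hr, weylEquiv r hr, psiEquiv r hr,
    ⟨fun n z => (hb n z).trans (basisVec_eq_pwBasis hr n z),
      fun n z hz => (hb n z).trans (basisVec_of_ne hr n hz), fun n => ?_, fun n m hm => ?_⟩,
    ⟨divIsometry_ae, restrictEquiv_ae hr⟩,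
    ⟨hamNormSq_eq hr, dense_contHam hr,
      fun F z => (weylEquiv_apply hr F z).trans (weylTransform_eq r F z).symm, weylEquiv_apply hr,
      psiLin_ae hr, norm_sq_psiLin hr, weylEquiv_psi hr⟩,
    summable_pwScrewTerm_nat hr, pwScrewFunction r hr, fun _ => rfl, isSpectralMeasure_pwTau hr,
    fun z hz => laplace_pwScrew hr hz,
    phiEquiv r hr, tauLevelEquiv r hr, screwLine r hr, screwPWEquiv r hr, screwHamEquiv r hr,
    kernelLimit r hr,
    ⟨hasSum_norm_toSpace hr, phiEquiv_ae hr, tauLevelEquiv_ae hr⟩,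
    ⟨isScrewLineOf_screwLine hr, hasSum_screwLine hr, hasSum_screwLine_ae hr⟩,
    ⟨screwLine_integral hr, hasSum_screwPWEquiv_coe hr, hasSum_screwPWEquiv hr⟩,
    ⟨hK, screwHamEquiv_ae hr⟩,
    fun ξ => (weylEquiv r hr).apply_symm_apply _, restrictEquiv_screwPWEquiv hr⟩
  · obtain rfl : F = basisVec r hr n :=
      deBrangesSpace_ext fun z => (h z).trans (basisVec_eq_pwBasis hr n z).symm
    exact mem_multExtGraph_basisVec hr hw n
  · simp only [hb]
    have h := tendsto_basisVec_div hr n n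
    rwa [basisVec_node_self, mul_div_cancel_right₀ _ ((pwHB r hr).no_real_zero _)] at h
  · simp only [hb]
    have h := tendsto_basisVec_div hr n m
    rwa [basisVec_node_of_ne hr hm, zero_div] at h
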